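/- Computation is on the randomized word RAM: words are integers in $\{0,\dots,2^w-1\}$ with word size $w\ge q\log_2 N$, where $N$ is the input size and $q$ a constant depending on the program; registers, arrays, arithmetic, comparison, bitwise, branching and loop instructions, and sampling a uniformly random element of $\{0,\dots,x-1\}$, each cost one unit of time. Memory outside the input may initially hold arbitrary words. Let $\omega\ge 2$ be a matrix multiplication exponent, that is, a real number such that two $n\times n$ integer matrices with entries in $\{0,1\}$ can be multiplied in $O(n^{\omega})$ time, and let $\alpha=\frac{\omega+1}{\omega+5}$. For a directed graph $G$, let $d(u,v)\in\{0,1,2,\dots\}\cup\{\infty\}$ be the least number of arcs of a directed walk from $u$ to $v$, and let $D(G)=\max_{u,v}d(u,v)$ be its diameter ($0$ if there are no vertices). Then there is a randomized $7/4$-approximation algorithm for the diameter of unweighted directed graphs running in $\tilde O(m^{1+\alpha})$ time. Precisely: for every constant $c\in\mathbb{N}$ there are a program and constants $k,C$ such that, given the number $n$ of vertices and a list of the $m$ arcs of any directed graph $G$ (not necessarily strongly connected), the program always halts within $C\,(m+2)^{1+\alpha}\log^k(m+2)$ steps, and with probability at least $1-(m+2)^{-c}$ it outputs a value $d\in\{0,1,2,\dots\}\cup\{\infty\}$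 with $D(G)\le d\le \frac74 D(G)$. Moreover, if $\omega\le 2.3728596$, then $\alpha\le 0.4575$, so that the exponent $1+\alpha$ is at most $1.4575$. -/

import Mathlib

/-! ### Directed graphs, distances and the diameter -/

/-- There is a directed walk with exactly `k` arcs from `u` to `v` in `G`. -/
def HasWalk {V : Type*} (G : Digraph V) : ℕ → V → V → Prop
  | 0, u, v => u = v
  | k + 1, u, v => ∃ x, G.Adj u x ∧ HasWalk G k x v

/-- The directed distance from `u` to `v`: the least number of arcs of a directed walk from `u`
to `v`, and `⊤` if there is none. -/
noncomputable def directedDist {V : Type*} (G : Digraph V) (u v : V) : ℕ∞ :=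
  ⨅ k ∈ {k : ℕ | HasWalk G k u v}, (k : ℕ∞)

/-- The (one-way) diameter: the largest directed distance over all ordered pairs of vertices. It is
`⊤` exactly when `G` is not strongly connected (for a finite vertex set). -/
noncomputable def directedDiam {V : Type*} (G : Digraph V) : ℕ∞ :=
  ⨆ (u : V) (v : V), directedDist G u v

/-- The directed graph on `Fin n` given by a list of `m` arcs, in any order. -/
def arcsToDigraph {n m : ℕ} (e : Fin m → Fin n × Fin n) : Digraph (Fin n) where
  Adj u v := ∃ i, e i = (u, v)

/-- `d` is a `7/4`-approximation of the diameter `D` of `G`, that is, `D ≤ d ≤ (7/4) D`. -/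
def IsSevenFourthsApprox {V : Type*} (G : Digraph V) (d : ℕ∞) : Prop :=
  directedDiam G ≤ d ∧ 4 * d ≤ 7 * directedDiam G

/-! ### The randomized word RAM

The machine has registers and (random access) arrays of words; a word of a `w`-bit machine is a
natural number below `2 ^ w`. A program is a finite piece of code, so it mentions only finitely many
registers and finitely many arrays. Every elementary instruction costs one unit of time. -/

/-- The binary operations on words. -/
inductive WordOp
  | add | sub | mul | div | mod | lt | eq | land | lor | xor | shl | shr

/-- Evaluation of the binary operations: `sub` is truncated, division by zero gives zero,
comparisons give `0` or `1`. -/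
def WordOp.eval : WordOp → ℕ → ℕ → ℕ
  | .add, x, y => x + y
  | .sub, x, y => x - y
  | .mul, x, y => x * y
  | .div, x, y => x / y
  | .mod, x, y => x % y
  | .lt, x, y => if x < y then 1 else 0
  | .eq, x, y => if x = y then 1 else 0
  | .land, x, y => x &&& y
  | .lor, x, y => x ||| y
  | .xor, x, y => x ^^^ y
  | .shl, x, y => x <<< y
  | .shr, x, y => x >>> y

/-- Programs. Registers and arrays are named by natural numbers. -/
inductive Prog
  /-- do nothing -/
  | skip
  /-- `r := k` -/
  | const (r k : ℕ)
  /-- `r := x op y` for registers `x`, `y` -/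
  | op (o : WordOp) (r x y : ℕ)
  /-- `r := a[x]` for an array `a` and a register `x` -/
  | load (r a x : ℕ)
  /-- `a[x] := y` for an array `a` and registers `x`, `y` -/
  | store (a x y : ℕ)
  /-- `r :=` a uniformly random element of `{0, …, x - 1}`, for a register `x` -/
  | rand (r x : ℕ)
  /-- first `p`, then `q` -/
  | seq (p q : Prog)
  /-- if the register `x` is nonzero then `p`, else `q` -/
  | ite (x : ℕ) (p q : Prog)
  /-- as long as the register `x` is nonzero, repeat `p` -/
  | loop (x : ℕ) (p : Prog)

/-- The contents of the memory: `reg r` is the content of register `r`, and `arr a i` is the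
content of cell `i` of array `a`. -/
structure Memory where
  reg : ℕ → ℕ
  arr : ℕ → ℕ → ℕ

/-- Every register and every cell holds a `w`-bit word. -/
def Memory.Valid (w : ℕ) (s : Memory) : Prop :=
  (∀ r, s.reg r < 2 ^ w) ∧ ∀ a i, s.arr a i < 2 ^ w

/-- Overwrite the register `r` with `v`. -/
def Memory.setReg (s : Memory) (r v : ℕ) : Memory :=
  { s with reg := Function.update s.reg r v }

/-- Overwrite the cell `i` of the array `a` with `v`. -/
def Memory.setArr (s : Memory) (a i v : ℕ) : Memory :=
  { s with arr := Function.update s.arr a (Function.update (s.arr a) i v) }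

/-- A configuration: the program parts that are still to be executed, in order, and the memory;
`none` is the configuration of a crashed machine. The machine has halted when nothing is left to be
executed. -/
abbrev Config := Option (List Prog × Memory)

/-- Write the result `v` of an instruction into the register `r` and go on with `K`. If `v` does not
fit into a word, then the machine crashes. -/
def writeReg (w r v : ℕ) (K : List Prog) (s : Memory) : Config :=
  if v < 2 ^ w then some (K, s.setReg r v) else none

/-- One step of the `w`-bit machine, as a probability distribution on the next configuration. -/
noncomputable def step (w : ℕ) : Config → PMF Config
  | none => PMF.pure none
  | some ([], s) => PMF.pure (some ([], s))
  | some (.skip :: K, s) => PMF.pure (some (K, s))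
  | some (.const r k :: K, s) => PMF.pure (writeReg w r k K s)
  | some (.op o r x y :: K, s) => PMF.pure (writeReg w r (o.eval (s.reg x) (s.reg y)) K s)
  | some (.load r a x :: K, s) => PMF.pure (writeReg w r (s.arr a (s.reg x)) K s)
  | some (.store a x y :: K, s) => PMF.pure (some (K, s.setArr a (s.reg x) (s.reg y)))
  | some (.rand r x :: K, s) =>
    match s.reg x with
    | 0 => PMF.pure none
    | b + 1 => (PMF.uniformOfFintype (Fin (b + 1))).map fun i => writeReg w r i K s
  | some (.seq p q :: K, s) => PMF.pure (some (p :: q :: K, s))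
  | some (.ite x p q :: K, s) => PMF.pure (some ((if s.reg x ≠ 0 then p else q) :: K, s))
  | some (.loop x p :: K, s) =>
    PMF.pure (some (if s.reg x ≠ 0 then p :: .loop x p :: K else K, s))

/-- The distribution of the configuration after `t` steps (a halted machine stays as it is). -/
noncomputable def runSteps (w : ℕ) : ℕ → Config → PMF Config
  | 0, c => PMF.pure c
  | t + 1, c => (step w c).bind (runSteps w t)

/-- The probability that the `w`-bit machine, started on the program `P` with memory `s`, halts
within `T` steps (without a crash) with a memory that satisfies `Q`. -/
noncomputable def probHalts (w T : ℕ) (P : Prog) (s : Memory) (Q : Memory → Prop) : ENNReal :=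
  (runSteps w T (some ([P], s))).toOuterMeasure {c | ∃ s', c = some ([], s') ∧ Q s'}

/-! ### The two computational problems

In both cases the memory outside the input may initially hold arbitrary words, and the word size
`w` may be any number that is at least a constant multiple of the logarithm of the input size. -/

/-- The memory `s` holds `n` in register `0` and the `n × n` matrices `A` and `B`, row by row, in the
arrays `0` and `1`. -/
def HoldsMatrices {n : ℕ} (A B : Matrix (Fin n) (Fin n) ℕ) (s : Memory) : Prop :=
  s.reg 0 = n ∧ (∀ i j : Fin n, s.arr 0 (i * n + j) = A i j) ∧
    ∀ i j : Fin n, s.arr 1 (i * n + j) = B i j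

/-- Two `n × n` matrices can be multiplied in time `O(n ^ τ)` on the word RAM. Only the integer
product of matrices with entries in `{0, 1}` is asked for. The product has to be found, row by row,
in the array `2`. -/
def IsMatMulExponent (τ : ℝ) : Prop :=
  ∃ (P : Prog) (q : ℕ) (C : ℝ), ∀ (n w : ℕ), 0 < n → (n + 2) ^ q ≤ 2 ^ w →
    ∀ A B : Matrix (Fin n) (Fin n) ℕ, (∀ i j, A i j ≤ 1) → (∀ i j, B i j ≤ 1) →
      ∀ s : Memory, s.Valid w → HoldsMatrices A B s →
        ∃ T : ℕ, (T : ℝ) ≤ C * (n : ℝ) ^ τ ∧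
          probHalts w T P s (fun s' => ∀ i j : Fin n, s'.arr 2 (i * n + j) = (A * B) i j) = 1

/-- The memory `s` holds the number `n` of vertices and the number `m` of arcs in the registers `0`
and `1`, and the tails and the heads of the arcs in the arrays `0` and `1`. -/
def HoldsArcs {n m : ℕ} (e : Fin m → Fin n × Fin n) (s : Memory) : Prop :=
  s.reg 0 = n ∧ s.reg 1 = m ∧ (∀ i : Fin m, s.arr 0 i = (e i).1) ∧
    ∀ i : Fin m, s.arr 1 i = (e i).2

/-- The number in `ℕ∞` that a word stands for as an output: `0` stands for infinity, and `d + 1`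
stands for `d`. -/
def decodeOutput : ℕ → ℕ∞
  | 0 => ⊤
  | d + 1 => d

/-! Work in the disjoint union of the graph and its reverse (`doubled`). Exchanging the copies
(`mirror`) turns distances to a vertex into distances from a vertex, so out-balls suffice. The core
is a test for a threshold D ≥ 2: with d = ⌈4D/7⌉ it either certifies a pair at distance at least d
or, if the random samples are good, excludes every pair at distance at least D (`attempt_spec`).
Binary search then ends with a number lo such that the diameter is at most lo and at least ⌈4 lo/7⌉,
and lo is the output.

The test has a size parameter a. Let M be the number of arcs of the doubled graph and L a
logarithmic factor. A sequence of random arcs is good (`Arcs.Good`) if every neighbourhood `arcsLt v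
r` consisting of s > 0 arcs is hit by one of the first ⌈ML/s⌉ samples. Suppose that v is at distance
at least D from u.

(1) Search from the tails of the first aL samples. If one of them does not reach its whole copy
within d - 1 steps, a pair at distance d has been found. Otherwise at most M/a arcs have their tail
within D - d of u, since a sample x among them would give a path u → x → v of length at most D - 1
(`arcsLt_card_le`); the same holds for v in the reversed graph.

(2) If some vertex w has at most a arcs at distance less than r = 2d - 1 - D, search from w, and
backwards from the at most a + 1 vertices of its r-ball. If all these searches reach everything
within d - 1 steps, a path from w to v and the vertex at distance r on it contradict the choice of u
and v (`not_far_of_ball`).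

(3) Otherwise all these neighbourhoods have more than a arcs, so about ML/a samples suffice to find
a tail x near u and, in the reversed graph, a tail y near v. By (1) both have at most M/a arcs
within the radii d/2 and (d - 1)/2 (rounded down); this is where 7d ≤ 4D + 6 enters. If the two
balls are disjoint, x and y are at distance at least d (`far_of_disjoint`); if they meet, u reaches
v too fast (`not_far_of_intersect`). It remains to look for a disjoint pair among all samples with
small balls.

For (3), each vertex z gets a bucket of the samples of one copy that are near it. Vertices with at
most Δ ≈ a³/M bucket entries are handled by listing pairs. There are only l = O(M³L/a⁵) other
vertices (`Search.heavy_mul_le`), and these are handled by a product of 0/1 matrices, cut into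
square blocks whose side is the number K ≈ ML/a of samples. Apart from that product everything costs
O(M a L²), and the product costs about l K^(ω-1), which balances M a at a ≈ M^α with α =
(ω+1)/(ω+5).

The machine does not know ω or the constant of the multiplication algorithm. Hence a starts near
M^(1/3), each test has a budget M a, and a is doubled whenever the budget is exceeded. The
multiplication is run with limited fuel (`clk`, `ClkRel.alive`). Exceeding the budget forces a =
O(M^α L) (`MayAbort.le`), so the final a is of that order too.

Time and correctness are proved for all outcomes of the random choices (`Ter`), with goodness of the
samples as a hypothesis of the one conclusion that needs it. Probability enters only when the
samples are drawn: `drawSamples_failBound` follows a potential that does not increase on average,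
instantiated with the expected number of neighbourhoods that are missed (`Arcs.badCount`). Initially
it is at most 2n(n + 1)/2^L. -/

/-! ### Demonic execution and total correctness triples -/

namespace Prog

/-- The registers that a program may overwrite. -/
def regs : Prog → List ℕ
  | skip => []
  | const r _ => [r]
  | op _ r _ _ => [r]
  | load r _ _ => [r]
  | store _ _ _ => []
  | rand r _ => [r]
  | seq p q => p.regs ++ q.regs
  | ite _ p q => p.regs ++ q.regs
  | loop _ p => p.regs

/-- The arrays that a program may overwrite. -/
def arrs : Prog → List ℕ
  | skip => []
  | const _ _ => []
  | op _ _ _ _ => []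
  | load _ _ _ => []
  | store a _ _ => [a]
  | rand _ _ => []
  | seq p q => p.arrs ++ q.arrs
  | ite _ p q => p.arrs ++ q.arrs
  | loop _ p => p.arrs

end Prog

infixr:60 " ;; " => Prog.seq

@[ext] theorem Memory.ext' {s t : Memory} (h1 : s.reg = t.reg) (h2 : s.arr = t.arr) : s = t := by
  cases s; cases t; simp_all

@[simp] theorem Memory.setReg_reg (s : Memory) (r v x : ℕ) :
    (s.setReg r v).reg x = if x = r then v else s.reg x := by
  simp [Memory.setReg, Function.update_apply]

@[simp] theorem Memory.setReg_arr (s : Memory) (r v : ℕ) : (s.setReg r v).arr = s.arr := rfl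

@[simp] theorem Memory.setArr_reg (s : Memory) (a i v : ℕ) : (s.setArr a i v).reg = s.reg := rfl

@[simp] theorem Memory.setArr_arr (s : Memory) (a i v b j : ℕ) :
    (s.setArr a i v).arr b j = if b = a then (if j = i then v else s.arr a j) else s.arr b j := by
  by_cases h : b = a
  · subst h; simp [Memory.setArr, Function.update_apply]
  · simp [Memory.setArr, h]

/-- Outside the registers and arrays that `p` may overwrite, the memories `s` and `s'` agree. -/
structure Fr (p : Prog) (s s' : Memory) : Prop where
  reg : ∀ r, r ∉ p.regs → s'.reg r = s.reg r
  arr : ∀ a, a ∉ p.arrs → s'.arr a = s.arr a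

theorem Fr.refl (p : Prog) (s : Memory) : Fr p s s := ⟨fun _ _ => rfl, fun _ _ => rfl⟩

theorem Fr.trans {p : Prog} {s s' s'' : Memory} (h : Fr p s s') (h' : Fr p s' s'') : Fr p s s'' :=
  ⟨fun r hr => (h'.reg r hr).trans (h.reg r hr), fun a ha => (h'.arr a ha).trans (h.arr a ha)⟩

theorem Fr.mono {p q : Prog} {s s' : Memory} (h : Fr p s s') (h1 : p.regs ⊆ q.regs)
    (h2 : p.arrs ⊆ q.arrs) : Fr q s s' :=
  ⟨fun r hr => h.reg r fun h => hr (h1 h), fun a ha => h.arr a fun h => ha (h2 h)⟩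

/-- Every run of the machine from the configuration `c` meets `G` within `t` steps. -/
inductive Ev (w : ℕ) (G : Config → Prop) : ℕ → Config → Prop
  | done {t : ℕ} {c : Config} (h : G c) : Ev w G t c
  | next {t : ℕ} {c : Config} (h : ∀ c' ∈ (step w c).support, Ev w G t c') : Ev w G (t + 1) c

theorem Ev.mono {w : ℕ} {G G' : Config → Prop} {t t' : ℕ} {c : Config} (h : Ev w G t c)
    (hG : ∀ c, G c → G' c) (ht : t ≤ t') : Ev w G' t' c := by
  induction h generalizing t' with
  | done h => exact .done (hG _ h)
  | @next t c h ih =>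
    obtain ⟨t'', rfl⟩ : ∃ t'', t' = t'' + 1 := ⟨t' - 1, by omega⟩
    exact .next fun c' hc' => ih c' hc' (by omega)

theorem Ev.trans {w : ℕ} {G G' : Config → Prop} {t t' : ℕ} {c : Config} (h : Ev w G t c)
    (hG : ∀ c, G c → Ev w G' t' c) : Ev w G' (t + t') c := by
  induction h with
  | done h => exact (hG _ h).mono (fun _ h => h) (by omega)
  | @next t c h ih =>
    rw [show t + 1 + t' = t + t' + 1 by omega]
    exact .next ih

/-- The machine has halted without a crash, with a memory that satisfies `Q`. -/
def Halted (Q : Memory → Prop) (c : Config) : Prop := ∃ s, c = some ([], s) ∧ Q s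

/-- The crashed configuration steps only to itself and is not halted, so no finite derivation can
start from it. This is how crashes are excluded in what follows. -/
theorem Ev.of_none {w : ℕ} {Q : Memory → Prop} {t : ℕ} {c : Config} (h : Ev w (Halted Q) t c) :
    c ≠ none := by
  induction h with
  | done h => obtain ⟨s, rfl, -⟩ := h; simp
  | @next t c h ih =>
    rintro rfl
    exact ih none (by simp [step]) rfl

/-- Append program parts that are to be executed later. -/
def Config.app (K : List Prog) : Config → Config :=
  Option.map fun x => (x.1 ++ K, x.2)

theorem writeReg_app (w r v : ℕ) (L K : List Prog) (s : Memory) :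
    Config.app K (writeReg w r v L s) = writeReg w r v (L ++ K) s := by
  unfold writeReg Config.app
  split <;> simp

/-- A step inspects only the top of the stack, so it commutes with appending `K` below. The stack
has to be nonempty: a halted machine stays put, but with `K` appended it would go on. -/
theorem step_app (w : ℕ) (p : Prog) (L K : List Prog) (s : Memory) :
    step w (some (p :: (L ++ K), s)) = (step w (some (p :: L, s))).map (Config.app K) := by
  cases p with
  | rand r x =>
    simp only [step]
    rcases h : s.reg x with _ | b
    · simp [PMF.pure_map, Config.app]
    · simp [PMF.map_comp, Function.comp_def, writeReg_app]
  | ite x p q => simp [step, PMF.pure_map, Config.app]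
  | loop x p =>
    simp only [step, PMF.pure_map, Config.app]
    split <;> simp
  | _ => simp [step, PMF.pure_map, writeReg_app]; try simp [Config.app]

theorem Memory.Valid.setReg {w : ℕ} {s : Memory} (h : s.Valid w) {r v : ℕ} (hv : v < 2 ^ w) :
    (s.setReg r v).Valid w := by
  refine ⟨fun x => ?_, h.2⟩
  rw [Memory.setReg_reg]; split
  · exact hv
  · exact h.1 x

theorem Memory.Valid.setArr {w : ℕ} {s : Memory} (h : s.Valid w) {a i v : ℕ} (hv : v < 2 ^ w) :
    (s.setArr a i v).Valid w := by
  refine ⟨h.1, fun b j => ?_⟩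
  rw [Memory.setArr_arr]; split_ifs
  · exact hv
  · exact h.2 _ j
  · exact h.2 b j

theorem mem_writeReg {w r v : ℕ} {L : List Prog} {s : Memory} {L' : List Prog} {s' : Memory}
    (h : some (L', s') = writeReg w r v L s) : v < 2 ^ w ∧ L' = L ∧ s' = s.setReg r v := by
  unfold writeReg at h
  split at h
  · simp at h; exact ⟨by assumption, h⟩
  · simp at h

/-- One step only touches what the first program part may overwrite, and leaves parts of it. -/
theorem step_frame {w : ℕ} {p : Prog} {L : List Prog} {s : Memory} {L' : List Prog} {s' : Memory}
    (h : some (L', s') ∈ (step w (some (p :: L, s))).support) (hs : s.Valid w) :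
    s'.Valid w ∧ Fr p s s' ∧ (∀ q ∈ L', q ∈ L ∨ (q.regs ⊆ p.regs ∧ q.arrs ⊆ p.arrs)) := by
  cases p with
  | skip => simp [step] at h; obtain ⟨rfl, rfl⟩ := h; exact ⟨hs, .refl _ _, by simp +contextual⟩
  | const r k =>
    simp [step] at h
    obtain ⟨hv, rfl, rfl⟩ := mem_writeReg h
    exact ⟨hs.setReg hv, ⟨by simp +contextual [Prog.regs], by simp⟩, by simp +contextual⟩
  | op o r x y =>
    simp [step] at h
    obtain ⟨hv, rfl, rfl⟩ := mem_writeReg h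
    exact ⟨hs.setReg hv, ⟨by simp +contextual [Prog.regs], by simp⟩, by simp +contextual⟩
  | load r a x =>
    simp [step] at h
    obtain ⟨hv, rfl, rfl⟩ := mem_writeReg h
    exact ⟨hs.setReg hv, ⟨by simp +contextual [Prog.regs], by simp⟩, by simp +contextual⟩
  | store a x y =>
    simp [step] at h; obtain ⟨rfl, rfl⟩ := h
    refine ⟨hs.setArr (hs.1 _), ⟨by simp, fun b hb => ?_⟩, by simp +contextual⟩
    simp [Prog.arrs] at hb
    funext j; simp [hb]
  | rand r x =>
    simp only [step] at h
    rcases hx : s.reg x with _ | b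
    · simp [hx] at h
    · simp [hx] at h
      obtain ⟨i, hi⟩ := h
      obtain ⟨hv, rfl, rfl⟩ := mem_writeReg hi.2.symm
      exact ⟨hs.setReg hv, ⟨by simp +contextual [Prog.regs], by simp⟩, by simp +contextual⟩
  | seq p q =>
    simp [step] at h; obtain ⟨rfl, rfl⟩ := h
    refine ⟨hs, .refl _ _, ?_⟩
    simp +contextual [Prog.regs, Prog.arrs]
  | ite x p q =>
    simp [step] at h; obtain ⟨rfl, rfl⟩ := h
    refine ⟨hs, .refl _ _, ?_⟩
    split <;> simp +contextual [Prog.regs, Prog.arrs]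
  | loop x p =>
    simp [step] at h; obtain ⟨rfl, rfl⟩ := h
    refine ⟨hs, .refl _ _, ?_⟩
    split <;> simp +contextual [Prog.regs, Prog.arrs]

/-- A terminating run can be continued with further program parts, and it respects the frame. -/
theorem Ev.lift {w : ℕ} {Q : Memory → Prop} {t : ℕ} {L : List Prog} {s : Memory}
    (h : Ev w (Halted Q) t (some (L, s))) (hs : s.Valid w) (p : Prog)
    (hL : ∀ q ∈ L, q.regs ⊆ p.regs ∧ q.arrs ⊆ p.arrs) (K : List Prog) :
    Ev w (fun c => ∃ s', c = some (K, s') ∧ s'.Valid w ∧ Fr p s s' ∧ Q s') t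
      (some (L ++ K, s)) := by
  generalize hc : (some (L, s) : Config) = c at h
  induction h generalizing L s with
  | done h =>
    obtain ⟨s', rfl, h⟩ := h
    simp at hc
    obtain ⟨rfl, rfl⟩ := hc
    exact .done ⟨s, by simp, hs, .refl _ _, h⟩
  | @next t c h ih =>
    subst hc
    rcases L with _ | ⟨q, L⟩
    · exact (ih (some ([], s)) (by simp [step]) hs (by simp) rfl).mono (fun _ h => h) (by omega)
    · refine .next fun c' hc' => ?_
      rw [List.cons_append, step_app, PMF.support_map] at hc'
      obtain ⟨c'', hc'', rfl⟩ := hc'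
      rcases c'' with _ | ⟨L'', s''⟩
      · exact absurd rfl (h _ hc'').of_none
      · obtain ⟨hv, hf, hq⟩ := step_frame hc'' hs
        have hqp := hL q (by simp)
        refine (ih _ hc'' hv (fun r hr => ?_) rfl).mono ?_ le_rfl
        · rcases hq r hr with h | h
          · exact hL r (by simp [h])
          · exact ⟨List.Subset.trans h.1 hqp.1, List.Subset.trans h.2 hqp.2⟩
        · rintro c ⟨s', rfl, h1, h2, h3⟩
          exact ⟨s', rfl, h1, (hf.mono hqp.1 hqp.2).trans h2, h3⟩

/-- Total correctness: from the memory `s`, the program `p` halts within `t` steps, whatever the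
random choices, with a memory that satisfies `Q`. -/
def Ter (w : ℕ) (p : Prog) (s : Memory) (t : ℕ) (Q : Memory → Prop) : Prop :=
  s.Valid w → Ev w (Halted Q) t (some ([p], s))

/-! ### Proof rules for total correctness, and weakest preconditions -/

section rules

variable {w : ℕ} {p q : Prog} {s : Memory} {t t1 t2 : ℕ} {Q R : Memory → Prop}

theorem Ter.lift (h : Ter w p s t Q) (hs : s.Valid w) (K : List Prog) :
    Ev w (fun c => ∃ s', c = some (K, s') ∧ s'.Valid w ∧ Fr p s s' ∧ Q s') t (some (p :: K, s)) :=
  Ev.lift (h hs) hs p (by simp) K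

/-- The rule of consequence, with the frame. -/
theorem Ter.conseq (h : Ter w p s t Q) (ht : t ≤ t1)
    (hQ : ∀ s', s'.Valid w → Fr p s s' → Q s' → R s') : Ter w p s t1 R := fun hs =>
  (h.lift hs []).mono (by rintro c ⟨s', rfl, h1, h2, h3⟩; exact ⟨s', rfl, hQ s' h1 h2 h3⟩) ht

theorem Ter.of_valid (h : s.Valid w → Ter w p s t Q) : Ter w p s t Q := fun hs => h hs hs

theorem Ev.head {G : Config → Prop} {c c' : Config} (h : step w c = PMF.pure c')
    (h' : Ev w G t c') : Ev w G (t + 1) c :=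
  .next fun d hd => by rw [h] at hd; simp at hd; subst hd; exact h'

theorem Ter.skip (h : Q s) : Ter w .skip s 1 Q := fun _ => .head rfl (.done ⟨s, rfl, h⟩)

theorem Ter.const {r k : ℕ} (hk : k < 2 ^ w) (h : Q (s.setReg r k)) : Ter w (.const r k) s 1 Q :=
  fun _ => .head rfl (.done ⟨_, by simp [writeReg, hk], h⟩)

theorem Ter.op {o : WordOp} {r x y : ℕ} (hk : o.eval (s.reg x) (s.reg y) < 2 ^ w)
    (h : Q (s.setReg r (o.eval (s.reg x) (s.reg y)))) : Ter w (.op o r x y) s 1 Q :=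
  fun _ => .head rfl (.done ⟨_, by simp [writeReg, hk], h⟩)

theorem Ter.load {r a x : ℕ} (h : Q (s.setReg r (s.arr a (s.reg x)))) :
    Ter w (.load r a x) s 1 Q :=
  fun hs => .head rfl (.done ⟨_, by simp [writeReg, hs.2 a (s.reg x)], h⟩)

theorem Ter.store {a x y : ℕ} (h : Q (s.setArr a (s.reg x) (s.reg y))) :
    Ter w (.store a x y) s 1 Q :=
  fun _ => .head rfl (.done ⟨_, rfl, h⟩)

theorem Ter.seq (h : Ter w p s t1 (fun s' => Ter w q s' t2 Q)) :
    Ter w (p ;; q) s (t1 + t2 + 1) Q := fun hs =>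
  .head rfl ((h.lift hs [q]).trans (by rintro c ⟨s', rfl, h1, h2, h3⟩; exact h3 h1))

/-- Sequential composition, with the frame of the first part. -/
theorem Ter.seq' (h : Ter w p s t1 R)
    (h' : ∀ s', s'.Valid w → Fr p s s' → R s' → Ter w q s' t2 Q) (ht : t1 + t2 + 1 ≤ t) :
    Ter w (p ;; q) s t Q :=
  (Ter.seq (h.conseq le_rfl h')).conseq ht fun _ _ _ h => h

theorem Ter.ite {x : ℕ} (h1 : s.reg x ≠ 0 → Ter w p s t Q) (h2 : s.reg x = 0 → Ter w q s t Q) :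
    Ter w (.ite x p q) s (t + 1) Q := fun hs => by
  refine .head rfl ?_
  by_cases hx : s.reg x = 0
  · simpa [hx] using h2 hx hs
  · simpa [hx] using h1 hx hs

/-- The rule for loops: `I k` holds as long as at most `k` units of time are left. -/
theorem Ter.loop {x : ℕ} (I : ℕ → Memory → Prop) (k : ℕ)
    (step : ∀ k s1, s1.Valid w → Fr (.loop x p) s s1 → I k s1 → s1.reg x ≠ 0 →
      ∃ t1, t1 + 1 ≤ k ∧ Ter w p s1 t1 (fun s2 => ∃ k2, I k2 s2 ∧ k2 + t1 + 1 ≤ k))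
    (h0 : I k s) (post : ∀ k s1, s1.Valid w → Fr (.loop x p) s s1 → I k s1 → s1.reg x = 0 → Q s1) :
    Ter w (.loop x p) s (k + 1) Q := by
  intro hs
  suffices H : ∀ k s1, s1.Valid w → Fr (.loop x p) s s1 → I k s1 →
      Ev w (Halted Q) (k + 1) (some ([.loop x p], s1)) from H k s hs (.refl _ _) h0
  intro k
  induction k using Nat.strong_induction_on with
  | _ k ih =>
    intro s1 hv hf hI
    by_cases hx : s1.reg x = 0
    · exact .head (c' := some ([], s1)) (by simp [_root_.step, hx]) (.done ⟨s1, rfl, post k s1 hv hf hI hx⟩)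
    · refine .head (c' := some ([p, .loop x p], s1)) (by simp [_root_.step, hx]) ?_
      obtain ⟨t1, ht1, h⟩ := step k s1 hv hf hI hx
      have := (h.lift hv [.loop x p]).trans (t' := k - t1) (G' := Halted Q) ?_
      · exact this.mono (fun _ h => h) (by omega)
      · rintro c ⟨s2, rfl, hv2, hf2, k2, hI2, hk2⟩
        refine (ih k2 (by omega) s2 hv2 (hf.trans (hf2.mono (by simp [Prog.regs]) (by simp [Prog.arrs]))) hI2).mono
          (fun _ h => h) (by omega)

/-- The weakest precondition of a program without loops and random choices. -/
def wp (w : ℕ) : Prog → (Memory → Prop) → Memory → Prop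
  | .skip, Q, s => Q s
  | .const r k, Q, s => k < 2 ^ w ∧ Q (s.setReg r k)
  | .op o r x y, Q, s => o.eval (s.reg x) (s.reg y) < 2 ^ w ∧
      Q (s.setReg r (o.eval (s.reg x) (s.reg y)))
  | .load r a x, Q, s => Q (s.setReg r (s.arr a (s.reg x)))
  | .store a x y, Q, s => Q (s.setArr a (s.reg x) (s.reg y))
  | .seq p q, Q, s => wp w p (wp w q Q) s
  | .ite x p q, Q, s => (s.reg x ≠ 0 → wp w p Q s) ∧ (s.reg x = 0 → wp w q Q s)
  | _, _, _ => False

/-- The number of program parts. -/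
def Prog.size : Prog → ℕ
  | .seq p q => p.size + q.size + 1
  | .ite _ p q => p.size + q.size + 1
  | .loop _ p => p.size + 1
  | _ => 1

/-- Without loops every node of the syntax tree is executed at most once, so the size of the program
bounds the time. For a conditional this charges both branches. -/
theorem Ter.of_wp' (p : Prog) {s : Memory} {Q : Memory → Prop} (h : wp w p Q s) :
    Ter w p s p.size Q := by
  induction p generalizing s Q with
  | skip => exact .skip h
  | const r k => exact .const h.1 h.2
  | op o r x y => exact .op h.1 h.2
  | load r a x => exact .load h
  | store a x y => exact .store h
  | rand r x => exact h.elim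
  | seq p q ihp ihq => exact Ter.seq ((ihp h).conseq le_rfl fun s' _ _ h => ihq h)
  | ite x p q ihp ihq =>
    refine (Ter.ite (t := p.size + q.size) ?_ ?_).conseq le_rfl fun _ _ _ h => h
    · exact fun hx => (ihp (h.1 hx)).conseq (by omega) fun _ _ _ h => h
    · exact fun hx => (ihq (h.2 hx)).conseq (by omega) fun _ _ _ h => h
  | loop x p ih => exact h.elim

theorem Ter.of_wp (h : wp w p Q s) (ht : p.size ≤ t) : Ter w p s t Q :=
  (Ter.of_wp' p h).conseq ht fun _ _ _ h => h

/-- A program without loops, followed by another program. -/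
theorem Ter.wp_seq (h : wp w p (fun s' => Ter w q s' t2 Q) s) (ht : p.size + t2 + 1 ≤ t) :
    Ter w (p ;; q) s t Q :=
  (Ter.seq (Ter.of_wp' p h)).conseq ht fun _ _ _ h => h

/-- For the counter `i` from `0` to the content of the register `b` (exclusive), with guard `g`;
the register `2` holds the constant `1`. -/
def forLoop (i g b : ℕ) (p : Prog) : Prog :=
  (.const i 0 ;; .op .lt g i b) ;; .loop g (p ;; .op .add i i 2 ;; .op .lt g i b)

/-- The invariant must survive arbitrary values in the counter and the guard, because both are
overwritten after the body; hence the quantification over `v` and `v'`. One iteration costs `T + 5`: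
the body, two updates, two sequencing steps and the test of the guard. -/
theorem Ter.forLoop {i g b : ℕ} (n T : ℕ) (I : ℕ → Memory → Prop)
    (hn : s.reg b = n) (h2 : s.reg 2 = 1)
    (hi : i ∉ p.regs) (hb : b ∉ p.regs) (hr2 : 2 ∉ p.regs)
    (hdis : i ≠ g ∧ i ≠ b ∧ g ≠ b ∧ i ≠ 2 ∧ g ≠ 2)
    (base : ∀ s1, Fr (_root_.forLoop i g b p) s s1 → s1.arr = s.arr →
      (∀ r, r ≠ i → r ≠ g → s1.reg r = s.reg r) → I 0 s1)
    (step : ∀ k s1, k < n → s1.Valid w → Fr (_root_.forLoop i g b p) s s1 → s1.reg i = k →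
      I k s1 → Ter w p s1 T (fun s2 => ∀ v v', I (k + 1) ((s2.setReg i v).setReg g v')))
    (post : ∀ s1, s1.Valid w → Fr (_root_.forLoop i g b p) s s1 → I n s1 → Q s1)
    (ht : n * (T + 5) + 5 ≤ t) :
    Ter w (_root_.forLoop i g b p) s t Q := by
  refine Ter.of_valid fun hs => ?_
  have hpos : 1 < 2 ^ w := h2 ▸ hs.1 2
  have hnw : n < 2 ^ w := hn ▸ hs.1 b
  obtain ⟨d1, d2, d3, d4, d5⟩ := hdis
  have hfr : ∀ s1 s2 : Memory, (∀ r, r ≠ i → r ≠ g → s2.reg r = s1.reg r) → s2.arr = s1.arr →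
      Fr (_root_.forLoop i g b p) s1 s2 := by
    intro s1 s2 h1 h2
    refine ⟨fun r hr => ?_, fun a _ => by rw [h2]⟩
    simp only [_root_.forLoop, Prog.regs, List.mem_append, List.mem_cons, List.not_mem_nil] at hr
    exact h1 r (by tauto) (by tauto)
  unfold _root_.forLoop
  have key : ∀ s1 : Memory, s1.Valid w → s1.arr = s.arr →
      (∀ r, r ≠ i → r ≠ g → s1.reg r = s.reg r) → s1.reg i = 0 →
      s1.reg g = (if 0 < n then 1 else 0) →
      Ter w (.loop g (p ;; .op .add i i 2 ;; .op .lt g i b)) s1 (n * (T + 5) + 1) Q := by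
    intro s1 hv1 ha1 hr1 hi1 hg1
    refine Ter.loop (fun k s2 => ∃ j, j ≤ n ∧ k = (n - j) * (T + 5) ∧ s2.reg i = j ∧
      s2.reg g = (if j < n then 1 else 0) ∧ I j s2) _ ?_ ?_ ?_
    · rintro k s2 hv2 hf2 ⟨j, hj, rfl, hij, hgj, hI⟩ hg
      have hjn : j < n := by by_contra hh; simp [hh] at hgj; exact hg hgj
      have hsub : Fr (_root_.forLoop i g b p) s1 s2 :=
        hf2.mono (by intro x; simp [Prog.regs, _root_.forLoop]; tauto)
          (by intro x; simp [Prog.arrs, _root_.forLoop])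
      have hfs := (hfr s s1 hr1 ha1).trans hsub
      refine ⟨T + 4, ?_, ?_⟩
      · have : 1 * (T + 5) ≤ (n - j) * (T + 5) := Nat.mul_le_mul_right _ (by omega)
        omega
      have hb2 : s2.reg b = n := by
        rw [hf2.reg b (by simp [Prog.regs, hb]; omega), hr1 b (by omega) (by omega), hn]
      have h22 : s2.reg 2 = 1 := by
        rw [hf2.reg 2 (by simp [Prog.regs, hr2]; omega), hr1 2 (by omega) (by omega), h2]
      refine Ter.seq' (step j s2 hjn hv2 hfs hij hI) ?_ (t2 := 3) (by omega)
      intro s3 hv3 hf3 hI3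
      have e1 : s3.reg i = j := by rw [hf3.reg i hi, hij]
      have e2 : s3.reg b = n := by rw [hf3.reg b hb, hb2]
      have e3 : s3.reg 2 = 1 := by rw [hf3.reg 2 hr2, h22]
      refine Ter.of_wp ?_ (by simp [Prog.size])
      simp only [wp, WordOp.eval, e1, e2, e3, Memory.setReg_reg, if_true, d2.symm, if_false]
      refine ⟨by omega, by split <;> omega, (n - (j + 1)) * (T + 5), ⟨j + 1, by omega, rfl, ?_, ?_, hI3 _ _⟩, ?_⟩
      · simp [d1]
      · simp
      · have : (n - j) * (T + 5) = (n - (j + 1)) * (T + 5) + (T + 5) := by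
          rw [show n - j = n - (j + 1) + 1 by omega]; ring
        omega
    · refine ⟨0, by omega, by simp, hi1, hg1, base s1 (hfr s s1 hr1 ha1) ha1 hr1⟩
    · rintro k s2 hv2 hf2 ⟨j, hj, rfl, hij, hgj, hI⟩ hg
      have hjn : j = n := by by_contra hh; simp [show j < n by omega] at hgj; omega
      subst hjn
      refine post s2 hv2 ((hfr s s1 hr1 ha1).trans (hf2.mono ?_ ?_)) hI
      · intro x; simp [Prog.regs, _root_.forLoop]; tauto
      · intro x; simp [Prog.arrs, _root_.forLoop]
  refine Ter.wp_seq (t2 := n * (T + 5) + 1) ?_ (by simp [Prog.size]; omega)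
  simp only [wp, WordOp.eval, Memory.setReg_reg, if_true, d2.symm, if_false, hn]
  refine ⟨by omega, by split <;> omega, key _ ?_ rfl ?_ ?_ ?_⟩
  · exact (hs.setReg (by omega)).setReg (by split <;> omega)
  · intro r h1 h2; simp [h1, h2]
  · simp [d1]
  · simp

end rules

/-- The number `v` fits into a word. -/
def Fits (w v : ℕ) : Prop := v < 2 ^ w

@[simp] theorem Fits.zero (w : ℕ) : Fits w 0 := Nat.two_pow_pos w

@[simp] theorem fits_ite {w a b : ℕ} {p : Prop} [Decidable p] :
    Fits w (if p then a else b) ↔ (p → Fits w a) ∧ (¬ p → Fits w b) := by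
  split <;> simp [*]

section wp

variable {w : ℕ} {Q : Memory → Prop} {s : Memory}

@[simp] theorem wp_skip : wp w .skip Q s = Q s := rfl

@[simp] theorem wp_const {r k : ℕ} : wp w (.const r k) Q s = (Fits w k ∧ Q (s.setReg r k)) := rfl

@[simp] theorem wp_op {o : WordOp} {r x y : ℕ} : wp w (.op o r x y) Q s =
    (Fits w (o.eval (s.reg x) (s.reg y)) ∧ Q (s.setReg r (o.eval (s.reg x) (s.reg y)))) := rfl

@[simp] theorem wp_load {r a x : ℕ} :
    wp w (.load r a x) Q s = Q (s.setReg r (s.arr a (s.reg x))) := rfl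

@[simp] theorem wp_store {a x y : ℕ} :
    wp w (.store a x y) Q s = Q (s.setArr a (s.reg x) (s.reg y)) := rfl

@[simp] theorem wp_seq {p q : Prog} : wp w (p ;; q) Q s = wp w p (wp w q Q) s := rfl

@[simp] theorem wp_ite {x : ℕ} {p q : Prog} : wp w (.ite x p q) Q s =
    ((s.reg x ≠ 0 → wp w p Q s) ∧ (s.reg x = 0 → wp w q Q s)) := rfl

end wp

section eval

variable {x y : ℕ}

@[simp] theorem WordOp.eval_add : WordOp.add.eval x y = x + y := rfl
@[simp] theorem WordOp.eval_sub : WordOp.sub.eval x y = x - y := rfl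
@[simp] theorem WordOp.eval_mul : WordOp.mul.eval x y = x * y := rfl
@[simp] theorem WordOp.eval_div : WordOp.div.eval x y = x / y := rfl
@[simp] theorem WordOp.eval_mod : WordOp.mod.eval x y = x % y := rfl
@[simp] theorem WordOp.eval_lt : WordOp.lt.eval x y = if x < y then 1 else 0 := rfl
@[simp] theorem WordOp.eval_land : WordOp.land.eval x y = x &&& y := rfl
@[simp] theorem WordOp.eval_lor : WordOp.lor.eval x y = x ||| y := rfl

@[simp] theorem ite_land_ite (p q : Prop) [Decidable p] [Decidable q] :
    ((if p then 1 else 0) &&& (if q then 1 else 0) : ℕ) = if p ∧ q then 1 else 0 := by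
  by_cases hp : p <;> by_cases hq : q <;> simp [hp, hq]

theorem ite_land_one (p : Prop) [Decidable p] :
    ((if p then 1 else 0) &&& 1 : ℕ) = if p then 1 else 0 := by split <;> rfl

end eval

/-! ### Running a program with a limited number of loop iterations -/

/-- The guard of a clocked loop: register `x` of the original program is nonzero and there is fuel
left. -/
def clkGuard (x : ℕ) : Prog :=
  .ite 90 (.ite (x + 100) (.const 91 1) (.const 91 0)) (.const 91 0)

/-- The clocked loop with clocked body `p`; the register `2` holds the constant `1`. -/
def clkLoop (x : ℕ) (p : Prog) : Prog :=
  .loop 91 (.op .sub 90 90 2 ;; p ;; clkGuard x)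

/-- The program `p`, with all registers and arrays shifted by `100`, where every iteration of a loop
consumes one unit of the fuel in register `90`, and which does nothing once there is no fuel left. -/
def clk : Prog → Prog
  | .skip => .skip
  | .const r k => .ite 90 (.const (r + 100) k) .skip
  | .op o r x y => .ite 90 (.op o (r + 100) (x + 100) (y + 100)) .skip
  | .load r a x => .ite 90 (.load (r + 100) (a + 100) (x + 100)) .skip
  | .store a x y => .ite 90 (.store (a + 100) (x + 100) (y + 100)) .skip
  | .rand r x => .ite 90 (.rand (r + 100) (x + 100)) .skip
  | .seq p q => clk p ;; clk q
  | .ite x p q => .ite 90 (.ite (x + 100) (clk p) (clk q)) .skip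
  | .loop x p => clkGuard x ;; clkLoop x (clk p)

/-- The time that the clocked program needs between two iterations of loops. -/
def clkCost : Prog → ℕ
  | .skip => 1
  | .seq p q => clkCost p + clkCost q + 1
  | .ite _ p q => clkCost p + clkCost q + 2
  | .loop _ p => clkCost p + 12
  | _ => 2

theorem clk_regs (p : Prog) : ∀ r ∈ (clk p).regs, 90 ≤ r := by
  induction p with
  | seq p q ihp ihq => simp only [clk, Prog.regs, List.mem_append]; grind
  | ite x p q ihp ihq => simp only [clk, Prog.regs, List.mem_append]; grind
  | loop x p ih =>
    simp only [clk, clkGuard, clkLoop, Prog.regs, List.mem_append, List.mem_cons,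
      List.not_mem_nil]
    grind
  | _ => simp [clk, Prog.regs]; try omega

theorem clk_arrs (p : Prog) : ∀ r ∈ (clk p).arrs, 100 ≤ r := by
  induction p with
  | seq p q ihp ihq => simp only [clk, Prog.arrs, List.mem_append]; grind
  | ite x p q ihp ihq => simp only [clk, Prog.arrs, List.mem_append]; grind
  | loop x p ih =>
    simp only [clk, clkGuard, clkLoop, Prog.arrs, List.mem_append, List.not_mem_nil]
    grind
  | _ => simp [clk, Prog.arrs]

/-- The memory of the original program inside the memory of the clocked one. -/
def Memory.shifted (s : Memory) : Memory := ⟨fun r => s.reg (r + 100), fun a => s.arr (a + 100)⟩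

theorem Memory.shifted_setReg (s : Memory) (r v : ℕ) :
    (s.setReg (r + 100) v).shifted = s.shifted.setReg r v := by
  ext x
  · simp [Memory.shifted]
  · simp [Memory.shifted]

theorem Memory.shifted_setArr (s : Memory) (a i v : ℕ) :
    (s.setArr (a + 100) i v).shifted = s.shifted.setArr a i v := by
  ext x
  · simp [Memory.shifted]
  · simp [Memory.shifted]

theorem Memory.shifted_setReg_of_lt (s : Memory) {r : ℕ} (v : ℕ) (hr : r < 100) :
    (s.setReg r v).shifted = s.shifted := by
  ext x
  · simp [Memory.shifted]; omega
  · simp [Memory.shifted]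

theorem clkGuard_dead {w : ℕ} {s : Memory} (h : s.reg 90 = 0) (x : ℕ) :
    Ter w (clkGuard x) s 2 (fun s' => s'.reg 90 = 0 ∧ s'.reg 91 = 0) :=
  .ite (t := 1) (fun h' => absurd h h') fun _ => .const (by positivity) (by simp [h])

theorem clkLoop_dead {w : ℕ} {s : Memory} (h : s.reg 90 = 0) (h' : s.reg 91 = 0) (x : ℕ)
    (p : Prog) : Ter w (clkLoop x p) s 1 (fun s' => s'.reg 90 = 0) := fun _ =>
  .head (c' := some ([], s)) (by simp [clkLoop, step, h']) (.done ⟨s, rfl, h⟩)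

/-- Without fuel no shifted instruction is executed and no loop is entered, so the rest of the run
is bounded by a constant that depends only on the program text. -/
theorem clk_dead {w : ℕ} (p : Prog) {s : Memory} (h : s.reg 90 = 0) :
    Ter w (clk p) s (clkCost p) (fun s' => s'.reg 90 = 0) := by
  induction p generalizing s with
  | skip => exact .skip h
  | seq p q ihp ihq => exact .seq ((ihp h).conseq le_rfl fun s' _ _ h => ihq h)
  | ite x p q ihp ihq =>
    exact (Ter.ite (t := 1) (fun h' => absurd h h') fun _ => .skip h).conseq
      (by simp only [clkCost]; omega) fun _ _ _ h => h
  | loop x p ih =>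
    refine Ter.seq' (clkGuard_dead h x) (t2 := 1) (fun s' _ _ h => ?_) (by simp only [clkCost]; omega)
    exact clkLoop_dead h.1 h.2 _ _
  | _ => exact Ter.ite (t := 1) (fun h' => absurd h h') fun _ => .skip h

/-! ### Simulation of a program by its clocked version -/

/-- The stack of the clocked machine that corresponds to a stack of the original one. -/
inductive ClkRel : List Prog → List Prog → Prop
  | nil : ClkRel [] []
  | cons {L L' : List Prog} (p : Prog) (h : ClkRel L L') : ClkRel (p :: L) (clk p :: L')
  -- After an iteration the original stack shows the loop again, whereas the clocked stack is about
  -- to recompute the guard. Before the first iteration a loop is an ordinary `cons` entry.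
  | loop {L L' : List Prog} (x : ℕ) (p : Prog) (h : ClkRel L L') :
      ClkRel (.loop x p :: L) (clkGuard x :: clkLoop x (clk p) :: L')

theorem ClkRel.dead {w : ℕ} {L L' : List Prog} (h : ClkRel L L') {s : Memory} (hs : s.Valid w)
    (h0 : s.reg 90 = 0) :
    Ev w (Halted fun s' => s'.reg 90 = 0) (L.map clkCost).sum (some (L', s)) := by
  induction h generalizing s with
  | nil => exact .done ⟨s, rfl, h0⟩
  | cons p h ih =>
    rw [List.map_cons, List.sum_cons]
    refine ((clk_dead p h0).lift hs _).trans ?_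
    rintro c ⟨s', rfl, h1, -, h2⟩
    exact ih h1 h2
  | @loop L L' x p h ih =>
    rw [List.map_cons, List.sum_cons]
    have : Ev w (Halted fun s' => s'.reg 90 = 0) (2 + (1 + (L.map clkCost).sum))
      (some (clkGuard x :: clkLoop x (clk p) :: L', s)) := by
      refine ((clkGuard_dead h0 x).lift hs _).trans ?_
      rintro c ⟨s', rfl, h1, -, h2⟩
      refine ((clkLoop_dead h2.1 h2.2 x (clk p)).lift h1 _).trans ?_
      rintro c ⟨s', rfl, h1, -, h2⟩
      exact ih h1 h2
    exact this.mono (fun _ h => h) (by simp only [clkCost]; omega)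

theorem clkGuard_alive {w : ℕ} {s : Memory} (h : s.reg 90 ≠ 0) (hw : 1 < 2 ^ w) (x : ℕ) :
    Ter w (clkGuard x) s 3 (fun s' => s'.shifted = s.shifted ∧ s'.reg 2 = s.reg 2 ∧
      s'.reg 90 = s.reg 90 ∧ s'.reg 91 = if s.shifted.reg x = 0 then 0 else 1) := by
  refine .ite (t := 2) (fun _ => .ite (t := 1) (fun hx => .const hw ?_)
    fun hx => .const (by positivity) ?_) (fun h' => absurd h' h)
  all_goals
    refine ⟨Memory.shifted_setReg_of_lt _ _ (by norm_num), by simp, by simp, ?_⟩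
    simp [Memory.shifted, hx]

/-- If the value did not fit into a word, the original machine would have crashed, against the
assumption that it halts; hence the clocked machine does not crash either. -/
theorem writeReg_alive {w r v : ℕ} {L L' : List Prog} {σ s : Memory} {t t' : ℕ}
    {Q Q' : Memory → Prop} (h : Ev w (Halted Q) t (writeReg w r v L σ)) (hs : s.Valid w)
    (hσ : s.shifted = σ)
    (h' : ∀ s', some (L, s'.shifted) = writeReg w r v L σ → s'.Valid w → s'.reg 2 = s.reg 2 →
      s'.reg 90 = s.reg 90 → Ev w (Halted Q') t' (some (L', s'))) :
    Ev w (Halted Q') t' (writeReg w (r + 100) v L' s) := by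
  have hv : v < 2 ^ w := by
    by_contra hv
    exact h.of_none (by simp [writeReg, hv])
  have := h' (s.setReg (r + 100) v) (by simp [writeReg, hv, Memory.shifted_setReg, hσ])
    (hs.setReg hv) (by simp) (by simp)
  simpa [writeReg, hv] using this

/-- What the clocked machine achieves, with `f` units of fuel, if the original one reaches `Q`
within `T` steps. -/
def ClkPost (T f : ℕ) (Q : Memory → Prop) (s : Memory) : Prop :=
  (s.reg 90 = 0 ∧ f ≤ T) ∨ (s.reg 90 ≠ 0 ∧ f ≤ s.reg 90 + T ∧ Q s.shifted)

theorem ClkPost.mono {T T' f f' : ℕ} {Q : Memory → Prop} {s : Memory} (h : ClkPost T f Q s)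
    (h1 : f' + T ≤ f + T') : ClkPost T' f' Q s := by
  rcases h with ⟨h2, h3⟩ | ⟨h2, h3, h4⟩
  · exact .inl ⟨h2, by omega⟩
  · exact .inr ⟨h2, by omega, h4⟩

/-- Induction on the run of the original machine. Each part on the stack pays for itself with its
`clkCost`. An iteration of a loop pushes the body once more, and this is paid for by the unit of
fuel that it consumes, which is worth `S`. An original step consumes at most one unit, so fuel that
runs out was at most `T`. -/
theorem ClkRel.alive {w T S : ℕ} {Q : Memory → Prop} {L : List Prog} {σ : Memory}
    (h : Ev w (Halted Q) T (some (L, σ))) {L' : List Prog} (hL : ClkRel L L') {s : Memory}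
    (hs : s.Valid w) (hσ : s.shifted = σ) (h2 : s.reg 2 = 1) (h0 : s.reg 90 ≠ 0)
    (hS : ∀ p ∈ L, clkCost p ≤ S) :
    Ev w (Halted (ClkPost T (s.reg 90) Q)) (s.reg 90 * S + (L.map clkCost).sum)
      (some (L', s)) := by
  have hw : 1 < 2 ^ w := h2 ▸ hs.1 2
  generalize hc : (some (L, σ) : Config) = c at h
  induction h generalizing L σ L' s with
  | done h =>
    obtain ⟨s', rfl, h⟩ := h
    simp at hc
    obtain ⟨rfl, rfl⟩ := hc
    cases hL
    exact .done ⟨s, rfl, .inr ⟨h0, by omega, hσ ▸ h⟩⟩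
  | @next T c h ih =>
    subst hc
    have up : ∀ {s : Memory} {f f' : ℕ}, f' ≤ f + 1 → ClkPost T f Q s → ClkPost (T + 1) f' Q s :=
      fun h1 h => h.mono (by omega)
    have fin : ∀ {t : ℕ} {c : Config} {f f' : ℕ}, f' ≤ f + 1 → Ev w (Halted (ClkPost T f Q)) t c →
        Ev w (Halted (ClkPost (T + 1) f' Q)) t c := fun h1 h => h.mono
      (by rintro c ⟨s', rfl, h⟩; exact ⟨s', rfl, up h1 h⟩) le_rfl
    -- Both ways in which a loop can be on top of the related stacks lead to this configuration, so
    -- it is treated once, with the induction hypothesis passed as an argument.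
    have doLoop : ∀ {x p L L' s}, s.Valid w → s.reg 2 = 1 → s.reg 90 ≠ 0 → s.shifted = σ →
        (∀ q ∈ Prog.loop x p :: L, clkCost q ≤ S) → ClkRel L L' →
        (∀ c' ∈ (step w (some (Prog.loop x p :: L, σ))).support, Ev w (Halted Q) T c') →
        (∀ c' ∈ (step w (some (Prog.loop x p :: L, σ))).support, ∀ {L : List Prog} {σ : Memory}
          {L' : List Prog}, ClkRel L L' → ∀ {s : Memory}, s.Valid w → s.shifted = σ → s.reg 2 = 1 →
          s.reg 90 ≠ 0 → (∀ p ∈ L, clkCost p ≤ S) → some (L, σ) = c' →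
          Ev w (Halted (ClkPost T (s.reg 90) Q)) (s.reg 90 * S + (L.map clkCost).sum)
            (some (L', s))) →
        Ev w (Halted (ClkPost (T + 1) (s.reg 90) Q))
          (s.reg 90 * S + (clkCost p + 11 + (L.map clkCost).sum))
          (some (clkGuard x :: clkLoop x (clk p) :: L', s)) := by
      clear ih h fin hs h0 hσ h2 hL hS
      intro x p L L' s hs h2 h0 hσ hS hL h ih
      have hSp := hS (.loop x p) (by simp)
      simp only [clkCost] at hSp
      have : Ev w (Halted (ClkPost (T + 1) (s.reg 90) Q))
          (3 + (s.reg 90 * S + (clkCost p + 8 + (L.map clkCost).sum)))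
          (some (clkGuard x :: clkLoop x (clk p) :: L', s)) := by
        refine ((clkGuard_alive h0 hw x).lift hs _).trans ?_
        rintro c ⟨s1, rfl, hv1, -, h11, h12, h13, h14⟩
        rw [hσ] at h14 h11
        rw [h2] at h12
        by_cases hx : σ.reg x = 0
        · have h' := ih (some (L, σ)) (by simp [step, hx]) hL hv1 h11 h12 (by omega)
            (fun q hq => hS q (by simp [hq])) rfl
          rw [h13] at h'
          refine (Ev.head (c' := some (L', s1)) (by simp [step, clkLoop, h14, hx]) ?_).mono
            (t := s.reg 90 * S + (L.map clkCost).sum + 1)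
            (G := Halted (ClkPost (T + 1) (s.reg 90) Q)) (fun _ h => h) (by omega)
          exact h'.mono (by rintro c ⟨s', rfl, h⟩; exact ⟨s', rfl, up (by omega) h⟩) le_rfl
        · have h' := @ih (some (p :: .loop x p :: L, σ)) (by simp [step, hx])
            (p :: .loop x p :: L) σ
          have hsub : (1 : ℕ) ≤ s.reg 90 := by omega
          obtain ⟨f, hf⟩ : ∃ f, s.reg 90 = f + 1 := ⟨s.reg 90 - 1, by omega⟩
          have hf1 : s1.reg 90 - s1.reg 2 = f := by omega
          have hflt : f < 2 ^ w := by have := hs.1 90; omega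
          have key : Ev w (Halted (ClkPost (T + 1) (s.reg 90) Q))
              (f * S + (clkCost p + clkCost p + 12 + (L.map clkCost).sum))
              (some (clk p :: clkGuard x :: clkLoop x (clk p) :: L', s1.setReg 90 f)) := by
            have hrel : ClkRel (p :: .loop x p :: L)
              (clk p :: clkGuard x :: clkLoop x (clk p) :: L') := .cons p (.loop x p hL)
            have hv : (s1.setReg 90 f).Valid w := hv1.setReg hflt
            -- If the last unit has just been spent, the rest of the stack is dead, and the fuel,
            -- being `1`, is at most `T + 1`. Otherwise the induction hypothesis applies to the
            -- pushed body.
            rcases Nat.eq_zero_or_pos f with hf0 | hf0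
            · refine (hrel.dead hv (by simp [hf0])).mono ?_ ?_
              · rintro c ⟨s', rfl, h⟩
                exact ⟨s', rfl, .inl ⟨h, by omega⟩⟩
              · simp only [List.map_cons, List.sum_cons, clkCost]; omega
            · have h'' := h' hrel hv
                ((Memory.shifted_setReg_of_lt _ _ (by norm_num)).trans h11) (by simp [h12])
                (by simp; omega) (by
                  intro q hq
                  simp only [List.mem_cons] at hq
                  rcases hq with rfl | hq
                  · omega
                  · exact hS q (by simpa using hq)) rfl
              simp only [Memory.setReg_reg, if_true, List.map_cons, List.sum_cons, clkCost] at h''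
              refine h''.mono (by
                rintro c ⟨s', rfl, h⟩; exact ⟨s', rfl, up (by omega) h⟩) (by omega)
          -- Four steps lead to the body: unfolding the loop, unfolding a sequence, decreasing the
          -- fuel, and unfolding a sequence again.
          refine Ev.mono (t := f * S + (clkCost p + clkCost p + 12 + (L.map clkCost).sum) + 1 + 1 + 1 + 1)
            ?_ (fun _ h => h) ?_
          · refine .head (c' := some ((.op .sub 90 90 2 ;; clk p ;; clkGuard x) ::
              clkLoop x (clk p) :: L', s1)) ?_ (.head rfl ?_)
            · simp only [clkLoop, step, h14, hx]
              simp
            · refine .head (c' := some ((clk p ;; clkGuard x) :: clkLoop x (clk p) :: L',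
                s1.setReg 90 f)) ?_ (.head rfl key)
              simp only [step, WordOp.eval, hf1, writeReg, hflt, if_true]
          · rw [hf, Nat.succ_mul]; omega
      exact this.mono (fun _ h => h) (by omega)
    cases hL with
    | nil => exact (fin (Nat.le_succ _) (ih _ (by simp [step]) .nil hs hσ h2 h0 hS rfl)).mono (fun _ h => h) le_rfl
    | @loop L L' x p hL =>
      refine (doLoop hs h2 h0 hσ hS hL h ih).mono (fun _ h => h) ?_
      simp only [List.map_cons, List.sum_cons, clkCost]; omega
    | @cons L L' p hL =>
      have hS' : ∀ q ∈ L, clkCost q ≤ S := fun q hq => hS q (by simp [hq])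
      have h90 : ∀ {K : List Prog} {a b : Prog},
          step w (some (.ite 90 a b :: K, s)) = PMF.pure (some (a :: K, s)) := by
        intro K a b; simp [step, h0]
      have wr : ∀ {r v : ℕ}, writeReg w r v L σ ∈ (step w (some (p :: L, σ))).support →
          Ev w (Halted (ClkPost (T + 1) (s.reg 90) Q)) (s.reg 90 * S + (L.map clkCost).sum)
            (writeReg w (r + 100) v L' s) := by
        intro r v hm
        refine writeReg_alive (h _ hm) hs hσ fun s' hs1 hs2 hs3 hs4 => ?_
        have := fin (Nat.le_succ _) (ih _ hm hL hs2 rfl (by omega) (by omega) hS' hs1)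
        rw [← hs4]
        exact this
      have hsr : ∀ r, s.reg (r + 100) = σ.reg r := fun r => by rw [← hσ]; rfl
      have hsa : ∀ r i, s.arr (r + 100) i = σ.arr r i := fun r i => by rw [← hσ]; rfl
      cases p with
      | skip =>
        refine (Ev.head rfl (fin (Nat.le_succ _) (ih _ (by simp [step]) hL hs hσ h2 h0 hS' rfl))).mono
          (fun _ h => h) ?_
        simp only [List.map_cons, List.sum_cons, clkCost]; omega
      | const r k =>
        refine (Ev.head h90 (Ev.head rfl (wr (v := k) (r := r) (by simp [step])))).mono
          (fun _ h => h) ?_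
        simp only [List.map_cons, List.sum_cons, clkCost]; omega
      | op o r x y =>
        refine (Ev.head h90 (Ev.head rfl (wr (v := o.eval (s.reg (x + 100)) (s.reg (y + 100))) (r := r)
          (by simp [step, hsr])))).mono (fun _ h => h) ?_
        simp only [List.map_cons, List.sum_cons, clkCost]; omega
      | load r a x =>
        refine (Ev.head h90 (Ev.head rfl (wr (v := s.arr (a + 100) (s.reg (x + 100))) (r := r)
          (by simp [step, hsr, hsa])))).mono (fun _ h => h) ?_
        simp only [List.map_cons, List.sum_cons, clkCost]; omega
      | store a x y =>
        have := fin (Nat.le_succ _) (ih (some (L, σ.setArr a (σ.reg x) (σ.reg y)))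
          (by simp [step]) hL (s := s.setArr (a + 100) (s.reg (x + 100)) (s.reg (y + 100)))
          (hs.setArr (hs.1 _)) (by rw [Memory.shifted_setArr, hσ, hsr, hsr]) (by simpa using h2)
          (by simpa using h0) hS' rfl)
        refine (Ev.head h90 (Ev.head rfl this)).mono (fun _ h => h) ?_
        simp only [List.map_cons, List.sum_cons, clkCost, Memory.setArr_reg]; omega
      | rand r x =>
        have : Ev w (Halted (ClkPost (T + 1) (s.reg 90) Q)) (s.reg 90 * S + (L.map clkCost).sum + 1)
            (some (.rand (r + 100) (x + 100) :: L', s)) := by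
          refine .next fun c' hc' => ?_
          simp only [step, hsr] at hc' wr
          rcases hx : σ.reg x with _ | b
          · exact absurd rfl (h none (by simp [step, hx])).of_none
          · simp only [hx] at hc' wr
            rw [PMF.support_map] at hc'
            obtain ⟨i, hi, rfl⟩ := hc'
            exact wr (by rw [PMF.support_map]; exact ⟨i, hi, rfl⟩)
        refine (Ev.head h90 this).mono (fun _ h => h) ?_
        simp only [List.map_cons, List.sum_cons, clkCost]; omega
      | seq p q =>
        have := fin (Nat.le_succ _) (ih _ (by simp [step]) (.cons p (.cons q hL)) hs hσ h2 h0 (by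
          intro r hr
          have := hS (p ;; q) (by simp)
          simp only [clkCost] at this
          simp only [List.mem_cons] at hr
          rcases hr with rfl | rfl | hr
          · omega
          · omega
          · exact hS' r hr) rfl)
        refine (Ev.head rfl this).mono (fun _ h => h) ?_
        simp only [List.map_cons, List.sum_cons, clkCost]; omega
      | ite x p q =>
        have hSp := hS (.ite x p q) (by simp)
        simp only [clkCost] at hSp
        have := fin (Nat.le_succ _) (ih (some ((if σ.reg x ≠ 0 then p else q) :: L, σ)) (by simp [step])
          (.cons (if σ.reg x ≠ 0 then p else q) hL) hs hσ h2 h0 (by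
            intro r hr
            simp only [List.mem_cons] at hr
            rcases hr with rfl | hr
            · split <;> omega
            · exact hS' r hr) rfl)
        refine (Ev.head h90 (Ev.head (c' := some (clk (if σ.reg x ≠ 0 then p else q) :: L', s)) ?_
          this)).mono (fun _ h => h) ?_
        · simp only [step, hsr]; split <;> rfl
        · simp only [List.map_cons, List.sum_cons, clkCost]; split <;> omega
      | loop x p =>
        refine (Ev.head rfl (doLoop hs h2 h0 hσ hS hL h ih)).mono (fun _ h => h) ?_
        simp only [List.map_cons, List.sum_cons, clkCost]; omega

/-- The clocked program with `f` units of fuel. -/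
theorem Ter.clk {w T : ℕ} {Q : Memory → Prop} {p : Prog} {s : Memory}
    (h : Ev w (Halted Q) T (some ([p], s.shifted))) (h2 : s.reg 2 = 1) :
    Ter w (clk p) s ((s.reg 90 + 1) * clkCost p) (ClkPost T (s.reg 90) Q) := by
  intro hs
  by_cases h0 : s.reg 90 = 0
  · refine (clk_dead p h0 hs).mono ?_ (by simp [h0])
    rintro c ⟨s', rfl, h⟩
    exact ⟨s', rfl, .inl ⟨h, by omega⟩⟩
  · refine (ClkRel.alive (S := clkCost p) h (.cons p .nil) hs rfl h2 h0 (by simp)).mono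
      (fun _ h => h) ?_
    simp; ring_nf; rfl

/-! ### Balls and truncated breadth-first search -/

/-- A finite directed multigraph on the vertices `0, …, N - 1` with arcs `0, …, M - 1`. -/
structure Arcs where
  N : ℕ
  M : ℕ
  tl : ℕ → ℕ
  hd : ℕ → ℕ
  tl_lt : ∀ j < M, tl j < N
  hd_lt : ∀ j < M, hd j < N

namespace Arcs

variable (S : Arcs)

/-- The arcs with tail in `X`. -/
def outArcs (X : Finset ℕ) : Finset ℕ := (Finset.range S.M).filter (S.tl · ∈ X)

/-- The vertices at distance at most `k` from `v`. -/
def ball (v : ℕ) : ℕ → Finset ℕ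
  | 0 => {v}
  | k + 1 => ball v k ∪ (S.outArcs (ball v k)).image S.hd

/-- The arcs with tail at distance less than `k` from `v`. -/
def arcsLt (v : ℕ) : ℕ → Finset ℕ
  | 0 => ∅
  | k + 1 => S.outArcs (S.ball v k)

/-- The arcs `j < k` with tail `u`, in decreasing order. -/
def outList (u : ℕ) : ℕ → List ℕ
  | 0 => []
  | k + 1 => if S.tl k = u then k :: outList u k else outList u k

/-- The out-degree of `u`. -/
def deg (u : ℕ) : ℕ := (S.outList u S.M).length

variable {S}

theorem mem_outArcs {X : Finset ℕ} {j : ℕ} : j ∈ S.outArcs X ↔ j < S.M ∧ S.tl j ∈ X := by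
  simp [outArcs]

theorem outArcs_mono {X Y : Finset ℕ} (h : X ⊆ Y) : S.outArcs X ⊆ S.outArcs Y := by
  intro j; simp only [mem_outArcs]; exact fun hj => ⟨hj.1, h hj.2⟩

theorem mem_ball_succ {v k y : ℕ} :
    y ∈ S.ball v (k + 1) ↔ y ∈ S.ball v k ∨ ∃ j < S.M, S.tl j ∈ S.ball v k ∧ S.hd j = y := by
  simp [ball, mem_outArcs, and_assoc]

theorem ball_subset {v k l : ℕ} (h : k ≤ l) : S.ball v k ⊆ S.ball v l := by
  induction l, h using Nat.le_induction with
  | base => exact Finset.Subset.refl _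
  | succ l _ ih => exact ih.trans Finset.subset_union_left

theorem arcsLt_subset {v k l : ℕ} (h : k ≤ l) : S.arcsLt v k ⊆ S.arcsLt v l := by
  rcases k with _ | k
  · simp [arcsLt]
  · obtain ⟨l, rfl⟩ : ∃ l', l = l' + 1 := ⟨l - 1, by omega⟩
    exact outArcs_mono (ball_subset (by omega))

theorem ball_lt {v : ℕ} (hv : v < S.N) (k : ℕ) : ∀ y ∈ S.ball v k, y < S.N := by
  induction k with
  | zero => simp [ball, hv]
  | succ k ih =>
    intro y hy
    rcases mem_ball_succ.1 hy with h | ⟨j, hj, -, rfl⟩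
    · exact ih y h
    · exact S.hd_lt j hj

theorem mem_ball_self (v k : ℕ) : v ∈ S.ball v k := ball_subset (Nat.zero_le k) (by simp [ball])

theorem ball_closed {v k : ℕ} (h : ∀ j < S.M, S.tl j ∈ S.ball v k → S.hd j ∈ S.ball v k) (l : ℕ) :
    S.ball v l ⊆ S.ball v k := by
  induction l with
  | zero => simpa [ball] using mem_ball_self v k
  | succ l ih =>
    intro y hy
    rcases mem_ball_succ.1 hy with h' | ⟨j, hj, h', rfl⟩
    · exact ih h'
    · exact h j hj (ih h')

theorem mem_outList {u k j : ℕ} : j ∈ S.outList u k ↔ j < k ∧ S.tl j = u := by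
  induction k with
  | zero => simp [outList]
  | succ k ih =>
    unfold outList
    split
    · simp only [List.mem_cons, ih]
      constructor
      · rintro (rfl | h)
        · exact ⟨by omega, by assumption⟩
        · exact ⟨by omega, h.2⟩
      · rintro ⟨h1, h2⟩
        by_cases h : j = k
        · exact .inl h
        · exact .inr ⟨by omega, h2⟩
    · rw [ih]
      constructor
      · rintro ⟨h1, h2⟩; exact ⟨by omega, h2⟩
      · rintro ⟨h1, h2⟩
        by_cases h : j = k
        · subst h; contradiction
        · exact ⟨by omega, h2⟩

theorem outList_nodup (u k : ℕ) : (S.outList u k).Nodup := by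
  induction k with
  | zero => simp [outList]
  | succ k ih =>
    unfold outList
    split
    · exact List.nodup_cons.2 ⟨fun h => by simpa using (mem_outList.1 h).1, ih⟩
    · exact ih

/-- The out-lists of distinct vertices are disjoint. Consequently the degrees that the search adds
up count exactly the arcs that it meets. -/
theorem card_outArcs {L : List ℕ} (h : L.Nodup) :
    (S.outArcs L.toFinset).card = (L.map S.deg).sum := by
  induction L with
  | nil => simp [outArcs]
  | cons u L ih =>
    have hu := List.nodup_cons.1 h
    have h1 : S.outArcs (u :: L).toFinset = (S.outList u S.M).toFinset ∪ S.outArcs L.toFinset := by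
      ext j
      simp only [mem_outArcs, List.mem_toFinset, List.mem_cons, Finset.mem_union, mem_outList]
      tauto
    rw [h1, Finset.card_union_of_disjoint, ih hu.2, List.toFinset_card_of_nodup (outList_nodup _ _)]
    · simp [deg]
    · rw [Finset.disjoint_left]
      intro j hj hj'
      simp only [List.mem_toFinset, mem_outList, mem_outArcs] at hj hj'
      exact hu.1 (hj.2 ▸ hj'.2)

end Arcs

/-! ### Truncated breadth-first search on linked adjacency lists -/

/-- The list `l` is stored as a linked list that starts with the code `c`; the code of `j` is
`j + 1`, and the code of the end of the list is `0`. -/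
def Chain (nxt : ℕ → ℕ) : ℕ → List ℕ → Prop
  | c, [] => c = 0
  | c, j :: l => c = j + 1 ∧ Chain nxt (nxt j) l

/-- The graph `S` is stored in the memory: arrays `2` and `3` hold the tails and heads of the
arcs, arrays `4` and `5` linked lists of the arcs that leave a vertex, and array `6` the degrees. -/
structure GraphMem (w : ℕ) (S : Arcs) (s : Memory) : Prop where
  one : s.reg 2 = 1
  N : s.reg 3 = S.N
  M : s.reg 4 = S.M
  tl : ∀ j < S.M, s.arr 2 j = S.tl j
  hd : ∀ j < S.M, s.arr 3 j = S.hd j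
  out : ∀ u < S.N, Chain (s.arr 5) (s.arr 4 u) (S.outList u S.M)
  deg : ∀ u < S.N, s.arr 6 u = S.deg u
  word : S.N + 2 * S.M + 2 < 2 ^ w

theorem GraphMem.congr {w : ℕ} {S : Arcs} {s s' : Memory} (h : GraphMem w S s)
    (hr : ∀ r < 20, s'.reg r = s.reg r) (ha : ∀ a < 8, s'.arr a = s.arr a) : GraphMem w S s' where
  one := by rw [hr _ (by norm_num), h.one]
  N := by rw [hr _ (by norm_num), h.N]
  M := by rw [hr _ (by norm_num), h.M]
  tl := by rw [ha _ (by norm_num)]; exact h.tl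
  hd := by rw [ha _ (by norm_num)]; exact h.hd
  out := by rw [ha _ (by norm_num), ha _ (by norm_num)]; exact h.out
  deg := by rw [ha _ (by norm_num)]; exact h.deg
  word := h.word

/-- All marks in array `8` are zero. -/
def Clean (S : Arcs) (s : Memory) : Prop := ∀ u < S.N, s.arr 8 u = 0

/-- The list `L` is stored in array `9`, its length in register `63`, and its members are marked. -/
structure QRep (S : Arcs) (L : List ℕ) (s : Memory) : Prop where
  len : s.reg 63 = L.length
  get : ∀ i (h : i < L.length), s.arr 9 i = L[i]
  mark : ∀ y < S.N, s.arr 8 y = if y ∈ L then 1 else 0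
  nodup : L.Nodup
  lt : ∀ y ∈ L, y < S.N

theorem QRep.congr {S : Arcs} {L : List ℕ} {s s' : Memory} (h : QRep S L s)
    (h63 : s'.reg 63 = s.reg 63) (h9 : s'.arr 9 = s.arr 9) (h8 : s'.arr 8 = s.arr 8) :
    QRep S L s' where
  len := by rw [h63, h.len]
  get := by rw [h9]; exact h.get
  mark := by rw [h8]; exact h.mark
  nodup := h.nodup
  lt := h.lt

theorem QRep.push {S : Arcs} {L : List ℕ} {s s' : Memory} (h : QRep S L s) {y : ℕ} (hy : y < S.N)
    (hyL : y ∉ L) (h63 : s'.reg 63 = s.reg 63 + 1)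
    (h9 : ∀ i, s'.arr 9 i = if i = s.reg 63 then y else s.arr 9 i)
    (h8 : ∀ i, s'.arr 8 i = if i = y then 1 else s.arr 8 i) : QRep S (L ++ [y]) s' where
  len := by simp [h63, h.len]
  get i hi := by
    rw [h9, h.len, List.getElem_append]
    simp only [List.length_append, List.length_singleton] at hi
    by_cases hiL : i < L.length
    · simp [hiL, h.get i hiL, hiL.ne]
    · simp [show i = L.length by omega]
  mark z hz := by
    rw [h8, h.mark z hz]
    by_cases hzy : z = y <;> simp [hzy]
  nodup := by
    rw [List.nodup_append]
    exact ⟨h.nodup, by simp, by simp; exact fun a ha hay => hyL (hay ▸ ha)⟩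
  lt z hz := by
    simp only [List.mem_append, List.mem_singleton] at hz
    rcases hz with hz | rfl
    · exact h.lt z hz
    · exact hy

theorem QRep.length_le {S : Arcs} {L : List ℕ} {s : Memory} (h : QRep S L s) : L.length ≤ S.N := by
  rw [← List.toFinset_card_of_nodup h.nodup, ← Finset.card_range S.N]
  exact Finset.card_le_card fun y hy => by simpa using h.lt y (by simpa using hy)

/-- Add the heads of the arcs in the linked list with code in register `73` to the queue. -/
def bfsArcs : Prog :=
  .loop 73 (.op .sub 73 73 2 ;; .load 74 3 73 ;; .load 75 8 74 ;;
    .ite 75 .skip (.store 9 63 74 ;; .store 8 74 2 ;; .op .add 63 63 2) ;; .load 73 5 73)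

theorem bfsArcs_spec {w : ℕ} {S : Arcs} {s : Memory} {L : List ℕ} {l : List ℕ}
    (hS : GraphMem w S s) (hL : QRep S L s) (hl : Chain (s.arr 5) (s.reg 73) l)
    (hlM : ∀ j ∈ l, j < S.M) :
    Ter w bfsArcs s (16 * l.length + 1) (fun s' => ∃ L', L <+: L' ∧ QRep S L' s' ∧
      (∀ y, y ∈ L' ↔ y ∈ L ∨ ∃ j ∈ l, S.hd j = y) ∧ L'.length ≤ L.length + l.length) := by
  refine Ter.loop (fun k s1 => ∃ L1 l1, k = 16 * l1.length ∧ Chain (s.arr 5) (s1.reg 73) l1 ∧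
    (∀ j ∈ l1, j < S.M) ∧ QRep S L1 s1 ∧ L <+: L1 ∧
    (∀ y, (y ∈ L1 ∨ ∃ j ∈ l1, S.hd j = y) ↔ y ∈ L ∨ ∃ j ∈ l, S.hd j = y) ∧
    L1.length + l1.length ≤ L.length + l.length) _ ?_ ?_ ?_
  · rintro k s1 hv hf ⟨L1, l1, rfl, hc, hM, hq, hpre, hmem, hlen⟩ hx
    rcases l1 with _ | ⟨j, l1⟩
    · exact absurd hc hx
    have e2 : s1.reg 2 = 1 := by rw [hf.reg 2 (by decide), hS.one]
    have e3 : s1.arr 3 = s.arr 3 := hf.arr 3 (by decide)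
    have e5 : s1.arr 5 = s.arr 5 := hf.arr 5 (by decide)
    obtain ⟨hcj, hc⟩ := hc
    have hj := hM j (by simp)
    have hjN := S.hd_lt j hj
    have hNw := hS.word
    have hLN := hq.length_le
    have hlen63 := hq.len
    refine ⟨15, by simp, Ter.of_wp (t := 15) ?_ (by simp [Prog.size])⟩
    simp only [wp, WordOp.eval, Memory.setReg_reg, hcj, e2, e3, Memory.setReg_arr, e5,
      Memory.setArr_reg, Memory.setArr_arr]
    norm_num
    simp only [hS.hd j hj]
    refine ⟨by omega, fun hm => ?_, fun hm => ?_⟩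
    · rw [hq.mark _ hjN] at hm
      have hin : S.hd j ∈ L1 := by by_contra h; simp [h] at hm
      refine ⟨16 * l1.length, ⟨L1, l1, rfl, hc, fun i hi => hM i (by simp [hi]),
        hq.congr (by simp) (by simp) (by simp), hpre, fun y => ?_, ?_⟩, by omega⟩
      · rw [← hmem]
        simp only [List.mem_cons]
        constructor
        · rintro (h | ⟨i, hi, h⟩)
          · exact .inl h
          · exact .inr ⟨i, .inr hi, h⟩
        · rintro (h | ⟨i, rfl | hi, h⟩)
          · exact .inl h
          · exact .inl (h ▸ hin)
          · exact .inr ⟨i, hi, h⟩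
      · simp at hlen; omega
    · rw [hq.mark _ hjN] at hm
      have hin : S.hd j ∉ L1 := by by_contra h; simp [h] at hm
      refine ⟨by omega, 16 * l1.length, ⟨L1 ++ [S.hd j], l1, rfl, hc, fun i hi => hM i (by simp [hi]),
        hq.push hjN hin (by simp) (by simp) (by simp), hpre.trans (List.prefix_append _ _),
        fun y => ?_, ?_⟩, by omega⟩
      · rw [← hmem]
        simp only [List.mem_cons, List.mem_append, List.not_mem_nil, or_false]
        constructor
        · rintro ((h | rfl) | ⟨i, hi, h⟩)
          · exact .inl h
          · exact .inr ⟨j, .inl rfl, rfl⟩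
          · exact .inr ⟨i, .inr hi, h⟩
        · rintro (h | ⟨i, rfl | hi, h⟩)
          · exact .inl (.inl h)
          · exact .inl (.inr h.symm)
          · exact .inr ⟨i, hi, h⟩
      · simp at hlen ⊢; omega
  · exact ⟨L, l, rfl, hl, hlM, hL, List.prefix_refl _, fun y => Iff.rfl, le_rfl⟩
  · rintro k s1 hv hf ⟨L1, l1, rfl, hc, hM, hq, hpre, hmem, hlen⟩ hx
    rcases l1 with _ | ⟨j, l1⟩
    · exact ⟨L1, hpre, hq, by simpa using hmem, by simpa using hlen⟩
    · have := hc.1; omega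

/-- Process the vertices of the queue from position `70` to position `67` (exclusive), as long as
not more than `62` arcs have been met. -/
def bfsLevel : Prog :=
  .loop 71 ((.load 72 9 70 ;; .load 75 6 72 ;; .op .add 64 64 75 ;; .op .lt 75 62 64) ;;
    .ite 75 (.const 65 0) (.load 73 4 72 ;; bfsArcs ;; .op .add 70 70 2) ;;
    .op .lt 71 70 67 ;; .op .land 71 71 65)

/-- The total degree of the first `p` vertices of the list. -/
def Arcs.degSum (S : Arcs) (L : List ℕ) (p : ℕ) : ℕ := ((L.take p).map S.deg).sum

theorem Arcs.degSum_succ (S : Arcs) {L : List ℕ} {p : ℕ} (h : p < L.length) :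
    S.degSum L (p + 1) = S.degSum L p + S.deg L[p] := by
  simp only [degSum, List.take_add_one, List.getElem?_eq_getElem h, Option.toList_some,
    List.map_append, List.map_cons, List.map_nil, List.sum_append, List.sum_cons, List.sum_nil,
    Nat.add_zero]

theorem Arcs.degSum_mono (S : Arcs) {L : List ℕ} {p q : ℕ} (h : p ≤ q) :
    S.degSum L p ≤ S.degSum L q := by
  refine List.Sublist.sum_le_sum ?_ (by simp)
  exact (List.take_sublist_take_left h).map _

theorem Arcs.degSum_le (S : Arcs) {L : List ℕ} (h : L.Nodup) (p : ℕ) :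
    S.degSum L p ≤ (S.outArcs L.toFinset).card := by
  rw [degSum, ← card_outArcs (h.sublist (List.take_sublist _ _))]
  refine Finset.card_le_card (outArcs_mono fun x hx => ?_)
  simp only [List.mem_toFinset] at hx ⊢
  exact List.mem_of_mem_take hx

theorem Arcs.deg_le (S : Arcs) (u : ℕ) : S.deg u ≤ S.M := by
  have := card_outArcs (S := S) (List.nodup_singleton u)
  simp only [List.map_cons, List.map_nil, List.sum_cons, List.sum_nil, add_zero] at this
  rw [← this]
  exact (Finset.card_le_card (Finset.filter_subset _ _)).trans (by simp)

/-- The degree of a vertex is added to the count before its arcs are scanned, so an overrun of the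
budget `B` is noticed without paying for it. The cost is measured by a potential: 20 for each arc
that may still be scanned, with the count capped by `B`, and 40 for each vertex of the level that
has not been processed. -/
theorem bfsLevel_spec {w : ℕ} {S : Arcs} {s : Memory} {L : List ℕ} {q B : ℕ}
    (hS : GraphMem w S s) (hL : QRep S L s) (hB : s.reg 62 = B) (hBM : B ≤ S.M)
    (hq : q < L.length) (h70 : s.reg 70 = q) (h67 : s.reg 67 = L.length) (h71 : s.reg 71 = 1)
    (h65 : s.reg 65 = 1) (h64 : s.reg 64 = S.degSum L q) (hcB : S.degSum L q ≤ B)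
    (hlen : L.length ≤ S.degSum L q + 1) :
    Ter w bfsLevel s
      (20 * (min (S.degSum L L.length) B - S.degSum L q) + 40 * (L.length - q) + 1) (fun s' =>
      (s'.reg 65 = 0 ∧ B < (S.outArcs L.toFinset).card ∧
        ∃ L', QRep S L' s' ∧ L'.length ≤ B + 1) ∨
      (∃ L', s'.reg 65 = 1 ∧ L <+: L' ∧ QRep S L' s' ∧ s'.reg 64 = S.degSum L L.length ∧
        (∀ y, y ∈ L' ↔ y ∈ L ∨ ∃ i, ∃ h : i < L.length, q ≤ i ∧ ∃ j < S.M, S.tl j = L[i] ∧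
          S.hd j = y) ∧
        L'.length + S.degSum L q ≤ L.length + S.degSum L L.length ∧ S.degSum L L.length ≤ B)) := by
  refine Ter.loop (fun k s1 =>
    (s1.reg 65 = 0 ∧ s1.reg 71 = 0 ∧ B < (S.outArcs L.toFinset).card ∧
        ∃ L', QRep S L' s1 ∧ L'.length ≤ B + 1) ∨
    (∃ p L1, q ≤ p ∧ p ≤ L.length ∧ s1.reg 70 = p ∧ s1.reg 65 = 1 ∧
      s1.reg 71 = (if p < L.length then 1 else 0) ∧ L <+: L1 ∧ QRep S L1 s1 ∧
      s1.reg 64 = S.degSum L p ∧ S.degSum L p ≤ B ∧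
      (∀ y, y ∈ L1 ↔ y ∈ L ∨ ∃ i, ∃ h : i < L.length, q ≤ i ∧ i < p ∧ ∃ j < S.M,
        S.tl j = L[i] ∧ S.hd j = y) ∧
      L1.length + S.degSum L q ≤ L.length + S.degSum L p ∧
      k = 20 * (min (S.degSum L L.length) B - S.degSum L p) + 40 * (L.length - p))) _ ?_ ?_ ?_
  · rintro k s1 hv hf (⟨-, h0, -⟩ | ⟨p, L1, hqp, hpL, e70, e65, e71, hpre, hq1, e64, hpB, hmem, hl1,
      hk⟩) hx
    · exact absurd h0 hx
    have hp : p < L.length := by by_contra h; simp [h] at e71; exact hx e71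
    have e2 : s1.reg 2 = 1 := by rw [hf.reg 2 (by decide), hS.one]
    have e62 : s1.reg 62 = B := by rw [hf.reg 62 (by decide), hB]
    have e67 : s1.reg 67 = L.length := by rw [hf.reg 67 (by decide), h67]
    have hw := hS.word
    have hpL1 : L1.length ≤ S.N := hq1.length_le
    have hLL1 : L.length ≤ L1.length := hpre.length_le
    have e9 : s1.arr 9 p = L[p] := by
      rw [hq1.get p (by omega)]
      obtain ⟨L2, rfl⟩ := hpre
      rw [List.getElem_append_left hp]
    have hLp : L[p] < S.N := hL.lt _ (List.getElem_mem _)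
    have e6 : s1.arr 6 L[p] = S.deg L[p] := by rw [hf.arr 6 (by decide), hS.deg _ hLp]
    have hd := S.deg_le L[p]
    have hsucc := S.degSum_succ hp
    have hmono := S.degSum_mono (L := L) (p := p + 1) (q := L.length) (by omega)
    -- The duration of an iteration depends on whether the degree exceeds what is left of the
    -- budget: constant if it does, otherwise proportional to the degree.
    obtain ⟨t1, ht1, ht2⟩ : ∃ t1, (B < S.degSum L p + S.deg L[p] → t1 = 15) ∧
        (¬ B < S.degSum L p + S.deg L[p] → t1 = 16 * S.deg L[p] + 19) := by
      by_cases h : B < S.degSum L p + S.deg L[p]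
      · exact ⟨15, fun _ => rfl, fun h' => absurd h h'⟩
      · exact ⟨_, fun h' => absurd h' h, fun _ => rfl⟩
    refine ⟨t1, by omega, ?_⟩
    refine Ter.seq' (t2 := t1 - 8) (R := fun s2 =>
      s2.reg 75 = (if B < S.degSum L p + S.deg L[p] then 1 else 0) ∧ s2.reg 72 = L[p] ∧
      s2.reg 64 = S.degSum L p + S.deg L[p]) (Ter.of_wp ?_ le_rfl) ?_ (by simp [Prog.size]; omega)
    · simp only [wp, WordOp.eval, Memory.setReg_reg, Memory.setReg_arr, e70, e9, e64, e62]
      norm_num [e6]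
      refine ⟨by omega, by split <;> omega⟩
    rintro s2 - hf2 ⟨f75, f72, f64⟩
    have hq2 : QRep S L1 s2 := hq1.congr (hf2.reg _ (by decide)) (hf2.arr _ (by decide))
      (hf2.arr _ (by decide))
    have f2 : s2.reg 2 = 1 := (hf2.reg _ (by decide)).trans e2
    have f70 : s2.reg 70 = p := (hf2.reg _ (by decide)).trans e70
    have f65 : s2.reg 65 = 1 := (hf2.reg _ (by decide)).trans e65
    have f67 : s2.reg 67 = L.length := (hf2.reg _ (by decide)).trans e67
    by_cases hab : B < S.degSum L p + S.deg L[p]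
    · refine Ter.seq' (R := fun s3 => s3 = s2.setReg 65 0) (t1 := 2) (t2 := 3)
        (.ite (t := 1) (fun _ => .const (by positivity) rfl) fun h => by simp [f75, hab] at h) ?_
        (by omega)
      rintro s3 - - rfl
      refine Ter.of_wp ?_ (by simp [Prog.size])
      simp only [wp, WordOp.eval, Memory.setReg_reg]
      norm_num
      refine ⟨by split <;> omega, ⟨?_, L1, ?_, ?_⟩, 0, by omega⟩
      · have := S.degSum_le hL.nodup (p + 1)
        omega
      · exact hq2.congr (by simp) (by simp) (by simp)
      · omega
    · refine Ter.seq' (t1 := 16 * S.deg L[p] + 7) (t2 := 3) (R := fun s3 => s3.reg 70 = p + 1 ∧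
        s3.reg 65 = 1 ∧ ∃ L', L1 <+: L' ∧ QRep S L' s3 ∧
          (∀ y, y ∈ L' ↔ y ∈ L1 ∨ ∃ j ∈ S.outList L[p] S.M, S.hd j = y) ∧
          L'.length ≤ L1.length + S.deg L[p])
        (.ite (t := 16 * S.deg L[p] + 6) (fun h => by simp [f75, hab] at h) fun _ => ?_) ?_
        (by omega)
      · refine Ter.seq' (t1 := 1) (t2 := 16 * S.deg L[p] + 3) (R := fun s3 =>
          s3 = s2.setReg 73 (s2.arr 4 (s2.reg 72))) (.load rfl) ?_ (by omega)
        rintro s3 - - rfl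
        have hS2 : GraphMem w S s2 := by
          refine hS.congr (fun r hr => ?_) fun a ha => ?_
          · rw [hf2.reg r (by simp [Prog.regs]; omega),
              hf.reg r (by simp [Prog.regs, bfsArcs]; omega)]
          · rw [hf2.arr a (by simp [Prog.arrs]),
              hf.arr a (by simp [Prog.arrs, bfsArcs]; omega)]
        refine Ter.seq' (t1 := 16 * S.deg L[p] + 1) (t2 := 1) (bfsArcs_spec (L := L1)
          (l := S.outList L[p] S.M) (hS2.congr ?_ ?_) ?_ ?_ ?_) ?_ (by omega)
        · intro r hr
          simp only [Memory.setReg_reg]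
          rw [if_neg (by omega)]
        · simp
        · exact hq2.congr (by simp) (by simp) (by simp)
        · simpa [f72] using hS2.out _ hLp
        · intro j hj; exact (Arcs.mem_outList.1 hj).1
        · rintro s4 - hf4 ⟨L', h1, h2, h3, h4⟩
          have g70 : s4.reg 70 = p := by rw [hf4.reg 70 (by decide)]; simpa using f70
          have g2 : s4.reg 2 = 1 := by rw [hf4.reg 2 (by decide)]; simpa using f2
          have g65 : s4.reg 65 = 1 := by rw [hf4.reg 65 (by decide)]; simpa using f65
          refine .op (by simp [WordOp.eval, g70, g2]; omega) ⟨by simp [WordOp.eval, g70, g2],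
            by simp [g65], L', h1, h2.congr (by simp) (by simp) (by simp), h3, h4⟩
      · rintro s4 - hf4 ⟨g70, g65, L', h1, h2, h3, h4⟩
        have g67 : s4.reg 67 = L.length := by rw [hf4.reg 67 (by decide), f67]
        have g64 : s4.reg 64 = S.degSum L p + S.deg L[p] := by rw [hf4.reg 64 (by decide), f64]
        have h11 : ∀ p : Prop, [Decidable p] → ((if p then 1 else 0) &&& 1 : ℕ) =
          if p then 1 else 0 := fun p _ => by split <;> rfl
        have hLL' : L1.length ≤ L'.length := h1.length_le
        refine (Ter.of_wp (t := 3) (Q := fun s5 => s5.reg 71 = if p + 1 < L.length then 1 else 0)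
          ?_ (by simp [Prog.size])).conseq le_rfl ?_
        · simp only [wp, WordOp.eval, Memory.setReg_reg, g70, g67, g65]
          norm_num [h11]
          split <;> omega
        intro s5 _ hf5 h71
        refine ⟨_, .inr ⟨p + 1, L', by omega, by omega, by rw [hf5.reg 70 (by decide), g70],
          by rw [hf5.reg 65 (by decide), g65], h71, hpre.trans h1,
          h2.congr (hf5.reg _ (by decide)) (hf5.arr _ (by decide)) (hf5.arr _ (by decide)),
          by rw [hf5.reg 64 (by decide), g64, hsucc], by omega, fun y => ?_, by omega, rfl⟩, by omega⟩
        rw [h3, hmem]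
        constructor
        · rintro ((h | ⟨i, hi, h5, h6, h7⟩) | ⟨j, hj, rfl⟩)
          · exact .inl h
          · exact .inr ⟨i, hi, h5, by omega, h7⟩
          · rw [Arcs.mem_outList] at hj
            exact .inr ⟨p, hp, hqp, by omega, j, hj.1, hj.2, rfl⟩
        · rintro (h | ⟨i, hi, h5, h6, j, hj, h7, h8⟩)
          · exact .inl (.inl h)
          · by_cases hip : i = p
            · subst hip
              exact .inr ⟨j, Arcs.mem_outList.2 ⟨hj, h7⟩, h8⟩
            · exact .inl (.inr ⟨i, hi, h5, by omega, j, hj, h7, h8⟩)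
  · exact .inr ⟨q, L, le_rfl, hq.le, h70, h65, by simp [hq, h71], List.prefix_refl _, hL, h64, hcB,
      by intro y; constructor
         · exact .inl
         · rintro (h | ⟨i, hi, h1, h2, -⟩)
           · exact h
           · omega,
      by omega, rfl⟩
  · rintro k s1 hv hf (⟨h0, -, h1, h2⟩ | ⟨p, L1, hqp, hpL, e70, e65, e71, hpre, hq1, e64, hpB, hmem,
      hl1, hk⟩) hx
    · exact .inl ⟨h0, h1, h2⟩
    · have hp : p = L.length := by by_contra h; simp [show p < L.length by omega] at e71; omega
      subst hp
      refine .inr ⟨L1, e65, hpre, hq1, e64, fun y => ?_, by omega, hpB⟩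
      rw [hmem]
      constructor
      · rintro (h | ⟨i, hi, h1, -, h2⟩)
        · exact .inl h
        · exact .inr ⟨i, hi, h1, h2⟩
      · rintro (h | ⟨i, hi, h1, h2⟩)
        · exact .inl h
        · exact .inr ⟨i, hi, h1, hi, h2⟩

/-- The guard of the loop over the levels. -/
def bfsGuard : Prog :=
  .op .lt 69 68 61 ;; .op .lt 75 66 63 ;; .op .land 69 69 75 ;; .op .land 69 69 65

/-- Truncated breadth-first search from the vertex in register `60`, up to the distance in register
`61`, which gives up after meeting more arcs than the number in register `62`. Register `65` tells
whether it succeeded; array `9` and register `63` hold the vertices that have been found. -/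
def bfs : Prog :=
  (.const 63 1 ;; .const 75 0 ;; .store 9 75 60 ;; .store 8 60 2 ;; .const 64 0 ;; .const 65 1 ;;
    .const 66 0 ;; .const 68 0) ;; bfsGuard ;;
  .loop 69 ((.op .lor 67 63 63 ;; .op .lor 70 66 66 ;; .op .lor 66 63 63 ;; .op .lt 71 70 67) ;;
    bfsLevel ;; .op .add 68 68 2 ;; bfsGuard) ;;
  .const 75 0 ;; forLoop 70 71 63 (.load 72 9 70 ;; .store 8 72 75)

theorem bfsGuard_spec {w : ℕ} {s : Memory} {k r q t x : ℕ} (hw : 1 < 2 ^ w) (h68 : s.reg 68 = k)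
    (h61 : s.reg 61 = r) (h66 : s.reg 66 = q) (h63 : s.reg 63 = t) (h65 : s.reg 65 = x) (hx : x ≤ 1) :
    Ter w bfsGuard s 7 (fun s' => s'.reg 69 = if k < r ∧ q < t ∧ x = 1 then 1 else 0) := by
  have h1 : Fits w 1 := hw
  refine Ter.of_wp ?_ (by simp [Prog.size, bfsGuard])
  interval_cases x
  · simp [bfsGuard, h68, h61, h66, h63, h65, h1]
  · simp [bfsGuard, h68, h61, h66, h63, h65, h1, ite_land_one, -Nat.and_one_is_mod]

theorem Arcs.degSum_prefix (S : Arcs) {L L' : List ℕ} (h : L <+: L') {p : ℕ} (hp : p ≤ L.length) :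
    S.degSum L' p = S.degSum L p := by
  obtain ⟨L2, rfl⟩ := h
  simp [degSum, List.take_append_of_le_length hp]

theorem Arcs.degSum_length (S : Arcs) {L : List ℕ} (h : L.Nodup) :
    S.degSum L L.length = (S.outArcs L.toFinset).card := by
  rw [card_outArcs h, degSum, List.take_length]

/-- The vertices `L` are stored in array `9`, their number in register `63`. -/
structure QList (L : List ℕ) (X : Finset ℕ) (s : Memory) : Prop where
  len : s.reg 63 = L.length
  get : ∀ i (h : i < L.length), s.arr 9 i = L[i]
  nodup : L.Nodup
  toFinset : L.toFinset = X

theorem QList.card {L : List ℕ} {X : Finset ℕ} {s : Memory} (h : QList L X s) :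
    L.length = X.card := by
  rw [← h.toFinset, List.toFinset_card_of_nodup h.nodup]

theorem QList.mem {L : List ℕ} {X : Finset ℕ} {s : Memory} (h : QList L X s) {y : ℕ} :
    y ∈ L ↔ y ∈ X := by
  rw [← h.toFinset, List.mem_toFinset]

theorem QList.congr {L : List ℕ} {X : Finset ℕ} {s s' : Memory} (h : QList L X s)
    (h63 : s'.reg 63 = s.reg 63) (h9 : s'.arr 9 = s.arr 9) : QList L X s' where
  len := by rw [h63, h.len]
  get := by rw [h9]; exact h.get
  nodup := h.nodup
  toFinset := h.toFinset

theorem Clean.congr {S : Arcs} {s s' : Memory} (h : Clean S s) (h8 : s'.arr 8 = s.arr 8) :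
    Clean S s' := by
  unfold Clean; rw [h8]; exact h

theorem bfs_frame_arr {s s' : Memory} (h : Fr bfs s s') : ∀ a, a ≠ 8 → a ≠ 9 → s'.arr a = s.arr a :=
  fun a h1 h2 => h.arr a (by
    simp only [bfs, bfsGuard, bfsLevel, bfsArcs, forLoop, Prog.arrs, List.mem_append,
      List.mem_singleton, List.not_mem_nil]
    tauto)

theorem bfs_regs : ∀ r ∈ bfs.regs, 63 ≤ r ∧ r < 80 := by decide

theorem bfs_frame_reg {s s' : Memory} (h : Fr bfs s s') : ∀ r < 63, s'.reg r = s.reg r :=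
  fun r hr => h.reg r fun hm => by have := bfs_regs r hm; omega

theorem GraphMem.bfs {w : ℕ} {S : Arcs} {s s' : Memory} (h : GraphMem w S s) (hf : Fr bfs s s') :
    GraphMem w S s' :=
  h.congr (fun r hr => bfs_frame_reg hf r (by omega))
    fun a ha => bfs_frame_arr hf a (by omega) (by omega)

/-- The time depends on the arc budget only, not on the radius: the search also stops when a level
yields no new vertex, and every vertex except `v` was found by scanning an arc, so the queue has at
most `B + 1` entries. The marks are erased through the queue, again in time O(B + 1), which lets the
next search start clean. -/
theorem bfs_spec {w : ℕ} {S : Arcs} {s : Memory} {v r B : ℕ} (hS : GraphMem w S s)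
    (hc : Clean S s) (hv : v < S.N) (h60 : s.reg 60 = v) (h61 : s.reg 61 = r) (h62 : s.reg 62 = B)
    (hBM : B ≤ S.M) :
    Ter w bfs s (200 * (B + 1)) (fun s' => Clean S s' ∧
      ((s'.reg 65 = 1 ∧ (S.arcsLt v r).card ≤ B ∧ ∃ L, QList L (S.ball v r) s') ∨
        (s'.reg 65 = 0 ∧ B < (S.arcsLt v r).card))) := by
  have hw := hS.word
  refine Ter.of_valid fun hvs => ?_
  have hr : r < 2 ^ w := h61 ▸ hvs.1 61
  have h1 : Fits w 1 := show 1 < 2 ^ w by omega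
  refine Ter.seq' (t1 := 15) (R := fun s' =>
      s'.reg 65 = 1 ∧ s'.reg 64 = 0 ∧ s'.reg 66 = 0 ∧ s'.reg 68 = 0 ∧ QRep S [v] s')
      (Ter.of_wp ?_ (by simp [Prog.size])) ?_ (t2 := 108 * B + 160) (by omega)
  · simp [h1, h60]
    refine ⟨by simp, ?_, ?_, by simp, by simpa using hv⟩
    · intro i hi
      simp at hi
      subst hi
      simp
    · intro y hy
      simp [hS.one, hc y hy]
  rintro s0 hv0 hf0 ⟨i65, i64, i66, i68, iq⟩
  refine Ter.seq' (bfsGuard_spec (k := 0) (r := r) (q := 0) (t := 1) (x := 1) h1 i68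
    (by rw [hf0.reg _ (by decide), h61]) i66 iq.len i65 le_rfl) ?_ (t2 := 108 * B + 150) (by omega)
  rintro s1 hv1 hf1 i69
  rw [← hf1.reg _ (by decide)] at i65 i64 i66 i68
  replace iq := iq.congr (hf1.reg _ (by decide)) (hf1.arr _ (by decide)) (hf1.arr _ (by decide))
  have hfr1 : ∀ r < 63, s1.reg r = s.reg r := fun r hr => by
    rw [hf1.reg r (by simp [Prog.regs, bfsGuard]; omega), hf0.reg r (by simp [Prog.regs]; omega)]
  have hfa1 : ∀ a < 8, s1.arr a = s.arr a := fun a ha => by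
    rw [hf1.arr a (by simp [Prog.arrs, bfsGuard]), hf0.arr a (by simp [Prog.arrs]; omega)]
  have main : Ter w (.loop 69 ((.op .lor 67 63 63 ;; .op .lor 70 66 66 ;; .op .lor 66 63 63 ;;
      .op .lt 71 70 67) ;; bfsLevel ;; .op .add 68 68 2 ;; bfsGuard)) s1 (100 * B + 80 + 1)
      (fun s' => (s'.reg 65 = 0 ∧ B < (S.arcsLt v r).card ∧ ∃ L, QRep S L s' ∧ L.length ≤ B + 1) ∨
        (s'.reg 65 = 1 ∧ (S.arcsLt v r).card ≤ B ∧ ∃ L, QRep S L s' ∧ L.length ≤ B + 1 ∧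
          L.toFinset = S.ball v r)) := by
    -- Potential over the levels: a new vertex of the queue adds 80, which is paid by the arc that
    -- discovered it, since scanning that arc releases 100.
    refine Ter.loop (fun κ s2 =>
      (s2.reg 69 = 0 ∧ s2.reg 65 = 0 ∧ B < (S.arcsLt v r).card ∧
        ∃ L, QRep S L s2 ∧ L.length ≤ B + 1) ∨
      (∃ k L q, k ≤ r ∧ q ≤ L.length ∧ s2.reg 68 = k ∧ s2.reg 66 = q ∧ s2.reg 65 = 1 ∧
        s2.reg 69 = (if k < r ∧ q < L.length then 1 else 0) ∧ QRep S L s2 ∧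
        L.toFinset = S.ball v k ∧
        (∀ i (h : i < L.length), i < q → ∀ j < S.M, S.tl j = L[i] → S.hd j ∈ L) ∧
        s2.reg 64 = S.degSum L q ∧ (S.arcsLt v k).card = S.degSum L q ∧ S.degSum L q ≤ B ∧
        L.length ≤ S.degSum L q + 1 ∧
        κ = 100 * (B - S.degSum L q) + 80 * (L.length - q))) _ ?_ ?_ ?_
    · rintro κ s2 hv2 hf2 (⟨h0, -⟩ | ⟨k, L, q, hkr, hqL, e68, e66, e65, e69, hq, hball, hclo, e64,
        harcs, hqB, hlen, rfl⟩) hx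
      · exact absurd h0 hx
      obtain ⟨hk, hqlt⟩ : k < r ∧ q < L.length := by
        by_contra h; rw [if_neg h] at e69; exact hx e69
      have fr1 : ∀ r < 63, s2.reg r = s.reg r := fun r hr => by
        rw [hf2.reg r fun hm => ?_, hfr1 r hr]
        have := (by decide : ∀ r ∈ Prog.regs (.loop 69 ((.op .lor 67 63 63 ;; .op .lor 70 66 66 ;;
          .op .lor 66 63 63 ;; .op .lt 71 70 67) ;; bfsLevel ;; .op .add 68 68 2 ;; bfsGuard)),
          63 ≤ r) r hm
        omega
      have fa1 : ∀ a < 8, s2.arr a = s.arr a := fun a ha => by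
        rw [hf2.arr a, hfa1 a ha]
        simp [Prog.arrs, bfsGuard, bfsLevel, bfsArcs]; omega
      have hS2 : GraphMem w S s2 := hS.congr (fun r hr => fr1 r (by omega)) fa1
      have hLN := hq.length_le
      have hmono := S.degSum_mono (L := L) hqlt.le
      refine ⟨20 * (min (S.degSum L L.length) B - S.degSum L q) + 40 * (L.length - q) + 1 + 21,
        by omega, ?_⟩
      refine Ter.seq' (t2 := 20 * (min (S.degSum L L.length) B - S.degSum L q) +
          40 * (L.length - q) + 1 + 12) (R := fun s3 => s3.reg 67 = L.length ∧ s3.reg 70 = q ∧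
          s3.reg 66 = L.length ∧ s3.reg 71 = 1) (Ter.of_wp ?_ le_rfl) ?_
        (by simp [Prog.size]; omega)
      · have : Fits w L.length := show _ < 2 ^ w by omega
        have : Fits w q := show _ < 2 ^ w by omega
        simp [hq.len, *]
      rintro s3 - hf3 ⟨f67, f70, f66, f71⟩
      have hS3 : GraphMem w S s3 := hS2.congr
        (fun r hr => hf3.reg r (by simp [Prog.regs]; omega)) fun a ha => hf3.arr a (by simp [Prog.arrs])
      have f62 : s3.reg 62 = B := by rw [hf3.reg 62 (by decide), fr1 62 (by norm_num), h62]
      have f65 : s3.reg 65 = 1 := by rw [hf3.reg 65 (by decide), e65]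
      have f64 : s3.reg 64 = S.degSum L q := by rw [hf3.reg 64 (by decide), e64]
      have f68 : s3.reg 68 = k := by rw [hf3.reg 68 (by decide), e68]
      refine Ter.seq' (t2 := 11) (bfsLevel_spec hS3 (hq.congr (hf3.reg _ (by decide)) (hf3.arr _ (by decide))
        (hf3.arr _ (by decide))) f62 hBM hqlt f70 f67 f71 f65 f64 hqB hlen) ?_ (by omega)
      rintro s4 - hf4 hs4
      have g2 : s4.reg 2 = 1 := by rw [hf4.reg 2 (by decide), hS3.one]
      have g68 : s4.reg 68 = k := by rw [hf4.reg 68 (by decide), f68]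
      have g66 : s4.reg 66 = L.length := by rw [hf4.reg 66 (by decide), f66]
      have g61 : s4.reg 61 = r := by
        rw [hf4.reg 61 (by decide), hf3.reg 61 (by decide), fr1 61 (by norm_num), h61]
      refine Ter.seq' (t1 := 1) (t2 := 7) (R := fun s5 => s5 = s4.setReg 68 (k + 1))
        (.op (by simp [WordOp.eval, g2, g68]; omega) (by simp [WordOp.eval, g2, g68])) ?_ (by omega)
      rintro s5 - - rfl
      rcases hs4 with ⟨g65, hB, L', hq', hL'⟩ | ⟨L', g65, hpre, hq', g64, hmem, hlen', hB⟩
      · refine (bfsGuard_spec (k := k + 1) (r := r) (q := L.length) (t := L'.length) (x := 0) (by omega)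
          (by simp) (by simpa using g61) (by simpa using g66) (by simpa using hq'.len)
          (by simpa using g65) (by omega)).conseq le_rfl ?_
        intro s6 _ hf6 h69
        refine ⟨0, .inl ⟨by simpa using h69, by rw [hf6.reg _ (by decide)]; simpa using g65, ?_, L',
          hq'.congr ?_ ?_ ?_, hL'⟩, by omega⟩
        · refine hB.trans_le (Finset.card_le_card ?_)
          rw [hball]
          exact Arcs.arcsLt_subset (k := k + 1) hk
        · rw [hf6.reg _ (by decide)]; simp
        · rw [hf6.arr _ (by decide)]; simp
        · rw [hf6.arr _ (by decide)]; simp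
      · refine (bfsGuard_spec (k := k + 1) (r := r) (q := L.length) (t := L'.length) (x := 1) (by omega)
          (by simp) (by simpa using g61) (by simpa using g66) (by simpa using hq'.len)
          (by simpa using g65) (by omega)).conseq le_rfl ?_
        intro s6 _ hf6 h69
        have hLL' := hpre.length_le
        have hd := S.degSum_prefix hpre (le_refl L.length)
        have hget : ∀ i (h : i < L.length), L'[i]'(h.trans_le hLL') = L[i] := by
          intro i h
          obtain ⟨L2, rfl⟩ := hpre
          rw [List.getElem_append_left h]
        have hballm : ∀ y, y ∈ L ↔ y ∈ S.ball v k := fun y => by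
          rw [← hball, List.mem_toFinset]
        refine ⟨_, .inr ⟨k + 1, L', L.length, by omega, hLL', ?_, ?_, ?_, ?_, hq'.congr ?_ ?_ ?_, ?_, ?_,
          ?_, ?_, ?_, ?_, rfl⟩, ?_⟩
        · rw [hf6.reg _ (by decide)]; simp
        · rw [hf6.reg _ (by decide)]; simpa using g66
        · rw [hf6.reg _ (by decide)]; simpa using g65
        · simpa using h69
        · rw [hf6.reg _ (by decide)]; simp
        · rw [hf6.arr _ (by decide)]; simp
        · rw [hf6.arr _ (by decide)]; simp
        · ext y
          rw [List.mem_toFinset, hmem, Arcs.mem_ball_succ, hballm]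
          constructor
          · rintro (h | ⟨i, hi, -, j, hj, h1, h2⟩)
            · exact .inl h
            · exact .inr ⟨j, hj, by rw [h1, ← hballm]; exact List.getElem_mem _, h2⟩
          · rintro (h | ⟨j, hj, h1, h2⟩)
            · exact .inl h
            · rw [← hballm] at h1
              obtain ⟨i, hi, h3⟩ := List.getElem_of_mem h1
              by_cases hiq : i < q
              · exact .inl (by rw [← hballm, ← h2]; exact hclo i hi hiq j hj h3.symm)
              · exact .inr ⟨i, hi, by omega, j, hj, h3.symm, h2⟩
        · intro i hi hiL j hj h1
          rw [hget i hiL] at h1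
          by_cases hiq : i < q
          · exact hpre.subset (hclo i hiL hiq j hj h1)
          · rw [hmem]; exact .inr ⟨i, hiL, by omega, j, hj, h1, rfl⟩
        · rw [hf6.reg _ (by decide), hd]; simpa using g64
        · rw [hd, S.degSum_length hq.nodup, hball]; rfl
        · omega
        · omega
        · omega
    · refine .inr ⟨0, [v], 0, by omega, by simp, i68, i66, i65, by simpa using i69, iq, by simp [Arcs.ball],
        by simp, by simp [i64, Arcs.degSum], by simp [Arcs.arcsLt, Arcs.degSum], by simp [Arcs.degSum],
        by simp, by simp [Arcs.degSum]⟩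
    · rintro κ s2 hv2 hf2 (⟨-, h65, h1, h2⟩ | ⟨k, L, q, hkr, hqL, e68, e66, e65, e69, hq, hball, hclo,
        e64, harcs, hqB, hlen, -⟩) hx
      · exact .inl ⟨h65, h1, h2⟩
      refine .inr ⟨e65, ?_⟩
      by_cases hk : k = r
      · subst hk
        exact ⟨by omega, L, hq, by omega, hball⟩
      -- The search stopped before radius `r` because the last level was empty. Then the ball is
      -- closed under out-arcs, so it already equals the ball of radius `r`.
      · have hqeq : q = L.length := by
          by_contra h; simp [show k < r ∧ q < L.length by omega] at e69; omega
        subst hqeq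
        have hcl : ∀ j < S.M, S.tl j ∈ S.ball v k → S.hd j ∈ S.ball v k := by
          intro j hj h1
          rw [← hball, List.mem_toFinset] at h1 ⊢
          obtain ⟨i, hi, h3⟩ := List.getElem_of_mem h1
          exact hclo i hi hi j hj h3.symm
        have hsub := Arcs.ball_closed hcl r
        refine ⟨?_, L, hq, by omega, ?_⟩
        · obtain ⟨r', rfl⟩ : ∃ r', r = r' + 1 := ⟨r - 1, by omega⟩
          refine (Finset.card_le_card (Arcs.outArcs_mono (Arcs.ball_closed hcl r'))).trans ?_
          rwa [← hball, ← S.degSum_length hq.nodup]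
        · rw [hball]
          exact Finset.Subset.antisymm (Arcs.ball_subset hkr) hsub
  refine Ter.seq' main ?_ (t2 := 8 * B + 60) (by omega)
  rintro s2 - hf2 hs2
  obtain ⟨L, hL, hlen, hs2⟩ : ∃ L, QRep S L s2 ∧ L.length ≤ B + 1 ∧
      ((s2.reg 65 = 1 ∧ (S.arcsLt v r).card ≤ B ∧ L.toFinset = S.ball v r) ∨
        (s2.reg 65 = 0 ∧ B < (S.arcsLt v r).card)) := by
    rcases hs2 with ⟨h1, h2, L, h3, h4⟩ | ⟨h1, h2, L, h3, h4, h5⟩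
    · exact ⟨L, h3, h4, .inr ⟨h1, h2⟩⟩
    · exact ⟨L, h3, h4, .inl ⟨h1, h2, h5⟩⟩
  refine Ter.seq' (t1 := 1) (t2 := 8 * B + 50) (R := fun s3 => s3 = s2.setReg 75 0)
    (.const (by omega) rfl) ?_ (by omega)
  rintro s3 - - rfl
  refine Ter.forLoop (n := L.length) (T := 3) (fun k s4 => ∀ y < S.N, s4.arr 8 y = 0 ∨ y ∈ L.drop k)
    (by simpa using hL.len) ?_ (by decide) (by decide) (by decide) (by decide) ?_ ?_ ?_ (by omega)
  · simp only [Memory.setReg_reg]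
    rw [if_neg (by norm_num), hf2.reg 2 (by decide), hfr1 2 (by norm_num), hS.one]
  · intro s4 _ ha _ y hy
    rw [ha, Memory.setReg_arr, hL.mark y hy]
    simp only [List.drop_zero]
    by_cases h : y ∈ L <;> simp [h]
  · intro k s4 hk hv4 hf4 h70 hI
    have e9 : s4.arr 9 k = L[k] := by rw [hf4.arr 9 (by decide)]; exact hL.get k hk
    have e75 : s4.reg 75 = 0 := by rw [hf4.reg 75 (by decide)]; simp
    refine Ter.of_wp ?_ (by simp [Prog.size])
    simp only [wp, Memory.setReg_reg, Memory.setReg_arr, Memory.setArr_arr, h70, e9]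
    intro v1 v2 y hy
    norm_num
    rcases hI y hy with h | h
    · left; simp [h, e75]
    · rw [List.drop_eq_getElem_cons hk] at h
      rcases List.mem_cons.1 h with rfl | h
      · left; simp [e75]
      · exact .inr h
  · intro s4 hv4 hf4 hI
    have e65 : s4.reg 65 = s2.reg 65 := by rw [hf4.reg 65 (by decide)]; simp
    refine ⟨fun y hy => by simpa using hI y hy, ?_⟩
    rcases hs2 with ⟨h1, h2, h3⟩ | h
    · refine .inl ⟨e65.trans h1, h2, L, ⟨?_, ?_, hL.nodup, h3⟩⟩
      · rw [hf4.reg 63 (by decide)]; simpa using hL.len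
      · rw [hf4.arr 9 (by decide)]; simpa using hL.get
    · exact .inr ⟨e65.trans h.1, h.2⟩

/-! ### The graph together with its reverse -/

/-- The disjoint union of the graph with vertices `0, …, n - 1`, tails `t` and heads `h`, and its
reverse, whose vertices are shifted by `n`. -/
def doubled (n m : ℕ) (t h : ℕ → ℕ) (ht : ∀ j < m, t j < n) (hh : ∀ j < m, h j < n) : Arcs where
  N := n + n
  M := m + m
  tl j := if j < m then t j else h (j - m) + n
  hd j := if j < m then h j else t (j - m) + n
  tl_lt j hj := by
    split
    · have := ht j ‹_›; omega
    · have := hh (j - m) (by omega); omega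
  hd_lt j hj := by
    split
    · have := hh j ‹_›; omega
    · have := ht (j - m) (by omega); omega

/-- Store the disjoint union of the input graph and its reverse. -/
def buildGraph : Prog :=
  (.const 2 1 ;; .op .add 3 0 0 ;; .op .add 4 1 1) ;;
  forLoop 30 31 1 (.load 32 0 30 ;; .load 33 1 30 ;; .store 2 30 32 ;; .store 3 30 33 ;;
    .op .add 34 30 1 ;; .op .add 32 32 0 ;; .op .add 33 33 0 ;; .store 2 34 33 ;; .store 3 34 32) ;;
  .const 32 0 ;;
  forLoop 30 31 3 (.store 4 30 32 ;; .store 6 30 32 ;; .store 8 30 32) ;;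
  forLoop 30 31 4 (.load 33 2 30 ;; .load 34 4 33 ;; .store 5 30 34 ;; .op .add 34 30 2 ;;
    .store 4 33 34 ;; .load 34 6 33 ;; .op .add 34 34 2 ;; .store 6 33 34)

theorem Chain.congr {f g : ℕ → ℕ} {c : ℕ} {l : List ℕ} (h : Chain f c l)
    (hfg : ∀ j ∈ l, g j = f j) : Chain g c l := by
  induction l generalizing c with
  | nil => exact h
  | cons j l ih =>
    refine ⟨h.1, ?_⟩
    rw [hfg j (by simp)]
    exact ih h.2 fun i hi => hfg i (by simp [hi])

theorem outList_length_le (S : Arcs) (u k : ℕ) : (S.outList u k).length ≤ k := by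
  induction k with
  | zero => simp [Arcs.outList]
  | succ k ih =>
    unfold Arcs.outList
    split
    · simp [ih]
    · omega

/-- The reverse of arc `j` is stored at index `m + j`. Since the memory may hold arbitrary words,
list heads, degrees and marks are zeroed first. Arcs are then prepended in increasing order, which
is why `Arcs.outList` is decreasing. -/
theorem buildGraph_spec {w n m : ℕ} {s : Memory} {t h : ℕ → ℕ} (ht : ∀ j < m, t j < n)
    (hh : ∀ j < m, h j < n) (h0 : s.reg 0 = n) (h1 : s.reg 1 = m) (hat : ∀ j < m, s.arr 0 j = t j)
    (hah : ∀ j < m, s.arr 1 j = h j) (hw : 2 * n + 4 * m + 2 < 2 ^ w) :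
    Ter w buildGraph s (100 * (n + m + 1)) (fun s' => GraphMem w (doubled n m t h ht hh) s' ∧
      Clean (doubled n m t h ht hh) s') := by
  have hf1 : Fits w 1 := show 1 < 2 ^ w by omega
  have hfi : ∀ {v}, v ≤ 2 * n + 4 * m + 2 → Fits w v := fun {v} hv => show v < 2 ^ w by omega
  refine Ter.seq' (t1 := 5) (t2 := 100 * (n + m + 1) - 6) (R := fun s1 => s1.reg 2 = 1 ∧
    s1.reg 3 = n + n ∧ s1.reg 4 = m + m ∧ s1.arr = s.arr ∧ s1.reg 0 = n ∧ s1.reg 1 = m)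
    (Ter.of_wp ?_ (by simp [Prog.size])) ?_ (by omega)
  · simp [h0, h1, hf1]
    exact ⟨hfi (by omega), hfi (by omega)⟩
  rintro s1 - - ⟨e2, e3, e4, ea, e0, e1⟩
  refine Ter.seq' (t1 := m * (17 + 5) + 5) (t2 := 100 * (n + m + 1) - 7 - (m * (17 + 5) + 5))
    (R := fun s2 => ∀ j < m, s2.arr 2 j = t j ∧ s2.arr 3 j = h j ∧ s2.arr 2 (m + j) = h j + n ∧
      s2.arr 3 (m + j) = t j + n)
    (Ter.forLoop m 17 (fun k s2 => ∀ j < k, s2.arr 2 j = t j ∧ s2.arr 3 j = h j ∧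
      s2.arr 2 (m + j) = h j + n ∧ s2.arr 3 (m + j) = t j + n) e1 e2 (by decide) (by decide)
      (by decide) (by decide) (by simp) ?_ (fun _ _ _ h => h) le_rfl) ?_ (by omega)
  · intro k s2 hk _ hf e30 hI
    have f0 : s2.reg 0 = n := by rw [hf.reg 0 (by decide), e0]
    have f1 : s2.reg 1 = m := by rw [hf.reg 1 (by decide), e1]
    have a0 : s2.arr 0 k = t k := by rw [hf.arr 0 (by decide), ea, hat k hk]
    have a1 : s2.arr 1 k = h k := by rw [hf.arr 1 (by decide), ea, hah k hk]
    have htk := ht k hk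
    have hhk := hh k hk
    refine (Ter.of_wp (t := 17) (Q := fun s3 => ∀ j,
      s3.arr 2 j = (if j = k + m then h k + n else if j = k then t k else s2.arr 2 j) ∧
      s3.arr 3 j = (if j = k + m then t k + n else if j = k then h k else s2.arr 3 j)) ?_
      (by simp [Prog.size])).conseq le_rfl ?_
    · simp [e30, f0, f1, a0, a1]
      exact ⟨hfi (by omega), hfi (by omega), hfi (by omega)⟩
    · intro s3 _ _ h3 v v' j hj
      simp only [Memory.setReg_arr]
      obtain ⟨h31, h32⟩ := h3 j
      obtain ⟨h33, h34⟩ := h3 (m + j)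
      rw [h31, h32, h33, h34]
      by_cases hjk : j = k
      · subst hjk
        simp [add_comm m j]
        constructor <;> intro <;> omega
      · have := hI j (by omega)
        rw [if_neg (by omega), if_neg hjk, if_neg (by omega), if_neg hjk, if_neg (by omega),
          if_neg (by omega), if_neg (by omega), if_neg (by omega)]
        exact this
  rintro s2 - hf2 hI2
  refine Ter.seq' (t1 := 1) (t2 := 100 * (n + m + 1) - 9 - (m * (17 + 5) + 5))
    (R := fun s3 => s3 = s2.setReg 32 0) (.const (by omega) rfl) ?_ (by omega)
  rintro s3 - - rfl
  have g2 : (s2.setReg 32 0).reg 2 = 1 := by simp; rw [hf2.reg 2 (by decide), e2]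
  have g3 : (s2.setReg 32 0).reg 3 = n + n := by simp; rw [hf2.reg 3 (by decide), e3]
  have g4 : (s2.setReg 32 0).reg 4 = m + m := by simp; rw [hf2.reg 4 (by decide), e4]
  refine Ter.seq' (t1 := (n + n) * (5 + 5) + 5) (t2 := (m + m) * (15 + 5) + 5)
    (R := fun s4 => ∀ u < n + n, s4.arr 4 u = 0 ∧ s4.arr 6 u = 0 ∧ s4.arr 8 u = 0)
    (Ter.forLoop (n + n) 5 (fun k s4 => ∀ u < k, s4.arr 4 u = 0 ∧ s4.arr 6 u = 0 ∧ s4.arr 8 u = 0)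
      g3 g2 (by decide) (by decide) (by decide) (by decide) (by simp) ?_ (fun _ _ _ h => h) le_rfl)
      ?_ (by omega)
  · intro k s4 hk _ hf e30 hI
    have f32 : s4.reg 32 = 0 := by rw [hf.reg 32 (by decide)]; simp
    refine Ter.of_wp ?_ (by simp [Prog.size])
    simp [e30, f32]
    intro u hu
    by_cases huk : u = k
    · simp [huk]
    · simpa [huk] using hI u (by omega)
  rintro s4 - hf4 hI4
  have k2 : s4.reg 2 = 1 := by rw [hf4.reg 2 (by decide), g2]
  have k4 : s4.reg 4 = m + m := by rw [hf4.reg 4 (by decide), g4]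
  set S := doubled n m t h ht hh with hS
  have hSM : S.M = m + m := rfl
  have hSN : S.N = n + n := rfl
  have htl : ∀ j < S.M, s4.arr 2 j = S.tl j := fun j hj => by
    rw [hf4.arr 2 (by decide), Memory.setReg_arr]
    simp only [hS, doubled]
    split
    · exact (hI2 j ‹_›).1
    · obtain ⟨j', rfl⟩ : ∃ j', j = m + j' := ⟨j - m, by omega⟩
      rw [(hI2 j' (by omega)).2.2.1, Nat.add_sub_cancel_left]
  have hhd : ∀ j < S.M, s4.arr 3 j = S.hd j := fun j hj => by
    rw [hf4.arr 3 (by decide), Memory.setReg_arr]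
    simp only [hS, doubled]
    split
    · exact (hI2 j ‹_›).2.1
    · obtain ⟨j', rfl⟩ : ∃ j', j = m + j' := ⟨j - m, by omega⟩
      rw [(hI2 j' (by omega)).2.2.2, Nat.add_sub_cancel_left]
  refine Ter.forLoop (m + m) 15 (fun k s5 => ∀ u < S.N, Chain (s5.arr 5) (s5.arr 4 u) (S.outList u k) ∧
    s5.arr 6 u = (S.outList u k).length) k4 k2 (by decide) (by decide) (by decide) (by decide)
    ?_ ?_ ?_ le_rfl
  · intro s5 _ ha _ u hu
    rw [ha]
    obtain ⟨h1, h2, -⟩ := hI4 u hu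
    exact ⟨h1, h2⟩
  · intro k s5 hk _ hf e30 hI
    have f2 : s5.reg 2 = 1 := by rw [hf.reg 2 (by decide), k2]
    have a2 : s5.arr 2 k = S.tl k := by rw [hf.arr 2 (by decide), htl k hk]
    obtain ⟨hI1, hI2⟩ := hI (S.tl k) (S.tl_lt k hk)
    have hlen := outList_length_le S (S.tl k) k
    refine (Ter.of_wp (t := 15) (Q := fun s6 => (∀ j, s6.arr 5 j = if j = k then s5.arr 4 (S.tl k)
      else s5.arr 5 j) ∧ (∀ u, s6.arr 4 u = if u = S.tl k then k + 1 else s5.arr 4 u) ∧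
      ∀ u, s6.arr 6 u = if u = S.tl k then s5.arr 6 (S.tl k) + 1 else s5.arr 6 u) ?_
      (by simp [Prog.size])).conseq le_rfl ?_
    · simp [e30, f2, a2]
      exact ⟨hfi (by omega), hfi (by omega)⟩
    · rintro s6 _ _ ⟨h5, h4, h6⟩ v v' u hu
      simp only [Memory.setReg_arr]
      have hcg : ∀ u, ∀ j ∈ S.outList u k, s6.arr 5 j = s5.arr 5 j := fun u j hj => by
        have := (Arcs.mem_outList.1 hj).1
        rw [h5, if_neg (by omega)]
      rw [h4, h6]
      by_cases huk : u = S.tl k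
      · subst huk
        simp only [if_true, Arcs.outList, List.length_cons, hI2]
        refine ⟨⟨rfl, ?_⟩, trivial⟩
        rw [h5, if_pos rfl]
        exact hI1.congr (hcg _)
      · simp only [huk, if_false, Arcs.outList, Ne.symm huk]
        exact ⟨(hI u hu).1.congr (hcg _), (hI u hu).2⟩
  · intro s5 _ hf hI
    refine ⟨⟨by rw [hf.reg 2 (by decide), k2], ?_, by rw [hf.reg 4 (by decide), k4]; rfl, ?_, ?_,
      fun u hu => (hI u hu).1, fun u hu => (hI u hu).2, ?_⟩, ?_⟩
    · rw [hf.reg 3 (by decide), hf4.reg 3 (by decide), g3]; rfl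
    · rw [hf.arr 2 (by decide)]; exact htl
    · rw [hf.arr 3 (by decide)]; exact hhd
    · rw [hSM, hSN]; omega
    · intro u hu
      rw [hf.arr 8 (by decide)]
      exact (hI4 u hu).2.2

/-! ### The mathematics of the approximation -/

namespace Arcs

variable {S : Arcs}

theorem ball_trans {v x y a b : ℕ} (h1 : x ∈ S.ball v a) (h2 : y ∈ S.ball x b) :
    y ∈ S.ball v (a + b) := by
  induction b generalizing y with
  | zero => simp only [ball, Finset.mem_singleton] at h2; subst h2; exact h1
  | succ b ih =>
    rw [← Nat.add_assoc, mem_ball_succ]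
    rcases mem_ball_succ.1 h2 with h | ⟨j, hj, h, rfl⟩
    · exact .inl (ih h)
    · exact .inr ⟨j, hj, ih h, rfl⟩

theorem ball_split {v y a b : ℕ} (h : y ∈ S.ball v (a + b)) : ∃ x ∈ S.ball v a, y ∈ S.ball x b := by
  induction b generalizing y with
  | zero => exact ⟨y, h, mem_ball_self _ _⟩
  | succ b ih =>
    rw [← Nat.add_assoc] at h
    rcases mem_ball_succ.1 h with h1 | ⟨j, hj, h1, rfl⟩
    · obtain ⟨x, hx, hy⟩ := ih h1
      exact ⟨x, hx, ball_subset (Nat.le_succ b) hy⟩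
    · obtain ⟨x, hx, hy⟩ := ih h1
      exact ⟨x, hx, mem_ball_succ.2 (.inr ⟨j, hj, hy, rfl⟩)⟩

theorem arcsLt_trans {v x a b : ℕ} (h : x ∈ S.ball v a) : S.arcsLt x b ⊆ S.arcsLt v (a + b) := by
  rcases b with _ | b
  · simp [arcsLt]
  · exact outArcs_mono fun y hy => ball_trans h hy

theorem arcsLt_lt {v k j : ℕ} (h : j ∈ S.arcsLt v k) : j < S.M := by
  rcases k with _ | k
  · simp [arcsLt] at h
  · exact (mem_outArcs.1 h).1

theorem tl_mem_of_arcsLt {v k j : ℕ} (h : j ∈ S.arcsLt v k) : 0 < k ∧ S.tl j ∈ S.ball v (k - 1) := by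
  rcases k with _ | k
  · simp [arcsLt] at h
  · exact ⟨by omega, (mem_outArcs.1 h).2⟩

/-- The samples `R` hit every set `arcsLt v r`, with a number of samples that is inversely
proportional to its size. -/
def Good (S : Arcs) (n L : ℕ) (R : ℕ → ℕ) : Prop :=
  ∀ v < S.N, ∀ r ≤ n, (S.arcsLt v r).Nonempty →
    ∃ i, i * (S.arcsLt v r).card < S.M * L ∧ R i ∈ S.arcsLt v r

end Arcs

/-- The other copy of the vertex `v`. -/
def mirror (n v : ℕ) : ℕ := if v < n then v + n else v - n

theorem mirror_lt {n v : ℕ} (h : v < n + n) : mirror n v < n + n := by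
  unfold mirror; split <;> omega

theorem mirror_mirror {n v : ℕ} (h : v < n + n) : mirror n (mirror n v) = v := by
  unfold mirror; split_ifs <;> omega

theorem mirror_lt_iff {n v : ℕ} (h : v < n + n) : mirror n v < n ↔ ¬ v < n := by
  unfold mirror; split <;> omega

section doubled

variable {n m : ℕ} {t h : ℕ → ℕ} {ht : ∀ j < m, t j < n} {hh : ∀ j < m, h j < n}

local notation "𝓢" => doubled n m t h ht hh

theorem doubled_copy {v y k : ℕ} (hy : y ∈ (𝓢).ball v k) : y < n ↔ v < n := by
  induction k generalizing y with
  | zero => simp only [Arcs.ball, Finset.mem_singleton] at hy; subst hy; rfl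
  | succ k ih =>
    rcases Arcs.mem_ball_succ.1 hy with h1 | ⟨j, hj, h1, rfl⟩
    · exact ih h1
    · rw [← ih h1]
      simp only [doubled] at hj ⊢
      split
      · simp [hh j ‹_›, ht j ‹_›]
      · simp

/-- The partner of an arc is its reverse in the other copy, at index `j + m` or `j - m`. -/
theorem doubled_arc {j : ℕ} (hj : j < (𝓢).M) :
    ∃ j' < (𝓢).M, (𝓢).tl j' = mirror n ((𝓢).hd j) ∧ (𝓢).hd j' = mirror n ((𝓢).tl j) := by
  simp only [doubled] at hj ⊢
  by_cases h1 : j < m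
  · refine ⟨j + m, by omega, ?_, ?_⟩
    · simp [h1, mirror, hh j h1]
    · simp [h1, mirror, ht j h1]
  · refine ⟨j - m, by omega, ?_, ?_⟩
    · simp [h1, mirror, show j - m < m by omega]
    · simp [h1, mirror, show j - m < m by omega]

theorem doubled_mirror {v y k : ℕ} (hy : y ∈ (𝓢).ball v k) :
    mirror n v ∈ (𝓢).ball (mirror n y) k := by
  induction k generalizing y with
  | zero =>
    simp only [Arcs.ball, Finset.mem_singleton] at hy ⊢; subst hy; rfl
  | succ k ih =>
    rcases Arcs.mem_ball_succ.1 hy with h0 | ⟨j, hj, h0, rfl⟩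
    · exact Arcs.ball_subset (Nat.le_succ k) (ih h0)
    · obtain ⟨j', hj', h1, h2⟩ := doubled_arc hj
      rw [Nat.add_comm k 1]
      refine Arcs.ball_trans (x := (𝓢).hd j') ?_ (h2 ▸ ih h0)
      rw [Arcs.mem_ball_succ]
      exact .inr ⟨j', hj', by simp [Arcs.ball, h1], rfl⟩

/-- Reversing a path exchanges its ends and the copies. This is the device by which searches that
only follow out-arcs also answer questions about in-balls. -/
theorem doubled_mirror_iff {v y k : ℕ} (hv : v < n + n) (hy : y < n + n) :
    y ∈ (𝓢).ball (mirror n v) k ↔ v ∈ (𝓢).ball (mirror n y) k := by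
  constructor
  · intro hm
    have := doubled_mirror hm
    rwa [mirror_mirror hv] at this
  · intro hm
    have := doubled_mirror hm
    rwa [mirror_mirror hy] at this

/-! ### Far pairs: the combinatorial core -/

/-- Some vertex is at distance at least `d` from another one. -/
def Far (A : Arcs) (n d : ℕ) : Prop := ∃ u v, u < n ∧ v < n ∧ ∀ k < d, v ∉ A.ball u k

/-- For a pair in the reversed copy, the mirrored pair in the opposite order is a witness in the
graph itself. -/
theorem far_of_not_mem {u v d : ℕ} (hu : u < n + n) (hv : v < n + n) (huv : u < n ↔ v < n)
    (H : v ∉ (𝓢).ball u (d - 1)) : Far 𝓢 n d := by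
  have H' : ∀ k < d, v ∉ (𝓢).ball u k := fun k hk hv => H (Arcs.ball_subset (by omega) hv)
  by_cases hun : u < n
  · exact ⟨u, v, hun, huv.1 hun, H'⟩
  · refine ⟨mirror n v, mirror n u, (mirror_lt_iff hv).2 fun h => hun (huv.2 h),
      (mirror_lt_iff hu).2 hun, fun k hk hm => H' k hk ?_⟩
    rw [doubled_mirror_iff hv (mirror_lt hu), mirror_mirror hu] at hm
    exact hm

/-- The vertices of the copy that contains `u`. -/
theorem far_of_card {u d : ℕ} (hu : u < n + n) (hc : ((𝓢).ball u (d - 1)).card < n) :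
    Far 𝓢 n d := by
  by_contra hF
  have hall : ∀ v < n + n, (u < n ↔ v < n) → v ∈ (𝓢).ball u (d - 1) := fun v hv huv => by
    by_contra H
    exact hF (far_of_not_mem hu hv huv H)
  by_cases hun : u < n
  · have : Finset.range n ⊆ (𝓢).ball u (d - 1) := fun v hv => by
      simp only [Finset.mem_range] at hv
      exact hall v (by omega) (by simp [hun, hv])
    have := Finset.card_le_card this
    simp at this; omega
  · have : Finset.Ico n (n + n) ⊆ (𝓢).ball u (d - 1) := fun v hv => by
      simp only [Finset.mem_Ico] at hv
      exact hall v hv.2 (by omega)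
    have := Finset.card_le_card this
    simp at this; omega

/-- A ball never leaves the copy of its centre, and a copy has `n` vertices; so a ball with `n`
elements is the whole copy. This is why the program only has to compare cardinalities. -/
theorem mem_of_card {u v k : ℕ} (hu : u < n + n) (hv : v < n + n) (huv : u < n ↔ v < n)
    (hc : n ≤ ((𝓢).ball u k).card) : v ∈ (𝓢).ball u k := by
  by_contra H
  have hlt : ∀ y ∈ (𝓢).ball u k, y < n + n := Arcs.ball_lt (show u < Arcs.N 𝓢 from hu) k
  by_cases hun : u < n
  · have : (𝓢).ball u k ⊆ (Finset.range n).erase v := fun y hy => by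
      simp only [Finset.mem_erase, Finset.mem_range]
      exact ⟨fun h => H (h ▸ hy), (doubled_copy hy).2 hun⟩
    have := Finset.card_le_card this
    rw [Finset.card_erase_of_mem (by simpa using huv.1 hun)] at this
    simp at this; omega
  · have : (𝓢).ball u k ⊆ (Finset.Ico n (n + n)).erase v := fun y hy => by
      have := hlt y hy
      have := (doubled_copy hy).not.2 hun
      simp only [Finset.mem_erase, Finset.mem_Ico]
      exact ⟨fun h => H (h ▸ hy), by omega, by omega⟩
    have := Finset.card_le_card this
    rw [Finset.card_erase_of_mem (by simp; omega)] at this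
    simp at this; omega

/-- A far pair in the copy of `w`. -/
theorem Far.exists (w : ℕ) {d : ℕ} (hF : Far 𝓢 n d) : ∃ u v, u < n + n ∧ v < n + n ∧
    (u < n ↔ w < n) ∧ (v < n ↔ w < n) ∧ ∀ k < d, v ∉ (𝓢).ball u k := by
  obtain ⟨u, v, hu, hv, H⟩ := hF
  by_cases hwn : w < n
  · exact ⟨u, v, by omega, by omega, by simp [hu, hwn], by simp [hv, hwn], H⟩
  · refine ⟨mirror n v, mirror n u, mirror_lt (by omega), mirror_lt (by omega), ?_, ?_,
      fun k hk hm => H k hk ?_⟩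
    · rw [mirror_lt_iff (by omega)]; simp [hv, hwn]
    · rw [mirror_lt_iff (by omega)]; simp [hu, hwn]
    · rw [doubled_mirror_iff (by omega) (mirror_lt (by omega)), mirror_mirror (by omega)] at hm
      exact hm

/-- Let `(u, v)` be a far pair in the copy of `w`. On a path from `w` to `v` of length at most `d -
1` take the vertex `x` at distance `r` from `w`. The search from `mirror n x` shows that `u` reaches
`x` within `d - 1` steps, so `u` reaches `v` within `(d - 1) + (d - 1 - r)` steps, which is less
than `D`. -/
theorem not_far_of_ball {w d D r : ℕ} (hw : w < n + n) (hd : 1 ≤ d) (hdD : d ≤ D)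
    (hr : 2 * d ≤ D + r + 1) (h1 : n ≤ ((𝓢).ball w (d - 1)).card)
    (h2 : ∀ x ∈ (𝓢).ball w r, n ≤ ((𝓢).ball (mirror n x) (d - 1)).card) : ¬ Far 𝓢 n D := by
  intro hF
  obtain ⟨u, v, hu, hv, huw, hvw, H⟩ := hF.exists w
  have hv1 : v ∈ (𝓢).ball w (d - 1) := mem_of_card hw hv hvw.symm h1
  have key : ∀ x ∈ (𝓢).ball w r, x ∈ (𝓢).ball u (d - 1) := fun x hx => by
    have hxlt : x < n + n := Arcs.ball_lt (show w < Arcs.N 𝓢 from hw) r x hx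
    have := mem_of_card (mirror_lt hxlt) (mirror_lt hu) (by
      rw [mirror_lt_iff hxlt, mirror_lt_iff hu, doubled_copy hx, huw]) (h2 x hx)
    rwa [doubled_mirror_iff hxlt (mirror_lt hu), mirror_mirror hu] at this
  -- If `r > d - 1`, then `v` itself lies in the ball of radius `r` around `w` and takes the role of
  -- `x`.
  by_cases hrd : r ≤ d - 1
  · rw [show d - 1 = r + (d - 1 - r) by omega] at hv1
    obtain ⟨x, hx, hvx⟩ := Arcs.ball_split hv1
    exact H _ (by omega) (Arcs.ball_trans (key x hx) hvx)
  · exact H (d - 1) (by omega) (key v (Arcs.ball_subset (by omega) hv1))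

/-- If the neighbourhood were larger, goodness would put one of the first `a * L` samples into it.
Its tail is within `D - d` of `u` and reaches `v` in at most `d - 1` further steps, for a total of
at most `D - 1`. -/
theorem arcsLt_card_le {R : ℕ → ℕ} {L a D d u v : ℕ} (hG : (𝓢).Good n L R) (hL : 0 < L)
    (hdD : d ≤ D) (hd : 1 ≤ d) (hDn : D ≤ n) (hu : u < n + n) (hv : v < n + n)
    (huv : u < n ↔ v < n) (H : ∀ k < D, v ∉ (𝓢).ball u k)
    (hR : ∀ i < a * L, n ≤ ((𝓢).ball ((𝓢).tl (R i)) (d - 1)).card) :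
    a * ((𝓢).arcsLt u (D - d + 1)).card ≤ (𝓢).M := by
  by_contra hlt
  push Not at hlt
  have hne : ((𝓢).arcsLt u (D - d + 1)).Nonempty := by
    rw [← Finset.card_pos]; by_contra h0; simp at h0; simp [h0] at hlt
  obtain ⟨i, hi, hiR⟩ := hG u hu (D - d + 1) (by omega) hne
  have hiL : i < a * L := by
    by_contra hge
    push Not at hge
    have : a * L * ((𝓢).arcsLt u (D - d + 1)).card ≤ i * ((𝓢).arcsLt u (D - d + 1)).card :=
      Nat.mul_le_mul_right _ hge
    nlinarith
  obtain ⟨-, h2⟩ := Arcs.tl_mem_of_arcsLt hiR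
  have hlt : (𝓢).tl (R i) < n + n := (𝓢).tl_lt _ (Arcs.arcsLt_lt hiR)
  have := mem_of_card hlt hv ((doubled_copy h2).trans huv) (hR i hiL)
  exact H _ (by omega) (Arcs.ball_trans h2 this)

/-- The radius of the truncated search from `x`. -/
def rad (n d x : ℕ) : ℕ := if x < n then d / 2 else (d - 1) / 2

/-- Given a far pair `(u, v)`, there are samples with tails near `u` and near `mirror n v`. By
`arcsLt_card_le` their search neighbourhoods are small, so `hint` applies to them and yields a
common vertex `z`. Concatenating the pieces through `z` gives a path from `u` to `v` that is too
short. -/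
theorem not_far_of_intersect {R : ℕ → ℕ} {L a D d : ℕ} (hG : (𝓢).Good n L R) (hL : 0 < L)
    (ha : 0 < a) (hd : 1 ≤ d) (hD : 2 ≤ D) (h7 : 7 * d ≤ 4 * D + 6) (hDn : D ≤ n)
    (hR : ∀ i < a * L, n ≤ ((𝓢).ball ((𝓢).tl (R i)) (d - 1)).card)
    (hbig : ∀ w < n + n, a < ((𝓢).arcsLt w (2 * d - 1 - D)).card)
    (hint : ∀ i i', i < (𝓢).M * L / a + 1 → i' < (𝓢).M * L / a + 1 → R i < (𝓢).M → R i' < (𝓢).M →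
      (𝓢).tl (R i) < n → ¬ (𝓢).tl (R i') < n →
      ((𝓢).arcsLt ((𝓢).tl (R i)) (rad n d ((𝓢).tl (R i)))).card ≤ (𝓢).M / a →
      ((𝓢).arcsLt ((𝓢).tl (R i')) (rad n d ((𝓢).tl (R i')))).card ≤ (𝓢).M / a →
      ∃ z < n, z ∈ (𝓢).ball ((𝓢).tl (R i)) (rad n d ((𝓢).tl (R i))) ∧
        z + n ∈ (𝓢).ball ((𝓢).tl (R i')) (rad n d ((𝓢).tl (R i')))) :
    ¬ Far 𝓢 n D := by
  rintro ⟨u, v, hu, hv, H⟩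
  have hdD : d ≤ D := by omega
  have hsample : ∀ w < n + n, ∃ i, i < (𝓢).M * L / a + 1 ∧ R i ∈ (𝓢).arcsLt w (2 * d - 1 - D) := by
    intro w hw
    have hb := hbig w hw
    obtain ⟨i, hi, hiR⟩ := hG w hw (2 * d - 1 - D) (by omega) (by rw [← Finset.card_pos]; omega)
    refine ⟨i, ?_, hiR⟩
    rw [Nat.lt_add_one_iff, Nat.le_div_iff_mul_le ha]
    exact (Nat.mul_le_mul_left i hb.le).trans hi.le
  have hret : ∀ x y i, x < n + n → y < n + n → (x < n ↔ y < n) → (∀ k < D, y ∉ (𝓢).ball x k) →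
      R i ∈ (𝓢).arcsLt x (2 * d - 1 - D) →
      ((𝓢).arcsLt ((𝓢).tl (R i)) (rad n d ((𝓢).tl (R i)))).card ≤ (𝓢).M / a := by
    intro x y i hx hy hxy H hi
    obtain ⟨h1, h2⟩ := Arcs.tl_mem_of_arcsLt hi
    rw [Nat.le_div_iff_mul_le ha, Nat.mul_comm]
    refine le_trans ?_ (arcsLt_card_le hG hL hdD hd hDn hx hy hxy H hR)
    refine Nat.mul_le_mul_left a (Finset.card_le_card ((Arcs.arcsLt_trans h2).trans
      (Arcs.arcsLt_subset ?_)))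
    -- The inclusion needs (2d - 2 - D) + ⌊d/2⌋ ≤ D - d + 1, which follows from 7d ≤ 4D + 6. This
    -- inequality determines the ratio 7/4.
    have : rad n d ((𝓢).tl (R i)) ≤ d / 2 := by unfold rad; split <;> omega
    omega
  obtain ⟨i, hi, hiR⟩ := hsample u (by omega)
  obtain ⟨i', hi', hiR'⟩ := hsample (mirror n v) (mirror_lt (by omega))
  have H' : ∀ k < D, mirror n u ∉ (𝓢).ball (mirror n v) k := fun k hk hm => H k hk (by
    rwa [doubled_mirror_iff (by omega) (mirror_lt (by omega)), mirror_mirror (by omega)] at hm)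
  obtain ⟨h1, h2⟩ := Arcs.tl_mem_of_arcsLt hiR
  obtain ⟨h1', h2'⟩ := Arcs.tl_mem_of_arcsLt hiR'
  have hmv : mirror n v = v + n := by simp [mirror, hv]
  have hmu : mirror n u = u + n := by simp [mirror, hu]
  have hx0 : (𝓢).tl (R i) < n := (doubled_copy h2).2 hu
  have hx1 : ¬ (𝓢).tl (R i') < n := (doubled_copy h2').not.2 (by omega)
  obtain ⟨z, hz, hz1, hz2⟩ := hint i i' hi hi' (Arcs.arcsLt_lt hiR) (Arcs.arcsLt_lt hiR')
    hx0 hx1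
    (hret u v i (by omega) (by omega) (by omega) H hiR)
    (hret _ _ i' (mirror_lt (by omega)) (mirror_lt (by omega)) (by omega) H' hiR')
  have h3 : z + n ∈ (𝓢).ball (mirror n v) _ := Arcs.ball_trans h2' hz2
  have hmz : z + n = mirror n z := by simp [mirror, hz]
  rw [hmz, doubled_mirror_iff (by omega) (mirror_lt (by omega)), mirror_mirror (by omega)] at h3
  have h4 := Arcs.ball_trans (Arcs.ball_trans h2 hz1) h3
  -- The total length is at most 2(2d - 2 - D) + (d - 1), and it is less than D because 5d ≤ 3D + 4.
  -- The latter follows from 7d ≤ 4D + 6 exactly when D ≥ 2, whence that assumption.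
  refine H _ ?_ h4
  simp only [rad, hx0, hx1, if_true, if_false]
  omega

/-- The radii satisfy d/2 + (d - 1)/2 = d - 1 in integer division, so a path of length at most d - 1
from `x` to `mirror n y` could be split at a vertex that lies in both balls. -/
theorem far_of_disjoint {x y d : ℕ} (hx : x < n) (hy : y < n + n) (hyn : ¬ y < n) (hd : 1 ≤ d)
    (H : ∀ z < n, z ∈ (𝓢).ball x (rad n d x) → z + n ∉ (𝓢).ball y (rad n d y)) : Far 𝓢 n d := by
  refine far_of_not_mem (u := x) (v := mirror n y) (by omega) (mirror_lt hy)
    (by rw [mirror_lt_iff hy]; simp [hx, hyn]) fun hm => ?_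
  simp only [rad, hx, hyn, if_true, if_false] at H
  rw [show d - 1 = d / 2 + (d - 1) / 2 by omega] at hm
  obtain ⟨z, hz, hzm⟩ := Arcs.ball_split hm
  have hzn : z < n := (doubled_copy hz).2 hx
  refine H z hzn hz ?_
  have := doubled_mirror hzm
  rw [mirror_mirror hy] at this
  simpa [mirror, hzn] using this

end doubled

/-! ### The first two stages of an attempt -/

/-- What the memory holds during the search: the graph, the number `n` of vertices, the parameter
`L`, and the samples `R`. -/
structure Env (w : ℕ) (S : Arcs) (n L K : ℕ) (R : ℕ → ℕ) (s : Memory) : Prop where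
  graph : GraphMem w S s
  clean : Clean S s
  n : s.reg 0 = n
  L : s.reg 5 = L
  R : ∀ i < K, s.arr 7 i = R i

theorem Env.congr {w : ℕ} {S : Arcs} {n L K : ℕ} {R : ℕ → ℕ} {s s' : Memory}
    (h : Env w S n L K R s) (hr : ∀ r < 20, s'.reg r = s.reg r)
    (ha : ∀ a < 9, s'.arr a = s.arr a) : Env w S n L K R s' where
  graph := h.graph.congr hr fun a h => ha a (by omega)
  clean := h.clean.congr (ha _ (by norm_num))
  n := by rw [hr _ (by norm_num), h.n]
  L := by rw [hr _ (by norm_num), h.L]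
  R := by rw [ha _ (by norm_num)]; exact h.R

theorem Env.frame {w : ℕ} {S : Arcs} {n L K : ℕ} {R : ℕ → ℕ} {s s' : Memory} {p : Prog}
    (h : Env w S n L K R s) (hf : Fr p s s') (hr : ∀ r ∈ p.regs, 20 ≤ r) (ha : ∀ a ∈ p.arrs, 9 ≤ a) :
    Env w S n L K R s' :=
  h.congr (fun r h => hf.reg r fun hm => by have := hr r hm; omega)
    fun a h => hf.arr a fun hm => by have := ha a hm; omega

theorem Env.bfs {w : ℕ} {S : Arcs} {n L K : ℕ} {R : ℕ → ℕ} {s s' : Memory}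
    (h : Env w S n L K R s) (hf : Fr bfs s s') (hc : Clean S s') : Env w S n L K R s' where
  graph := h.graph.bfs hf
  clean := hc
  n := by rw [bfs_frame_reg hf _ (by norm_num), h.n]
  L := by rw [bfs_frame_reg hf _ (by norm_num), h.L]
  R := by rw [bfs_frame_arr hf _ (by norm_num) (by norm_num)]; exact h.R

theorem Env.setReg {w : ℕ} {S : Arcs} {n L K : ℕ} {R : ℕ → ℕ} {s : Memory} {r : ℕ}
    (h : Env w S n L K R s) (hr : 20 ≤ r) (v : ℕ) : Env w S n L K R (s.setReg r v) :=
  h.congr (fun x hx => by simp [show x ≠ r by omega]) (by simp)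

/-- The number `x` is the truth value of `p`. -/
def Truth (x : ℕ) (p : Prop) : Prop := (x = 1 ∧ p) ∨ (x = 0 ∧ ¬ p)

theorem Truth.congr {x y : ℕ} {p q : Prop} (h : Truth x p) (hxy : y = x) (hpq : p ↔ q) :
    Truth y q := by
  rw [hxy]; unfold Truth at *; rwa [← hpq]

theorem Truth.ne_zero {x : ℕ} {p : Prop} (h : Truth x p) : x ≠ 0 ↔ p := by
  rcases h with ⟨rfl, h⟩ | ⟨rfl, h⟩ <;> simp [h]

theorem Truth.or {x : ℕ} {p q : Prop} [Decidable q] (h : Truth x p) :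
    Truth (x ||| if q then 1 else 0) (p ∨ q) := by
  rcases h with ⟨rfl, h⟩ | ⟨rfl, h⟩ <;> split <;> simp [Truth, *]

theorem Truth.le_one {x : ℕ} {p : Prop} (h : Truth x p) : x ≤ 1 := by
  rcases h with ⟨rfl, h⟩ | ⟨rfl, h⟩ <;> omega

theorem Truth.fits {w x : ℕ} {p : Prop} (h : Truth x p) (h1 : Fits w 1) : Fits w x :=
  lt_of_le_of_lt h.le_one h1

/-- Check whether the ball around the vertex in register `60` with the radius in register `30` has
less than `n` vertices; if so, set register `22`. -/
def probe : Prog :=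
  (.op .lor 61 30 30 ;; .op .lor 62 4 4) ;; bfs ;; .op .lt 38 63 0 ;; .op .lor 22 22 38

section

variable {w : ℕ} {S : Arcs} {n L K : ℕ} {R : ℕ → ℕ}

theorem GraphMem.fits_one {s : Memory} (h : GraphMem w S s) : Fits w 1 := by
  have := h.word; show 1 < 2 ^ w; omega

theorem Arcs.card_arcsLt_le (v r : ℕ) : (S.arcsLt v r).card ≤ S.M := by
  have : S.arcsLt v r ⊆ Finset.range S.M := fun j hj => by simpa using arcsLt_lt hj
  simpa using Finset.card_le_card this

theorem probe_frame_reg {s s' : Memory} (h : Fr probe s s') :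
    ∀ r < 60, r ≠ 22 → r ≠ 38 → s'.reg r = s.reg r := fun r hr h1 h2 => h.reg r fun hm => by
  have := (by decide : ∀ r ∈ probe.regs, 60 ≤ r ∨ r = 22 ∨ r = 38) r hm
  omega

/-- With the number of all arcs as budget, the truncated search cannot give up, so the queue length
is the cardinality of the ball. -/
theorem probe_spec {s : Memory} {k u : ℕ} {p : Prop} (hE : Env w S n L K R s)
    (h30 : s.reg 30 = k) (h60 : s.reg 60 = u) (hu : u < S.N) (h22 : Truth (s.reg 22) p) :
    Ter w probe s (200 * (S.M + 1) + 10) (fun s' => Env w S n L K R s' ∧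
      Truth (s'.reg 22) (p ∨ (S.ball u k).card < n)) := by
  refine Ter.of_valid fun hv => ?_
  have hf1 := hE.graph.fits_one
  refine Ter.seq' (t1 := 3) (t2 := 200 * (S.M + 1) + 5) (R := fun s1 =>
    s1.reg 61 = k ∧ s1.reg 62 = S.M) (Ter.of_wp ?_ (by simp [Prog.size])) ?_ (by omega)
  · simp [h30, hE.graph.M]
    exact ⟨h30 ▸ hv.1 30, hE.graph.M ▸ hv.1 4⟩
  rintro s1 - hf ⟨e61, e62⟩
  have hE1 : Env w S n L K R s1 := hE.frame hf (by decide) (by decide)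
  refine Ter.seq' (t2 := 3) (bfs_spec hE1.graph hE1.clean hu
    (by rw [hf.reg _ (by decide), h60]) e61 e62 le_rfl) ?_ (by omega)
  rintro s2 - hf2 ⟨hc, hq⟩
  have hE2 := hE1.bfs hf2 hc
  rcases hq with ⟨-, -, Lq, hq⟩ | ⟨-, hlt⟩
  · have e22 : s2.reg 22 = s.reg 22 := by
      rw [bfs_frame_reg hf2 _ (by norm_num), hf.reg _ (by decide)]
    refine (Ter.of_wp (t := 3) (Q := fun s3 =>
      s3.reg 22 = s.reg 22 ||| if (S.ball u k).card < n then 1 else 0) ?_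
      (by simp [Prog.size])).conseq le_rfl ?_
    · simp [hq.len, hq.card, hE2.n, e22, hf1]
      exact h22.or.fits hf1
    · rintro s3 - hf3 h3
      exact ⟨hE2.frame hf3 (by decide) (by decide), by rw [h3]; exact h22.or⟩
  · have := Arcs.card_arcsLt_le (S := S) u k
    omega

/-- Probe the tails of the first samples; their number is in register `32`. -/
def probeSamples : Prog :=
  .const 22 0 ;; forLoop 36 37 32 ((.load 38 7 36 ;; .load 60 2 38) ;; probe)

theorem probeSamples_spec {s : Memory} {k K1 : ℕ} (hE : Env w S n L K R s) (h30 : s.reg 30 = k)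
    (h32 : s.reg 32 = K1) (hK : K1 ≤ K) (hR : ∀ i < K, R i < S.M) :
    Ter w probeSamples s (K1 * (200 * (S.M + 1) + 20) + 10) (fun s' => Env w S n L K R s' ∧
      Truth (s'.reg 22) (∃ i < K1, (S.ball (S.tl (R i)) k).card < n)) := by
  have hf1 := hE.graph.fits_one
  refine Ter.seq' (t1 := 1) (t2 := K1 * (200 * (S.M + 1) + 20) + 5)
    (R := fun s1 => s1 = s.setReg 22 0) (.const (Fits.zero _) rfl) ?_ (by omega)
  rintro s1 - hf1 rfl
  have hE1 : Env w S n L K R (s.setReg 22 0) := hE.frame hf1 (by decide) (by decide)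
  refine Ter.forLoop K1 (200 * (S.M + 1) + 15) (fun k1 s2 => Env w S n L K R s2 ∧
      Truth (s2.reg 22) (∃ i < k1, (S.ball (S.tl (R i)) k).card < n)) (by simpa using h32)
      hE1.graph.one (by decide) (by decide) (by decide) (by decide) ?_ ?_ (fun _ _ _ h => h) le_rfl
  · intro s2 _ ha hr
    refine ⟨hE1.congr (fun r h => hr r (by omega) (by omega)) (by simp [ha]), ?_⟩
    rw [hr 22 (by norm_num) (by norm_num)]
    exact .inr ⟨by simp, by simp⟩
  · rintro i s2 hi hv2 hf2 e36 ⟨hE2, hfl⟩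
    have hiM := hR i (by omega)
    refine Ter.seq' (t1 := 3) (t2 := 200 * (S.M + 1) + 10) (R := fun s3 => s3.reg 60 = S.tl (R i))
      (Ter.of_wp ?_ (by simp [Prog.size])) ?_ (by omega)
    · simp [e36, hE2.R i (by omega), hE2.graph.tl _ hiM]
    rintro s3 - hf3 e60
    have hE3 : Env w S n L K R s3 := hE2.frame hf3 (by decide) (by decide)
    refine (probe_spec hE3 (k := k) ?_ e60 (S.tl_lt _ hiM)
      (hfl.congr (hf3.reg _ (by decide)) Iff.rfl)).conseq le_rfl ?_
    · rw [hf3.reg _ (by decide), hf2.reg _ (by decide)]; simpa using h30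
    · rintro s4 - hf4 ⟨hE4, hfl4⟩ v v'
      refine ⟨(hE4.setReg (by norm_num) _).setReg (by norm_num) _, ?_⟩
      refine hfl4.congr (by simp) ⟨?_, ?_⟩
      · rintro (⟨j, hj, h⟩ | h)
        · exact ⟨j, by omega, h⟩
        · exact ⟨i, by omega, h⟩
      · rintro ⟨j, hj, h⟩
        by_cases hji : j = i
        · subst hji; exact .inr h
        · exact .inl ⟨j, by omega, h⟩

/-- Look for a vertex such that there are at most as many arcs as told by register `21` at
distance less than the number in register `31`. -/
def findSmall : Prog :=
  .const 39 0 ;; forLoop 36 37 3 (.ite 39 .skip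
    ((.op .lor 60 36 36 ;; .op .lor 61 31 31 ;; .op .lor 62 21 21) ;; bfs ;;
      .ite 65 (.const 39 1 ;; .op .lor 40 36 36) .skip))

/-- Each search is cut off after `a` arcs, so trying all vertices costs O(N (a + 1)). The success
flag of the truncated search is precisely the sought property. -/
theorem findSmall_spec {s : Memory} {r a : ℕ} (hE : Env w S n L K R s) (h31 : s.reg 31 = r)
    (h21 : s.reg 21 = a) (haM : a ≤ S.M) :
    Ter w findSmall s (S.N * (200 * (a + 1) + 25) + 10) (fun s' => Env w S n L K R s' ∧
      ((s'.reg 39 = 1 ∧ s'.reg 40 < S.N ∧ (S.arcsLt (s'.reg 40) r).card ≤ a) ∨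
        (s'.reg 39 = 0 ∧ ∀ v < S.N, a < (S.arcsLt v r).card))) := by
  have hf1 := hE.graph.fits_one
  refine Ter.seq' (t1 := 1) (t2 := S.N * (200 * (a + 1) + 25) + 5)
    (R := fun s1 => s1 = s.setReg 39 0) (.const (Fits.zero _) rfl) ?_ (by omega)
  rintro s1 - hf1' rfl
  have hE1 : Env w S n L K R (s.setReg 39 0) := hE.frame hf1' (by decide) (by decide)
  refine Ter.forLoop S.N (200 * (a + 1) + 20) (fun k s2 => Env w S n L K R s2 ∧
      ((s2.reg 39 = 1 ∧ s2.reg 40 < S.N ∧ (S.arcsLt (s2.reg 40) r).card ≤ a) ∨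
        (s2.reg 39 = 0 ∧ ∀ v < k, a < (S.arcsLt v r).card))) hE1.graph.N
      hE1.graph.one (by decide) (by decide) (by decide) (by decide) ?_ ?_ (fun _ _ _ h => h) le_rfl
  · intro s2 _ ha hr
    refine ⟨hE1.congr (fun r h => hr r (by omega) (by omega)) (by simp [ha]), .inr ⟨?_, by simp⟩⟩
    rw [hr 39 (by norm_num) (by norm_num)]; simp
  · rintro v s2 hi hv2 hf2 e36 ⟨hE2, hcase⟩
    refine (Ter.ite (t := 200 * (a + 1) + 15) (fun h39 => ?_) fun h39 => ?_).conseq (by omega)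
      fun _ _ _ h => h
    · rcases hcase with hcase | ⟨h, -⟩
      · refine (Ter.skip (Q := fun s3 => s3 = s2) rfl).conseq (by omega) ?_
        rintro s3 - - rfl v v'
        exact ⟨(hE2.setReg (by norm_num) _).setReg (by norm_num) _, .inl (by simpa using hcase)⟩
      · exact absurd h h39
    · have hcase' : ∀ v' < v, a < (S.arcsLt v' r).card := by
        rcases hcase with ⟨h, -⟩ | ⟨-, h⟩
        · omega
        · exact h
      refine Ter.seq' (t1 := 5) (t2 := 200 * (a + 1) + 8) (R := fun s3 => s3.reg 60 = v ∧
        s3.reg 61 = r ∧ s3.reg 62 = a) (Ter.of_wp ?_ (by simp [Prog.size])) ?_ (by omega)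
      · have e31 : s2.reg 31 = r := by rw [hf2.reg _ (by decide)]; simpa using h31
        have e21 : s2.reg 21 = a := by rw [hf2.reg _ (by decide)]; simpa using h21
        simp [e36, e31, e21]
        exact ⟨e36 ▸ hv2.1 36, e31 ▸ hv2.1 31, e21 ▸ hv2.1 21⟩
      rintro s3 - hf3 ⟨e60, e61, e62⟩
      have hE3 : Env w S n L K R s3 := hE2.frame hf3 (by decide) (by decide)
      refine Ter.seq' (t2 := 7) (bfs_spec hE3.graph hE3.clean hi e60 e61 e62 haM) ?_ (by omega)
      rintro s4 hv4 hf4 ⟨hc, hq⟩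
      have hE4 := hE3.bfs hf4 hc
      have g36 : s4.reg 36 = v := by rw [bfs_frame_reg hf4 _ (by norm_num), hf3.reg _ (by decide), e36]
      have g39 : s4.reg 39 = 0 := by rw [bfs_frame_reg hf4 _ (by norm_num), hf3.reg _ (by decide), h39]
      have fv : Fits w v := g36 ▸ hv4.1 36
      refine (Ter.of_wp (t := 7) (Q := fun s5 => (s4.reg 65 ≠ 0 → s5.reg 39 = 1 ∧ s5.reg 40 = v) ∧
        (s4.reg 65 = 0 → s5.reg 39 = 0)) ?_ (by simp [Prog.size])).conseq le_rfl ?_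
      · simp +contextual [g36, g39, hf1, fv]
      · rintro s5 - hf5 ⟨h1, h2⟩ v1 v2
        have hE5 : Env w S n L K R s5 := hE4.frame hf5 (by decide) (by decide)
        refine ⟨(hE5.setReg (by norm_num) _).setReg (by norm_num) _, ?_⟩
        rcases hq with ⟨h65, hcard, -⟩ | ⟨h65, hcard⟩
        · obtain ⟨h3, h4⟩ := h1 (by omega)
          left; simp [h3, h4]; exact ⟨hi, hcard⟩
        · right
          refine ⟨by simpa using h2 h65, fun v' hv' => ?_⟩
          by_cases hvv : v' = v
          · subst hvv; exact hcard
          · exact hcase' v' (by omega)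

/-- Probe the vertex in register `40`, and the mirror images of the vertices in a ball around it. -/
def probeSmall : Prog :=
  .op .lor 60 40 40 ;; probe ;;
  (.op .lor 60 40 40 ;; .op .lor 61 31 31 ;; .op .lor 62 21 21) ;; bfs ;; .op .lor 41 63 63 ;;
  forLoop 36 37 41 (.load 38 9 36 ;; .store 10 36 38) ;;
  forLoop 36 37 41 ((.load 38 10 36 ;; .op .lt 42 38 0 ;;
    .ite 42 (.op .add 60 38 0) (.op .sub 60 38 0)) ;; probe)

/-- A ball with at most `a` arcs inside has at most `a + 1` vertices, so O(a + 1) complete searches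
suffice. -/
theorem probeSmall_spec {s : Memory} {k r a v : ℕ} (hE : Env w S n L K R s) (h30 : s.reg 30 = k)
    (h31 : s.reg 31 = r) (h21 : s.reg 21 = a) (haM : a ≤ S.M) (h40 : s.reg 40 = v) (hv : v < S.N)
    (hcard : (S.arcsLt v r).card ≤ a) (hball : (S.ball v r).card ≤ a + 1) (h22 : s.reg 22 = 0)
    (hN : S.N = n + n) :
    Ter w probeSmall s ((a + 3) * (200 * (S.M + 1) + 60)) (fun s' => Env w S n L K R s' ∧
      Truth (s'.reg 22) ((S.ball v k).card < n ∨
        ∃ x ∈ S.ball v r, (S.ball (mirror n x) k).card < n)) := by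
  have hf1 := hE.graph.fits_one
  have hword := hE.graph.word
  refine Ter.of_valid fun hval => ?_
  have fv : Fits w v := h40 ▸ hval.1 40
  have hMa : 200 * (a + 1) ≤ 200 * (S.M + 1) := by omega
  have ht : (a + 3) * (200 * (S.M + 1) + 60) = (a + 1) * (200 * (S.M + 1) + 60) +
      2 * (200 * (S.M + 1) + 60) := by ring
  have ht2 : (a + 1) * (200 * (S.M + 1) + 60) = (a + 1) * (200 * (S.M + 1) + 30) + (a + 1) * 30 := by
    ring
  refine Ter.seq' (t1 := 1) (t2 := (a + 3) * (200 * (S.M + 1) + 60) - 2)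
    (R := fun s1 => s1.reg 60 = v) (Ter.of_wp (by simp [h40, fv]) (by simp [Prog.size])) ?_ (by omega)
  rintro s1 - hf e60
  have hE1 : Env w S n L K R s1 := hE.frame hf (by decide) (by decide)
  refine Ter.seq' (t2 := (a + 3) * (200 * (S.M + 1) + 60) - (200 * (S.M + 1) + 20))
    (probe_spec hE1 (k := k) (p := False) (by rw [hf.reg _ (by decide), h30]) e60 hv
    (.inr ⟨by rw [hf.reg _ (by decide), h22], id⟩)) ?_ (by omega)
  rintro s2 hv2 hf2 ⟨hE2, hfl⟩
  have e30 : s2.reg 30 = k := by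
    rw [probe_frame_reg hf2 _ (by norm_num) (by norm_num) (by norm_num), hf.reg _ (by decide), h30]
  have e31 : s2.reg 31 = r := by
    rw [probe_frame_reg hf2 _ (by norm_num) (by norm_num) (by norm_num), hf.reg _ (by decide), h31]
  have e21 : s2.reg 21 = a := by
    rw [probe_frame_reg hf2 _ (by norm_num) (by norm_num) (by norm_num), hf.reg _ (by decide), h21]
  have e40 : s2.reg 40 = v := by
    rw [probe_frame_reg hf2 _ (by norm_num) (by norm_num) (by norm_num), hf.reg _ (by decide), h40]
  refine Ter.seq' (t1 := 5) (t2 := (a + 3) * (200 * (S.M + 1) + 60) - (200 * (S.M + 1) + 26))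
    (R := fun s3 => s3.reg 60 = v ∧ s3.reg 61 = r ∧ s3.reg 62 = a)
    (Ter.of_wp ?_ (by simp [Prog.size])) ?_ (by omega)
  · simp [e40, e31, e21]
    exact ⟨fv, e31 ▸ hv2.1 31, e21 ▸ hv2.1 21⟩
  rintro s3 hv3 hf3 ⟨f60, f61, f62⟩
  have hE3 : Env w S n L K R s3 := hE2.frame hf3 (by decide) (by decide)
  refine Ter.seq' (t2 := (a + 3) * (200 * (S.M + 1) + 60) - (200 * (S.M + 1) + 27) - (200 * (a + 1)))
    (bfs_spec hE3.graph hE3.clean hv f60 f61 f62 haM) ?_ (by omega)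
  rintro s4 hv4 hf4 ⟨hc, hq⟩
  have hE4 := hE3.bfs hf4 hc
  rcases hq with ⟨-, -, Lq, hq⟩ | ⟨-, hlt⟩
  swap
  · omega
  have g30 : s4.reg 30 = k := by rw [bfs_frame_reg hf4 _ (by norm_num), hf3.reg _ (by decide), e30]
  have g22 : s4.reg 22 = s2.reg 22 := by
    rw [bfs_frame_reg hf4 _ (by norm_num), hf3.reg _ (by decide)]
  have hlen : Lq.length ≤ a + 1 := hq.card ▸ hball
  refine Ter.seq' (t1 := 1) (t2 := Lq.length * (3 + 5) + Lq.length * (200 * (S.M + 1) + 23) + 12)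
    (R := fun s5 => s5 = s4.setReg 41 Lq.length)
    (.op (by simp [hq.len]; exact hq.len ▸ hv4.1 63) (by simp [hq.len])) ?_ ?_
  swap
  · have : Lq.length * (3 + 5) ≤ (a + 1) * (3 + 5) := Nat.mul_le_mul_right _ hlen
    have : Lq.length * (200 * (S.M + 1) + 23) ≤ (a + 1) * (200 * (S.M + 1) + 23) :=
      Nat.mul_le_mul_right _ hlen
    have : (a + 1) * (200 * (S.M + 1) + 30) = (a + 1) * (200 * (S.M + 1) + 23) + (a + 1) * 7 := by
      ring
    omega
  rintro s5 - hf5 rfl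
  have hE5 : Env w S n L K R (s4.setReg 41 Lq.length) := hE4.frame hf5 (by decide) (by decide)
  -- The ball is copied to array `10`, because the searches that follow overwrite the queue.
  refine Ter.seq' (t1 := Lq.length * (3 + 5) + 5) (t2 := Lq.length * (200 * (S.M + 1) + 23) + 5)
    (R := fun s6 => ∀ i (h : i < Lq.length), s6.arr 10 i = Lq[i])
    (Ter.forLoop Lq.length 3 (fun k s6 => ∀ i (h : i < Lq.length), i < k → s6.arr 10 i = Lq[i])
      (by simp) hE5.graph.one (by decide) (by decide) (by decide) (by decide) (by simp) ?_
      (fun s6 _ _ h i hi => h i hi hi) le_rfl) ?_ (by omega)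
  · intro j s6 hj _ hf6 e36 hI
    have e9 : s6.arr 9 j = Lq[j] := by rw [hf6.arr _ (by decide)]; exact hq.get j hj
    refine Ter.of_wp ?_ (by simp [Prog.size])
    simp [e36, e9]
    intro i hi hik
    by_cases hij : i = j
    · subst hij; simp
    · simp [hij]; exact hI i hi (by omega)
  rintro s6 - hf6 h10
  have hE6 : Env w S n L K R s6 := hE5.frame hf6 (by decide) (by decide)
  have k30 : s6.reg 30 = k := by rw [hf6.reg _ (by decide)]; simpa using g30
  have k22 : s6.reg 22 = s2.reg 22 := by rw [hf6.reg _ (by decide)]; simpa using g22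
  have k41 : s6.reg 41 = Lq.length := by rw [hf6.reg _ (by decide)]; simp
  refine Ter.forLoop Lq.length (200 * (S.M + 1) + 18) (fun k1 s7 => Env w S n L K R s7 ∧
      Truth (s7.reg 22) ((S.ball v k).card < n ∨
        ∃ i, ∃ h : i < Lq.length, i < k1 ∧ (S.ball (mirror n Lq[i]) k).card < n)) k41
      hE6.graph.one (by decide) (by decide) (by decide) (by decide) ?_ ?_ ?_ le_rfl
  · intro s7 _ ha hr
    refine ⟨hE6.congr (fun r h => hr r (by omega) (by omega)) (by simp [ha]), ?_⟩
    exact hfl.congr (by rw [hr 22 (by norm_num) (by norm_num), k22]) (by simp)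
  · rintro i s7 hi hv7 hf7 l36 ⟨hE7, hfl7⟩
    have l10 : s7.arr 10 i = Lq[i] := by rw [hf7.arr _ (by decide), h10 i hi]
    have hlt : Lq[i] < S.N := Arcs.ball_lt hv r _ (hq.mem.1 (List.getElem_mem _))
    refine Ter.seq' (t1 := 7) (t2 := 200 * (S.M + 1) + 10)
      (R := fun s8 => s8.reg 60 = mirror n Lq[i]) (Ter.of_wp ?_ (by simp [Prog.size])) ?_ (by omega)
    · simp [l36, l10, hE7.n, hf1, mirror]
      refine ⟨fun h => ⟨show _ < 2 ^ w by omega, ?_⟩, fun h => ⟨show _ < 2 ^ w by omega, ?_⟩⟩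
      · exact fun _ => by omega
      · exact fun _ => by omega
    rintro s8 - hf8 m60
    have hE8 : Env w S n L K R s8 := hE7.frame hf8 (by decide) (by decide)
    refine (probe_spec hE8 (k := k) ?_ m60 ?_
      (hfl7.congr (hf8.reg _ (by decide)) Iff.rfl)).conseq le_rfl ?_
    · rw [hf8.reg _ (by decide), hf7.reg _ (by decide), k30]
    · rw [hN]; exact mirror_lt (hN ▸ hlt)
    · rintro s9 - hf9 ⟨hE9, hfl9⟩ v1 v2
      refine ⟨(hE9.setReg (by norm_num) _).setReg (by norm_num) _, ?_⟩
      refine hfl9.congr (by simp) ⟨?_, ?_⟩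
      · rintro ((h | ⟨j, hj, h, h'⟩) | h)
        · exact .inl h
        · exact .inr ⟨j, hj, by omega, h'⟩
        · exact .inr ⟨i, hi, by omega, h⟩
      · rintro (h | ⟨j, hj, h, h'⟩)
        · exact .inl (.inl h)
        · by_cases hji : j = i
          · subst hji; exact .inr h'
          · exact .inl (.inr ⟨j, hj, by omega, h'⟩)
  · rintro s7 - - ⟨hE7, hfl7⟩
    refine ⟨hE7, hfl7.congr rfl ?_⟩
    refine or_congr_right ⟨?_, ?_⟩
    · rintro ⟨i, hi, -, h⟩
      exact ⟨Lq[i], hq.mem.1 (List.getElem_mem _), h⟩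
    · rintro ⟨x, hx, h⟩
      obtain ⟨i, hi, rfl⟩ := List.getElem_of_mem (hq.mem.2 hx)
      exact ⟨i, hi, hi, h⟩

end

/-! ### Collecting the vertices near the samples in buckets -/

/-- Set the first cells of the array `a` to zero; their number is in register `b`. -/
def zeroFill (a b : ℕ) : Prog := forLoop 36 37 b (.const 38 0 ;; .store a 36 38)

theorem zeroFill_spec {w a b k : ℕ} {s : Memory} (h2 : s.reg 2 = 1) (hb : s.reg b = k)
    (hb' : b ≠ 36 ∧ b ≠ 37 ∧ b ≠ 38) :
    Ter w (zeroFill a b) s (k * 8 + 5) (fun s' => ∀ i < k, s'.arr a i = 0) := by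
  obtain ⟨b1, b2, b3⟩ := hb'
  refine Ter.forLoop k 3 (fun j s' => ∀ i < j, s'.arr a i = 0) hb h2
    (by simp [Prog.regs]) (by simp [Prog.regs, b3]) (by simp [Prog.regs]) ⟨by decide, b1.symm, b2.symm, by decide, by decide⟩
    (by simp) ?_ (fun _ _ _ h => h) le_rfl
  intro j s1 hj _ _ e36 hI
  refine Ter.of_wp ?_ (by simp [Prog.size])
  simp [e36]
  intro i hi hij
  exact hI i (by omega)

/-- The array `a` holds the truth values of `X`, row by row. -/
def Bits (a r c : ℕ) (X : ℕ → ℕ → Prop) (s : Memory) : Prop :=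
  ∀ i < r, ∀ j < c, Truth (s.arr a (i * c + j)) (X i j)

theorem Bits.congr {a r c : ℕ} {X Y : ℕ → ℕ → Prop} {s s' : Memory} (h : Bits a r c X s)
    (ha : s'.arr a = s.arr a) (hXY : ∀ i < r, ∀ j < c, X i j ↔ Y i j) : Bits a r c Y s' :=
  fun i hi j hj => (h i hi j hj).congr (by rw [ha]) (hXY i hi j hj)

/-- Uniqueness of quotient and remainder: distinct entries of a matrix occupy distinct cells. -/
theorem mul_add_inj {c i j i' j' : ℕ} (hj : j < c) (hj' : j' < c) (h : i * c + j = i' * c + j') :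
    i = i' ∧ j = j' := by
  have h1 : (i * c + j) / c = i := by
    rw [Nat.mul_comm, Nat.mul_add_div (by omega), Nat.div_eq_of_lt hj, Nat.add_zero]
  have h2 : (i' * c + j') / c = i' := by
    rw [Nat.mul_comm, Nat.mul_add_div (by omega), Nat.div_eq_of_lt hj', Nat.add_zero]
  have : i = i' := by rw [← h1, ← h2, h]
  subst this
  exact ⟨rfl, by omega⟩

theorem mul_add_lt {c r i j : ℕ} (hi : i < r) (hj : j < c) : i * c + j < r * c := by
  have : (i + 1) * c ≤ r * c := Nat.mul_le_mul_right c hi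
  rw [Nat.succ_mul] at this
  omega

theorem Bits.set {a r c i j : ℕ} {X : ℕ → ℕ → Prop} {s s' : Memory} (h : Bits a r c X s)
    (hj : j < c) (ha : ∀ x, s'.arr a x = if x = i * c + j then 1 else s.arr a x) :
    Bits a r c (fun i' j' => X i' j' ∨ (i' = i ∧ j' = j)) s' := by
  intro i' hi' j' hj'
  rw [ha]
  by_cases he : i' * c + j' = i * c + j
  · rw [if_pos he]
    exact .inl ⟨rfl, .inr (mul_add_inj hj' hj he)⟩
  · rw [if_neg he]
    refine (h i' hi' j' hj').congr rfl ⟨.inl, ?_⟩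
    rintro (h | ⟨rfl, rfl⟩)
    · exact h
    · exact absurd rfl he

theorem Bits.zero {a r c : ℕ} {s : Memory} (h : ∀ i < r * c, s.arr a i = 0) :
    Bits a r c (fun _ _ => False) s :=
  fun _ hi _ hj => .inr ⟨h _ (mul_add_lt hi hj), id⟩

/-- The parameters of the last stage of an attempt: `K2` samples, of which those are retained that
have at most `b` arcs within the search radius, which is `ρ false` for the vertices of the graph, and
`ρ true` for those of the reversed graph. -/
structure Search where
  S : Arcs
  n : ℕ
  L : ℕ
  K : ℕ
  R : ℕ → ℕ
  b : ℕ
  K2 : ℕ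
  ρ : Bool → ℕ
  hN : S.N = n + n
  copy : ∀ v y k, y ∈ S.ball v k → (y < n ↔ v < n)
  hR : ∀ i < K, R i < S.M
  hK : K2 ≤ K
  hb : b ≤ S.M
  hK2 : 0 < K2

namespace Search

variable (X : Search)

/-- The ball around the sample `i`. -/
def near (c : Bool) (i : ℕ) : Finset ℕ := X.S.ball (X.S.tl (X.R i)) (X.ρ c)

/-- The sample `i` is in copy `c`, and it is retained. -/
def Ret (c : Bool) (i : ℕ) : Prop :=
  (X.S.tl (X.R i) < X.n ↔ c = false) ∧ (X.S.arcsLt (X.S.tl (X.R i)) (X.ρ c)).card ≤ X.b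

/-- The sample `i` is retained, and `z` is near it. -/
def Hit (c : Bool) (i z : ℕ) : Prop := X.Ret c i ∧ z + (bif c then X.n else 0) ∈ X.near c i

/-- What the memory holds in the last stage. -/
structure Mem (w : ℕ) (s : Memory) : Prop where
  env : Env w X.S X.n X.L X.K X.R s
  r28 : s.reg 28 = X.ρ false
  r29 : s.reg 29 = X.ρ true
  r33 : s.reg 33 = X.K2
  r34 : s.reg 34 = X.b
  word : (X.S.N + X.S.M + X.K2 + 2) ^ 3 ≤ 2 ^ w

variable {X}

theorem Mem.frame {w : ℕ} {s s' : Memory} {p : Prog} (h : X.Mem w s) (hf : Fr p s s')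
    (hr : ∀ r ∈ p.regs, 36 ≤ r) (ha : ∀ a ∈ p.arrs, 9 ≤ a) : X.Mem w s' where
  env := h.env.frame hf (fun r h => by have := hr r h; omega) ha
  r28 := by rw [hf.reg _ fun h => by simpa using hr _ h, h.r28]
  r29 := by rw [hf.reg _ fun h => by simpa using hr _ h, h.r29]
  r33 := by rw [hf.reg _ fun h => by simpa using hr _ h, h.r33]
  r34 := by rw [hf.reg _ fun h => by simpa using hr _ h, h.r34]
  word := h.word

theorem Mem.congr {w : ℕ} {s s' : Memory} (h : X.Mem w s) (hr : ∀ r < 36, s'.reg r = s.reg r)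
    (ha : ∀ a < 9, s'.arr a = s.arr a) : X.Mem w s' where
  env := h.env.congr (fun r h => hr r (by omega)) ha
  r28 := by rw [hr _ (by norm_num), h.r28]
  r29 := by rw [hr _ (by norm_num), h.r29]
  r33 := by rw [hr _ (by norm_num), h.r33]
  r34 := by rw [hr _ (by norm_num), h.r34]
  word := h.word

theorem Mem.setReg {w r : ℕ} {s : Memory} (h : X.Mem w s) (hr : 36 ≤ r) (v : ℕ) :
    X.Mem w (s.setReg r v) :=
  h.congr (fun x hx => by simp [show x ≠ r by omega]) (by simp)

/-- All indices in this stage are at most quadratic in the input parameters, so the cubic lower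
bound on `2 ^ w` absorbs the constants. -/
theorem Mem.fits {w : ℕ} {s : Memory} (h : X.Mem w s) {i j k : ℕ}
    (hi : i ≤ 2 * (X.S.N + X.S.M + X.K2)) (hj : j ≤ X.S.N + X.S.M + X.K2)
    (hk : k ≤ 2 * (X.S.N + X.S.M + X.K2) + 2) :
    Fits w (i * j + k) := by
  refine lt_of_lt_of_le ?_ h.word
  have := Nat.mul_le_mul hi hj
  nlinarith [Nat.zero_le ((X.S.N + X.S.M + X.K2) ^ 3)]

theorem Mem.fits_le {w : ℕ} {s : Memory} (h : X.Mem w s) {k : ℕ}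
    (hk : k ≤ 2 * (X.S.N + X.S.M + X.K2) + 2) : Fits w k := by
  simpa using h.fits (i := 0) (j := 0) (k := k) (by omega) (by omega) hk

end Search

/-- Search from the sample in register `36`, if it is in copy `c`. -/
def retain (c : Bool) : Prog :=
  (.load 43 7 36 ;; .load 60 2 43 ;; .op .lt 42 60 0 ;; .op .lor 62 34 34) ;;
  bif c then .ite 42 (.const 65 0) (.op .lor 61 29 29 ;; bfs)
  else .ite 42 (.op .lor 61 28 28 ;; bfs) (.const 65 0)

theorem retain_frame_reg {c : Bool} {s s' : Memory} (h : Fr (retain c) s s') :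
    ∀ r < 60, r ≠ 42 → r ≠ 43 → s'.reg r = s.reg r := fun r hr h1 h2 => h.reg r fun hm => by
  have : ∀ r ∈ (retain c).regs, 60 ≤ r ∨ r = 42 ∨ r = 43 := by cases c <;> decide
  have := this r hm
  omega

theorem retain_frame_arr {c : Bool} {s s' : Memory} (h : Fr (retain c) s s') :
    ∀ a, a ≠ 8 → a ≠ 9 → s'.arr a = s.arr a := fun a h1 h2 => h.arr a fun hm => by
  have : ∀ a ∈ (retain c).arrs, a = 8 ∨ a = 9 := by cases c <;> decide
  have := this a hm
  omega

namespace Search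

variable {X : Search} {w : ℕ}

theorem searchFrom {s : Memory} {k i r : ℕ} (h : X.Mem w s) (hk : s.reg k = r)
    (h60 : s.reg 60 = X.S.tl (X.R i)) (h62 : s.reg 62 = X.b)
    (hi : i < X.K) :
    Ter w (.op .lor 61 k k ;; bfs) s (200 * (X.b + 1) + 2) (fun s' => X.Mem w s' ∧
      ((s'.reg 65 = 1 ∧ (X.S.arcsLt (X.S.tl (X.R i)) r).card ≤ X.b ∧
        ∃ Lq, QList Lq (X.S.ball (X.S.tl (X.R i)) r) s') ∨
        (s'.reg 65 = 0 ∧ X.b < (X.S.arcsLt (X.S.tl (X.R i)) r).card))) := by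
  refine Ter.of_valid fun hv => ?_
  refine Ter.seq' (t1 := 1) (t2 := 200 * (X.b + 1)) (R := fun s1 => s1 = s.setReg 61 r)
    (.op (by simpa [hk] using hk ▸ hv.1 k) (by simp [hk])) ?_ (by omega)
  rintro s1 - - rfl
  have h1 := h.setReg (r := 61) (by norm_num) r
  refine (bfs_spec (r := r) h1.env.graph h1.env.clean (X.S.tl_lt _ (X.hR i hi)) (by simpa using h60)
    (by simp) (by simpa using h62) X.hb).conseq le_rfl ?_
  rintro s2 - hf ⟨hc, hq⟩
  refine ⟨⟨h1.env.bfs hf hc, ?_, ?_, ?_, ?_, h.word⟩, hq⟩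
  · rw [bfs_frame_reg hf _ (by norm_num), h1.r28]
  · rw [bfs_frame_reg hf _ (by norm_num), h1.r29]
  · rw [bfs_frame_reg hf _ (by norm_num), h1.r33]
  · rw [bfs_frame_reg hf _ (by norm_num), h1.r34]

/-- A sample in the wrong copy gets the flag `0` without a search. For the others the truncation
budget `b` is the bound in `Ret`, so success of the search is the same as being retained. -/
theorem retain_spec {s : Memory} {c : Bool} {i : ℕ} (h : X.Mem w s) (h36 : s.reg 36 = i)
    (hi : i < X.K) :
    Ter w (retain c) s (200 * (X.b + 1) + 12) (fun s' => X.Mem w s' ∧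
      ((s'.reg 65 = 1 ∧ X.Ret c i ∧ ∃ Lq, QList Lq (X.near c i) s') ∨
        (s'.reg 65 = 0 ∧ ¬ X.Ret c i))) := by
  refine Ter.of_valid fun hv => ?_
  have hf1 := h.env.graph.fits_one
  refine Ter.seq' (t1 := 7) (t2 := 200 * (X.b + 1) + 3) (R := fun s1 =>
    s1.reg 60 = X.S.tl (X.R i) ∧ s1.reg 62 = X.b ∧
      s1.reg 42 = if X.S.tl (X.R i) < X.n then 1 else 0) (Ter.of_wp ?_ (by simp [Prog.size])) ?_
    (by omega)
  · simp [h36, h.env.R i hi, h.env.graph.tl _ (X.hR i hi), h.env.n, h.r34, hf1]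
    exact h.r34 ▸ hv.1 34
  rintro s1 - hf ⟨h60, h62, h42⟩
  have h1 := h.frame hf (by decide) (by decide)
  have off : ¬ X.Ret c i → Ter w (.const 65 0) s1 (200 * (X.b + 1) + 2) (fun s' => X.Mem w s' ∧
      ((s'.reg 65 = 1 ∧ X.Ret c i ∧ ∃ Lq, QList Lq (X.near c i) s') ∨
        (s'.reg 65 = 0 ∧ ¬ X.Ret c i))) := fun hret =>
    (Ter.const (Fits.zero _) ⟨h1.setReg (by norm_num) _, .inr ⟨by simp, hret⟩⟩).conseq
      (by omega) fun _ _ _ h => h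
  cases c
  · refine Ter.ite (t := 200 * (X.b + 1) + 2) (fun hx => ?_) fun hx => off ?_
    · refine (searchFrom h1 h1.r28 h60 h62 hi).conseq le_rfl ?_
      rintro s2 - - ⟨h2, h3⟩
      have hx' : X.S.tl (X.R i) < X.n := by by_contra hh; simp [h42, hh] at hx
      refine ⟨h2, h3.imp (fun h => ⟨h.1, ⟨by simp [hx'], h.2.1⟩, h.2.2⟩) fun h => ⟨h.1, fun hr => ?_⟩⟩
      have := hr.2
      omega
    · rintro ⟨hr, -⟩; simp at hr; simp [h42, hr] at hx
  · refine Ter.ite (t := 200 * (X.b + 1) + 2) (fun hx => off ?_) fun hx => ?_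
    · rintro ⟨hr, -⟩; simp at hr; simp [h42, hr] at hx
    · refine (searchFrom h1 h1.r29 h60 h62 hi).conseq le_rfl ?_
      rintro s2 - - ⟨h2, h3⟩
      have hx' : ¬ X.S.tl (X.R i) < X.n := by intro hh; simp [h42, hh] at hx
      refine ⟨h2, h3.imp (fun h => ⟨h.1, ⟨by simp [hx'], h.2.1⟩, h.2.2⟩) fun h => ⟨h.1, fun hr => ?_⟩⟩
      have := hr.2
      omega

open Classical in
/-- The first `k` samples in copy `true` that are retained and near `z`. -/
noncomputable def bucket (X : Search) (k z : ℕ) : List ℕ :=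
  (List.range k).filter fun i => X.Hit true i z

theorem mem_bucket {k z i : ℕ} : i ∈ X.bucket k z ↔ i < k ∧ X.Hit true i z := by
  simp [bucket]

theorem bucket_length_le (k z : ℕ) : (X.bucket k z).length ≤ k :=
  (List.length_filter_le _ _).trans (by simp)

theorem bucket_succ_of_hit {k z : ℕ} (h : X.Hit true k z) :
    X.bucket (k + 1) z = X.bucket k z ++ [k] := by
  simp [bucket, List.range_succ, h]

theorem bucket_succ_of_not_hit {k z : ℕ} (h : ¬ X.Hit true k z) :
    X.bucket (k + 1) z = X.bucket k z := by
  simp [bucket, List.range_succ, h]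

/-- The array `13` holds the lengths of the lists `f`, and the array `14` holds their entries. -/
def Buckets (X : Search) (f : ℕ → List ℕ) (s : Memory) : Prop :=
  ∀ z < X.n, s.arr 13 z = (f z).length ∧
    ∀ j (h : j < (f z).length), s.arr 14 (z * X.K2 + j) = (f z)[j]

theorem Buckets.congr {f g : ℕ → List ℕ} {s s' : Memory} (h : X.Buckets f s)
    (h13 : s'.arr 13 = s.arr 13) (h14 : s'.arr 14 = s.arr 14) (hfg : ∀ z < X.n, f z = g z) :
    X.Buckets g s' := by
  intro z hz
  have := h z hz
  rw [h13, h14, ← hfg z hz]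
  exact this

theorem Buckets.push {f : ℕ → List ℕ} {s s' : Memory} (h : X.Buckets f s)
    (hf : ∀ z < X.n, (f z).length ≤ X.K2) {z i : ℕ} (hz : (f z).length < X.K2)
    (h13 : ∀ x, s'.arr 13 x = if x = z then (f z).length + 1 else s.arr 13 x)
    (h14 : ∀ x, s'.arr 14 x = if x = z * X.K2 + (f z).length then i else s.arr 14 x) :
    X.Buckets (Function.update f z (f z ++ [i])) s' := by
  intro y hy
  obtain ⟨h1, h2⟩ := h y hy
  have hfy := hf y hy
  by_cases hyz : y = z
  · subst hyz
    rw [Function.update_self]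
    refine ⟨by simp [h13], fun j hj => ?_⟩
    rw [h14]
    by_cases hj' : j = (f y).length
    · subst hj'; simp
    · have : j < (f y).length := by simp at hj; omega
      rw [if_neg (by omega), h2 j this, List.getElem_append_left]
  · rw [Function.update_of_ne hyz]
    refine ⟨by rw [h13, if_neg hyz, h1], fun j hj => ?_⟩
    rw [h14, if_neg, h2]
    intro he
    exact hyz (mul_add_inj (by omega) hz he).1

end Search

/-- Put the sample in register `36` into the bucket of the vertex at place `48` of the queue. -/
def pushBucket : Prog :=
  .load 52 9 48 ;; .op .sub 52 52 0 ;; .load 53 13 52 ;; .op .mul 54 52 33 ;; .op .add 54 54 53 ;;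
  .store 14 54 36 ;; .op .add 53 53 2 ;; .store 13 52 53

/-- Put the samples in copy `true` into buckets. -/
def fillBuckets : Prog :=
  zeroFill 13 0 ;;
  forLoop 36 37 33 (retain true ;; .store 12 36 65 ;;
    .ite 65 (.op .lor 41 63 63 ;; forLoop 48 49 41 pushBucket) .skip)

theorem Arcs.card_ball_le (S : Arcs) (v r : ℕ) : (S.ball v r).card ≤ (S.arcsLt v r).card + 1 := by
  have : S.ball v r ⊆ insert v ((S.arcsLt v r).image S.hd) := by
    induction r with
    | zero => simp [Arcs.ball]
    | succ r ih =>
      intro y hy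
      rcases Arcs.mem_ball_succ.1 hy with h | ⟨j, hj, h, rfl⟩
      · exact Finset.insert_subset_insert _
          (Finset.image_subset_image (Arcs.arcsLt_subset (Nat.le_succ r))) (ih h)
      · exact Finset.mem_insert_of_mem (Finset.mem_image_of_mem _ (Arcs.mem_outArcs.2 ⟨hj, h⟩))
  exact (Finset.card_le_card this).trans ((Finset.card_insert_le _ _).trans
    (Nat.add_le_add_right Finset.card_image_le 1))

namespace Search

variable {X : Search} {w : ℕ}

theorem near_length {c : Bool} {i : ℕ} {Lq : List ℕ} {s : Memory} (hr : X.Ret c i)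
    (hq : QList Lq (X.near c i) s) : Lq.length ≤ X.b + 1 := by
  rw [hq.card]
  exact (X.S.card_ball_le _ _).trans (Nat.add_le_add_right hr.2 1)

/-- A ball stays in the copy of its centre, so after subtracting the offset of the copy both kinds
of samples are indexed by vertices of the original graph. -/
theorem near_lt {c : Bool} {i y : ℕ} (hi : i < X.K) (hr : X.Ret c i) (hy : y ∈ X.near c i) :
    ∃ z < X.n, y = z + (bif c then X.n else 0) := by
  have h1 : y < X.S.N := Arcs.ball_lt (X.S.tl_lt _ (X.hR i hi)) _ _ hy
  have h2 := X.copy _ _ _ hy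
  rw [X.hN] at h1
  have h3 := hr.1
  cases c
  · exact ⟨y, h2.2 (h3.2 rfl), rfl⟩
  · simp only [Bool.true_eq_false, iff_false] at h3
    exact ⟨y - X.n, by omega, by simp; omega⟩

/-- The queue has no repetitions, so the sample enters each bucket at most once. Before it enters, a
bucket has at most `i < K2` entries, so rows of length `K2` never overflow. -/
theorem fillBuckets_step {s : Memory} {i : ℕ} {Lq : List ℕ} (h : X.Mem w s) (h36 : s.reg 36 = i)
    (hi : i < X.K2) (hr : X.Ret true i) (hq : QList Lq (X.near true i) s)
    (hB : X.Buckets (X.bucket i) s) :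
    Ter w (.op .lor 41 63 63 ;; forLoop 48 49 41 pushBucket) s ((X.b + 1) * 20 + 7)
      (X.Buckets (X.bucket (i + 1))) := by
  refine Ter.of_valid fun hv => ?_
  have hiK : i < X.K := lt_of_lt_of_le hi X.hK
  have hlen := near_length hr hq
  refine Ter.seq' (t1 := 1) (t2 := Lq.length * (15 + 5) + 5)
    (R := fun s5 => s5 = s.setReg 41 Lq.length)
    (.op (by simp [hq.len]; exact hq.len ▸ hv.1 63) (by simp [hq.len])) ?_ ?_
  swap
  · have : Lq.length * (15 + 5) ≤ (X.b + 1) * 20 := Nat.mul_le_mul_right _ hlen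
    omega
  rintro s1 - hf1 rfl
  have h1 := h.setReg (r := 41) (by norm_num) Lq.length
  refine Ter.forLoop Lq.length 15 (fun j s2 => X.Buckets (fun z =>
    if z + X.n ∈ Lq.take j then X.bucket i z ++ [i] else X.bucket i z) s2) (by simp)
    h1.env.graph.one (by decide) (by decide) (by decide) (by decide) ?_ ?_ ?_ le_rfl
  · intro s2 _ ha hr
    exact hB.congr (by simp [ha]) (by simp [ha]) (by simp)
  · intro j s2 hj hv2 hf2 e48 hI
    have h2 := h1.frame hf2 (by decide) (by decide)
    have e9 : s2.arr 9 j = Lq[j] := by rw [hf2.arr _ (by decide)]; exact hq.get j hj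
    have e36 : s2.reg 36 = i := by rw [hf2.reg _ (by decide)]; simpa using h36
    obtain ⟨z, hz, hLz⟩ := near_lt hiK hr (hq.mem.1 (List.getElem_mem hj))
    simp only [cond_true] at hLz
    -- The current vertex has not been treated yet, so its bucket is still the one formed by the
    -- first `i` samples.
    have hnot : Lq[j] ∉ Lq.take j := by
      intro hm
      obtain ⟨l, hl, he⟩ := List.getElem_of_mem hm
      simp only [List.getElem_take] at he
      simp only [List.length_take] at hl
      have := (hq.nodup.getElem_inj_iff).1 he
      omega
    obtain ⟨c1, c2⟩ := hI z hz
    have hnot' : z + X.n ∉ Lq.take j := hLz ▸ hnot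
    simp only [hnot', if_false] at c1 c2
    have hlz : (X.bucket i z).length < X.K2 := lt_of_le_of_lt (bucket_length_le i z) hi
    refine (Ter.of_wp (t := 15) (Q := fun s3 =>
      (∀ x, s3.arr 13 x = if x = z then (X.bucket i z).length + 1 else s2.arr 13 x) ∧
      (∀ x, s3.arr 14 x = if x = z * X.K2 + (X.bucket i z).length then i else s2.arr 14 x)) ?_
      (by simp [Prog.size, pushBucket])).conseq le_rfl ?_
    · have hN := X.hN
      simp [pushBucket, e48, e9, h2.env.n, hLz, c1, h2.r33, e36, h2.env.graph.one]
      exact ⟨h2.fits_le (by omega), h2.fits (k := 0) (by omega) (by omega) (by omega),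
        h2.fits (by omega) (by omega) (by omega), h2.fits_le (by omega)⟩
    · rintro s3 - - ⟨d13, d14⟩ v v'
      have := hI.push (z := z) (i := i) (s' := s3) ?_ ?_ ?_ ?_
      · refine this.congr (by simp) (by simp) ?_
        intro y hy
        simp only [Function.update_apply, List.take_succ_eq_append_getElem hj, List.mem_append,
          List.mem_singleton]
        rw [← hLz]
        by_cases hyz : y = z
        · subst hyz; simp [hnot', hLz]
        · simp [hyz, hLz]
      · intro y hy
        have := bucket_length_le (X := X) i y
        split <;> simp <;> omega
      · simpa [hnot'] using hlz
      · simpa [hnot'] using d13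
      · simpa [hnot'] using d14
  · intro s2 _ _ hI
    refine hI.congr rfl rfl fun z hz => ?_
    simp only [List.take_length]
    split
    · rename_i hm
      rw [bucket_succ_of_hit ⟨hr, by simpa using hq.mem.1 hm⟩]
    · rename_i hm
      rw [bucket_succ_of_not_hit fun hh => hm (hq.mem.2 (by simpa using hh.2))]

theorem fillBuckets_spec {s : Memory} (h : X.Mem w s) :
    Ter w fillBuckets s (X.n * 8 + X.K2 * (220 * (X.b + 1) + 40) + 20) (fun s' => X.Mem w s' ∧
      X.Buckets (X.bucket X.K2) s' ∧ ∀ i < X.K2, Truth (s'.arr 12 i) (X.Ret true i)) := by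
  refine Ter.seq' (t2 := X.K2 * (220 * (X.b + 1) + 30 + 5) + 5)
    (zeroFill_spec h.env.graph.one h.env.n (by norm_num)) ?_ (by
      have : X.K2 * (220 * (X.b + 1) + 30 + 5) ≤ X.K2 * (220 * (X.b + 1) + 40) :=
        Nat.mul_le_mul_left _ (by omega)
      omega)
  intro s1 _ hf1 hz
  have h1 := h.frame hf1 (by decide) (by decide)
  refine Ter.forLoop X.K2 (220 * (X.b + 1) + 30) (fun k s2 => X.Mem w s2 ∧
      X.Buckets (X.bucket k) s2 ∧ ∀ i < k, Truth (s2.arr 12 i) (X.Ret true i)) h1.r33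
    h1.env.graph.one (by decide) (by decide) (by decide) (by decide) ?_ ?_ (fun _ _ _ h => h) le_rfl
  · intro s2 _ ha hr
    refine ⟨h1.congr (fun r hr' => hr r (by omega) (by omega)) (by simp [ha]), ?_, by simp⟩
    intro z hz'
    simp [bucket, ha, hz z hz']
  · rintro i s2 hi hv2 hf2 e36 ⟨h2, hB, h12⟩
    refine Ter.seq' (t2 := (X.b + 1) * 20 + 12) (retain_spec h2 e36 (lt_of_lt_of_le hi X.hK)) ?_
      (by omega)
    rintro s3 hv3 hf3 ⟨h3, hret⟩
    have e36' : s3.reg 36 = i := by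
      rw [retain_frame_reg hf3 _ (by norm_num) (by norm_num) (by norm_num), e36]
    refine Ter.seq' (t1 := 1) (t2 := (X.b + 1) * 20 + 8)
      (R := fun s4 => s4 = s3.setArr 12 i (s3.reg 65)) (.store (by rw [e36'])) ?_ (by omega)
    rintro s4 - hf4 rfl
    have h4 := h3.frame hf4 (by decide) (by decide)
    have hB4 : X.Buckets (X.bucket i) (s3.setArr 12 i (s3.reg 65)) := hB.congr
      (by rw [hf4.arr _ (by decide), retain_frame_arr hf3 _ (by norm_num) (by norm_num)])
      (by rw [hf4.arr _ (by decide), retain_frame_arr hf3 _ (by norm_num) (by norm_num)])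
      fun _ _ => rfl
    have h12' : ∀ j < i + 1, Truth ((s3.setArr 12 i (s3.reg 65)).arr 12 j) (X.Ret true j) := by
      intro j hj
      by_cases hji : j = i
      · subst hji
        simp only [Memory.setArr_arr, if_true]
        rcases hret with ⟨h, h', -⟩ | ⟨h, h'⟩
        · exact .inl ⟨h, h'⟩
        · exact .inr ⟨h, h'⟩
      · simp only [Memory.setArr_arr, if_true, hji, if_false]
        rw [retain_frame_arr hf3 _ (by norm_num) (by norm_num)]
        exact h12 j (by omega)
    refine Ter.ite (t := (X.b + 1) * 20 + 7) (fun hx => ?_) fun hx => ?_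
    · rcases hret with ⟨-, hr, Lq, hq⟩ | ⟨h, -⟩
      · refine (fillBuckets_step h4 (by simpa using e36') hi hr (hq.congr rfl (hf4.arr _ (by decide)))
          hB4).conseq le_rfl ?_
        intro s5 _ hf5 hB5 v v'
        have h5 := h4.frame hf5 (by decide) (by decide)
        refine ⟨(h5.setReg (by norm_num) _).setReg (by norm_num) _,
          hB5.congr (by simp) (by simp) fun _ _ => rfl, ?_⟩
        simp only [Memory.setReg_arr]
        rw [hf5.arr _ (by decide)]
        exact h12'
      · simp [h] at hx
    · rcases hret with ⟨h, -⟩ | ⟨-, hr⟩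
      · simp [h] at hx
      · refine (Ter.skip (Q := fun s5 => s5 = s3.setArr 12 i (s3.reg 65)) rfl).conseq (by omega) ?_
        rintro s5 - - rfl v v'
        refine ⟨(h4.setReg (by norm_num) _).setReg (by norm_num) _,
          hB4.congr (by simp) (by simp) fun _ _ => ?_, h12'⟩
        rw [bucket_succ_of_not_hit fun hh => hr hh.1]

end Search

/-! ### The products of the indicator matrices of the vertices with large buckets -/

/-- In the array `a`, in the row that starts at the index in register `55`, mark the entries of the
bucket that starts at the index in register `56`. -/
def markRow (a : ℕ) : Prog :=
  forLoop 50 51 53 (.op .add 57 56 50 ;; .load 57 14 57 ;; .op .add 57 57 55 ;; .store a 57 2)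

/-- Number the vertices with more than `Δ` bucket entries, where `Δ` is in register `45`. -/
def countHeavy : Prog :=
  .const 46 0 ;; forLoop 36 37 0 (.load 52 13 36 ;; .op .lt 53 45 52 ;;
    .ite 53 (.store 16 36 46 ;; .store 17 46 36 ;; .op .add 46 46 2) .skip)

/-- Put the buckets of the numbered vertices into the rows of the array `19`. -/
def fillRight : Prog :=
  forLoop 36 37 46 ((.load 52 17 36 ;; .load 53 13 52 ;; .op .mul 56 52 33 ;; .op .mul 55 36 33) ;;
    markRow 19)

/-- Treat the vertex at place `48` of the queue as a vertex near the sample in register `36`. -/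
def markVertex : Prog :=
  (.load 52 9 48 ;; .load 53 13 52 ;; .op .lt 54 45 53) ;;
  .ite 54 (.load 54 16 52 ;; .op .mul 54 54 33 ;; .op .add 54 54 36 ;; .store 18 54 2)
    (.op .mul 56 52 33 ;; markRow 15)

/-- Go through the samples in copy `false`. -/
def fillLeft : Prog :=
  forLoop 36 37 33 (retain false ;; .store 11 36 65 ;;
    .ite 65 ((.op .mul 55 36 33 ;; .op .lor 41 63 63) ;; forLoop 48 49 41 markVertex) .skip)

namespace Search

variable {X : Search} {w : ℕ}

theorem markRow_spec {a r g z : ℕ} {Y : ℕ → ℕ → Prop} {f : ℕ → List ℕ} {s : Memory}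
    (ha : a = 15 ∨ a = 19) (h : X.Mem w s) (hB : X.Buckets f s) (hz : z < X.n)
    (h53 : s.reg 53 = (f z).length) (h56 : s.reg 56 = z * X.K2) (h55 : s.reg 55 = g * X.K2)
    (hg : g ≤ 2 * (X.S.N + X.S.M + X.K2)) (hfz : ∀ i ∈ f z, i < X.K2)
    (hlen : (f z).length ≤ X.K2) (hY : Bits a r X.K2 Y s) :
    Ter w (markRow a) s ((f z).length * 12 + 5)
      (Bits a r X.K2 (fun i j => Y i j ∨ (i = g ∧ j ∈ f z))) := by
  have hN := X.hN
  refine Ter.forLoop (f z).length 7 (fun q s1 =>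
    Bits a r X.K2 (fun i j => Y i j ∨ (i = g ∧ j ∈ (f z).take q)) s1) h53 h.env.graph.one
    (by rcases ha with rfl | rfl <;> decide) (by rcases ha with rfl | rfl <;> decide)
    (by rcases ha with rfl | rfl <;> decide) (by decide) ?_ ?_ ?_ le_rfl
  · intro s1 _ ha' hr
    exact hY.congr (by rw [ha']) (by simp)
  · intro q s1 hq _ hf1 e50 hI
    have e55 : s1.reg 55 = g * X.K2 := by
      rw [hf1.reg _ (by rcases ha with rfl | rfl <;> decide), h55]
    have e56 : s1.reg 56 = z * X.K2 := by
      rw [hf1.reg _ (by rcases ha with rfl | rfl <;> decide), h56]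
    have e2 : s1.reg 2 = 1 := by
      rw [hf1.reg _ (by rcases ha with rfl | rfl <;> decide), h.env.graph.one]
    have e14 : s1.arr 14 (z * X.K2 + q) = (f z)[q] := by
      rw [hf1.arr _ (by rcases ha with rfl | rfl <;> decide)]
      exact (hB z hz).2 q hq
    have hm := hfz _ (List.getElem_mem hq)
    refine (Ter.of_wp (t := 7) (Q := fun s3 =>
      (∀ x, s3.arr a x = if x = g * X.K2 + (f z)[q] then 1 else s1.arr a x)) ?_
      (by simp [Prog.size])).conseq le_rfl ?_
    · simp [e50, e55, e56, e14, e2, Nat.add_comm (f z)[q]]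
      exact ⟨h.fits (by omega) (by omega) (by omega), h.fits (by omega) (by omega) (by omega)⟩
    · intro s3 _ _ h3 v v'
      refine (hI.set hm (s' := s3) h3).congr (by simp) ?_
      intro i _ j _
      simp only [List.take_succ_eq_append_getElem hq, List.mem_append, List.mem_singleton]
      tauto
  · intro s1 _ _ hI
    simpa using hI

variable (X) in
/-- The vertices below `k` whose bucket has more than `Δ` entries. -/
noncomputable def heavy (Δ k : ℕ) : List ℕ :=
  (List.range k).filter fun z => Δ < (X.bucket X.K2 z).length

theorem mem_heavy {Δ k z : ℕ} : z ∈ X.heavy Δ k ↔ z < k ∧ Δ < (X.bucket X.K2 z).length := by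
  simp [heavy]

theorem heavy_length_le (Δ k : ℕ) : (X.heavy Δ k).length ≤ k :=
  (List.length_filter_le _ _).trans (by simp)

/-- The array `17` holds the list `l`, and the array `16` the positions of its entries. -/
def Numbered (l : List ℕ) (s : Memory) : Prop :=
  ∀ g z, l[g]? = some z → s.arr 17 g = z ∧ s.arr 16 z = g

theorem Numbered.congr {l : List ℕ} {s s' : Memory} (h : Numbered l s)
    (h16 : s'.arr 16 = s.arr 16) (h17 : s'.arr 17 = s.arr 17) : Numbered l s' := by
  intro g z hg; rw [h16, h17]; exact h g z hg

/-- Both directions of the numbering are recorded: array `17` drives the filling of one matrix by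
rows, and array `16` finds the row of a vertex met during a search. -/
theorem countHeavy_spec {s : Memory} {Δ : ℕ} (h : X.Mem w s) (h45 : s.reg 45 = Δ)
    (hB : X.Buckets (X.bucket X.K2) s) :
    Ter w countHeavy s (X.n * 20 + 10) (fun s' => s'.reg 46 = (X.heavy Δ X.n).length ∧
      Numbered (X.heavy Δ X.n) s') := by
  have hf1 := h.env.graph.fits_one
  have hN := X.hN
  refine Ter.seq' (t1 := 1) (t2 := X.n * (15 + 5) + 5)
    (R := fun s1 => s1 = s.setReg 46 0) (.const (Fits.zero _) rfl) ?_ (by omega)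
  rintro s1 - hf1' rfl
  have h1 := h.frame hf1' (by decide) (by decide)
  refine Ter.forLoop X.n 15 (fun k s2 => s2.reg 46 = (X.heavy Δ k).length ∧
    Numbered (X.heavy Δ k) s2) h1.env.n h1.env.graph.one (by decide) (by decide) (by decide)
    (by decide) ?_ ?_ (fun _ _ _ h => h) le_rfl
  · intro s2 _ ha hr
    refine ⟨?_, fun g z hg => by simp [heavy] at hg⟩
    rw [hr 46 (by norm_num) (by norm_num)]; simp [heavy]
  · rintro k s2 hk hv2 hf2 e36 ⟨e46, hI⟩
    have h2 := h1.frame hf2 (by decide) (by decide)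
    have e13 : s2.arr 13 k = (X.bucket X.K2 k).length := by
      rw [hf2.arr _ (by decide)]; exact (hB k hk).1
    have e45 : s2.reg 45 = Δ := by rw [hf2.reg _ (by decide)]; simpa using h45
    have hle := heavy_length_le (X := X) Δ k
    have hfit : Fits w ((X.heavy Δ k).length + 1) := h2.fits_le (by omega)
    have fk : Fits w k := h2.fits_le (by omega)
    by_cases hΔ : Δ < (X.bucket X.K2 k).length
    · have hsucc : X.heavy Δ (k + 1) = X.heavy Δ k ++ [k] := by simp [heavy, List.range_succ, hΔ]
      refine (Ter.of_wp (t := 15) (Q := fun s3 => s3.reg 46 = (X.heavy Δ k).length + 1 ∧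
        (∀ x, s3.arr 16 x = if x = k then (X.heavy Δ k).length else s2.arr 16 x) ∧
        (∀ x, s3.arr 17 x = if x = (X.heavy Δ k).length then k else s2.arr 17 x)) ?_
        (by simp [Prog.size])).conseq le_rfl ?_
      · simp [e36, e13, e45, e46, hΔ, h2.env.graph.one, hf1, hfit]
      · rintro s3 - - ⟨c46, c16, c17⟩ v v'
        rw [hsucc]
        refine ⟨by simp [c46], fun g z hg => ?_⟩
        simp only [Memory.setReg_arr, c16, c17]
        rw [List.getElem?_append] at hg
        split at hg
        · rename_i hlt
          obtain ⟨d1, d2⟩ := hI g z hg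
          have hz : z < k := (mem_heavy.1 (List.mem_of_getElem? hg)).1
          rw [if_neg (by omega), if_neg (by omega)]
          exact ⟨d1, d2⟩
        · rename_i hlt
          have : g - (X.heavy Δ k).length = 0 := by
            by_contra hh
            obtain ⟨y, hy⟩ := Nat.exists_eq_succ_of_ne_zero hh
            simp [hy] at hg
          rw [this] at hg
          simp at hg
          subst hg
          rw [if_pos (by omega), if_pos rfl]
          exact ⟨rfl, by omega⟩
    · have hsucc : X.heavy Δ (k + 1) = X.heavy Δ k := by simp [heavy, List.range_succ, hΔ]
      refine (Ter.of_wp (t := 15) (Q := fun s3 => s3.reg 46 = s2.reg 46 ∧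
        s3.arr 16 = s2.arr 16 ∧ s3.arr 17 = s2.arr 17) ?_
        (by simp [Prog.size])).conseq le_rfl ?_
      · simp [e36, e13, e45, hΔ]
      · rintro s3 - - ⟨c46, c16, c17⟩ v v'
        rw [hsucc]
        exact ⟨by simp [c46, e46], hI.congr (by simp [c16]) (by simp [c17])⟩

variable (X) in
/-- The sample `i` is retained, and the entry `g` of the list `l` is near it. -/
def HitAt (l : List ℕ) (c : Bool) (g i : ℕ) : Prop := ∃ z, l[g]? = some z ∧ X.Hit c i z

theorem fillRight_spec {s : Memory} {l : List ℕ} (h : X.Mem w s) (h46 : s.reg 46 = l.length)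
    (hB : X.Buckets (X.bucket X.K2) s) (hl : Numbered l s) (hlt : ∀ z ∈ l, z < X.n)
    (hlen : l.length ≤ X.n) (hz : ∀ i < (l.length + X.K2) * X.K2, s.arr 19 i = 0) :
    Ter w fillRight s (l.length * (X.K2 * 12 + 25) + 5)
      (Bits 19 (l.length + X.K2) X.K2 (X.HitAt l true)) := by
  have hf1 := h.env.graph.fits_one
  have hN := X.hN
  refine Ter.forLoop l.length (X.K2 * 12 + 20) (fun k s1 =>
    Bits 19 (l.length + X.K2) X.K2 (fun g i => g < k ∧ X.HitAt l true g i) s1) h46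
    h.env.graph.one (by decide) (by decide) (by decide) (by decide) ?_ ?_ ?_ le_rfl
  · intro s1 _ ha _
    exact (Bits.zero (s := s1) (by rw [ha]; exact hz)).congr rfl (by simp)
  · intro k s1 hk hv1 hf1' e36 hI
    have h1 := h.frame hf1' (by decide) (by decide)
    have hB1 : X.Buckets (X.bucket X.K2) s1 :=
      hB.congr (hf1'.arr _ (by decide)) (hf1'.arr _ (by decide)) fun _ _ => rfl
    have hg : l[k]? = some l[k] := List.getElem?_eq_getElem hk
    have e17 : s1.arr 17 k = l[k] := by rw [hf1'.arr _ (by decide)]; exact (hl _ _ hg).1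
    have hz := hlt _ (List.getElem_mem hk)
    have hbl := bucket_length_le (X := X) X.K2 l[k]
    refine Ter.seq' (t1 := 7) (t2 := X.K2 * 12 + 5) (R := fun s2 =>
      s2.reg 53 = (X.bucket X.K2 l[k]).length ∧ s2.reg 56 = l[k] * X.K2 ∧ s2.reg 55 = k * X.K2)
      (Ter.of_wp ?_ (by simp [Prog.size])) ?_ (by omega)
    · simp [e36, e17, (hB1 _ hz).1, h1.r33]
      exact ⟨h1.fits (k := 0) (by omega) (by omega) (by omega),
        h1.fits (k := 0) (by omega) (by omega) (by omega)⟩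
    rintro s2 - hf2 ⟨e53, e56, e55⟩
    have h2 := h1.frame hf2 (by decide) (by decide)
    refine (markRow_spec (.inr rfl) h2 (hB1.congr (hf2.arr _ (by decide)) (hf2.arr _ (by decide))
      fun _ _ => rfl) hz e53 e56 e55 (by omega) (fun i hi => (mem_bucket.1 hi).1) hbl
      (hI.congr (hf2.arr _ (by decide)) fun _ _ _ _ => Iff.rfl)).conseq ?_ ?_
    · have : (X.bucket X.K2 l[k]).length * 12 ≤ X.K2 * 12 := Nat.mul_le_mul_right _ hbl
      omega
    · intro s3 _ _ h3 v v'
      refine h3.congr (by simp) fun g _ i hi => ?_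
      simp only [mem_bucket, HitAt]
      constructor
      · rintro (⟨h1, h2⟩ | ⟨rfl, -, h2⟩)
        · exact ⟨by omega, h2⟩
        · exact ⟨by omega, _, hg, h2⟩
      · rintro ⟨h1, z, h2, hz'⟩
        by_cases hgk : g = k
        · subst hgk
          rw [hg] at h2
          simp only [Option.some.injEq] at h2
          exact .inr ⟨rfl, hi, h2 ▸ hz'⟩
        · exact .inl ⟨by omega, z, h2, hz'⟩
  · intro s1 _ _ hI
    refine hI.congr rfl fun g _ i _ => ?_
    constructor
    · exact fun h => h.2
    · rintro ⟨z, h1, h2⟩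
      refine ⟨?_, z, h1, h2⟩
      by_contra hh
      rw [List.getElem?_eq_none (by omega)] at h1
      simp at h1

/-- Two samples hit a common vertex whose bucket is not large. -/
def Direct (X : Search) (Δ i i' : ℕ) : Prop :=
  ∃ z < X.n, (X.bucket X.K2 z).length ≤ Δ ∧ X.Hit false i z ∧ X.Hit true i' z

/-- For a vertex with a large bucket only an incidence is recorded, and the pairs are left to the
matrix product. Otherwise at most `Δ` pairs are marked directly, which bounds the time. -/
theorem markVertex_spec {s : Memory} {Δ r i z j : ℕ} {Y Z : ℕ → ℕ → Prop} (h : X.Mem w s)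
    (h45 : s.reg 45 = Δ)
    (h36 : s.reg 36 = i) (hi : i < X.K2) (h48 : s.reg 48 = j) (h9 : s.arr 9 j = z) (hz : z < X.n)
    (h55 : s.reg 55 = i * X.K2)
    (hB : X.Buckets (X.bucket X.K2) s) (hl : Numbered (X.heavy Δ X.n) s)
    (hY : Bits 15 X.K2 X.K2 Y s) (hZ : Bits 18 r X.K2 Z s) :
    Ter w markVertex s (Δ * 12 + 20) (fun s' =>
      Bits 15 X.K2 X.K2 (fun i1 i2 => Y i1 i2 ∨
        (i1 = i ∧ (X.bucket X.K2 z).length ≤ Δ ∧ i2 ∈ X.bucket X.K2 z)) s' ∧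
      Bits 18 r X.K2 (fun g i1 => Z g i1 ∨ ((X.heavy Δ X.n)[g]? = some z ∧ i1 = i)) s') := by
  have hf1 := h.env.graph.fits_one
  have hN := X.hN
  have hbl := bucket_length_le (X := X) X.K2 z
  refine Ter.seq' (t1 := 5) (t2 := Δ * 12 + 9) (R := fun s1 => s1.reg 52 = z ∧
    s1.reg 53 = (X.bucket X.K2 z).length ∧
    s1.reg 54 = if Δ < (X.bucket X.K2 z).length then 1 else 0)
    (Ter.of_wp ?_ (by simp [Prog.size])) ?_ (by omega)
  · simp [h48, h9, (hB z hz).1, h45, hf1]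
  rintro s1 hv1 hf1' ⟨e52, e53, e54⟩
  have h1 := h.frame hf1' (by decide) (by decide)
  have e36 : s1.reg 36 = i := by rw [hf1'.reg _ (by decide), h36]
  refine Ter.ite (t := Δ * 12 + 8) (fun hx => ?_) fun hx => ?_
  · have hheavy : Δ < (X.bucket X.K2 z).length := by
      by_contra hh; simp [e54, hh] at hx
    obtain ⟨g, hg, hgz⟩ := List.getElem_of_mem (mem_heavy.2 ⟨hz, hheavy⟩)
    have hg' : (X.heavy Δ X.n)[g]? = some z := by rw [List.getElem?_eq_getElem hg, hgz]
    have hgn := heavy_length_le (X := X) Δ X.n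
    have e16 : s1.arr 16 z = g := by rw [hf1'.arr _ (by decide)]; exact (hl g z hg').2
    refine (Ter.of_wp (t := 8) (Q := fun s3 => s3.arr 15 = s1.arr 15 ∧
      (∀ x, s3.arr 18 x = if x = g * X.K2 + i then 1 else s1.arr 18 x)) ?_
      (by simp [Prog.size])).conseq (by omega) ?_
    · simp [e52, e16, h1.r33, e36, h1.env.graph.one]
      exact ⟨h1.fits (k := 0) (by omega) (by omega) (by omega),
        h1.fits (by omega) (by omega) (by omega), by funext x; simp⟩
    · rintro s3 - - ⟨c15, c18⟩
      refine ⟨hY.congr (by rw [c15, hf1'.arr _ (by decide)]) fun i1 _ i2 _ => ?_, ?_⟩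
      · constructor
        · exact .inl
        · rintro (h | ⟨-, h, -⟩)
          · exact h
          · omega
      · refine ((hZ.congr (s' := s1) (hf1'.arr _ (by decide)) fun _ _ _ _ => Iff.rfl).set hi c18).congr rfl
          fun g' _ i1 _ => ?_
        refine or_congr Iff.rfl (and_congr ⟨?_, ?_⟩ Iff.rfl)
        · rintro rfl; exact hg'
        · intro h'
          have := (hl g' z h').2
          have := (hl g z hg').2
          omega
  · have hlight : (X.bucket X.K2 z).length ≤ Δ := by
      by_contra hh; simp [e54, not_le.1 hh] at hx
    refine Ter.seq' (t1 := 1) (t2 := Δ * 12 + 5) (R := fun s2 => s2 = s1.setReg 56 (z * X.K2))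
      (.op ?_ ?_) ?_ (by omega)
    · simp [e52, h1.r33]; exact h1.fits (k := 0) (by omega) (by omega) (by omega)
    · simp [e52, h1.r33]
    rintro s2 - hf2 rfl
    have h2 := h1.frame hf2 (by decide) (by decide)
    refine (markRow_spec (r := X.K2) (Y := Y) (f := X.bucket X.K2) (z := z) (g := i) (.inl rfl) h2
      (hB.congr (by simp [hf1'.arr 13 (by decide)]) (by simp [hf1'.arr 14 (by decide)])
        fun _ _ => rfl) hz (by simpa using e53) (by simp) ?_ (by omega)
      (fun i hi => (mem_bucket.1 hi).1) hbl
      (hY.congr (by simp [hf1'.arr 15 (by decide)]) fun _ _ _ _ => Iff.rfl)).conseq ?_ ?_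
    · simp [hf1'.reg 55 (by decide), h55]
    · have : (X.bucket X.K2 z).length * 12 ≤ Δ * 12 := Nat.mul_le_mul_right _ hlight
      omega
    · intro s3 _ hf3 h3
      refine ⟨h3.congr rfl fun i1 _ i2 _ => by simp [hlight], ?_⟩
      refine hZ.congr (by rw [hf3.arr _ (by decide), hf2.arr _ (by decide), hf1'.arr _ (by decide)])
        fun g _ i1 _ => ⟨.inl, ?_⟩
      rintro (h | ⟨h, -⟩)
      · exact h
      · have := (mem_heavy.1 (List.mem_of_getElem? h)).2
        omega

theorem fillLeft_step {s : Memory} {Δ r i : ℕ} {Lq : List ℕ} {Y Z : ℕ → ℕ → Prop} (h : X.Mem w s)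
    (h45 : s.reg 45 = Δ) (h36 : s.reg 36 = i) (hi : i < X.K2)
    (hr : X.Ret false i) (hq : QList Lq (X.near false i) s)
    (hB : X.Buckets (X.bucket X.K2) s) (hl : Numbered (X.heavy Δ X.n) s)
    (hY : Bits 15 X.K2 X.K2 Y s) (hZ : Bits 18 r X.K2 Z s) :
    Ter w ((.op .mul 55 36 33 ;; .op .lor 41 63 63) ;; forLoop 48 49 41 markVertex) s
      ((X.b + 1) * (Δ * 12 + 25) + 10) (fun s' =>
      Bits 15 X.K2 X.K2 (fun i1 i2 => Y i1 i2 ∨ (i1 = i ∧ X.Direct Δ i i2)) s' ∧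
      Bits 18 r X.K2 (fun g i1 => Z g i1 ∨ (i1 = i ∧ X.HitAt (X.heavy Δ X.n) false g i)) s') := by
  refine Ter.of_valid fun hv => ?_
  have hN := X.hN
  have hiK : i < X.K := lt_of_lt_of_le hi X.hK
  have hlen := near_length hr hq
  refine Ter.seq' (t1 := 3) (t2 := Lq.length * (Δ * 12 + 20 + 5) + 5)
    (R := fun s1 => s1.reg 55 = i * X.K2 ∧ s1.reg 41 = Lq.length)
    (Ter.of_wp ?_ (by simp [Prog.size])) ?_ ?_
  · simp [h36, h.r33, hq.len]
    exact ⟨h.fits (k := 0) (by omega) (by omega) (by omega), hq.len ▸ hv.1 63⟩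
  swap
  · have : Lq.length * (Δ * 12 + 20 + 5) ≤ (X.b + 1) * (Δ * 12 + 25) :=
      Nat.mul_le_mul_right _ hlen
    omega
  rintro s1 - hf1 ⟨e55, e41⟩
  have h1 := h.frame hf1 (by decide) (by decide)
  refine Ter.forLoop Lq.length (Δ * 12 + 20) (fun j s2 =>
      Bits 15 X.K2 X.K2 (fun i1 i2 => Y i1 i2 ∨ (i1 = i ∧ ∃ z ∈ Lq.take j,
        (X.bucket X.K2 z).length ≤ Δ ∧ i2 ∈ X.bucket X.K2 z)) s2 ∧
      Bits 18 r X.K2 (fun g i1 => Z g i1 ∨ (i1 = i ∧ ∃ z ∈ Lq.take j,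
        (X.heavy Δ X.n)[g]? = some z)) s2) e41 h1.env.graph.one
    (by decide) (by decide) (by decide) (by decide) ?_ ?_ ?_ le_rfl
  · intro s2 _ ha _
    exact ⟨hY.congr (by rw [ha, hf1.arr _ (by decide)]) (by simp),
      hZ.congr (by rw [ha, hf1.arr _ (by decide)]) (by simp)⟩
  · rintro j s2 hj hv2 hf2 e48 ⟨hI1, hI2⟩
    have h2 := h1.frame hf2 (by decide) (by decide)
    have e9 : s2.arr 9 j = Lq[j] := by
      rw [hf2.arr _ (by decide), hf1.arr _ (by decide)]; exact hq.get j hj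
    obtain ⟨z, hz, hLz⟩ := near_lt hiK hr (hq.mem.1 (List.getElem_mem hj))
    simp only [cond_false, Nat.add_zero] at hLz
    rw [hLz] at e9
    refine (markVertex_spec h2 (Δ := Δ) (i := i) (by
      rw [hf2.reg _ (by decide), hf1.reg _ (by decide), h45]) (by
      rw [hf2.reg _ (by decide), hf1.reg _ (by decide), h36]) hi e48 e9 hz (by
      rw [hf2.reg _ (by decide), e55])
      (hB.congr (by rw [hf2.arr _ (by decide), hf1.arr _ (by decide)])
        (by rw [hf2.arr _ (by decide), hf1.arr _ (by decide)]) fun _ _ => rfl)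
      (hl.congr (by rw [hf2.arr _ (by decide), hf1.arr _ (by decide)])
        (by rw [hf2.arr _ (by decide), hf1.arr _ (by decide)])) hI1 hI2).conseq le_rfl ?_
    rintro s3 - - ⟨c1, c2⟩ v v'
    refine ⟨c1.congr (by simp) fun i1 _ i2 _ => ?_, c2.congr (by simp) fun g _ i1 _ => ?_⟩
    · simp only [List.take_succ_eq_append_getElem hj, List.mem_append, List.mem_singleton, hLz,
        or_and_right, exists_or, exists_eq_left, and_or_left, or_assoc]
    · simp only [List.take_succ_eq_append_getElem hj, List.mem_append, List.mem_singleton, hLz,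
        or_and_right, exists_or, exists_eq_left, and_or_left, or_assoc, and_comm (b := i1 = i)]
  · rintro s2 - - ⟨hI1, hI2⟩
    have hhit : ∀ z, z < X.n ∧ X.Hit false i z ↔ z ∈ Lq := fun z => by
      rw [hq.mem]
      constructor
      · rintro ⟨-, -, h2⟩; simpa using h2
      · intro hz
        obtain ⟨z', hz', he⟩ := near_lt hiK hr hz
        simp only [cond_false, Nat.add_zero] at he
        subst he
        exact ⟨hz', hr, by simpa using hz⟩
    refine ⟨hI1.congr rfl fun i1 _ i2 hi2 => ?_, hI2.congr rfl fun g _ i1 _ => ?_⟩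
    · refine or_congr Iff.rfl (and_congr Iff.rfl ?_)
      simp only [List.take_length, Direct, mem_bucket]
      constructor
      · rintro ⟨z, hz, h1, -, h2⟩
        exact ⟨z, ((hhit z).2 hz).1, h1, ((hhit z).2 hz).2, h2⟩
      · rintro ⟨z, hz, h1, h2, h3⟩
        exact ⟨z, (hhit z).1 ⟨hz, h2⟩, h1, hi2, h3⟩
    · refine or_congr Iff.rfl (and_congr Iff.rfl ?_)
      simp only [List.take_length, HitAt]
      constructor
      · rintro ⟨z, hz, h1⟩
        exact ⟨z, h1, ((hhit z).2 hz).2⟩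
      · rintro ⟨z, h1, h2⟩
        exact ⟨z, (hhit z).1 ⟨(mem_heavy.1 (List.mem_of_getElem? h1)).1, h2⟩, h1⟩

theorem fillLeft_spec {s : Memory} {Δ r : ℕ} (h : X.Mem w s)
    (h45 : s.reg 45 = Δ)
    (hB : X.Buckets (X.bucket X.K2) s) (hl : Numbered (X.heavy Δ X.n) s)
    (hY : ∀ i < X.K2 * X.K2, s.arr 15 i = 0) (hZ : ∀ i < r * X.K2, s.arr 18 i = 0) :
    Ter w fillLeft s (X.K2 * ((X.b + 1) * (Δ * 12 + 225) + 40) + 5) (fun s' => X.Mem w s' ∧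
      (∀ i < X.K2, Truth (s'.arr 11 i) (X.Ret false i)) ∧
      Bits 15 X.K2 X.K2 (X.Direct Δ) s' ∧
      Bits 18 r X.K2 (fun g i => X.HitAt (X.heavy Δ X.n) false g i) s') := by
  refine Ter.forLoop X.K2 ((X.b + 1) * (Δ * 12 + 225) + 35) (fun k s2 => X.Mem w s2 ∧
      (∀ i < k, Truth (s2.arr 11 i) (X.Ret false i)) ∧
      Bits 15 X.K2 X.K2 (fun i i' => i < k ∧ X.Direct Δ i i') s2 ∧
      Bits 18 r X.K2 (fun g i => i < k ∧ X.HitAt (X.heavy Δ X.n) false g i) s2) h.r33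
    h.env.graph.one (by decide) (by decide) (by decide) (by decide) ?_ ?_ ?_ le_rfl
  · intro s2 _ ha hr
    refine ⟨h.congr (fun r hr' => hr r (by omega) (by omega)) (by simp [ha]), by simp, ?_, ?_⟩
    · exact (Bits.zero (s := s2) (by rw [ha]; exact hY)).congr rfl (by simp)
    · exact (Bits.zero (s := s2) (by rw [ha]; exact hZ)).congr rfl (by simp)
  · rintro i s2 hi hv2 hf2 e36 ⟨h2, h11, hY2, hZ2⟩
    have hsplit : (X.b + 1) * (Δ * 12 + 225) = (X.b + 1) * (Δ * 12 + 25) + 200 * (X.b + 1) := by ring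
    refine Ter.seq' (t2 := (X.b + 1) * (Δ * 12 + 25) + 15)
      (retain_spec h2 e36 (lt_of_lt_of_le hi X.hK)) ?_ (by omega)
    rintro s3 hv3 hf3 ⟨h3, hret⟩
    have e36' : s3.reg 36 = i := by
      rw [retain_frame_reg hf3 _ (by norm_num) (by norm_num) (by norm_num), e36]
    refine Ter.seq' (t1 := 1) (t2 := (X.b + 1) * (Δ * 12 + 25) + 11)
      (R := fun s4 => s4 = s3.setArr 11 i (s3.reg 65)) (.store (by rw [e36'])) ?_ (by omega)
    rintro s4 - hf4 rfl
    have h4 := h3.frame hf4 (by decide) (by decide)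
    set s4 := s3.setArr 11 i (s3.reg 65) with hs4
    have ar : ∀ a, a ≠ 8 → a ≠ 9 → a ≠ 11 → s4.arr a = s2.arr a := fun a h8 h9 h11 => by
      rw [hf4.arr a (by simpa [Prog.arrs] using h11), retain_frame_arr hf3 a h8 h9]
    have af : ∀ a, a ∉ fillLeft.arrs → a ≠ 8 → a ≠ 9 → a ≠ 11 → s4.arr a = s.arr a :=
      fun a h0 h8 h9 h11 => by rw [ar a h8 h9 h11]; exact hf2.arr a h0
    have h11' : ∀ j < i + 1, Truth (s4.arr 11 j) (X.Ret false j) := by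
      intro j hj
      by_cases hji : j = i
      · subst hji
        simp only [hs4, Memory.setArr_arr, if_true]
        rcases hret with ⟨h, h', -⟩ | ⟨h, h'⟩
        · exact .inl ⟨h, h'⟩
        · exact .inr ⟨h, h'⟩
      · simp only [hs4, Memory.setArr_arr, if_true, hji, if_false]
        rw [retain_frame_arr hf3 _ (by norm_num) (by norm_num)]
        exact h11 j (by omega)
    have hY4 : Bits 15 X.K2 X.K2 _ s4 :=
      hY2.congr (ar _ (by norm_num) (by norm_num) (by norm_num)) fun _ _ _ _ => Iff.rfl
    have hZ4 : Bits 18 r X.K2 _ s4 :=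
      hZ2.congr (ar _ (by norm_num) (by norm_num) (by norm_num)) fun _ _ _ _ => Iff.rfl
    refine Ter.ite (t := (X.b + 1) * (Δ * 12 + 25) + 10) (fun hx => ?_) fun hx => ?_
    · rcases hret with ⟨-, hr, Lq, hq⟩ | ⟨h, -⟩
      · refine (fillLeft_step h4 (Δ := Δ) ?_ (i := i) e36' hi hr
          (hq.congr rfl (hf4.arr _ (by decide))) ?_ ?_ hY4 hZ4).conseq le_rfl ?_
        · rw [hf4.reg _ (by decide), retain_frame_reg hf3 _ (by norm_num) (by norm_num) (by norm_num),
            hf2.reg _ (by decide), h45]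
        · exact hB.congr (af _ (by decide) (by norm_num) (by norm_num) (by norm_num))
            (af _ (by decide) (by norm_num) (by norm_num) (by norm_num)) fun _ _ => rfl
        · exact hl.congr (af _ (by decide) (by norm_num) (by norm_num) (by norm_num))
            (af _ (by decide) (by norm_num) (by norm_num) (by norm_num))
        rintro s5 - hf5 ⟨c1, c2⟩ v v'
        have h5 := h4.frame hf5 (by decide) (by decide)
        refine ⟨(h5.setReg (by norm_num) _).setReg (by norm_num) _, ?_,
          c1.congr (by simp) fun i1 _ i2 _ => ?_, c2.congr (by simp) fun g _ i1 _ => ?_⟩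
        · simp only [Memory.setReg_arr]
          rw [hf5.arr _ (by decide)]
          exact h11'
        · rw [Nat.lt_succ_iff_lt_or_eq]
          constructor
          · rintro (⟨h1, h2⟩ | ⟨rfl, h2⟩)
            · exact ⟨.inl h1, h2⟩
            · exact ⟨.inr rfl, h2⟩
          · rintro ⟨h1 | rfl, h2⟩
            · exact .inl ⟨h1, h2⟩
            · exact .inr ⟨rfl, h2⟩
        · rw [Nat.lt_succ_iff_lt_or_eq]
          constructor
          · rintro (⟨h1, h2⟩ | ⟨rfl, h2⟩)
            · exact ⟨.inl h1, h2⟩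
            · exact ⟨.inr rfl, h2⟩
          · rintro ⟨h1 | rfl, h2⟩
            · exact .inl ⟨h1, h2⟩
            · exact .inr ⟨rfl, h2⟩
      · simp [hs4, h] at hx
    · rcases hret with ⟨h, -⟩ | ⟨-, hr⟩
      · simp [hs4, h] at hx
      · refine (Ter.skip (Q := fun s5 => s5 = s4) rfl).conseq (by omega) ?_
        rintro s5 - - rfl v v'
        refine ⟨(h4.setReg (by norm_num) _).setReg (by norm_num) _, h11',
          hY4.congr (by simp) fun i1 _ i2 _ => ?_, hZ4.congr (by simp) fun g _ i1 _ => ?_⟩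
        -- A sample that is not retained hits no vertex, so its row stays zero and nothing has to be
        -- written.
        · refine ⟨fun h => ⟨by omega, h.2⟩, fun ⟨h1, h2⟩ => ⟨?_, h2⟩⟩
          by_contra hh
          obtain rfl : i1 = i := by omega
          obtain ⟨z, -, -, h3, -⟩ := h2
          exact hr h3.1
        · refine ⟨fun h => ⟨by omega, h.2⟩, fun ⟨h1, h2⟩ => ⟨?_, h2⟩⟩
          by_contra hh
          obtain rfl : i1 = i := by omega
          obtain ⟨z, -, h3⟩ := h2
          exact hr h3.1
  · rintro s2 - - ⟨h2, h11, hY2, hZ2⟩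
    exact ⟨h2, h11, hY2.congr rfl fun i hi _ _ => by simp [hi],
      hZ2.congr rfl fun _ _ i hi => by simp [hi]⟩

end Search

/-! ### Blockwise matrix multiplication and the search for an unmarked pair -/

/-- The program `P` multiplies `k × k` matrices with entries in `{0, 1}` within `T` steps. -/
def Multiplies (P : Prog) (w k T : ℕ) : Prop :=
  ∀ A B : Matrix (Fin k) (Fin k) ℕ, (∀ i j, A i j ≤ 1) → (∀ i j, B i j ≤ 1) →
    ∀ s : Memory, s.Valid w → HoldsMatrices A B s →
      Ev w (Halted fun s' => ∀ i j : Fin k, s'.arr 2 (i * k + j) = (A * B) i j) T (some ([P], s))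

/-- Copy two square blocks to the input of the multiplication; the first one is transposed. The
number of the blocks is in register `36`, and their size in register `82`. -/
def loadBlock : Prog :=
  .op .mul 55 36 33 ;;
  forLoop 48 49 82 ((.op .mod 52 48 33 ;; .op .add 52 52 55 ;; .op .mul 52 52 33 ;;
    .op .div 53 48 33 ;; .op .add 52 52 53 ;; .load 52 18 52 ;; .store 100 48 52) ;;
    .op .mul 53 55 33 ;; .op .add 53 53 48 ;; .load 53 19 53 ;; .store 101 48 53)

/-- Mark the nonzero entries of the product. -/
def addBlock : Prog :=
  forLoop 48 49 82 (.load 52 102 48 ;; .ite 52 (.store 15 48 2) .skip)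

/-- Multiply two blocks with the program `P` and a limited amount of fuel, which is in register
`47`; set register `80` if it does not suffice. -/
def mulBlock (P : Prog) : Prog :=
  loadBlock ;; (.op .lor 100 33 33 ;; .op .lor 90 47 47) ;; clk P ;;
    .ite 90 addBlock (.const 80 1)

/-- Multiply all blocks; their number is in register `81`. -/
def mulBlocks (P : Prog) : Prog := forLoop 36 37 81 (mulBlock P)

/-- Look for two retained samples in different copies that are not marked. -/
def findPair : Prog :=
  forLoop 36 37 33 (.load 52 11 36 ;; .op .mul 55 36 33 ;;
    forLoop 48 49 33 (.load 53 12 48 ;; .op .add 54 55 48 ;; .load 54 15 54 ;; .op .sub 54 2 54 ;;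
      .op .land 54 54 53 ;; .op .land 54 54 52 ;; .op .lor 22 22 54))

theorem mulBlock_regs {P : Prog} : ∀ r ∈ (mulBlock P).regs,
    r = 48 ∨ r = 49 ∨ r = 52 ∨ r = 53 ∨ r = 55 ∨ r = 80 ∨ 90 ≤ r := by
  intro r hr
  simp only [mulBlock, Prog.regs, List.mem_append] at hr
  rcases hr with h | h | h | h
  · have := (by decide : ∀ r ∈ loadBlock.regs, r = 48 ∨ r = 49 ∨ r = 52 ∨ r = 53 ∨ r = 55) r h
    omega
  · simp at h; omega
  · have := clk_regs P r h; omega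
  · have : ∀ r ∈ addBlock.regs, r = 48 ∨ r = 49 ∨ r = 52 := by decide
    rcases h with h | h
    · have := this r h; omega
    · simp at h; omega

theorem mulBlock_arrs {P : Prog} : ∀ r ∈ (mulBlock P).arrs, r = 15 ∨ 100 ≤ r := by
  intro r hr
  simp only [mulBlock, Prog.arrs, List.mem_append] at hr
  rcases hr with h | h | h | h
  · have := (by decide : ∀ r ∈ loadBlock.arrs, 100 ≤ r) r h
    omega
  · simp at h
  · have := clk_arrs P r h; omega
  · have : ∀ r ∈ addBlock.arrs, r = 15 := by decide
    rcases h with h | h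
    · have := this r h; omega
    · simp at h

theorem mulBlocks_regs {P : Prog} : ∀ r ∈ (mulBlocks P).regs,
    r = 36 ∨ r = 37 ∨ r = 48 ∨ r = 49 ∨ r = 52 ∨ r = 53 ∨ r = 55 ∨ r = 80 ∨ 90 ≤ r := by
  intro r hr
  simp only [mulBlocks, forLoop, Prog.regs, List.mem_append, List.mem_singleton] at hr
  have := mulBlock_regs (P := P) r
  tauto

theorem mulBlocks_arrs {P : Prog} : ∀ r ∈ (mulBlocks P).arrs, r = 15 ∨ 100 ≤ r := by
  intro r hr
  simp only [mulBlocks, forLoop, Prog.arrs, List.mem_append, List.not_mem_nil, or_false,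
    false_or] at hr
  exact mulBlock_arrs r hr

theorem Truth.not {x : ℕ} {p : Prop} (h : Truth x p) : Truth (1 - x) (¬ p) := by
  rcases h with ⟨rfl, h⟩ | ⟨rfl, h⟩ <;> simp [Truth, h]

theorem Truth.and {x y : ℕ} {p q : Prop} (h : Truth x p) (h' : Truth y q) :
    Truth (x &&& y) (p ∧ q) := by
  rcases h with ⟨rfl, h⟩ | ⟨rfl, h⟩ <;> rcases h' with ⟨rfl, h'⟩ | ⟨rfl, h'⟩ <;> simp [Truth, h, h']

theorem Truth.or' {x y : ℕ} {p q : Prop} (h : Truth x p) (h' : Truth y q) :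
    Truth (x ||| y) (p ∨ q) := by
  rcases h with ⟨rfl, h⟩ | ⟨rfl, h⟩ <;> rcases h' with ⟨rfl, h'⟩ | ⟨rfl, h'⟩ <;> simp [Truth, h, h']

namespace Search

variable {X : Search} {w : ℕ}

/-- Both incidence matrices are stored with one row per numbered vertex. The product has to sum over
vertices, so the left block is transposed while it is copied. Arrays `100` and `101` are the inputs
`0` and `1` of the shifted program. -/
theorem loadBlock_spec {s : Memory} {k : ℕ} (h : X.Mem w s) (h36 : s.reg 36 = k)
    (hk : k * X.K2 ≤ X.n) (h82 : s.reg 82 = X.K2 * X.K2) :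
    Ter w loadBlock s (X.K2 * X.K2 * 28 + 8) (fun s' =>
      ∀ x < X.K2 * X.K2, s'.arr 100 x = s.arr 18 ((k * X.K2 + x % X.K2) * X.K2 + x / X.K2) ∧
        s'.arr 101 x = s.arr 19 (k * X.K2 * X.K2 + x)) := by
  have hN := X.hN
  refine Ter.seq' (t1 := 1) (t2 := X.K2 * X.K2 * (23 + 5) + 5)
    (R := fun s1 => s1 = s.setReg 55 (k * X.K2)) (.op ?_ ?_) ?_ (by omega)
  · simp [h36, h.r33]; exact h.fits_le (by omega)
  · simp [h36, h.r33]
  rintro s1 - hf1 rfl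
  have h1 := h.frame hf1 (by decide) (by decide)
  refine Ter.forLoop (X.K2 * X.K2) 23 (fun y s' =>
      ∀ x < y, s'.arr 100 x = s.arr 18 ((k * X.K2 + x % X.K2) * X.K2 + x / X.K2) ∧
        s'.arr 101 x = s.arr 19 (k * X.K2 * X.K2 + x)) (by simpa using h82) h1.env.graph.one
    (by decide) (by decide) (by decide) (by decide) (by simp) ?_ (fun _ _ _ h => h) le_rfl
  intro y s2 hy hv2 hf2 e48 hI
  have h2 := h1.frame hf2 (by decide) (by decide)
  have e55 : s2.reg 55 = k * X.K2 := by rw [hf2.reg _ (by decide)]; simp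
  have e18 : s2.arr 18 = s.arr 18 := by rw [hf2.arr _ (by decide)]; simp
  have e19 : s2.arr 19 = s.arr 19 := by rw [hf2.arr _ (by decide)]; simp
  have hmod : y % X.K2 < X.K2 := Nat.mod_lt _ X.hK2
  have hdiv : y / X.K2 < X.K2 := Nat.div_lt_of_lt_mul hy
  have hyf : Fits w (k * X.K2 * X.K2 + y) := by
    have := h2.fits (i := k * X.K2 + X.K2) (j := X.K2) (k := 0) (by omega) (by omega) (by omega)
    refine lt_of_le_of_lt ?_ this
    rw [Nat.add_mul]; omega
  have hyf' : Fits w (k * X.K2 * X.K2) := lt_of_le_of_lt (Nat.le_add_right _ _) hyf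
  refine (Ter.of_wp (t := 23) (Q := fun s3 =>
    (∀ x, s3.arr 100 x = if x = y then s.arr 18 ((k * X.K2 + y % X.K2) * X.K2 + y / X.K2) else
      s2.arr 100 x) ∧ (∀ x, s3.arr 101 x = if x = y then s.arr 19 (k * X.K2 * X.K2 + y) else
      s2.arr 101 x)) ?_ (by simp [Prog.size])).conseq le_rfl ?_
  · simp [WordOp.eval, e48, h2.r33, e55, e18, e19, Nat.add_comm (y % X.K2), hyf, hyf']
    refine ⟨h2.fits_le (by omega), h2.fits_le (by omega),
      h2.fits (k := 0) (by omega) (by omega) (by omega), h2.fits_le (by omega),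
      h2.fits (by omega) (by omega) (by omega)⟩
  · rintro s3 - - ⟨c1, c2⟩ v v' x hx
    simp only [Memory.setReg_arr, c1, c2]
    by_cases hxy : x = y
    · subst hxy; simp
    · simp only [hxy, if_false]; exact hI x (by omega)

theorem addBlock_spec {s : Memory} {Y Z : ℕ → ℕ → Prop} (h2 : s.reg 2 = 1)
    (h82 : s.reg 82 = X.K2 * X.K2) (hY : Bits 15 X.K2 X.K2 Y s)
    (hZ : ∀ i < X.K2, ∀ j < X.K2, (s.arr 102 (i * X.K2 + j) ≠ 0 ↔ Z i j)) :
    Ter w addBlock s (X.K2 * X.K2 * 12 + 5) (Bits 15 X.K2 X.K2 (fun i j => Y i j ∨ Z i j)) := by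
  refine Ter.forLoop (X.K2 * X.K2) 7 (fun y s' => Bits 15 X.K2 X.K2 (fun i j => Y i j ∨
    (i * X.K2 + j < y ∧ Z i j)) s') h82 h2 (by decide) (by decide) (by decide) (by decide) ?_ ?_ ?_
    le_rfl
  · intro s1 _ ha _
    exact hY.congr (by rw [ha]) (by simp)
  · intro y s1 hy _ hf1 e48 hI
    have e102 : s1.arr 102 = s.arr 102 := hf1.arr _ (by decide)
    have e2 : s1.reg 2 = 1 := by rw [hf1.reg _ (by decide), h2]
    have hmod : y % X.K2 < X.K2 := Nat.mod_lt _ X.hK2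
    have hdiv : y / X.K2 < X.K2 := Nat.div_lt_of_lt_mul hy
    have hyy : y / X.K2 * X.K2 + y % X.K2 = y := Nat.div_add_mod' _ _
    have hZy := hZ _ hdiv _ hmod
    rw [hyy] at hZy
    refine (Ter.of_wp (t := 7) (Q := fun s3 => (s.arr 102 y ≠ 0 →
      ∀ x, s3.arr 15 x = if x = y then 1 else s1.arr 15 x) ∧ (s.arr 102 y = 0 →
      s3.arr 15 = s1.arr 15)) ?_ (by simp [Prog.size])).conseq le_rfl ?_
    · simp [e48, e102, e2]
      exact ⟨fun h h' => absurd h' h, fun h h' => absurd h h'⟩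
    · rintro s3 - - ⟨c1, c2⟩ v v'
      by_cases hz : s.arr 102 y = 0
      · refine hI.congr (by simp [c2 hz]) fun i _ j hj => ?_
        refine or_congr Iff.rfl ⟨fun h => ⟨by omega, h.2⟩, fun h => ⟨?_, h.2⟩⟩
        by_contra hh
        have he : i * X.K2 + j = y := by omega
        rw [← hyy] at he
        obtain ⟨rfl, rfl⟩ := mul_add_inj hj hmod he
        exact hZy.2 h.2 hz
      · refine (hI.set (i := y / X.K2) (j := y % X.K2) (s' := (s3.setReg 48 v).setReg 49 v') hmod
          (by rw [hyy]; exact c1 hz)).congr rfl fun i _ j hj => ?_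
        constructor
        · rintro ((h | h) | ⟨rfl, rfl⟩)
          · exact .inl h
          · exact .inr ⟨by omega, h.2⟩
          · exact .inr ⟨by omega, hZy.1 hz⟩
        · rintro (h | ⟨h, h'⟩)
          · exact .inl (.inl h)
          · by_cases he : i * X.K2 + j = y
            · rw [← hyy] at he
              exact .inr (mul_add_inj hj hmod he)
            · exact .inl (.inr ⟨by omega, h'⟩)
  · intro s1 _ _ hI
    exact hI.congr rfl fun i hi j hj => by simp [mul_add_lt hi hj]

/-- If the fuel suffices, the nonzero entries of the product are added to the marks. If not,
register `80` is set and `ClkPost` yields `F ≤ T`: the failure itself is a lower bound for the time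
of the multiplication. -/
theorem mulBlock_spec {P : Prog} {s : Memory} {k r F T : ℕ} {Y A B : ℕ → ℕ → Prop} (h : X.Mem w s)
    (hP : Multiplies P w X.K2 T) (h36 : s.reg 36 = k)
    (hk : k * X.K2 ≤ X.n) (hr : k * X.K2 + X.K2 ≤ r) (h82 : s.reg 82 = X.K2 * X.K2)
    (h47 : s.reg 47 = F) (hA : Bits 18 r X.K2 A s) (hB : Bits 19 r X.K2 B s)
    (hY : Bits 15 X.K2 X.K2 Y s) :
    Ter w (mulBlock P) s (X.K2 * X.K2 * 40 + (F + 1) * clkCost P + 25) (fun s' => X.Mem w s' ∧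
      ∃ Y', Bits 15 X.K2 X.K2 Y' s' ∧ ((s'.reg 80 = s.reg 80 ∧
        ∀ i < X.K2, ∀ j < X.K2, (Y' i j ↔ Y i j ∨
          ∃ t < X.K2, A (k * X.K2 + t) i ∧ B (k * X.K2 + t) j)) ∨ (s'.reg 80 = 1 ∧ F ≤ T))) := by
  have hf1 := h.env.graph.fits_one
  have hN := X.hN
  refine Ter.seq' (t2 := X.K2 * X.K2 * 12 + (F + 1) * clkCost P + 16)
    (loadBlock_spec h h36 hk h82) ?_ (by omega)
  intro s1 hv1 hfr1 hld
  have h1 := h.frame hfr1 (by decide) (by decide)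
  refine Ter.seq' (t1 := 3) (t2 := X.K2 * X.K2 * 12 + (F + 1) * clkCost P + 12)
    (R := fun s2 => s2.reg 100 = X.K2 ∧ s2.reg 90 = F) (Ter.of_wp ?_ (by simp [Prog.size])) ?_
    (by omega)
  · have e47 : s1.reg 47 = F := by rw [hfr1.reg _ (by decide), h47]
    simp [h1.r33, e47]
    exact ⟨h1.fits_le (by omega), e47 ▸ hv1.1 47⟩
  rintro s2 hv2 hf2 ⟨e100, e90⟩
  have h2 := h1.frame hf2 (by decide) (by decide)
  have hfr : ∀ r, r ∉ loadBlock.regs → r ∉ (Prog.op .lor 100 33 33 ;; .op .lor 90 47 47).regs →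
      s2.reg r = s.reg r := fun r h1 h2 => by rw [hf2.reg r h2, hfr1.reg r h1]
  have har : ∀ r, r ∉ loadBlock.arrs → s2.arr r = s.arr r := fun r h1 => by
    rw [hf2.arr r (by simp [Prog.arrs]), hfr1.arr r h1]
  obtain ⟨A', hA'⟩ : ∃ A' : Matrix (Fin X.K2) (Fin X.K2) ℕ,
      ∀ i t, A' i t = s2.arr 100 (i * X.K2 + t) := ⟨fun i t => _, fun _ _ => rfl⟩
  obtain ⟨B', hB'⟩ : ∃ B' : Matrix (Fin X.K2) (Fin X.K2) ℕ,
      ∀ i t, B' i t = s2.arr 101 (i * X.K2 + t) := ⟨fun i t => _, fun _ _ => rfl⟩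
  have tA : ∀ i t : Fin X.K2, Truth (A' i t) (A (k * X.K2 + t) i) := by
    intro i t
    have hx : (i : ℕ) * X.K2 + t < X.K2 * X.K2 := mul_add_lt i.2 t.2
    rw [hA', hf2.arr _ (by decide), (hld _ hx).1, Nat.mul_comm (i : ℕ), Nat.mul_add_mod,
      Nat.mod_eq_of_lt t.2, Nat.mul_add_div X.hK2, Nat.div_eq_of_lt t.2, Nat.add_zero]
    exact hA _ (by omega) _ i.2
  have tB : ∀ t j : Fin X.K2, Truth (B' t j) (B (k * X.K2 + t) j) := by
    intro t j
    have hx : (t : ℕ) * X.K2 + j < X.K2 * X.K2 := mul_add_lt t.2 j.2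
    rw [hB', hf2.arr _ (by decide), (hld _ hx).2, ← Nat.add_assoc, ← Nat.add_mul]
    exact hB _ (by omega) _ j.2
  have hev := hP A' B' (fun i j => (tA i j).le_one) (fun i j => (tB i j).le_one) s2.shifted
    ⟨fun r => hv2.1 _, fun a i => hv2.2 _ _⟩
    ⟨e100, fun i j => (hA' i j).symm, fun i j => (hB' i j).symm⟩
  have hclk := Ter.clk hev h2.env.graph.one
  rw [e90] at hclk
  refine Ter.seq' (t2 := X.K2 * X.K2 * 12 + 8) hclk ?_ (by omega)
  intro s3 _ hf3 hpost
  have h3 := h2.frame hf3 (fun r hr => by have := clk_regs P r hr; omega)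
    (fun r hr => by have := clk_arrs P r hr; omega)
  have r3 : ∀ r < 90, s3.reg r = s2.reg r := fun r hr =>
    hf3.reg r fun hm => by have := clk_regs P r hm; omega
  have a3 : ∀ r < 100, s3.arr r = s2.arr r := fun r hr =>
    hf3.arr r fun hm => by have := clk_arrs P r hm; omega
  have hY3 : Bits 15 X.K2 X.K2 Y s3 := hY.congr
    (by rw [a3 _ (by norm_num), har _ (by decide)]) fun _ _ _ _ => Iff.rfl
  refine Ter.ite (t := X.K2 * X.K2 * 12 + 7) (fun hx => ?_) fun hx => ?_
  · rcases hpost with ⟨h0, -⟩ | ⟨-, -, hprod⟩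
    · exact absurd h0 hx
    refine (addBlock_spec (X := X) (Z := fun i j => ∃ t < X.K2, A (k * X.K2 + t) i ∧
      B (k * X.K2 + t) j) h3.env.graph.one
      (by rw [r3 _ (by norm_num), hfr _ (by decide) (by decide), h82]) hY3 ?_).conseq (by omega) ?_
    · intro i hi j hj
      have := hprod ⟨i, hi⟩ ⟨j, hj⟩
      simp only [Memory.shifted, Nat.reduceAdd] at this
      -- No cancellation occurs over the naturals, so an entry is nonzero exactly if the two samples
      -- have a common vertex in this block.
      rw [this, Matrix.mul_apply, Ne, Finset.sum_eq_zero_iff]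
      simp only [Finset.mem_univ, true_implies, not_forall, Nat.mul_eq_zero, not_or]
      constructor
      · rintro ⟨t, h1, h2⟩
        exact ⟨t, t.2, (tA ⟨i, hi⟩ t).ne_zero.1 h1, (tB t ⟨j, hj⟩).ne_zero.1 h2⟩
      · rintro ⟨t, ht, h1, h2⟩
        exact ⟨⟨t, ht⟩, (tA ⟨i, hi⟩ ⟨t, ht⟩).ne_zero.2 h1, (tB ⟨t, ht⟩ ⟨j, hj⟩).ne_zero.2 h2⟩
    · intro s4 _ hf4 h4
      refine ⟨h3.frame hf4 (by decide) (by decide), _, h4, .inl ⟨?_, fun _ _ _ _ => Iff.rfl⟩⟩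
      rw [hf4.reg _ (by decide), r3 _ (by norm_num), hfr _ (by decide) (by decide)]
  · rcases hpost with ⟨-, hFT⟩ | ⟨h0, -⟩
    swap
    · exact absurd hx h0
    refine (Ter.const (r := 80) (Q := fun s4 => s4 = s3.setReg 80 1) hf1 rfl).conseq (by omega) ?_
    rintro s4 - - rfl
    exact ⟨h3.setReg (by norm_num) _, Y, hY3, .inr ⟨by simp, hFT⟩⟩

/-- The marks accumulate over blocks of `X.K2` consecutive rows. Once register `80` is set it stays
set, so any failure is visible at the end; `0 < k` is kept for dividing the total fuel. -/
theorem mulBlocks_spec {P : Prog} {s : Memory} {k r F T : ℕ} {Y A B : ℕ → ℕ → Prop} (h : X.Mem w s)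
    (hP : Multiplies P w X.K2 T) (h81 : s.reg 81 = k)
    (hk : k * X.K2 ≤ X.n + X.K2) (hr : k * X.K2 ≤ r) (h82 : s.reg 82 = X.K2 * X.K2)
    (h47 : s.reg 47 = F) (h80 : s.reg 80 = 0) (hA : Bits 18 r X.K2 A s) (hB : Bits 19 r X.K2 B s)
    (hY : Bits 15 X.K2 X.K2 Y s) :
    Ter w (mulBlocks P) s (k * (X.K2 * X.K2 * 40 + (F + 1) * clkCost P + 30) + 5)
      (fun s' => X.Mem w s' ∧ ((s'.reg 80 = 0 ∧ Bits 15 X.K2 X.K2 (fun i j => Y i j ∨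
          ∃ g < k * X.K2, A g i ∧ B g j) s') ∨ (s'.reg 80 = 1 ∧ 0 < k ∧ F ≤ T))) := by
  have hregs : ∀ r ∈ (mulBlock P).regs, r ≠ 36 ∧ r ≠ 81 ∧ r ≠ 2 := fun r hr => by
    have := mulBlock_regs r hr; omega
  refine Ter.forLoop k (X.K2 * X.K2 * 40 + (F + 1) * clkCost P + 25)
    (fun l s' => X.Mem w s' ∧ ∃ Y', Bits 15 X.K2 X.K2 Y' s' ∧ ((s'.reg 80 = 0 ∧
      ∀ i < X.K2, ∀ j < X.K2, (Y' i j ↔ Y i j ∨ ∃ g < l * X.K2, A g i ∧ B g j)) ∨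
        (s'.reg 80 = 1 ∧ 0 < k ∧ F ≤ T))) h81 h.env.graph.one
    (fun hm => (hregs _ hm).1 rfl) (fun hm => (hregs _ hm).2.1 rfl) (fun hm => (hregs _ hm).2.2 rfl)
    (by decide) ?_ ?_ ?_ le_rfl
  · intro s1 _ ha hr
    refine ⟨h.congr (fun r hr' => hr r (by omega) (by omega)) (by simp [ha]), Y,
      hY.congr (by rw [ha]) fun _ _ _ _ => Iff.rfl, .inl ⟨?_, by simp⟩⟩
    rw [hr _ (by norm_num) (by norm_num), h80]
  · rintro l s1 hl hv1 hf1 e36 ⟨h1, Y', hY', hcase⟩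
    have hlk : l * X.K2 + X.K2 ≤ k * X.K2 := by
      have := Nat.mul_le_mul_right X.K2 (show l + 1 ≤ k from hl)
      rwa [Nat.succ_mul] at this
    have fr : ∀ x, x = 82 ∨ x = 47 → s1.reg x = s.reg x := fun x hx => hf1.reg x fun hm => by
      have := mulBlocks_regs (P := P) x hm; omega
    have fa : ∀ x, x = 18 ∨ x = 19 → s1.arr x = s.arr x := fun x hx => hf1.arr x fun hm => by
      have := mulBlocks_arrs (P := P) x hm; omega
    refine (mulBlock_spec h1 hP e36 (by omega) (hlk.trans hr) (by rw [fr _ (.inl rfl), h82])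
      (by rw [fr _ (.inr rfl), h47]) (hA.congr (fa _ (.inl rfl)) fun _ _ _ _ => Iff.rfl)
      (hB.congr (fa _ (.inr rfl)) fun _ _ _ _ => Iff.rfl) hY').conseq le_rfl ?_
    rintro s2 - - ⟨h2, Y'', hY'', hc⟩ v v'
    refine ⟨(h2.setReg (by norm_num) _).setReg (by norm_num) _, Y'',
      hY''.congr (by simp) fun _ _ _ _ => Iff.rfl, ?_⟩
    simp only [Memory.setReg_reg, Nat.reduceEqDiff, if_false]
    rcases hc with ⟨hc, hiff⟩ | ⟨hc, hc'⟩
    · rcases hcase with ⟨h0, hiff'⟩ | ⟨h0, h0'⟩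
      · refine .inl ⟨by omega, fun i hi j hj => ?_⟩
        rw [hiff i hi j hj, hiff' i hi j hj, or_assoc]
        refine or_congr Iff.rfl ⟨?_, ?_⟩
        · rintro (⟨g, h1, h2⟩ | ⟨t, h1, h2⟩)
          · exact ⟨g, by rw [Nat.succ_mul]; omega, h2⟩
          · exact ⟨_, by rw [Nat.succ_mul]; omega, h2⟩
        · rintro ⟨g, h1, h2⟩
          rw [Nat.succ_mul] at h1
          by_cases hg : g < l * X.K2
          · exact .inl ⟨g, hg, h2⟩
          · refine .inr ⟨g - l * X.K2, by omega, ?_⟩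
            rwa [show l * X.K2 + (g - l * X.K2) = g by omega]
      · exact .inr ⟨by omega, h0'⟩
    · exact .inr ⟨hc, by omega, hc'⟩
  · rintro s1 - - ⟨h1, Y', hY', hcase⟩
    exact ⟨h1, hcase.imp (fun h => ⟨h.1, hY'.congr rfl h.2⟩) id⟩

/-- The flags are 0/1 words, so each pair is tested with bitwise operations, without branching. -/
theorem findPair_spec {s : Memory} {Y : ℕ → ℕ → Prop} {p q : ℕ → Prop} (h : X.Mem w s)
    (h22 : s.reg 22 = 0) (hp : ∀ i < X.K2, Truth (s.arr 11 i) (p i))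
    (hq : ∀ i < X.K2, Truth (s.arr 12 i) (q i)) (hY : Bits 15 X.K2 X.K2 Y s) :
    Ter w findPair s (X.K2 * (X.K2 * 20 + 20) + 5) (fun s' =>
      Truth (s'.reg 22) (∃ i < X.K2, ∃ j < X.K2, p i ∧ q j ∧ ¬ Y i j)) := by
  have hf1 := h.env.graph.fits_one
  have hN := X.hN
  refine Ter.forLoop X.K2 (X.K2 * 20 + 15) (fun k s' =>
    Truth (s'.reg 22) (∃ i < k, ∃ j < X.K2, p i ∧ q j ∧ ¬ Y i j)) h.r33 h.env.graph.one
    (by decide) (by decide) (by decide) (by decide) ?_ ?_ (fun _ _ _ h => h) le_rfl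
  · intro s1 _ _ hr
    rw [hr _ (by norm_num) (by norm_num), h22]
    exact .inr ⟨rfl, by simp⟩
  intro i s1 hi _ hf1' e36 hI
  refine Ter.seq' (t1 := 1) (t2 := X.K2 * 20 + 13) (R := fun s2 => s2.reg 52 = s.arr 11 i)
    (.load ?_) ?_ (by omega)
  · simp [e36, hf1'.arr 11 (by decide)]
  intro s2 _ hf2 e52
  refine Ter.seq' (t1 := 1) (t2 := X.K2 * 20 + 11) (R := fun s3 => s3.reg 55 = i * X.K2)
    (.op ?_ ?_) ?_ (by omega)
  · rw [hf2.reg _ (by decide), hf2.reg _ (by decide), e36, hf1'.reg _ (by decide), h.r33]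
    exact h.fits (k := 0) (by omega) (by omega) (by omega)
  · rw [hf2.reg _ (by decide), hf2.reg _ (by decide), e36, hf1'.reg _ (by decide), h.r33]
    simp
  intro s3 _ hf3 e55
  have ar : ∀ a, a ∉ findPair.arrs → s3.arr a = s.arr a := fun a ha => by
    rw [hf3.arr a (by simp [Prog.arrs]), hf2.arr a (by simp [Prog.arrs]), hf1'.arr a ha]
  have rg : ∀ r, r ∉ findPair.regs → s3.reg r = s.reg r := fun r hr => by
    have : ¬ (r = 52 ∨ r = 55) := by
      rintro (rfl | rfl)
      · exact hr (by decide)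
      · exact hr (by decide)
    rw [hf3.reg r (by simp [Prog.regs]; omega), hf2.reg r (by simp [Prog.regs]; omega),
      hf1'.reg r hr]
  have e22 : s3.reg 22 = s1.reg 22 := by rw [hf3.reg _ (by decide), hf2.reg _ (by decide)]
  refine Ter.forLoop X.K2 13 (fun k s' =>
    Truth (s'.reg 22) ((∃ i' < i, ∃ j < X.K2, p i' ∧ q j ∧ ¬ Y i' j) ∨
      ∃ j < k, p i ∧ q j ∧ ¬ Y i j))
    (by rw [rg _ (by decide), h.r33]) (by rw [rg _ (by decide), h.env.graph.one])
    (by decide) (by decide) (by decide) (by decide) ?_ ?_ ?_ (by omega)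
  · intro s4 _ _ hr
    rw [hr _ (by norm_num) (by norm_num)]
    exact hI.congr e22 (by simp)
  · intro j s4 hj _ hf4 e48 hI4
    have e12 : s4.arr 12 j = s.arr 12 j := by rw [hf4.arr _ (by decide), ar _ (by decide)]
    have e15 : s4.arr 15 = s.arr 15 := by rw [hf4.arr _ (by decide), ar _ (by decide)]
    have g55 : s4.reg 55 = i * X.K2 := by rw [hf4.reg _ (by decide), e55]
    have g52 : s4.reg 52 = s.arr 11 i := by
      rw [hf4.reg _ (by decide), hf3.reg _ (by decide), e52]
    have g2 : s4.reg 2 = 1 := by rw [hf4.reg _ (by decide), rg _ (by decide), h.env.graph.one]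
    have t1 := (hY i hi j hj).not
    have t2 := t1.and (hq j hj)
    have t3 := t2.and (hp i hi)
    have t4 := hI4.or' t3
    refine (Ter.of_wp (t := 13) (Q := fun s5 => s5.reg 22 = s4.reg 22 |||
      (((1 - s.arr 15 (i * X.K2 + j)) &&& s.arr 12 j) &&& s.arr 11 i)) ?_
      (by simp [Prog.size])).conseq le_rfl ?_
    · simp [e48, e12, e15, g55, g52, g2, -Nat.and_one_is_mod]
      exact ⟨h.fits (by omega) (by omega) (by omega), t1.fits hf1, t2.fits hf1, t3.fits hf1,
        t4.fits hf1⟩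
    · intro s5 _ _ h5 v v'
      simp only [Memory.setReg_reg, Nat.reduceEqDiff, if_false]
      rw [h5]
      refine t4.congr rfl ⟨?_, ?_⟩
      · rintro ((h | ⟨j', hj', h⟩) | h)
        · exact .inl h
        · exact .inr ⟨j', by omega, h⟩
        · exact .inr ⟨j, by omega, h.2, h.1.2, h.1.1⟩
      · rintro (h | ⟨j', hj', h⟩)
        · exact .inl (.inl h)
        · by_cases hjj : j' = j
          · subst hjj; exact .inr ⟨⟨h.2.2, h.2.1⟩, h.1⟩
          · exact .inl (.inr ⟨j', by omega, h⟩)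
  · intro s4 _ _ hI4 v v'
    refine hI4.congr (by simp) ⟨?_, ?_⟩
    · rintro (⟨i', hi', h⟩ | ⟨j, hj, h⟩)
      · exact ⟨i', by omega, h⟩
      · exact ⟨i, by omega, j, hj, h⟩
    · rintro ⟨i', hi', j, hj, h⟩
      by_cases hii : i' = i
      · subst hii; exact .inr ⟨j, hj, h⟩
      · exact .inl ⟨i', by omega, j, hj, h⟩

end Search

/-! ### The last stage of an attempt -/

/-- Compute the number of entries from which on a bucket is large. -/
def heavyBound : Prog :=
  .op .mul 52 21 21 ;; .op .lt 53 52 4 ;;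
    .ite 53 (.op .mul 52 52 21 ;; .op .div 45 52 4) (.op .lor 45 33 33)

/-- Mark the pairs of samples that have a common vertex nearby, and look for a pair that is not
marked. The total amount of fuel is in register `84`. -/
def markPairs (P : Prog) : Prog :=
  (.op .add 81 46 33 ;; .op .mul 85 81 33 ;; .op .mul 82 33 33 ;; .op .sub 81 81 2 ;;
    .op .div 81 81 33 ;; .op .div 47 84 81 ;; .op .add 47 47 2) ;;
  zeroFill 18 85 ;; zeroFill 19 85 ;; zeroFill 15 82 ;; fillRight ;; fillLeft ;; mulBlocks P ;;
    .ite 80 .skip findPair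

/-- The last stage of an attempt: the result is in register `22`, unless register `80` tells that
the attempt has been aborted. -/
def pairSearch (P : Prog) : Prog :=
  (.const 22 0 ;; .const 80 0) ;; fillBuckets ;; heavyBound ;; countHeavy ;;
  (.op .mul 83 46 33 ;; .op .mul 84 4 21 ;; .op .lt 52 84 83) ;;
    .ite 52 (.const 80 1) (markPairs P)

theorem pairSearch_regs {P : Prog} : ∀ r ∈ (pairSearch P).regs, r = 22 ∨ 36 ≤ r := by
  intro r hr
  simp only [pairSearch, markPairs, Prog.regs, List.mem_append, List.mem_cons, List.not_mem_nil,
    or_false] at hr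
  have h1 : ∀ r, r ∈ fillBuckets.regs ∨ r ∈ heavyBound.regs ∨ r ∈ countHeavy.regs ∨
      r ∈ (zeroFill 18 85).regs ∨ r ∈ (zeroFill 19 85).regs ∨ r ∈ (zeroFill 15 82).regs ∨
      r ∈ fillRight.regs ∨ r ∈ fillLeft.regs ∨ r ∈ findPair.regs → r = 22 ∨ 36 ≤ r := by
    intro r h
    rcases h with h | h | h | h | h | h | h | h | h <;> revert r <;> decide
  have h2 := mulBlocks_regs (P := P) r
  by_contra hne
  push Not at hne
  have h3 : r ∉ (mulBlocks P).regs := fun h => by have := h2 h; omega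
  have h4 : ¬ (r ∈ fillBuckets.regs ∨ r ∈ heavyBound.regs ∨ r ∈ countHeavy.regs ∨
      r ∈ (zeroFill 18 85).regs ∨ r ∈ (zeroFill 19 85).regs ∨ r ∈ (zeroFill 15 82).regs ∨
      r ∈ fillRight.regs ∨ r ∈ fillLeft.regs ∨ r ∈ findPair.regs) := fun h => by
    have := h1 r h; omega
  simp only [not_or] at h4
  simp only [h3, h4, false_or, or_false] at hr
  omega

namespace Search

variable {X : Search} {w : ℕ}

variable (X) in
-- Double counting: a retained sample has at most `X.b` arcs in its neighbourhood, hence at most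
-- `X.b + 1` vertices nearby, and contributes to that many buckets at most.
theorem sum_bucket_le :
    ∑ z ∈ Finset.range X.n, (X.bucket X.K2 z).length ≤ X.K2 * (X.b + 1) := by
  classical
  have h1 : ∀ z, (X.bucket X.K2 z).length =
      ∑ i ∈ Finset.range X.K2, if X.Hit true i z then 1 else 0 := fun z => by
    rw [← Finset.card_filter, ← List.toFinset_card_of_nodup (l := X.bucket X.K2 z) (List.nodup_range.filter _)]
    congr 1
    ext i
    simp [bucket]
  simp only [h1]
  rw [Finset.sum_comm]
  refine (Finset.sum_le_card_nsmul _ _ (X.b + 1) fun i hi => ?_).trans (by simp)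
  rw [← Finset.card_filter]
  by_cases hr : X.Ret true i
  · refine le_trans (Finset.card_le_card_of_injOn (t := X.near true i) (fun z => z + X.n) ?_ ?_)
      ((X.S.card_ball_le _ _).trans (Nat.add_le_add_right hr.2 1))
    · intro z hz
      have := (Finset.mem_filter.1 hz).2.2
      simpa using this
    · intro x _ y _ hxy
      simpa using hxy
  · rw [Finset.filter_false_of_mem fun z _ hz => hr hz.1]
    simp

/-- Markov's inequality for bucket sizes. It bounds the inner dimension of the matrix product. -/
theorem heavy_mul_le (Δ : ℕ) : (X.heavy Δ X.n).length * (Δ + 1) ≤ X.K2 * (X.b + 1) := by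
  refine le_trans ?_ X.sum_bucket_le
  rw [← List.toFinset_card_of_nodup (l := X.heavy Δ X.n) (List.nodup_range.filter _), ← smul_eq_mul]
  refine (Finset.card_nsmul_le_sum _ (fun z => (X.bucket X.K2 z).length) (Δ + 1)
    fun z hz => (mem_heavy.1 (List.mem_toFinset.1 hz)).2).trans ?_
  refine Finset.sum_le_sum_of_subset fun z hz => ?_
  simpa using (mem_heavy.1 (List.mem_toFinset.1 hz)).1

theorem heavy_length_eq_zero {Δ : ℕ} (h : X.K2 ≤ Δ) : (X.heavy Δ X.n).length = 0 := by
  rw [List.length_eq_zero_iff, List.eq_nil_iff_forall_not_mem]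
  intro z hz
  have := (mem_heavy.1 hz).2
  have := bucket_length_le (X := X) X.K2 z
  omega

/-- Some retained samples in the two copies have no common vertex nearby. -/
def Apart (X : Search) : Prop :=
  ∃ i < X.K2, ∃ j < X.K2, X.Ret false i ∧ X.Ret true j ∧ ¬ ∃ z < X.n, X.Hit false i z ∧ X.Hit true j z

/-- A common vertex has either a small bucket, and is found by listing pairs, or a large one, and is
found by the matrix product. Rows beyond the list carry no hits, so rounding up to full blocks is
harmless. -/
theorem direct_or {Δ i j k : ℕ} (hk : (X.heavy Δ X.n).length ≤ k) :
    (X.Direct Δ i j ∨ ∃ g < k, X.HitAt (X.heavy Δ X.n) false g i ∧ X.HitAt (X.heavy Δ X.n) true g j) ↔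
      ∃ z < X.n, X.Hit false i z ∧ X.Hit true j z := by
  constructor
  · rintro (⟨z, h1, -, h2⟩ | ⟨g, -, ⟨z, h1, h2⟩, ⟨z', h1', h2'⟩⟩)
    · exact ⟨z, h1, h2⟩
    · rw [h1] at h1'
      simp only [Option.some.injEq] at h1'
      subst h1'
      exact ⟨z, (mem_heavy.1 (List.mem_of_getElem? h1)).1, h2, h2'⟩
  · rintro ⟨z, h1, h2, h3⟩
    by_cases hz : (X.bucket X.K2 z).length ≤ Δ
    · exact .inl ⟨z, h1, hz, h2, h3⟩
    · obtain ⟨g, hg, hgz⟩ := List.getElem_of_mem (mem_heavy.2 ⟨h1, not_le.1 hz⟩)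
      have hg' : (X.heavy Δ X.n)[g]? = some z := by rw [List.getElem?_eq_getElem hg, hgz]
      exact .inr ⟨g, by omega, ⟨z, hg', h2⟩, ⟨z, hg', h3⟩⟩

/-- The arrays are zeroed with `X.K2` spare rows, so that the last block is complete. The fuel `F`
is divided evenly among the `k` blocks, so a failure of one block, with `f ≤ T`, still yields `F < k
* T` for the whole product. -/
theorem markPairs_spec {P : Prog} {s : Memory} {Δ l F T : ℕ} (h : X.Mem w s)
    (hP : Multiplies P w X.K2 T) (h45 : s.reg 45 = Δ) (hl : (X.heavy Δ X.n).length = l)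
    (h46 : s.reg 46 = l) (h84 : s.reg 84 = F) (hF : l * X.K2 ≤ F) (hFw : F + 1 < 2 ^ w)
    (h80 : s.reg 80 = 0) (h22 : s.reg 22 = 0) (hB : X.Buckets (X.bucket X.K2) s)
    (hnum : Numbered (X.heavy Δ X.n) s) (h12 : ∀ i < X.K2, Truth (s.arr 12 i) (X.Ret true i)) :
    Ter w (markPairs P) s ((700 + 3 * clkCost P) * (F + X.K2 * X.K2 + X.K2 * (X.b + 1) * (Δ + 1)))
      (fun s' => Env w X.S X.n X.L X.K X.R s' ∧ ((s'.reg 80 = 0 ∧ Truth (s'.reg 22) X.Apart) ∨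
        (s'.reg 80 = 1 ∧ F < (l + X.K2 - 1) / X.K2 * T))) := by
  have hf1 := h.env.graph.fits_one
  have hN := X.hN
  have hK2 := X.hK2
  have hln : l ≤ X.n := hl ▸ heavy_length_le (X := X) Δ X.n
  obtain ⟨k, hk⟩ : ∃ k, (l + X.K2 - 1) / X.K2 = k := ⟨_, rfl⟩
  rw [hk]
  have hk1 : k * X.K2 ≤ l + X.K2 - 1 := by rw [← hk]; exact Nat.div_mul_le_self _ _
  have hk2 : l ≤ k * X.K2 := by
    have := Nat.lt_div_mul_add hK2 (a := l + X.K2 - 1)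
    rw [hk] at this; omega
  -- The `+ 1` makes the share strictly larger than the average, which gives `F < k * f` for `k >
  -- 0`; it adds only `k` to the total.
  obtain ⟨f, hf⟩ : ∃ f, F / k + 1 = f := ⟨_, rfl⟩
  have hfk : k * f ≤ F + k := by
    rw [← hf, Nat.mul_add, Nat.mul_one]; exact Nat.add_le_add_right (Nat.mul_div_le _ _) _
  have hfF : f ≤ F + 1 := by rw [← hf]; exact Nat.add_le_add_right (Nat.div_le_self _ _) 1
  -- the running time
  have hlK : (l + X.K2) * X.K2 = l * X.K2 + X.K2 * X.K2 := by ring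
  have hKK : X.K2 ≤ X.K2 * X.K2 := Nat.le_mul_of_pos_left _ hK2
  have hll : l ≤ l * X.K2 := Nat.le_mul_of_pos_right _ hK2
  have hkk : k ≤ k * X.K2 := Nat.le_mul_of_pos_right _ hK2
  have time1 : k * (X.K2 * X.K2 * 40 + (f + 1) * clkCost P + 30) ≤
      (F + X.K2 * X.K2) * 40 + (F + 2 * (F + X.K2 * X.K2)) * clkCost P + 30 * (F + X.K2 * X.K2) := by
    have e1 : k * (X.K2 * X.K2) ≤ (l + X.K2) * X.K2 := by
      rw [← Nat.mul_assoc]; exact Nat.mul_le_mul_right _ (by omega)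
    have e2 : k * (f + 1) ≤ F + 2 * (F + X.K2 * X.K2) := by
      rw [Nat.mul_add, Nat.mul_one]; omega
    have e3 := Nat.mul_le_mul_right (clkCost P) e2
    calc k * (X.K2 * X.K2 * 40 + (f + 1) * clkCost P + 30)
        = k * (X.K2 * X.K2) * 40 + k * (f + 1) * clkCost P + 30 * k := by ring
      _ ≤ _ := by omega
  have time2 : X.K2 * ((X.b + 1) * (Δ * 12 + 225) + 40) ≤
      225 * (X.K2 * (X.b + 1) * (Δ + 1)) + 40 * X.K2 := by
    have : (X.b + 1) * (Δ * 12 + 225) ≤ (X.b + 1) * ((Δ + 1) * 225) :=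
      Nat.mul_le_mul_left _ (by omega)
    calc X.K2 * ((X.b + 1) * (Δ * 12 + 225) + 40)
        ≤ X.K2 * ((X.b + 1) * ((Δ + 1) * 225) + 40) :=
          Nat.mul_le_mul_left _ (Nat.add_le_add_right this 40)
      _ = _ := by ring
  have time3 : l * (X.K2 * 12 + 25) = 12 * (l * X.K2) + 25 * l := by ring
  have time4 : X.K2 * (X.K2 * 20 + 20) = 20 * (X.K2 * X.K2) + 20 * X.K2 := by ring
  obtain ⟨t1, ht1⟩ : ∃ t, k * (X.K2 * X.K2 * 40 + (f + 1) * clkCost P + 30) = t := ⟨_, rfl⟩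
  obtain ⟨t2, ht2⟩ : ∃ t, X.K2 * ((X.b + 1) * (Δ * 12 + 225) + 40) = t := ⟨_, rfl⟩
  have htotal : 13 + (2 * ((l + X.K2) * X.K2 * 8 + 5) + (X.K2 * X.K2 * 8 + 5)
      + (l * (X.K2 * 12 + 25) + 5) + (t2 + 5) + (t1 + 5) + (X.K2 * (X.K2 * 20 + 20) + 5) + 20) ≤
      (700 + 3 * clkCost P) * (F + X.K2 * X.K2 + X.K2 * (X.b + 1) * (Δ + 1)) := by
    have e : (F + 2 * (F + X.K2 * X.K2)) * clkCost P ≤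
        3 * clkCost P * (F + X.K2 * X.K2 + X.K2 * (X.b + 1) * (Δ + 1)) := by
      calc (F + 2 * (F + X.K2 * X.K2)) * clkCost P
          ≤ (3 * (F + X.K2 * X.K2 + X.K2 * (X.b + 1) * (Δ + 1))) * clkCost P :=
            Nat.mul_le_mul_right _ (by omega)
        _ = _ := by ring
    rw [Nat.add_mul 700]
    omega
  refine Ter.conseq (t := 13 + (2 * ((l + X.K2) * X.K2 * 8 + 5) + (X.K2 * X.K2 * 8 + 5)
      + (l * (X.K2 * 12 + 25) + 5) + (t2 + 5) + (t1 + 5) + (X.K2 * (X.K2 * 20 + 20) + 5) + 20))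
    ?_ htotal fun _ _ _ h => h
  clear htotal time1 time2 time3 time4
  obtain ⟨t3, ht3⟩ : ∃ t, X.K2 * (X.K2 * 20 + 20) = t := ⟨_, rfl⟩
  obtain ⟨t4, ht4⟩ : ∃ t, l * (X.K2 * 12 + 25) = t := ⟨_, rfl⟩
  rw [ht3, ht4]
  refine Ter.seq' (t1 := 13) (t2 := 2 * ((l + X.K2) * X.K2 * 8 + 5) + (X.K2 * X.K2 * 8 + 5)
      + (t4 + 5) + (t2 + 5) + (t1 + 5) + (t3 + 5) + 19)
    (R := fun s1 => s1.reg 81 = k ∧ s1.reg 85 = (l + X.K2) * X.K2 ∧ s1.reg 82 = X.K2 * X.K2 ∧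
      s1.reg 47 = f) (Ter.of_wp ?_ (by simp [Prog.size])) ?_ (by omega)
  · simp [h46, h.r33, h.env.graph.one, h84, hk, hf]
    refine ⟨h.fits_le (by omega), h.fits (k := 0) (by omega) (by omega) (by omega),
      h.fits (k := 0) (by omega) (by omega) (by omega), h.fits_le (by omega),
      h.fits_le (by omega), ?_, ?_⟩
    · show F / k < 2 ^ w
      omega
    · show f < 2 ^ w
      omega
  rintro s1 - hf1' ⟨e81, e85, e82, e47⟩
  have h1 := h.frame hf1' (by decide) (by decide)
  refine Ter.seq' (t2 := ((l + X.K2) * X.K2 * 8 + 5) + (X.K2 * X.K2 * 8 + 5)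
      + (t4 + 5) + (t2 + 5) + (t1 + 5) + (t3 + 5) + 18)
    (zeroFill_spec h1.env.graph.one e85 (by norm_num)) ?_ (by omega)
  rintro s2 - hf2 z18
  have h2 := h1.frame hf2 (by decide) (by decide)
  refine Ter.seq' (t2 := (X.K2 * X.K2 * 8 + 5)
      + (t4 + 5) + (t2 + 5) + (t1 + 5) + (t3 + 5) + 17)
    (zeroFill_spec h2.env.graph.one (by rw [hf2.reg _ (by decide), e85]) (by norm_num)) ?_ (by omega)
  rintro s3 - hf3 z19
  have h3 := h2.frame hf3 (by decide) (by decide)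
  refine Ter.seq' (t2 := (t4 + 5) + (t2 + 5) + (t1 + 5) + (t3 + 5) + 16)
    (zeroFill_spec h3.env.graph.one (by rw [hf3.reg _ (by decide), hf2.reg _ (by decide), e82])
      (by norm_num)) ?_ (by omega)
  rintro s4 - hf4 z15
  have h4 := h3.frame hf4 (by decide) (by decide)
  have a4 : ∀ a, a ≠ 18 → a ≠ 19 → a ≠ 15 → s4.arr a = s.arr a := fun a b1 b2 b3 => by
    rw [hf4.arr a (by simpa [zeroFill, forLoop, Prog.arrs] using b3),
      hf3.arr a (by simpa [zeroFill, forLoop, Prog.arrs] using b2),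
      hf2.arr a (by simpa [zeroFill, forLoop, Prog.arrs] using b1),
      hf1'.arr a (by simp [Prog.arrs])]
  have r4 : ∀ r, r ≠ 36 → r ≠ 37 → r ≠ 38 → s4.reg r = s1.reg r := fun r b1 b2 b3 => by
    rw [hf4.reg r (by simp [zeroFill, forLoop, Prog.regs, b1, b2, b3]),
      hf3.reg r (by simp [zeroFill, forLoop, Prog.regs, b1, b2, b3]),
      hf2.reg r (by simp [zeroFill, forLoop, Prog.regs, b1, b2, b3])]
  have hB4 : X.Buckets (X.bucket X.K2) s4 := hB.congr
    (a4 _ (by norm_num) (by norm_num) (by norm_num)) (a4 _ (by norm_num) (by norm_num) (by norm_num))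
    fun _ _ => rfl
  have hnum4 : Numbered (X.heavy Δ X.n) s4 := hnum.congr
    (a4 _ (by norm_num) (by norm_num) (by norm_num)) (a4 _ (by norm_num) (by norm_num) (by norm_num))
  refine Ter.seq' (t1 := t4 + 5) (t2 := (t2 + 5) + (t1 + 5) + (t3 + 5) + 15)
    ((fillRight_spec h4 (l := X.heavy Δ X.n) ?_ hB4 hnum4 (fun z hz => (mem_heavy.1 hz).1)
      (heavy_length_le _ _) ?_).conseq (by rw [hl, ht4]) fun _ _ _ h => h) ?_ (by omega)
  · rw [r4 _ (by norm_num) (by norm_num) (by norm_num), hf1'.reg _ (by decide), h46, hl]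
  · rw [hl, hf4.arr _ (by decide)]; exact z19
  rintro s5 - hf5 b19
  rw [hl] at b19
  have h5 := h4.frame hf5 (by decide) (by decide)
  refine Ter.seq' (t1 := t2 + 5) (t2 := (t1 + 5) + (t3 + 5) + 14)
    ((fillLeft_spec (Δ := Δ) (r := l + X.K2) h5 ?_ ?_ ?_ ?_ ?_).conseq (by rw [ht2])
      fun _ _ _ h => h) ?_ (by omega)
  · rw [hf5.reg _ (by decide), r4 _ (by norm_num) (by norm_num) (by norm_num),
      hf1'.reg _ (by decide), h45]
  · exact hB4.congr (hf5.arr _ (by decide)) (hf5.arr _ (by decide)) fun _ _ => rfl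
  · exact hnum4.congr (hf5.arr _ (by decide)) (hf5.arr _ (by decide))
  · rw [hf5.arr _ (by decide)]; exact z15
  · rw [hf5.arr _ (by decide), hf4.arr _ (by decide), hf3.arr _ (by decide)]; exact z18
  rintro s6 - hf6 ⟨h6, c11, b15, b18⟩
  refine Ter.seq' (t1 := t1 + 5) (t2 := (t3 + 5) + 12)
    ((mulBlocks_spec (k := k) (F := f) (r := l + X.K2) h6 hP ?_ (by omega) (by omega) ?_ ?_ ?_ b18
      (b19.congr (hf6.arr _ (by decide)) fun _ _ _ _ => Iff.rfl) b15).conseq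
      (by rw [ht1]) fun _ _ _ h => h) ?_ (by omega)
  · rw [hf6.reg _ (by decide), hf5.reg _ (by decide), r4 _ (by norm_num) (by norm_num) (by norm_num), e81]
  · rw [hf6.reg _ (by decide), hf5.reg _ (by decide), r4 _ (by norm_num) (by norm_num) (by norm_num), e82]
  · rw [hf6.reg _ (by decide), hf5.reg _ (by decide), r4 _ (by norm_num) (by norm_num) (by norm_num), e47]
  · rw [hf6.reg _ (by decide), hf5.reg _ (by decide), r4 _ (by norm_num) (by norm_num) (by norm_num),
      hf1'.reg _ (by decide), h80]
  rintro s7 - hf7 ⟨h7, hcase⟩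
  refine Ter.ite (t := t3 + 16) (fun hx => ?_) fun hx => ?_
  · rcases hcase with ⟨h0, -⟩ | ⟨h1, hk0, hfT⟩
    · exact absurd h0 hx
    · refine (Ter.skip (Q := fun s8 => s8 = s7) rfl).conseq (by omega) ?_
      rintro s8 - - rfl
      refine ⟨h7.env, .inr ⟨h1, ?_⟩⟩
      have e1 := Nat.mul_le_mul_left k hfT
      have e2 := Nat.lt_mul_div_succ F hk0
      rw [hf] at e2
      omega
  · rcases hcase with ⟨-, hbits⟩ | ⟨h1, -⟩
    swap
    · omega
    have r7 : ∀ a, a = 11 ∨ a = 12 → s7.arr a = s6.arr a := fun a ha => hf7.arr a fun hm => by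
      have := mulBlocks_arrs (P := P) a hm; omega
    refine (findPair_spec (p := X.Ret false) (q := X.Ret true) h7 ?_ ?_ ?_ hbits).conseq
      (by rw [ht3]; omega) ?_
    · rw [hf7.reg _ fun hm => by have := mulBlocks_regs (P := P) _ hm; omega,
        hf6.reg _ (by decide), hf5.reg _ (by decide), r4 _ (by norm_num) (by norm_num) (by norm_num),
        hf1'.reg _ (by decide), h22]
    · rw [r7 _ (.inl rfl)]; exact c11
    · rw [r7 _ (.inr rfl), hf6.arr _ (by decide), hf5.arr _ (by decide),
        a4 _ (by norm_num) (by norm_num) (by norm_num)]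
      exact h12
    · intro s8 _ hf8 ht
      refine ⟨h7.env.frame hf8 (by decide) (by decide), .inl ⟨?_, ht.congr rfl ?_⟩⟩
      · rw [hf8.reg _ (by decide), hx]
      · unfold Apart
        simp only [direct_or (hl.symm ▸ hk2)]

/-- The reason for aborting an attempt: there are too many vertices with large buckets, or the
multiplication of matrices took too long. -/
def Aborted (X : Search) (a T : ℕ) : Prop :=
  a * a < X.S.M ∧ ∃ l, l * (a * a * a / X.S.M + 1) ≤ X.K2 * (X.b + 1) ∧
    (X.S.M * a < l * X.K2 ∨ X.S.M * a < (l + X.K2 - 1) / X.K2 * T)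

/-- The budget `M * a` is checked before memory is cleared for the matrices, so the time is under
control even if there are too many large buckets. For `a * a ≥ M` the threshold is `K2`, which no
bucket exceeds, and the matrices are not needed. -/
theorem pairSearch_spec {P : Prog} {s : Memory} {a T : ℕ} (h : X.Mem w s)
    (hP : Multiplies P w X.K2 T) (h21 : s.reg 21 = a) (ha : a ≤ X.S.M) :
    Ter w (pairSearch P) s ((1200 + 3 * clkCost P) * (X.n + X.S.M * a + X.K2 * X.K2 +
        X.K2 * (X.b + 1) * ((if a * a < X.S.M then a * a * a / X.S.M else X.K2) + 1)))
      (fun s' => Env w X.S X.n X.L X.K X.R s' ∧ ((s'.reg 80 = 0 ∧ Truth (s'.reg 22) X.Apart) ∨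
        (s'.reg 80 = 1 ∧ X.Aborted a T))) := by
  have hf1 := h.env.graph.fits_one
  have hN := X.hN
  have hK2 := X.hK2
  obtain ⟨Δ, hΔ⟩ : ∃ Δ, (if a * a < X.S.M then a * a * a / X.S.M else X.K2) = Δ := ⟨_, rfl⟩
  obtain ⟨l, hl⟩ : ∃ l, (X.heavy Δ X.n).length = l := ⟨_, rfl⟩
  have hln : l ≤ X.n := hl ▸ heavy_length_le (X := X) Δ X.n
  rw [hΔ]
  obtain ⟨W, hW⟩ : ∃ W, X.S.M * a + X.K2 * X.K2 + X.K2 * (X.b + 1) * (Δ + 1) = W := ⟨_, rfl⟩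
  have time1 : X.K2 * (220 * (X.b + 1) + 40) ≤ 260 * W := by
    have : X.K2 * (X.b + 1) * 1 ≤ X.K2 * (X.b + 1) * (Δ + 1) := Nat.mul_le_mul_left _ (by omega)
    have e : X.K2 * (220 * (X.b + 1) + 40) = 220 * (X.K2 * (X.b + 1)) + 40 * X.K2 := by ring
    have : X.K2 * 1 ≤ X.K2 * (X.b + 1) := Nat.mul_le_mul_left _ (by omega)
    omega
  have hW1 : 1 ≤ W := by
    have := Nat.mul_pos hK2 hK2
    omega
  have abort : (X.S.M * a < l * X.K2 ∨ X.S.M * a < (l + X.K2 - 1) / X.K2 * T) → X.Aborted a T := by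
    intro hor
    by_cases haM : a * a < X.S.M
    · refine ⟨haM, l, ?_, hor⟩
      rw [if_pos haM] at hΔ
      rw [hΔ, ← hl]
      exact heavy_mul_le Δ
    -- Here no bucket is large, so there are no blocks at all and neither reason for giving up can
    -- occur.
    · rw [if_neg haM] at hΔ
      have : l = 0 := hl ▸ heavy_length_eq_zero hΔ.le
      subst this
      rw [Nat.div_eq_of_lt (by omega)] at hor
      omega
  have fits : ∀ {u v : ℕ}, u ≤ X.S.N + X.S.M + X.K2 → v ≤ X.S.N + X.S.M + X.K2 → Fits w (u * v + 1) :=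
    fun hu hv => h.fits (by omega) hv (by omega)
  refine Ter.conseq (t := 3 + (X.n * 8 + 260 * W + 20) + 14 + (X.n * 20 + 10) + 5 +
    ((700 + 3 * clkCost P) * W + 1) + 6) ?_ (by
      have : (1200 + 3 * clkCost P) * (X.n + X.S.M * a + X.K2 * X.K2 + X.K2 * (X.b + 1) * (Δ + 1)) =
        500 * W + (700 + 3 * clkCost P) * W + (1200 + 3 * clkCost P) * X.n := by rw [← hW]; ring
      have : 1200 * X.n ≤ (1200 + 3 * clkCost P) * X.n := Nat.mul_le_mul_right _ (by omega)
      omega) fun _ _ _ h => h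
  refine Ter.seq' (t1 := 3) (t2 := (X.n * 8 + 260 * W + 20) + 14 + (X.n * 20 + 10) + 5 +
    ((700 + 3 * clkCost P) * W + 1) + 5) (R := fun s1 => s1 = (s.setReg 22 0).setReg 80 0)
    (Ter.of_wp (by simp) (by simp [Prog.size])) ?_ (by omega)
  rintro s1 - hf1' rfl
  have h1 : X.Mem w ((s.setReg 22 0).setReg 80 0) := by
    refine ⟨(h.env.setReg (by norm_num) _).setReg (by norm_num) _, ?_, ?_, ?_, ?_, h.word⟩
    · simp [h.r28]
    · simp [h.r29]
    · simp [h.r33]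
    · simp [h.r34]
  have h22 : ((s.setReg 22 0).setReg 80 0).reg 22 = 0 := by simp
  have h80 : ((s.setReg 22 0).setReg 80 0).reg 80 = 0 := by simp
  have g21 : ((s.setReg 22 0).setReg 80 0).reg 21 = a := by simp [h21]
  generalize (s.setReg 22 0).setReg 80 0 = s1 at h1 h22 h80 g21
  refine Ter.seq' (t1 := X.n * 8 + 260 * W + 20) (t2 := 14 + (X.n * 20 + 10) + 5 +
    ((700 + 3 * clkCost P) * W + 1) + 4) ((fillBuckets_spec h1).conseq (by omega) fun _ _ _ h => h) ?_
    (by omega)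
  rintro s2 hv2 hf2 ⟨h2, hB2, h12⟩
  refine Ter.seq' (t1 := 14) (t2 := (X.n * 20 + 10) + 5 +
    ((700 + 3 * clkCost P) * W + 1) + 3) (R := fun s3 => s3.reg 45 = Δ)
    (Ter.of_wp ?_ (by simp [Prog.size, heavyBound])) ?_ (by omega)
  · have e21 : s2.reg 21 = a := by rw [hf2.reg _ (by decide), g21]
    simp [heavyBound, e21, h2.env.graph.M, hf1, h2.r33]
    have haa : Fits w (a * a + 1) := fits (by omega) (by omega)
    have haaa : Fits w (a * a * a) := by
      refine lt_of_lt_of_le ?_ h.word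
      calc a * a * a ≤ X.S.M * X.S.M * X.S.M := by gcongr
        _ < (X.S.N + X.S.M + X.K2 + 2) ^ 3 := by
          rw [show X.S.M * X.S.M * X.S.M = X.S.M ^ 3 by ring]
          exact Nat.pow_lt_pow_left (by omega) (by norm_num)
    refine ⟨lt_trans (Nat.lt_succ_self _) haa, fun hlt => ⟨haaa, ?_, ?_⟩, fun hlt => ⟨?_, ?_⟩⟩
    · exact lt_of_le_of_lt (Nat.div_le_self _ _) haaa
    · rw [← hΔ, if_pos hlt]
    · exact h.fits_le (by omega)
    · rw [← hΔ, if_neg (by omega)]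
  rintro s3 - hf3 e45
  have h3 := h2.frame hf3 (by decide) (by decide)
  refine Ter.seq' (t1 := X.n * 20 + 10) (t2 := 5 + ((700 + 3 * clkCost P) * W + 1) + 2)
    (countHeavy_spec h3 e45 (hB2.congr (hf3.arr _ (by decide)) (hf3.arr _ (by decide))
      fun _ _ => rfl)) ?_ (by omega)
  rintro s4 - hf4 ⟨e46, hnum⟩
  rw [hl] at e46
  have h4 := h3.frame hf4 (by decide) (by decide)
  refine Ter.seq' (t1 := 5) (t2 := (700 + 3 * clkCost P) * W + 1 + 1)
    (R := fun s5 => s5.reg 84 = X.S.M * a ∧ s5.reg 52 = if X.S.M * a < l * X.K2 then 1 else 0)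
    (Ter.of_wp ?_ (by simp [Prog.size])) ?_ (by omega)
  · have e21 : s4.reg 21 = a := by
      rw [hf4.reg _ (by decide), hf3.reg _ (by decide), hf2.reg _ (by decide), g21]
    simp [e46, h4.r33, h4.env.graph.M, e21, hf1]
    exact ⟨lt_trans (Nat.lt_succ_self _) (fits (by omega) (by omega)),
      lt_trans (Nat.lt_succ_self _) (fits (by omega) (by omega))⟩
  rintro s5 - hf5 ⟨e84, e52⟩
  have h5 := h4.frame hf5 (by decide) (by decide)
  have r5 : ∀ r, r = 22 ∨ r = 80 → s5.reg r = s1.reg r := by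
    rintro r (rfl | rfl)
    · rw [hf5.reg _ (by decide), hf4.reg _ (by decide), hf3.reg _ (by decide), hf2.reg _ (by decide)]
    · rw [hf5.reg _ (by decide), hf4.reg _ (by decide), hf3.reg _ (by decide), hf2.reg _ (by decide)]
  refine (Ter.ite (t := (700 + 3 * clkCost P) * W + 1) (fun hx => ?_) fun hx => ?_).conseq le_rfl
    fun _ _ _ h => h
  · have hlt : X.S.M * a < l * X.K2 := by by_contra hh; simp [e52, hh] at hx
    refine (Ter.const (r := 80) (Q := fun s6 => s6 = s5.setReg 80 1) hf1 rfl).conseq (by omega) ?_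
    rintro s6 - - rfl
    exact ⟨(h5.setReg (by norm_num) _).env, .inr ⟨by simp, abort (.inl hlt)⟩⟩
  · have hle : l * X.K2 ≤ X.S.M * a := by by_contra hh; simp [e52, not_le.1 hh] at hx
    refine (markPairs_spec (Δ := Δ) (l := l) (F := X.S.M * a) (T := T) h5 hP ?_ hl ?_ e84 hle
      (fits (by omega) (by omega)) (by rw [r5 _ (.inr rfl), h80]) (by rw [r5 _ (.inl rfl), h22])
      ?_ ?_ ?_).conseq (by rw [hW]; omega) ?_
    · rw [hf5.reg _ (by decide), hf4.reg _ (by decide), e45]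
    · rw [hf5.reg _ (by decide), e46]
    · exact hB2.congr (by rw [hf5.arr _ (by decide), hf4.arr _ (by decide), hf3.arr _ (by decide)])
        (by rw [hf5.arr _ (by decide), hf4.arr _ (by decide), hf3.arr _ (by decide)]) fun _ _ => rfl
    · exact hnum.congr (hf5.arr _ (by decide)) (hf5.arr _ (by decide))
    · rw [hf5.arr _ (by decide), hf4.arr _ (by decide), hf3.arr _ (by decide)]
      exact h12
    · rintro s6 - - ⟨h6, hc⟩
      exact ⟨h6, hc.imp id fun h => ⟨h.1, abort (.inr h.2)⟩⟩

end Search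

/-! ### One attempt to decide whether there is a far pair of vertices -/

/-- Compute the parameters of an attempt from the distance `D` in register `20` and the number `a`
in register `21`. -/
def attemptParams : Prog :=
  .const 38 4 ;; .op .mul 35 20 38 ;; .const 38 6 ;; .op .add 35 35 38 ;; .const 38 7 ;;
  .op .div 35 35 38 ;; .op .sub 30 35 2 ;; .op .add 31 35 35 ;; .op .sub 31 31 2 ;;
  .op .sub 31 31 20 ;; .op .mul 32 21 5 ;; .op .mul 33 4 5 ;; .op .div 33 33 21 ;;
  .op .add 33 33 2 ;; .op .div 34 4 21 ;; .op .shr 28 35 2 ;; .op .shr 29 30 2 ;; .const 80 0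

/-- Decide whether there are far vertices. -/
def attempt (P : Prog) : Prog :=
  attemptParams ;; probeSamples ;;
    .ite 22 .skip (findSmall ;; .ite 39 probeSmall (pairSearch P))

set_option maxRecDepth 8000 in
theorem attempt_regs {P : Prog} : ∀ r ∈ (attempt P).regs, r = 22 ∨ 28 ≤ r := by
  intro r hr
  simp only [attempt, Prog.regs, List.mem_append, List.not_mem_nil, false_or] at hr
  have h1 : ∀ r, r ∈ attemptParams.regs ∨ r ∈ probeSamples.regs ∨ r ∈ findSmall.regs ∨
      r ∈ probeSmall.regs → r = 22 ∨ 28 ≤ r := by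
    intro r h
    rcases h with h | h | h | h <;> revert r <;> decide
  have h2 := pairSearch_regs (P := P) r
  rcases hr with h | h | h | h | h
  · exact h1 r (.inl h)
  · exact h1 r (.inr (.inl h))
  · exact h1 r (.inr (.inr (.inl h)))
  · exact h1 r (.inr (.inr (.inr h)))
  · have := h2 h; omega

/-! ### Cost estimates and correctness of a single test -/

/-- The condition under which an attempt may be aborted. -/
def MayAbort (M L a T : ℕ) : Prop :=
  a * a < M ∧ ∃ l, l * (a * a * a / M + 1) ≤ (M * L / a + 1) * (M / a + 1) ∧
    (M * a < l * (M * L / a + 1) ∨ M * a < (l + (M * L / a + 1) - 1) / (M * L / a + 1) * T)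

theorem samples_mul_le {M L a : ℕ} (haM : a ≤ M) (hL : 1 ≤ L) :
    (M * L / a + 1) * a ≤ 2 * (M * L) := by
  have h1 : M * L / a * a ≤ M * L := Nat.div_mul_le_self _ _
  have h2 : M * 1 ≤ M * L := Nat.mul_le_mul_left _ hL
  rw [Nat.add_mul]; omega

theorem radius_mul_le {M a : ℕ} (haM : a ≤ M) : (M / a + 1) * a ≤ 2 * M := by
  have h1 : M / a * a ≤ M := Nat.div_mul_le_self _ _
  rw [Nat.add_mul]; omega

/-- The number of samples is about ML/a, and its square is of order M a L² as soon as a³ ≥ M. This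
is why the parameter starts near the cube root. -/
theorem samples_sq_le {M L a : ℕ} (ha : 1 ≤ a) (haM : a ≤ M) (hL : 1 ≤ L) (ha3 : M ≤ a * a * a) :
    (M * L / a + 1) * (M * L / a + 1) ≤ 4 * (M * a * L ^ 2) := by
  have h1 := samples_mul_le haM hL
  generalize M * L / a + 1 = k at *
  refine Nat.le_of_mul_le_mul_right (c := a * a) ?_ (by positivity)
  calc k * k * (a * a) = (k * a) * (k * a) := by ring
    _ ≤ (2 * (M * L)) * (2 * (M * L)) := Nat.mul_le_mul h1 h1
    _ = 4 * M * L ^ 2 * M := by ring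
    _ ≤ 4 * M * L ^ 2 * (a * a * a) := Nat.mul_le_mul_left _ ha3
    _ = _ := by ring

/-- Listing the pairs costs (samples) × (ball size) × (bucket bound). With the bound a³/M this is
(ML/a)(M/a)(a³/M) = M a L. If a² ≥ M, the bound is the number of samples, and M³L²/a³ ≤ M a L². -/
theorem collisions_le {M L a : ℕ} (ha : 1 ≤ a) (haM : a ≤ M) (hL : 1 ≤ L) (ha3 : M ≤ a * a * a) :
    (M * L / a + 1) * (M / a + 1) *
      ((if a * a < M then a * a * a / M else M * L / a + 1) + 1) ≤ 16 * (M * a * L ^ 2) := by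
  have h1 := samples_mul_le haM hL
  have h2 := radius_mul_le haM
  have hk : 1 ≤ M * L / a + 1 := Nat.le_add_left 1 _
  have hM : 1 ≤ M := by omega
  generalize M * L / a + 1 = k at *
  generalize M / a + 1 = b at *
  split
  · have h3 : (a * a * a / M + 1) * M ≤ 2 * (a * a * a) := by
      have := Nat.div_mul_le_self (a * a * a) M
      rw [Nat.add_mul]; omega
    generalize a * a * a / M + 1 = e at *
    refine Nat.le_of_mul_le_mul_right (c := a * a * M) ?_ (by positivity)
    calc k * b * e * (a * a * M) = (k * a) * (b * a) * (e * M) := by ring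
      _ ≤ (2 * (M * L)) * (2 * M) * (2 * (a * a * a)) := by gcongr
      _ = 8 * (M * a * L) * (a * a * M) := by ring
      _ ≤ 16 * (M * a * L ^ 2) * (a * a * M) := by
        gcongr
        · omega
        · nlinarith
  · rename_i hlt
    push Not at hlt
    refine Nat.le_of_mul_le_mul_right (c := a * a * a) ?_ (by positivity)
    calc k * b * (k + 1) * (a * a * a) ≤ k * b * (2 * k) * (a * a * a) := by gcongr; omega
      _ = 2 * ((k * a) * (k * a) * (b * a)) := by ring
      _ ≤ 2 * ((2 * (M * L)) * (2 * (M * L)) * (2 * M)) := by gcongr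
      _ = 16 * M * L ^ 2 * (M * M) := by ring
      _ ≤ 16 * M * L ^ 2 * ((a * a) * (a * a)) := by gcongr
      _ = _ := by ring

/-- The parameters of the last stage of an attempt. -/
def attemptSearch (n m : ℕ) (t h : ℕ → ℕ) (ht : ∀ j < m, t j < n) (hh : ∀ j < m, h j < n)
    (L : ℕ) (R : ℕ → ℕ) (hR : ∀ i < (doubled n m t h ht hh).M * L + 1, R i < (doubled n m t h ht hh).M) (a d : ℕ) : Search where
  S := doubled n m t h ht hh
  n := n
  L := L
  K := (doubled n m t h ht hh).M * L + 1
  R := R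
  b := (doubled n m t h ht hh).M / a
  K2 := (doubled n m t h ht hh).M * L / a + 1
  ρ := fun c => bif c then (d - 1) / 2 else d / 2
  hN := rfl
  copy := fun _ _ _ hy => doubled_copy hy
  hR := hR
  hK := Nat.add_le_add_right (Nat.div_le_self _ _) 1
  hb := Nat.div_le_self _ _
  hK2 := Nat.succ_pos _

section

variable {n m : ℕ} {t h : ℕ → ℕ} {ht : ∀ j < m, t j < n} {hh : ∀ j < m, h j < n}

local notation "𝓢" => doubled n m t h ht hh

/-- Both samples are retained, so in the absence of a common hit it is the balls themselves that are
disjoint. -/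
theorem far_of_apart {L a d : ℕ} {R : ℕ → ℕ} {hR : ∀ i < (𝓢).M * L + 1, R i < (𝓢).M} (hd : 1 ≤ d)
    (H : (attemptSearch n m t h ht hh L R hR a d).Apart) : Far 𝓢 n d := by
  obtain ⟨i, hi, j, hj, hri, hrj, hne⟩ := H
  have h1 : (𝓢).tl (R i) < n := hri.1.2 rfl
  have h2 : ¬ (𝓢).tl (R j) < n := fun hlt => by simpa using hrj.1.1 hlt
  have hjK : R j < (𝓢).M := hR j (lt_of_lt_of_le hj (attemptSearch n m t h ht hh L R hR a d).hK)
  refine far_of_disjoint h1 ((𝓢).tl_lt _ hjK) h2 hd fun z hz hz1 hz2 => hne ⟨z, hz, ⟨hri, ?_⟩, hrj, ?_⟩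
  · simp only [rad, h1, if_true] at hz1
    exact hz1
  · simp only [rad, h2, if_false] at hz2
    exact hz2

theorem not_far_of_not_apart {L a d D : ℕ} {R : ℕ → ℕ}
    {hR : ∀ i < (𝓢).M * L + 1, R i < (𝓢).M} (hG : (𝓢).Good n L R) (hL : 0 < L)
    (ha : 0 < a) (hd : 1 ≤ d) (hD : 2 ≤ D) (h7 : 7 * d ≤ 4 * D + 6) (hDn : D ≤ n)
    (hball : ∀ i < a * L, n ≤ ((𝓢).ball ((𝓢).tl (R i)) (d - 1)).card)
    (hbig : ∀ w < n + n, a < ((𝓢).arcsLt w (2 * d - 1 - D)).card)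
    (H : ¬ (attemptSearch n m t h ht hh L R hR a d).Apart) : ¬ Far 𝓢 n D := by
  refine not_far_of_intersect hG hL ha hd hD h7 hDn hball hbig ?_
  intro i i' hi hi' hRi hRi' hx hx' hc hc'
  by_contra hne
  refine H ⟨i, hi, i', hi', ⟨iff_of_true hx rfl, ?_⟩, ⟨iff_of_false hx' (by simp), ?_⟩, ?_⟩
  · simp only [rad, hx, if_true] at hc
    exact hc
  · simp only [rad, hx', if_false] at hc'
    exact hc'
  · rintro ⟨z, hz, hz1, hz2⟩
    refine hne ⟨z, hz, ?_, ?_⟩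
    · simp only [rad, hx, if_true]
      exact hz1.2
    · simp only [rad, hx', if_false]
      exact hz2.2

/-- A positive answer is always correct; only a negative one depends on the samples being good. So
the running time and the approximation from below hold for every outcome of the random choices. -/
theorem attempt_spec {w L a D T : ℕ} {R : ℕ → ℕ} {P : Prog} {s : Memory}
    (hE : Env w 𝓢 n L ((𝓢).M * L + 1) R s) (hR : ∀ i < (𝓢).M * L + 1, R i < (𝓢).M)
    (hw : ((𝓢).N + (𝓢).M + (𝓢).M * L + 3) ^ 3 ≤ 2 ^ w)
    (hP : Multiplies P w ((𝓢).M * L / a + 1) T) (hL : 1 ≤ L) (ha : 1 ≤ a) (haM : a ≤ (𝓢).M)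
    (ha3 : (𝓢).M ≤ a * a * a) (hNM : (𝓢).N ≤ (𝓢).M)
    (hD : 2 ≤ D) (hDn : D ≤ n) (h20 : s.reg 20 = D) (h21 : s.reg 21 = a) :
    Ter w (attempt P) s ((40000 + 66 * clkCost P) * ((𝓢).M * a * L ^ 2)) (fun s' =>
      Env w 𝓢 n L ((𝓢).M * L + 1) R s' ∧
      ((s'.reg 80 = 0 ∧ ((s'.reg 22 = 1 ∧ Far 𝓢 n ((4 * D + 6) / 7)) ∨
        (s'.reg 22 = 0 ∧ ((𝓢).Good n L R → ¬ Far 𝓢 n D)))) ∨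
      (s'.reg 80 = 1 ∧ MayAbort (𝓢).M L a T))) := by
  have hf1 := hE.graph.fits_one
  have hN : (𝓢).N = n + n := rfl
  obtain ⟨d, hd⟩ : ∃ d, (4 * D + 6) / 7 = d := ⟨_, rfl⟩
  have hd1 : 1 ≤ d := by omega
  have hdD : d ≤ D := by omega
  have h7 : 7 * d ≤ 4 * D + 6 := by omega
  rw [hd]
  obtain ⟨X, hX⟩ : ∃ X, attemptSearch n m t h ht hh L R hR a d = X := ⟨_, rfl⟩
  have hXS : X.S = 𝓢 := by rw [← hX]; rfl
  have hXn : X.n = n := by rw [← hX]; rfl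
  have hXL : X.L = L := by rw [← hX]; rfl
  have hXK : X.K = (𝓢).M * L + 1 := by rw [← hX]; rfl
  have hXR : X.R = R := by rw [← hX]; rfl
  have hXb : X.b = (𝓢).M / a := by rw [← hX]; rfl
  have hXK2 : X.K2 = (𝓢).M * L / a + 1 := by rw [← hX]; rfl
  have hXρ0 : X.ρ false = d / 2 := by rw [← hX]; rfl
  have hXρ1 : X.ρ true = (d - 1) / 2 := by rw [← hX]; rfl
  have far : X.Apart → Far 𝓢 n d := by rw [← hX]; exact far_of_apart hd1
  have notFar : (𝓢).Good n L R →
      (∀ i < a * L, n ≤ ((𝓢).ball ((𝓢).tl (R i)) (d - 1)).card) →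
      (∀ w < n + n, a < ((𝓢).arcsLt w (2 * d - 1 - D)).card) → ¬ X.Apart → ¬ Far 𝓢 n D := by
    intro hG hb1 hb2
    rw [← hX]
    exact not_far_of_not_apart hG hL ha hd1 hD h7 hDn hb1 hb2
  have hab : X.Aborted a T → MayAbort (𝓢).M L a T := by
    rw [← hX]; exact id
  clear hX
  generalize hS : (𝓢) = S at *
  -- the running time
  have b1 := samples_sq_le ha haM hL ha3
  have b2 := collisions_le ha haM hL ha3
  obtain ⟨Y, hY⟩ : ∃ Y, S.M * a * L ^ 2 = Y := ⟨_, rfl⟩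
  rw [hY] at b1 b2 ⊢
  have hM1 : 1 ≤ S.M := by omega
  have y1 : S.M * a ≤ Y := by rw [← hY]; exact Nat.le_mul_of_pos_right _ (by positivity)
  have y2 : S.M ≤ S.M * a := Nat.le_mul_of_pos_right _ ha
  have y3 : a ≤ S.M * a := Nat.le_mul_of_pos_left _ hM1
  have y4 : S.M * a * L ≤ Y := by
    rw [← hY]; exact Nat.mul_le_mul_left _ (Nat.le_self_pow (by norm_num) L)
  have time1 : a * L * (200 * (S.M + 1) + 20) ≤ 420 * Y := by
    calc a * L * (200 * (S.M + 1) + 20) ≤ a * L * (420 * S.M) := Nat.mul_le_mul_left _ (by omega)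
      _ = 420 * (S.M * a * L) := by ring
      _ ≤ _ := by omega
  have time2 : S.N * (200 * (a + 1) + 25) ≤ 425 * Y := by
    calc S.N * (200 * (a + 1) + 25) ≤ S.M * (425 * a) := Nat.mul_le_mul hNM (by omega)
      _ = 425 * (S.M * a) := by ring
      _ ≤ _ := by omega
  have time3 : (a + 3) * (200 * (S.M + 1) + 60) ≤ 1840 * Y := by
    calc (a + 3) * (200 * (S.M + 1) + 60) ≤ (4 * a) * (460 * S.M) :=
          Nat.mul_le_mul (by omega) (by omega)
      _ = 1840 * (S.M * a) := by ring
      _ ≤ _ := by omega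
  -- The factor 22 = 1 + 1 + 4 + 16 collects the vertices, the budget `M * a`, `samples_sq_le` and
  -- `collisions_le`.
  have time4 : (1200 + 3 * clkCost P) * (X.n + X.S.M * a + X.K2 * X.K2 +
        X.K2 * (X.b + 1) * ((if a * a < X.S.M then a * a * a / X.S.M else X.K2) + 1)) ≤
      (1200 + 3 * clkCost P) * (22 * Y) := by
    refine Nat.mul_le_mul_left _ ?_
    rw [hXS, hXn, hXK2, hXb]
    have : n ≤ S.M := by omega
    omega
  have time5 : (40000 + 66 * clkCost P) * Y = (1200 + 3 * clkCost P) * (22 * Y) + 13600 * Y := by ring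
  have hw1 : S.N + S.M + S.M * L + 3 < 2 ^ w := by
    refine lt_of_lt_of_le ?_ hw
    exact lt_self_pow₀ (by omega) (by norm_num)
  have hLM : L ≤ S.M * L := Nat.le_mul_of_pos_left _ hM1
  have haL : a * L ≤ S.M * L := Nat.mul_le_mul_right _ haM
  have hw7 : 7 * (S.N + S.M + S.M * L + 3) < 2 ^ w := by
    refine lt_of_lt_of_le ?_ hw
    have h9 : 3 * 3 ≤ (S.N + S.M + S.M * L + 3) * (S.N + S.M + S.M * L + 3) :=
      Nat.mul_le_mul (by omega) (by omega)
    calc 7 * (S.N + S.M + S.M * L + 3) < (3 * 3) * (S.N + S.M + S.M * L + 3) := by omega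
      _ ≤ (S.N + S.M + S.M * L + 3) * (S.N + S.M + S.M * L + 3) * (S.N + S.M + S.M * L + 3) :=
        Nat.mul_le_mul_right _ h9
      _ = _ := by ring
  have hdiv1 : S.M * L / a ≤ S.M * L := Nat.div_le_self _ _
  have hdiv2 : S.M / a ≤ S.M := Nat.div_le_self _ _
  have hw2 : (X.S.N + X.S.M + X.K2 + 2) ^ 3 ≤ 2 ^ w := by
    refine le_trans (Nat.pow_le_pow_left ?_ 3) hw
    rw [hXS, hXK2]; omega
  rw [time5]
  refine Ter.seq' (t1 := 60) (t2 := (1200 + 3 * clkCost P) * (22 * Y) + 13600 * Y - 61)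
    (R := fun s1 => s1.reg 30 = d - 1 ∧ s1.reg 31 = 2 * d - 1 - D ∧ s1.reg 32 = a * L ∧
      s1.reg 33 = S.M * L / a + 1 ∧ s1.reg 34 = S.M / a ∧ s1.reg 28 = d / 2 ∧
      s1.reg 29 = (d - 1) / 2 ∧ s1.reg 80 = 0) (Ter.of_wp ?_ (by simp [Prog.size, attemptParams])) ?_
      (by omega)
  · have F : ∀ x, x ≤ 7 * (S.N + S.M + S.M * L + 3) → Fits w x := fun x hx => lt_of_le_of_lt hx hw7
    simp [attemptParams, WordOp.eval, h20, h21, hE.L, hE.graph.M, hE.graph.one,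
      Nat.mul_comm D 4, hd, Nat.shiftRight_one, ← Nat.two_mul]
    refine ⟨F _ (by omega), F _ (by omega), F _ (by omega), F _ (by omega), F _ (by omega),
      F _ (by omega), F _ (by omega), F _ (by omega), F _ (by omega), F _ (by omega), F _ (by omega),
      F _ (by omega), F _ (by omega), F _ (by omega), F _ (by omega), F _ (by omega), ?_⟩
    exact F _ (by omega)
  rintro s1 - hfr1 ⟨e30, e31, e32, e33, e34, e28, e29, e80⟩
  have hE1 : Env w S n L (S.M * L + 1) R s1 := hE.frame hfr1 (by decide) (by decide)
  refine Ter.seq' (t2 := (1200 + 3 * clkCost P) * (22 * Y) + 2300 * Y)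
    (probeSamples_spec hE1 e30 e32 (by omega) hR) ?_ (by omega)
  rintro s2 - hfr2 ⟨hE2, hT2⟩
  have e80' : s2.reg 80 = 0 := by rw [hfr2.reg _ (by decide), e80]
  refine (Ter.ite (t := (1200 + 3 * clkCost P) * (22 * Y) + 2300 * Y - 1) (fun hx => ?_)
    fun hx => ?_).conseq (by omega) fun _ _ _ h => h
  · refine (Ter.skip (Q := fun s3 => s3 = s2) rfl).conseq (by omega) ?_
    rintro s3 - - rfl
    obtain ⟨i, hi, hc⟩ := hT2.ne_zero.1 hx
    refine ⟨hE2, .inl ⟨e80', .inl ⟨?_, ?_⟩⟩⟩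
    · have := hT2.le_one; omega
    · subst hS
      exact far_of_card ((𝓢).tl_lt _ (hR i (by omega))) hc
  have hball : ∀ i < a * L, n ≤ (S.ball (S.tl (R i)) (d - 1)).card := fun i hi => by
    by_contra hlt
    exact hT2.ne_zero.2 ⟨i, hi, not_le.1 hlt⟩ hx
  have e30' : s2.reg 30 = d - 1 := by rw [hfr2.reg _ (by decide), e30]
  have e31' : s2.reg 31 = 2 * d - 1 - D := by rw [hfr2.reg _ (by decide), e31]
  have e21' : s2.reg 21 = a := by rw [hfr2.reg _ (by decide), hfr1.reg _ (by decide), h21]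
  refine Ter.seq' (t2 := (1200 + 3 * clkCost P) * (22 * Y) + 1841 * Y)
    (findSmall_spec hE2 e31' e21' haM) ?_ (by omega)
  rintro s3 - hfr3 ⟨hE3, hT3⟩
  have e80'' : s3.reg 80 = 0 := by rw [hfr3.reg _ (by decide), e80']
  have e22 : s3.reg 22 = 0 := by rw [hfr3.reg _ (by decide), hx]
  have e21'' : s3.reg 21 = a := by rw [hfr3.reg _ (by decide), e21']
  refine (Ter.ite (t := (1200 + 3 * clkCost P) * (22 * Y) + 1840 * Y) (fun h39 => ?_)
    fun h39 => ?_).conseq (by omega) fun _ _ _ h => h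
  · rcases hT3 with ⟨-, hv, hcard⟩ | ⟨h0, -⟩
    swap
    · exact absurd h0 h39
    refine (probeSmall_spec hE3 (by rw [hfr3.reg _ (by decide), e30'])
      (by rw [hfr3.reg _ (by decide), e31']) e21'' haM rfl hv hcard
      ((S.card_ball_le _ _).trans (by omega)) e22 hN).conseq (by omega) ?_
    rintro s4 - hfr4 ⟨hE4, hT4⟩
    refine ⟨hE4, .inl ⟨by rw [hfr4.reg _ (by decide), e80''], ?_⟩⟩
    rcases hT4 with ⟨h1, hT4⟩ | ⟨h0, hT4⟩
    · refine .inl ⟨h1, ?_⟩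
      subst hS
      rcases hT4 with hT4 | ⟨x, hx, hT4⟩
      · exact far_of_card hv hT4
      · exact far_of_card (mirror_lt (Arcs.ball_lt hv _ _ hx)) hT4
    · refine .inr ⟨h0, fun _ => ?_⟩
      push Not at hT4
      subst hS
      exact not_far_of_ball hv hd1 hdD (by omega) hT4.1 hT4.2
  · rcases hT3 with ⟨h1, -⟩ | ⟨-, hbig⟩
    · omega
    have hM3 : X.Mem w s3 := by
      refine ⟨?_, ?_, ?_, ?_, ?_, hw2⟩
      · rw [hXS, hXn, hXL, hXK, hXR]; exact hE3
      · rw [hXρ0, hfr3.reg _ (by decide), hfr2.reg _ (by decide), e28]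
      · rw [hXρ1, hfr3.reg _ (by decide), hfr2.reg _ (by decide), e29]
      · rw [hXK2, hfr3.reg _ (by decide), hfr2.reg _ (by decide), e33]
      · rw [hXb, hfr3.reg _ (by decide), hfr2.reg _ (by decide), e34]
    refine (Search.pairSearch_spec hM3 (hXK2 ▸ hP) e21'' (by rw [hXS]; exact haM)).conseq
      (time4.trans (by omega)) ?_
    rintro s4 - - ⟨hE4, hc⟩
    rw [hXS, hXn, hXL, hXK, hXR] at hE4
    refine ⟨hE4, ?_⟩
    rcases hc with ⟨h0, hT⟩ | ⟨h1, hA⟩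
    · refine .inl ⟨h0, ?_⟩
      rcases hT with ⟨h1, hT⟩ | ⟨h1, hT⟩
      · exact .inl ⟨h1, far hT⟩
      · exact .inr ⟨h1, fun hG => notFar hG hball (by rw [← hN]; exact hbig) hT⟩
    · exact .inr ⟨h1, hab hA⟩

end

/-! ### The binary search -/

/-- Check whether the search has to go on. -/
def searchGuard : Prog := .op .sub 25 24 23 ;; .op .lt 25 2 25

/-- One step of the binary search: the lower bound is in register `23`, the upper bound in register
`24`. -/
def searchStep (P : Prog) : Prog :=
  (.op .add 20 23 24 ;; .op .shr 20 20 2) ;; attempt P ;;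
  .ite 80 (.op .add 21 21 21) (.ite 22 (.op .lor 23 20 20) (.op .lor 24 20 20)) ;; searchGuard

/-- The binary search. -/
def searchLoop (P : Prog) : Prog := searchGuard ;; .loop 25 (searchStep P)

/-- Compute the first power of `2` whose cube is at least the number of arcs. -/
def cubeRoot : Prog :=
  (.const 21 1 ;; .op .mul 38 21 21 ;; .op .mul 38 38 21 ;; .op .lt 25 38 4) ;;
  .loop 25 (.op .add 21 21 21 ;; .op .mul 38 21 21 ;; .op .mul 38 38 21 ;; .op .lt 25 38 4)

/-- Compute an upper bound of the binary logarithm of `m + 2` in register `27`. -/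
def logTwo : Prog :=
  (.const 26 1 ;; .const 27 0 ;; .op .add 38 1 2 ;; .op .add 38 38 2 ;; .op .lt 25 26 38) ;;
  .loop 25 (.op .add 26 26 26 ;; .op .add 27 27 2 ;; .op .lt 25 26 38)

theorem logTwo_spec {w m : ℕ} {s : Memory} (h1 : s.reg 1 = m) (h2 : s.reg 2 = 1)
    (hw : 2 * (m + 2) < 2 ^ w) :
    Ter w logTwo s (Nat.clog 2 (m + 2) * 10 + 12) (fun s' => s'.reg 27 = Nat.clog 2 (m + 2)) := by
  have f : ∀ x, x ≤ 2 * (m + 2) → Fits w x := fun x hx => lt_of_le_of_lt hx hw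
  have hp : m + 2 ≤ 2 ^ Nat.clog 2 (m + 2) := Nat.le_pow_clog (by norm_num) _
  refine Ter.seq' (t1 := 9) (t2 := Nat.clog 2 (m + 2) * 10 + 1) (R := fun s1 => s1.reg 26 = 1 ∧
    s1.reg 27 = 0 ∧ s1.reg 38 = m + 2 ∧ s1.reg 25 = 1) (Ter.of_wp ?_ (by simp [Prog.size])) ?_
    (by omega)
  · simp [h1, h2]
    exact ⟨f _ (by omega), f _ (by omega), f _ (by omega), f _ (by omega)⟩
  rintro s1 - hf1 ⟨e26, e27, e38, e25⟩
  have e2 : s1.reg 2 = 1 := by rw [hf1.reg _ (by decide), h2]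
  refine Ter.loop (fun k s2 => ∃ j, k = (Nat.clog 2 (m + 2) - j) * 10 ∧ j ≤ Nat.clog 2 (m + 2) ∧
    s2.reg 27 = j ∧ s2.reg 26 = 2 ^ j ∧ s2.reg 25 = if 2 ^ j < m + 2 then 1 else 0) _ ?_ ?_ ?_
  · rintro k s2 hv2 hf2 ⟨j, rfl, hj, c27, c26, c25⟩ hg
    have hlt : 2 ^ j < m + 2 := by by_contra hh; simp [hh] at c25; exact hg c25
    have hj' : j < Nat.clog 2 (m + 2) := (Nat.lt_clog_iff_pow_lt (by norm_num)).2 hlt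
    have c38 : s2.reg 38 = m + 2 := by rw [hf2.reg _ (by decide), e38]
    have c2 : s2.reg 2 = 1 := by rw [hf2.reg _ (by decide), e2]
    refine ⟨9, by omega, Ter.of_wp ?_ (by simp [Prog.size])⟩
    have hpow : 2 ^ j + 2 ^ j = 2 ^ (j + 1) := by rw [pow_succ]; omega
    have hfj : Fits w (j + 1) := f _ (by
      have := Nat.lt_two_pow_self (n := j); omega)
    simp only [wp_seq, wp_op, WordOp.eval_add, WordOp.eval_lt, Memory.setReg_reg, c26, c27, c38, c2,
      hpow, Nat.reduceEqDiff, if_true, if_false]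
    refine ⟨f _ (by omega), hfj, by split <;> exact f _ (by omega), (Nat.clog 2 (m + 2) - (j + 1)) * 10,
      ⟨j + 1, rfl, hj', by simp, by simp, rfl⟩, by omega⟩
  · exact ⟨0, by simp, by simp, e27, by simpa using e26, by rw [e25, if_pos]; norm_num⟩
  · rintro k s2 - - ⟨j, -, hj, c27, c26, c25⟩ hg
    have hlt : m + 2 ≤ 2 ^ j := by by_contra hh; simp [not_le.1 hh] at c25; omega
    rw [c27]
    exact le_antisymm hj (Nat.clog_le_of_le_pow hlt)

/-- Doubling multiplies the cube by 8, so the first power of two whose cube reaches `M` has a cube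
of at most `8 * M`. -/
theorem cubeRoot_spec {w M J : ℕ} {s : Memory} (h4 : s.reg 4 = M) (hM : 1 ≤ M)
    (hw : 8 * M < 2 ^ w) (hJ : M ≤ 2 ^ J) :
    Ter w cubeRoot s (J * 10 + 12) (fun s' => ∃ a, s'.reg 21 = a ∧ 1 ≤ a ∧ M ≤ a * a * a ∧
      a * a * a ≤ 8 * M) := by
  have f : ∀ x, x ≤ 8 * M → Fits w x := fun x hx => lt_of_le_of_lt hx hw
  refine Ter.seq' (t1 := 7) (t2 := J * 10 + 1) (R := fun s1 => s1.reg 21 = 1 ∧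
    s1.reg 25 = if 1 < M then 1 else 0) (Ter.of_wp ?_ (by simp [Prog.size])) ?_ (by omega)
  · simp [h4]
    exact ⟨f _ (by omega), fun _ => f _ (by omega)⟩
  rintro s1 - hf1 ⟨e21, e25⟩
  have e4 : s1.reg 4 = M := by rw [hf1.reg _ (by decide), h4]
  refine Ter.loop (fun k s2 => ∃ j a, k = (J - j) * 10 ∧ j ≤ J ∧ s2.reg 21 = a ∧ a = 2 ^ j ∧
    a * a * a ≤ 8 * M ∧ s2.reg 25 = if a * a * a < M then 1 else 0) _ ?_ ?_ ?_
  · rintro k s2 hv2 hf2 ⟨j, a, rfl, hj, c21, rfl, c8, c25⟩ hg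
    have hlt : 2 ^ j * 2 ^ j * 2 ^ j < M := by by_contra hh; simp [hh] at c25; exact hg c25
    have hpos : 0 < 2 ^ j := by positivity
    have hjJ : j < J := by
      by_contra hh
      have := Nat.pow_le_pow_right (n := 2) (by norm_num) (not_lt.1 hh)
      have : 2 ^ j * 1 ≤ 2 ^ j * (2 ^ j * 2 ^ j) := Nat.mul_le_mul_left _ (Nat.mul_pos hpos hpos)
      rw [← Nat.mul_assoc] at this
      omega
    have c4 : s2.reg 4 = M := by rw [hf2.reg _ (by decide), e4]
    refine ⟨9, by omega, Ter.of_wp ?_ (by simp [Prog.size])⟩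
    have hpow : 2 ^ j + 2 ^ j = 2 ^ (j + 1) := by rw [pow_succ]; omega
    have h8 : 2 ^ (j + 1) * 2 ^ (j + 1) * 2 ^ (j + 1) ≤ 8 * M := by
      rw [pow_succ]
      calc 2 ^ j * 2 * (2 ^ j * 2) * (2 ^ j * 2) = 8 * (2 ^ j * 2 ^ j * 2 ^ j) := by ring
        _ ≤ _ := by omega
    have hpos' : 0 < 2 ^ (j + 1) := by positivity
    have h81 : 2 ^ (j + 1) * 2 ^ (j + 1) ≤ 8 * M :=
      le_trans (Nat.le_mul_of_pos_right _ hpos') h8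
    have h82 : 2 ^ (j + 1) ≤ 8 * M := le_trans (Nat.le_mul_of_pos_right _ hpos') h81
    simp only [wp_seq, wp_op, WordOp.eval_add, WordOp.eval_mul, WordOp.eval_lt, Memory.setReg_reg,
      c21, c4, hpow, Nat.reduceEqDiff, if_true, if_false]
    exact ⟨f _ h82, f _ h81, f _ h8, by split <;> exact f _ (by omega), (J - (j + 1)) * 10,
      ⟨j + 1, _, rfl, hjJ, by simp, rfl, h8, by simp⟩, by omega⟩
  · exact ⟨0, 1, by simp, by simp, e21, by simp, by omega, by simpa using e25⟩
  · rintro k s2 - - ⟨j, a, -, hj, c21, c2, c8, c25⟩ hg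
    have hlt : M ≤ a * a * a := by by_contra hh; simp [not_le.1 hh] at c25; omega
    exact ⟨a, c21, by rw [c2]; exact Nat.one_le_two_pow, hlt, c8⟩

theorem searchGuard_spec {w lo hi : ℕ} {s : Memory} (h2 : s.reg 2 = 1) (h23 : s.reg 23 = lo)
    (h24 : s.reg 24 = hi) (hw : hi < 2 ^ w) :
    Ter w searchGuard s 3 (fun s' => s'.reg 25 = if 1 < hi - lo then 1 else 0) := by
  refine Ter.of_valid fun hv => Ter.of_wp ?_ (by simp [Prog.size, searchGuard])
  simp [searchGuard, h2, h23, h24]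
  exact ⟨show hi - lo < 2 ^ w by omega, fun _ => show 1 < 2 ^ w from h2 ▸ hv.1 2⟩

section

variable {n m : ℕ} {t h : ℕ → ℕ} {ht : ∀ j < m, t j < n} {hh : ∀ j < m, h j < n}

local notation "𝓢" => doubled n m t h ht hh

/-- What holds during the binary search. -/
structure SearchInv (w n m : ℕ) (t h : ℕ → ℕ) (ht : ∀ j < m, t j < n) (hh : ∀ j < m, h j < n)
    (L : ℕ) (R : ℕ → ℕ) (A lo hi a : ℕ) (s : Memory) : Prop where
  env : Env w (doubled n m t h ht hh) n L ((doubled n m t h ht hh).M * L + 1) R s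
  r21 : s.reg 21 = a
  r23 : s.reg 23 = lo
  r24 : s.reg 24 = hi
  lo_pos : 1 ≤ lo
  lo_lt : lo < hi
  hi_le : hi ≤ n
  far : Far (doubled n m t h ht hh) n ((4 * lo + 6) / 7)
  near : (doubled n m t h ht hh).Good n L R → ¬ Far (doubled n m t h ht hh) n hi
  a_pos : 1 ≤ a
  a_le : a ≤ A
  cube : (doubled n m t h ht hh).M ≤ a * a * a

/-- Every iteration either halves the interval or doubles `a`. The first happens at most `e1` times;
the second at most `e2` times, because by `hA` doubling never takes `a` above `A`. After a doubling
the same threshold is tested again. -/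
theorem searchLoop_spec {w L A a e1 e2 : ℕ} {T : ℕ → ℕ} {R : ℕ → ℕ} {P : Prog} {s : Memory}
    (hR : ∀ i < (𝓢).M * L + 1, R i < (𝓢).M)
    (hw : ((𝓢).N + (𝓢).M + (𝓢).M * L + 3) ^ 3 ≤ 2 ^ w)
    (hP : ∀ a, 1 ≤ a → Multiplies P w ((𝓢).M * L / a + 1) (T a)) (hL : 1 ≤ L)
    (hAM : A ≤ (𝓢).M) (hNM : (𝓢).N ≤ (𝓢).M)
    (hA : ∀ a, 1 ≤ a → (𝓢).M ≤ a * a * a → MayAbort (𝓢).M L a (T a) → 2 * a ≤ A)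
    (hI : SearchInv w n m t h ht hh L R A 1 n a s) (he1 : n ≤ 2 ^ e1) (he2 : A < 2 ^ e2) :
    Ter w (searchLoop P) s
      ((e1 + e2) * ((40000 + 66 * clkCost P) * ((𝓢).M * A * L ^ 2) + 20) + 5) (fun s' =>
        ∃ lo, s'.reg 23 = lo ∧ 1 ≤ lo ∧ lo < n ∧ s'.reg 2 = 1 ∧ Far 𝓢 n ((4 * lo + 6) / 7) ∧
          ((𝓢).Good n L R → ¬ Far 𝓢 n (lo + 1))) := by
  obtain ⟨W, hW⟩ : ∃ W, (40000 + 66 * clkCost P) * ((𝓢).M * A * L ^ 2) = W := ⟨_, rfl⟩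
  rw [hW]
  have hNn : (𝓢).N = n + n := rfl
  have hw1 : n + n < 2 ^ w := by
    have := hI.env.graph.word; omega
  refine Ter.seq' (t2 := (e1 + e2) * (W + 20) + 1) (searchGuard_spec hI.env.graph.one hI.r23 hI.r24
    (by omega)) ?_ (by omega)
  intro s1 _ hf1 e25
  refine Ter.loop (fun k s2 => ∃ lo hi a e1 e2, k = (e1 + e2) * (W + 20) ∧ hi ≤ lo + 2 ^ e1 ∧
    A < a * 2 ^ e2 ∧ SearchInv w n m t h ht hh L R A lo hi a s2 ∧
    s2.reg 25 = if 1 < hi - lo then 1 else 0) _ ?_ ?_ ?_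
  · rintro k s2 hv2 - ⟨lo, hi, a, e1, e2, rfl, b1, b2, hI, e25⟩ hg
    have hlt : 1 < hi - lo := by by_contra hh; simp [hh] at e25; exact hg e25
    have := hI.hi_le
    have := hI.lo_pos
    obtain ⟨D, hD⟩ : ∃ D, (lo + hi) / 2 = D := ⟨_, rfl⟩
    have he1 : 1 ≤ e1 := by
      by_contra hh
      obtain rfl : e1 = 0 := by omega
      simp at b1; omega
    obtain ⟨e1', rfl⟩ : ∃ e, e1 = e + 1 := ⟨e1 - 1, by omega⟩
    rw [pow_succ] at b1
    have hbudget : (e1' + 1 + e2) * (W + 20) = (e1' + e2) * (W + 20) + (W + 20) := by ring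
    refine ⟨W + 19, by omega, ?_⟩
    refine Ter.seq' (t1 := 3) (t2 := W + 15) (R := fun s3 => s3.reg 20 = D)
      (Ter.of_wp ?_ (by simp [Prog.size])) ?_ (by omega)
    · simp [WordOp.eval, hI.r23, hI.r24, hI.env.graph.one, Nat.shiftRight_one, hD]
      exact ⟨show _ < 2 ^ w by omega, show _ < 2 ^ w by omega⟩
    rintro s3 - hf3 e20
    have hE3 := hI.env.frame hf3 (by decide) (by decide)
    refine Ter.seq' (t1 := W) (t2 := 14) ((attempt_spec (a := a) (D := D) hE3 hR hw
      (hP a hI.a_pos) hL hI.a_pos (hI.a_le.trans hAM) hI.cube hNM (by omega) (by omega) e20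
      (by rw [hf3.reg _ (by decide), hI.r21])).conseq (by
        rw [← hW]
        exact Nat.mul_le_mul_left _ (Nat.mul_le_mul_right _ (Nat.mul_le_mul_left _ hI.a_le)))
      fun _ _ _ h => h) ?_ (by omega)
    rintro s4 - hf4 ⟨hE4, hcase⟩
    have hr4 : ∀ r, 20 ≤ r → r < 28 → r ≠ 22 → s4.reg r = s3.reg r := fun r h1 h2 h3 =>
      hf4.reg r fun hm => by
        have := attempt_regs (P := P) r hm
        omega
    have c21 : s4.reg 21 = a := by
      rw [hr4 _ (by norm_num) (by norm_num) (by norm_num), hf3.reg _ (by decide), hI.r21]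
    have c23 : s4.reg 23 = lo := by
      rw [hr4 _ (by norm_num) (by norm_num) (by norm_num), hf3.reg _ (by decide), hI.r23]
    have c24 : s4.reg 24 = hi := by
      rw [hr4 _ (by norm_num) (by norm_num) (by norm_num), hf3.reg _ (by decide), hI.r24]
    have c20 : s4.reg 20 = D := by
      rw [hr4 _ (by norm_num) (by norm_num) (by norm_num), e20]
    have hA2 : 1 ≤ e2 := by
      by_contra hh
      obtain rfl : e2 = 0 := by omega
      have := hI.a_le
      simp at b2; omega
    obtain ⟨e2', rfl⟩ : ∃ e, e2 = e + 1 := ⟨e2 - 1, by omega⟩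
    have hbudget' : (e1' + 1 + (e2' + 1)) * (W + 20) = (e1' + 1 + e2') * (W + 20) + (W + 20) := by
      ring
    refine Ter.seq' (t1 := 8) (t2 := 4) (R := fun s5 => ∃ lo' hi' a' f1 f2,
      (f1 + f2) * (W + 20) + (W + 20) ≤ (e1' + 1 + (e2' + 1)) * (W + 20) ∧
      hi' ≤ lo' + 2 ^ f1 ∧ A < a' * 2 ^ f2 ∧ SearchInv w n m t h ht hh L R A lo' hi' a' s5)
      ?_ ?_ (by omega)
    · rcases hcase with ⟨h80, hcase⟩ | ⟨h80, hab⟩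
      · rcases hcase with ⟨h22, hfar⟩ | ⟨h22, hnear⟩
        · refine (Ter.of_wp (t := 8) (Q := fun s5 => s5.reg 21 = a ∧ s5.reg 23 = D ∧ s5.reg 24 = hi)
            ?_ (by simp [Prog.size])).conseq le_rfl ?_
          · simp [h80, h22, c20, c21, c24]
            exact show D < 2 ^ w by omega
          · rintro s5 - hf5 ⟨d21, d23, d24⟩
            refine ⟨D, hi, a, e1', e2' + 1, by omega, by omega, b2, ?_⟩
            exact ⟨hE4.frame hf5 (by decide) (by decide), d21, d23, d24, by omega, by omega, hI.hi_le,
              hfar, hI.near, hI.a_pos, hI.a_le, hI.cube⟩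
        · refine (Ter.of_wp (t := 8) (Q := fun s5 => s5.reg 21 = a ∧ s5.reg 23 = lo ∧ s5.reg 24 = D)
            ?_ (by simp [Prog.size])).conseq le_rfl ?_
          · simp [h80, h22, c20, c21, c23]
            exact show D < 2 ^ w by omega
          · rintro s5 - hf5 ⟨d21, d23, d24⟩
            refine ⟨lo, D, a, e1', e2' + 1, by omega, by omega, b2, ?_⟩
            exact ⟨hE4.frame hf5 (by decide) (by decide), d21, d23, d24, by omega, by omega, by omega,
              hI.far, hnear, hI.a_pos, hI.a_le, hI.cube⟩
      · have h2a := hA a hI.a_pos hI.cube hab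
        have hM2 := hI.env.graph.word
        refine (Ter.of_wp (t := 8) (Q := fun s5 => s5.reg 21 = 2 * a ∧ s5.reg 23 = lo ∧ s5.reg 24 = hi)
          ?_ (by simp [Prog.size])).conseq le_rfl ?_
        · simp [h80, c21, c23, c24, ← Nat.two_mul]
          exact show 2 * a < 2 ^ w by omega
        · rintro s5 - hf5 ⟨d21, d23, d24⟩
          refine ⟨lo, hi, 2 * a, e1' + 1, e2', by omega, by rw [pow_succ]; omega, ?_, ?_⟩
          · rw [pow_succ] at b2
            linarith
          · refine ⟨hE4.frame hf5 (by decide) (by decide), d21, d23, d24, hI.lo_pos, hI.lo_lt,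
              hI.hi_le, hI.far, hI.near, by have := hI.a_pos; omega, h2a, ?_⟩
            have hc := hI.cube
            calc (𝓢).M ≤ a * a * a := hc
              _ ≤ 2 * a * (2 * a) * (2 * a) := by gcongr <;> omega
    · rintro s5 - - ⟨lo', hi', a', f1, f2, g1, g2, g3, hI5⟩
      have := hI5.hi_le
      refine (searchGuard_spec hI5.env.graph.one hI5.r23 hI5.r24 (by omega)).conseq (by omega) ?_
      rintro s6 - hf6 d25
      refine ⟨_, ⟨lo', hi', a', f1, f2, rfl, g2, g3, ?_, d25⟩, by omega⟩
      exact ⟨hI5.env.frame hf6 (by decide) (by decide), by rw [hf6.reg _ (by decide), hI5.r21],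
        by rw [hf6.reg _ (by decide), hI5.r23], by rw [hf6.reg _ (by decide), hI5.r24], hI5.lo_pos,
        hI5.lo_lt, hI5.hi_le, hI5.far, hI5.near, hI5.a_pos, hI5.a_le, hI5.cube⟩
  · refine ⟨1, n, a, e1, e2, rfl, by omega, ?_, ?_, e25⟩
    · exact lt_of_lt_of_le he2 (Nat.le_mul_of_pos_left _ hI.a_pos)
    · exact ⟨hI.env.frame hf1 (by decide) (by decide), by rw [hf1.reg _ (by decide), hI.r21],
        by rw [hf1.reg _ (by decide), hI.r23], by rw [hf1.reg _ (by decide), hI.r24], hI.lo_pos,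
        hI.lo_lt, hI.hi_le, hI.far, hI.near, hI.a_pos, hI.a_le, hI.cube⟩
  · rintro k s2 - - ⟨lo, hi, a, e1, e2, -, -, -, hI, e25⟩ hg
    have hlt : ¬ 1 < hi - lo := by intro hh; simp [hh] at e25; omega
    have := hI.lo_lt
    have := hI.hi_le
    obtain rfl : hi = lo + 1 := by omega
    exact ⟨lo, hI.r23, hI.lo_pos, by omega, hI.env.graph.one, hI.far, hI.near⟩

end

/-! ### The parts of the algorithm before and after the sampling -/

/-- As long as a ball is not closed under out-arcs, raising the radius adds a vertex. Hence finite
distances are less than the number of vertices. -/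
theorem Arcs.ball_stable_or {S : Arcs} (u k : ℕ) :
    (∃ j ≤ k, ∀ l, S.ball u l ⊆ S.ball u j) ∨ k + 1 ≤ (S.ball u k).card := by
  induction k with
  | zero => right; simp [Arcs.ball]
  | succ k ih =>
    rcases ih with ⟨j, hj, h⟩ | h
    · exact .inl ⟨j, by omega, h⟩
    · by_cases hc : ∀ j < S.M, S.tl j ∈ S.ball u k → S.hd j ∈ S.ball u k
      · exact .inl ⟨k, by omega, Arcs.ball_closed hc⟩
      · push Not at hc
        obtain ⟨j, hj, h1, h2⟩ := hc
        right
        have : insert (S.hd j) (S.ball u k) ⊆ S.ball u (k + 1) := by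
          intro y hy
          rcases Finset.mem_insert.1 hy with rfl | hy
          · exact Arcs.mem_ball_succ.2 (.inr ⟨j, hj, h1, rfl⟩)
          · exact Arcs.ball_subset (Nat.le_succ k) hy
        have := Finset.card_le_card this
        rw [Finset.card_insert_of_notMem h2] at this
        omega

section

variable {n m : ℕ} {t h : ℕ → ℕ} {ht : ∀ j < m, t j < n} {hh : ∀ j < m, h j < n}

local notation "𝓢" => doubled n m t h ht hh

theorem mem_ball_pred {u v k : ℕ} (hu : u < n) (hv : v ∈ (𝓢).ball u k) : v ∈ (𝓢).ball u (n - 1) := by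
  have hvn : v < n := (doubled_copy hv).2 hu
  rcases Arcs.ball_stable_or (S := 𝓢) u (n - 1) with ⟨j, hj, h⟩ | h
  · exact Arcs.ball_subset hj (h k hv)
  · exact mem_of_card (by omega) (by omega) (by simp [hu, hvn]) (by omega)

theorem Far.mono {d d' : ℕ} (hF : Far 𝓢 n d) (h : d' ≤ d) : Far 𝓢 n d' := by
  obtain ⟨u, v, hu, hv, H⟩ := hF
  exact ⟨u, v, hu, hv, fun k hk => H k (by omega)⟩

/-- A vertex that is not reached within `n - 1` steps is never reached, so distance at least `n`
means infinite distance. -/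
theorem Far.all (hF : Far 𝓢 n n) (d : ℕ) : Far 𝓢 n d := by
  obtain ⟨u, v, hu, hv, H⟩ := hF
  exact ⟨u, v, hu, hv, fun k _ hm => H (n - 1) (by omega) (mem_ball_pred hu hm)⟩

/-- Vertex `0` reaches everything, and its mirror image `n` does so in the reversed graph; any two
vertices are therefore connected through `0`. -/
theorem not_far_of_connected (hn : 0 < n) (h1 : n ≤ ((𝓢).ball 0 n).card)
    (h2 : n ≤ ((𝓢).ball n n).card) : ¬ Far 𝓢 n n := by
  rintro ⟨u, v, hu, hv, H⟩
  have hv' : v ∈ (𝓢).ball 0 n := mem_of_card (by omega) (by omega) (by simp [hn, hv]) h1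
  have hu' : mirror n u ∈ (𝓢).ball n n := mem_of_card (by omega) (mirror_lt (by omega))
    (by rw [mirror_lt_iff (by omega)]; simp [hu]) h2
  have h0 : mirror n 0 = n := by simp [mirror, hn]
  have hu' : mirror n u ∈ (𝓢).ball (mirror n 0) n := by simpa only [h0] using hu'
  rw [doubled_mirror_iff (by omega) (mirror_lt (by omega)), mirror_mirror (by omega)] at hu'
  exact H (n - 1) (by omega) (mem_ball_pred hu (Arcs.ball_trans hu' hv'))

/-- What remains to be done after the sampling: the search, and the output. -/
def finish (P : Prog) : Prog :=
  cubeRoot ;; (.op .lor 23 2 2 ;; .op .lor 24 0 0) ;; searchLoop P ;; .op .add 0 23 2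

/-- The output is shifted by one, since the word `0` is reserved for infinity. -/
theorem finish_spec {w L A e : ℕ} {T : ℕ → ℕ} {R : ℕ → ℕ} {P : Prog} {s : Memory} (hn : 2 ≤ n)
    (hE : Env w 𝓢 n L ((𝓢).M * L + 1) R s)
    (hR : ∀ i < (𝓢).M * L + 1, R i < (𝓢).M)
    (hw : ((𝓢).N + (𝓢).M + (𝓢).M * L + 3) ^ 3 ≤ 2 ^ w) (hw8 : 8 * (𝓢).M < 2 ^ w)
    (hP : ∀ a, 1 ≤ a → Multiplies P w ((𝓢).M * L / a + 1) (T a)) (hL : 1 ≤ L)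
    (hAM : A ≤ (𝓢).M) (hNM : (𝓢).N ≤ (𝓢).M)
    (hA : ∀ a, 1 ≤ a → (𝓢).M ≤ a * a * a → MayAbort (𝓢).M L a (T a) → 2 * a ≤ A)
    (hA0 : ∀ a, a * a * a ≤ 8 * (𝓢).M → a ≤ A)
    (hfar : ¬ Far 𝓢 n n) (he : (𝓢).M < 2 ^ e) :
    Ter w (finish P) s
      ((e + e) * ((40000 + 66 * clkCost P) * ((𝓢).M * A * L ^ 2) + 20) + e * 10 + 30) (fun s' =>
        ∃ lo, s'.reg 0 = lo + 1 ∧ Far 𝓢 n ((4 * lo + 6) / 7) ∧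
          ((𝓢).Good n L R → ¬ Far 𝓢 n (lo + 1))) := by
  have hNn : (𝓢).N = n + n := rfl
  obtain ⟨W, hW⟩ : ∃ W, (40000 + 66 * clkCost P) * ((𝓢).M * A * L ^ 2) = W := ⟨_, rfl⟩
  have hfi : ∀ {x}, x ≤ (𝓢).M → Fits w x := fun {x} h => show x < 2 ^ w by omega
  refine Ter.seq' (t2 := (e + e) * (W + 20) + 15) (cubeRoot_spec hE.graph.M (by omega) hw8 he.le) ?_
    (by rw [hW]; omega)
  rintro s1 - hf1 ⟨a, e21, ha1, haM, ha8⟩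
  have hE1 := hE.frame hf1 (by decide) (by decide)
  refine Ter.seq' (t1 := 3) (t2 := (e + e) * (W + 20) + 8) (R := fun s2 => s2.reg 23 = 1 ∧
    s2.reg 24 = n) (Ter.of_wp ?_ (by simp [Prog.size])) ?_ (by omega)
  · simp [hE1.graph.one, hE1.n]
    exact ⟨hfi (by omega), hfi (by omega)⟩
  rintro s2 - hf2 ⟨e23, e24⟩
  have hE2 := hE1.frame hf2 (by decide) (by decide)
  have hI : SearchInv w n m t h ht hh L R A 1 n a s2 := by
    refine ⟨hE2, ?_, e23, e24, le_rfl, by omega, le_rfl, ?_, fun _ => hfar, ha1, hA0 a ha8, haM⟩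
    · rw [hf2.reg _ (by decide), e21]
    -- The initial lower bound `lo = 1` requires a pair at distance at least (4 + 6)/7 = 1, that is,
    -- two distinct vertices.
    · exact ⟨0, 1, by omega, by omega, fun k hk => by
        obtain rfl : k = 0 := by omega
        simp [Arcs.ball]⟩
  have hs := searchLoop_spec hR hw hP hL hAM hNM hA hI (e1 := e) (e2 := e) (by omega) (by omega)
  rw [hW] at hs
  refine Ter.seq' (t2 := 1) hs ?_ (by omega)
  rintro s3 - hf3 ⟨lo, e23, h1, h2, hone, hfar, hnear⟩
  refine Ter.of_wp ?_ (by simp [Prog.size])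
  simp [e23, hone]
  exact ⟨hfi (by omega), hfar, hnear⟩

/-- Check that the graph is strongly connected: if not, register `22` is set. -/
def connected : Prog :=
  (.const 22 0 ;; .op .lor 30 0 0 ;; .const 60 0) ;; probe ;; .op .lor 60 0 0 ;; probe

theorem connected_spec {w : ℕ} {s : Memory} (hn : 0 < n) (h0 : s.reg 0 = n)
    (hg : GraphMem w 𝓢 s) (hc : Clean 𝓢 s) :
    Ter w connected s (400 * ((𝓢).M + 1) + 40) (fun s' => GraphMem w 𝓢 s' ∧ Clean 𝓢 s' ∧
      s'.reg 0 = n ∧ s'.reg 1 = s.reg 1 ∧ Truth (s'.reg 22) (Far 𝓢 n n)) := by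
  have hNn : (𝓢).N = n + n := rfl
  have hfi : ∀ {x}, x ≤ n → Fits w x := fun {x} h => show x < 2 ^ w by
    have := hg.word; omega
  have hE : Env w 𝓢 n (s.reg 5) 0 (fun _ => 0) s := ⟨hg, hc, h0, rfl, by simp⟩
  refine Ter.seq' (t1 := 5) (t2 := 400 * ((𝓢).M + 1) + 30) (R := fun s1 => s1.reg 22 = 0 ∧
    s1.reg 30 = n ∧ s1.reg 60 = 0) (Ter.of_wp ?_ (by simp [Prog.size])) ?_ (by omega)
  · simp [h0]
    exact hfi le_rfl
  rintro s1 - hf1 ⟨e22, e30, e60⟩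
  have hE1 := hE.frame hf1 (by decide) (by decide)
  refine Ter.seq' (t2 := 200 * ((𝓢).M + 1) + 15) (probe_spec (p := False) hE1 e30 e60 (by omega)
    (.inr ⟨e22, by simp⟩)) ?_ (by omega)
  rintro s2 - hf2 ⟨hE2, ht2⟩
  refine Ter.seq' (t1 := 1) (t2 := 200 * ((𝓢).M + 1) + 10) (R := fun s3 => s3.reg 60 = n)
    (Ter.of_wp ?_ (by simp [Prog.size])) ?_ (by omega)
  · simp [hE2.n]
    exact hfi le_rfl
  rintro s3 - hf3 e60'
  have hE3 := hE2.frame hf3 (by decide) (by decide)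
  refine (probe_spec (k := n) hE3 ?_ e60' (by omega) (ht2.congr (hf3.reg _ (by decide)) Iff.rfl)).conseq
    le_rfl ?_
  · rw [hf3.reg _ (by decide), probe_frame_reg hf2 _ (by norm_num) (by norm_num) (by norm_num), e30]
  rintro s4 - hf4 ⟨hE4, ht4⟩
  refine ⟨hE4.graph, hE4.clean, hE4.n, ?_, ht4.congr rfl ⟨?_, fun hF => ?_⟩⟩
  · rw [probe_frame_reg hf4 _ (by norm_num) (by norm_num) (by norm_num), hf3.reg _ (by decide),
      probe_frame_reg hf2 _ (by norm_num) (by norm_num) (by norm_num), hf1.reg _ (by decide)]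
  -- The searches use radius `n`, which corresponds to distance `n + 1` in `far_of_card`; this is
  -- weakened to `n`.
  · rintro ((⟨⟨⟩⟩ | hlt) | hlt)
    · exact (far_of_card (d := n + 1) (by omega) hlt).mono (by omega)
    · exact (far_of_card (d := n + 1) (by omega) hlt).mono (by omega)
  · by_contra hcon
    push Not at hcon
    exact not_far_of_connected hn hcon.1.2 hcon.2 hF

end

open scoped ENNReal

/-! ### The probability of failure -/

/-- From the configuration `c`, the machine fails to halt with a memory that satisfies `Q` within
`T` steps with probability at most `φ`. -/
def FailBound (w : ℕ) (Q : Memory → Prop) (T : ℕ) (c : Config) (φ : ℝ≥0∞) : Prop :=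
  ∀ T' ≥ T, (runSteps w T' c).toOuterMeasure {c | ¬ Halted Q c} ≤ φ

theorem PMF.toOuterMeasure_le_one {α : Type*} (p : PMF α) (s : Set α) : p.toOuterMeasure s ≤ 1 := by
  rw [PMF.toOuterMeasure_apply, ← p.tsum_coe]
  exact ENNReal.tsum_le_tsum fun a => Set.indicator_le_self _ _ _

theorem PMF.toOuterMeasure_add_compl {α : Type*} (p : PMF α) (s : Set α) :
    p.toOuterMeasure s + p.toOuterMeasure sᶜ = 1 := by
  rw [PMF.toOuterMeasure_apply, PMF.toOuterMeasure_apply, ← ENNReal.tsum_add, ← p.tsum_coe]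
  exact tsum_congr fun a => Set.indicator_self_add_compl_apply _ _ _

section

variable {w T T' t : ℕ} {Q : Memory → Prop} {c : Config} {φ φ' : ℝ≥0∞}

theorem FailBound.mono (h : FailBound w Q T c φ) (hT : T ≤ T') (hφ : φ ≤ φ') :
    FailBound w Q T' c φ' := fun T'' hT'' => (h T'' (by omega)).trans hφ

theorem FailBound.one : FailBound w Q T c 1 := fun _ _ => PMF.toOuterMeasure_le_one _ _

/-- The failure probability after one step is the average over the successors, so a common bound for
the reachable ones carries over. Asking for all `T' ≥ T` in `FailBound` lets branches of different
lengths be compared. -/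
theorem FailBound.next (h : ∀ c' ∈ (step w c).support, FailBound w Q T c' φ) :
    FailBound w Q (T + 1) c φ := by
  intro T' hT'
  obtain ⟨T', rfl⟩ : ∃ k, T' = k + 1 := ⟨T' - 1, by omega⟩
  rw [runSteps, PMF.toOuterMeasure_bind_apply]
  calc ∑' a, step w c a * (runSteps w T' a).toOuterMeasure {c | ¬ Halted Q c}
      ≤ ∑' a, step w c a * φ := ENNReal.tsum_le_tsum fun a => by
        by_cases ha : a ∈ (step w c).support
        · exact mul_le_mul_right (h a ha T' (by omega)) _
        · rw [PMF.mem_support_iff, not_not] at ha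
          simp [ha]
    _ = φ := by rw [ENNReal.tsum_mul_right, PMF.tsum_coe, one_mul]

theorem Ev.failBound {G : Config → Prop} (h : Ev w G t c) (hG : ∀ c, G c → FailBound w Q T c φ) :
    FailBound w Q (t + T) c φ := by
  induction h with
  | done h => exact (hG _ h).mono (by omega) le_rfl
  | @next t c h ih =>
    rw [show t + 1 + T = t + T + 1 by omega]
    exact .next ih

theorem runSteps_halted (T : ℕ) (s : Memory) :
    runSteps w T (some ([], s)) = PMF.pure (some ([], s)) := by
  induction T with
  | zero => rfl
  | succ T ih => rw [runSteps]; simp [step, ih]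

theorem FailBound.halted (h : Halted Q c) : FailBound w Q 0 c 0 := by
  obtain ⟨s, rfl, hs⟩ := h
  intro T' _
  rw [runSteps_halted, PMF.toOuterMeasure_pure_apply, if_neg]
  simp only [Set.mem_ofPred_eq, not_not]
  exact ⟨s, rfl, hs⟩

theorem FailBound.of_ev (h : Ev w (Halted Q) t c) : FailBound w Q t c 0 :=
  h.failBound (T := 0) fun _ hc => .halted hc

/-- The one rule in which probabilities are really averaged: the successors may have different
bounds. -/
theorem FailBound.rand {r x b : ℕ} {K : List Prog} {s : Memory} {φ : ℕ → ℝ≥0∞}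
    (hx : s.reg x = b + 1) (hb : b < 2 ^ w)
    (h : ∀ i < b + 1, FailBound w Q T (some (K, s.setReg r i)) (φ i)) :
    FailBound w Q (T + 1) (some (.rand r x :: K, s))
      (∑ i ∈ Finset.range (b + 1), ((b + 1 : ℕ) : ℝ≥0∞)⁻¹ * φ i) := by
  intro T' hT'
  obtain ⟨T', rfl⟩ : ∃ k, T' = k + 1 := ⟨T' - 1, by omega⟩
  have hstep : step w (some (.rand r x :: K, s)) =
      PMF.map (fun i : Fin (b + 1) => writeReg w r i.val K s)
        (PMF.uniformOfFintype (Fin (b + 1))) := by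
    simp only [step, hx]
    change PMF.map _ (PMF.bind _ fun a : Fin (b + 1) => PMF.pure a.val) = _
    rw [PMF.map_bind, PMF.map]
    congr 1
    funext a
    rw [PMF.pure_map]
    rfl
  rw [runSteps, hstep, PMF.bind_map, PMF.toOuterMeasure_bind_apply, tsum_fintype,
    Finset.sum_range fun i => ((b + 1 : ℕ) : ℝ≥0∞)⁻¹ * φ i]
  refine Finset.sum_le_sum fun i _ => ?_
  rw [PMF.uniformOfFintype_apply, Fintype.card_fin]
  refine mul_le_mul_right ?_ _
  have : writeReg w r i K s = some (K, s.setReg r i) := by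
    rw [writeReg, if_pos (by omega)]
  simp only [Function.comp_apply, this]
  exact h i i.2 T' (by omega)

theorem FailBound.le_probHalts {P : Prog} {s : Memory} (h : FailBound w Q T (some ([P], s)) φ) :
    1 - φ ≤ probHalts w T P s Q := by
  have h1 := PMF.toOuterMeasure_add_compl (runSteps w T (some ([P], s))) {c | Halted Q c}
  rw [tsub_le_iff_right]
  calc (1 : ℝ≥0∞) = _ := h1.symm
    _ ≤ _ := add_le_add (le_of_eq rfl) (h T le_rfl)

theorem FailBound.probHalts_eq_one {P : Prog} {s : Memory}
    (h : FailBound w Q T (some ([P], s)) 0) : probHalts w T P s Q = 1 :=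
  le_antisymm (PMF.toOuterMeasure_le_one _ _) (by simpa using h.le_probHalts)

theorem Ev.of_support (h : ∀ c' ∈ (runSteps w T c).support, Halted Q c') : Ev w (Halted Q) T c := by
  induction T generalizing c with
  | zero => exact .done (h c (by simp [runSteps]))
  | succ T ih =>
    refine .next fun c' hc' => ih fun c'' hc'' => h c'' ?_
    rw [runSteps, PMF.mem_support_bind_iff]
    exact ⟨c', hc', hc''⟩

/-- Probability one means that every run is successful. -/
theorem Ev.of_probHalts {P : Prog} {s : Memory} (h : probHalts w T P s Q = 1) :
    Ev w (Halted Q) T (some ([P], s)) :=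
  .of_support fun _ hc => ((PMF.toOuterMeasure_apply_eq_one_iff _ _).1 h) hc

theorem FailBound.head {c' : Config} (h : step w c = PMF.pure c') (h' : FailBound w Q T c' φ) :
    FailBound w Q (T + 1) c φ :=
  .next fun d hd => by rw [h] at hd; simp at hd; subst hd; exact h'

theorem FailBound.seq {p q : Prog} {K : List Prog} {s : Memory} {R : Memory → Prop}
    (h : Ter w p s t R) (hs : s.Valid w)
    (hq : ∀ s', s'.Valid w → Fr p s s' → R s' → FailBound w Q T (some (q :: K, s')) φ)
    (hT : t + T + 1 ≤ T') : FailBound w Q T' (some ((p ;; q) :: K, s)) φ := by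
  refine FailBound.mono (T := t + T + 1) (.head rfl ?_) hT le_rfl
  exact (h.lift hs (q :: K)).failBound fun c ⟨s', hc, h1, h2, h3⟩ => hc ▸ hq s' h1 h2 h3

theorem FailBound.ite {p q : Prog} {x : ℕ} {K : List Prog} {s : Memory}
    (h1 : s.reg x ≠ 0 → FailBound w Q T (some (p :: K, s)) φ)
    (h2 : s.reg x = 0 → FailBound w Q T (some (q :: K, s)) φ) :
    FailBound w Q (T + 1) (some (.ite x p q :: K, s)) φ := by
  refine .head rfl ?_
  by_cases hx : s.reg x = 0
  · simpa [hx] using h2 hx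
  · simpa [hx] using h1 hx

theorem FailBound.of_ter {p : Prog} {s : Memory} (h : Ter w p s T Q) (hs : s.Valid w) :
    FailBound w Q T (some ([p], s)) 0 := .of_ev (h hs)

/-! ### Random sampling and the potential argument -/

/-- Draw the samples. -/
def drawSamples : Prog := forLoop 36 37 6 (.rand 38 4 ;; .store 7 36 38)

/-- A potential that does not increase on average bounds the probability of failure. -/
theorem drawSamples_failBound {M K : ℕ} {s : Memory} {L : List Prog} {φ : ℕ → (ℕ → ℕ) → ℝ≥0∞}
    (hs : s.Valid w) (hM : 0 < M) (h2 : s.reg 2 = 1) (h4 : s.reg 4 = M) (h6 : s.reg 6 = K)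
    (havg : ∀ i < K, ∀ R, ∑ x ∈ Finset.range M, (M : ℝ≥0∞)⁻¹ * φ (i + 1) (Function.update R i x) ≤
      φ i R)
    (hL : ∀ s', s'.Valid w → Fr drawSamples s s' → (∀ i < K, s'.arr 7 i < M) →
      FailBound w Q T (some (L, s')) (φ K (s'.arr 7))) :
    FailBound w Q (K * 10 + 10 + T) (some (drawSamples :: L, s)) (φ 0 (s.arr 7)) := by
  have hK : Fits w K := h6 ▸ hs.1 6
  have hf1 : Fits w 1 := h2 ▸ hs.1 2
  have hMw : M < 2 ^ w := h4 ▸ hs.1 4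
  have hfi : ∀ {i}, i ≤ K → Fits w i := fun {i} h => lt_of_le_of_lt h hK
  have key : ∀ k i s', k + i = K → s'.Valid w → Fr drawSamples s s' → s'.reg 36 = i →
      s'.reg 37 = (if i < K then 1 else 0) → (∀ j < i, s'.arr 7 j < M) →
      FailBound w Q (k * 10 + 1 + T) (some (.loop 37 ((.rand 38 4 ;; .store 7 36 38) ;;
        (.op .add 36 36 2 ;; .op .lt 37 36 6)) :: L, s')) (φ i (s'.arr 7)) := by
    intro k
    induction k with
    | zero =>
      rintro i s' hk hv hf e36 e37 hR
      obtain rfl : i = K := by omega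
      refine FailBound.mono (T := T + 1) (.head (c' := some (L, s')) ?_ (hL s' hv hf hR)) (by omega)
        le_rfl
      simp [step, e37]
    | succ k ih =>
      rintro i s' hk hv hf e36 e37 hR
      have hiK : i < K := by omega
      have e4 : s'.reg 4 = M := by rw [hf.reg _ (by decide), h4]
      have e6 : s'.reg 6 = K := by rw [hf.reg _ (by decide), h6]
      have e2 : s'.reg 2 = 1 := by rw [hf.reg _ (by decide), h2]
      obtain ⟨b, rfl⟩ : ∃ b, M = b + 1 := ⟨M - 1, by omega⟩
      refine FailBound.mono (T := (k * 10 + 1 + T) + 3 + 1 + 1 + 1 + 1 + 1) (.head (by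
        simp [step, e37, hiK]; rfl) (.head rfl (.head rfl (FailBound.mono (.rand e4 (by omega)
          (φ := fun x => φ (i + 1) (Function.update (s'.arr 7) i x)) fun x hx => ?_) le_rfl
          (havg i hiK _))))) (by omega) le_rfl
      refine .head (c' := some (_, (s'.setReg 38 x).setArr 7 i x)) (by simp [step, e36]; rfl) ?_
      have hvx : ((s'.setReg 38 x).setArr 7 i x).Valid w :=
        (hv.setReg (by omega)).setArr (by omega)
      have harr : ((s'.setReg 38 x).setArr 7 i x).arr 7 = Function.update (s'.arr 7) i x := by
        simp [Memory.setArr]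
      have hfx : Fr drawSamples s ((s'.setReg 38 x).setArr 7 i x) :=
        hf.trans ⟨fun r hr => by
          simp only [Memory.setArr_reg, Memory.setReg_reg]
          rw [if_neg]; rintro rfl; exact hr (by decide), fun a ha => by
          funext j
          have : a ≠ 7 := by rintro rfl; exact ha (by decide)
          simp [this]⟩
      have hter : Ter w (.op .add 36 36 2 ;; .op .lt 37 36 6) ((s'.setReg 38 x).setArr 7 i x) 3
          (fun s1 => s1.reg 36 = i + 1 ∧ s1.reg 37 = if i + 1 < K then 1 else 0) := by
        refine Ter.of_wp ?_ (by simp [Prog.size])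
        simp [e36, e2, e6, hf1]
        exact hfi (by omega)
      have := (hter.lift hvx (.loop 37 ((.rand 38 4 ;; .store 7 36 38) ;;
        (.op .add 36 36 2 ;; .op .lt 37 36 6)) :: L)).failBound (T := k * 10 + 1 + T) (Q := Q)
        (φ := φ (i + 1) (Function.update (s'.arr 7) i x)) ?_
      · rw [Nat.add_comm _ 3]; exact this
      · rintro c ⟨s1, rfl, hv1, hf1, g36, g37⟩
        have ha1 : s1.arr 7 = Function.update (s'.arr 7) i x := by
          rw [hf1.arr _ (by decide), harr]
        rw [← ha1]
        refine ih (i + 1) s1 (by omega) hv1 (hfx.trans (hf1.mono (by decide) (by decide))) g36 g37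
          fun j hj => ?_
        rw [ha1, Function.update_apply]
        split
        · exact hx
        · exact hR j (by omega)
  refine FailBound.seq (t := 3) (T := K * 10 + 1 + T) (R := fun s1 => s1.reg 36 = 0 ∧
    s1.reg 37 = (if 0 < K then 1 else 0) ∧ s1.arr = s.arr) (Ter.of_wp ?_ (by simp [Prog.size])) hs ?_
    (by omega)
  · simp [h6, hf1]
  · rintro s1 hv1 hf1 ⟨e36, e37, ea⟩
    rw [← ea]
    exact key K 0 s1 (by omega) hv1 (hf1.mono (by decide) (by decide)) e36 e37 (by simp)

end

/-! ### The algorithm -/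

/-- What is to be done for a graph with at least two vertices and at least as many arcs as
vertices: check that it is strongly connected, draw the samples, and search. -/
def search (P : Prog) (c : ℕ) : Prog :=
  buildGraph ;; connected ;; .ite 22 (.const 0 0)
    (logTwo ;; (.const 38 (c + 4) ;; .op .mul 5 27 38 ;; .op .mul 6 4 5 ;; .op .add 6 6 2) ;;
      drawSamples ;; finish P)

/-- The algorithm for the diameter; the matrices are multiplied by `P`, and `c` determines the
probability of failure. -/
def diameter (P : Prog) (c : ℕ) : Prog :=
  (.const 2 1 ;; .op .lt 25 2 0) ;;
    .ite 25 (.op .lt 25 1 0 ;; .ite 25 (.const 0 0) (search P c)) (.const 0 1)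

section

variable {n m : ℕ} {t h : ℕ → ℕ} {ht : ∀ j < m, t j < n} {hh : ∀ j < m, h j < n}

local notation "𝓢" => doubled n m t h ht hh

theorem GraphMem.frame {w : ℕ} {S : Arcs} {s s' : Memory} {p : Prog} (hg : GraphMem w S s)
    (hf : Fr p s s') (hr : ∀ r ∈ p.regs, 5 ≤ r) (ha : ∀ a ∈ p.arrs, 7 ≤ a) : GraphMem w S s' := by
  have hr' : ∀ r < 5, s'.reg r = s.reg r := fun r h => hf.reg r fun hm => by
    have := hr r hm; omega
  have ha' : ∀ a < 7, s'.arr a = s.arr a := fun a h => hf.arr a fun hm => by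
    have := ha a hm; omega
  refine ⟨?_, ?_, ?_, ?_, ?_, ?_, ?_, hg.word⟩
  · rw [hr' _ (by norm_num), hg.one]
  · rw [hr' _ (by norm_num), hg.N]
  · rw [hr' _ (by norm_num), hg.M]
  · rw [ha' _ (by norm_num)]; exact hg.tl
  · rw [ha' _ (by norm_num)]; exact hg.hd
  · rw [ha' _ (by norm_num), ha' _ (by norm_num)]; exact hg.out
  · rw [ha' _ (by norm_num)]; exact hg.deg

/-- The potential `φ` is left abstract: zero gives halting with probability one, and `Arcs.badCount`
gives the bound for the error. The time does not depend on the choice. -/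
theorem search_failBound {w L A e c ell : ℕ} {T : ℕ → ℕ} {P : Prog} {s : Memory}
    {Q : Memory → Prop} {φ : ℕ → (ℕ → ℕ) → ℝ≥0∞} {δ : ℝ≥0∞} (hn : 2 ≤ n) (hnm : n ≤ m)
    (hs : s.Valid w) (h0 : s.reg 0 = n) (h1 : s.reg 1 = m) (hat : ∀ j < m, s.arr 0 j = t j)
    (hah : ∀ j < m, s.arr 1 j = h j)
    (hell : ell = Nat.clog 2 (m + 2)) (hL : L = (c + 4) * ell)
    (hw : ((𝓢).N + (𝓢).M + (𝓢).M * L + 3) ^ 3 ≤ 2 ^ w)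
    (hP : ∀ a, 1 ≤ a → Multiplies P w ((𝓢).M * L / a + 1) (T a))
    (hAM : A ≤ (𝓢).M)
    (hA : ∀ a, 1 ≤ a → (𝓢).M ≤ a * a * a → MayAbort (𝓢).M L a (T a) → 2 * a ≤ A)
    (hA0 : ∀ a, a * a * a ≤ 8 * (𝓢).M → a ≤ A) (he : (𝓢).M < 2 ^ e)
    (havg : ∀ i < (𝓢).M * L + 1, ∀ R, ∑ x ∈ Finset.range (𝓢).M,
      ((𝓢).M : ℝ≥0∞)⁻¹ * φ (i + 1) (Function.update R i x) ≤ φ i R)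
    (hδ : ∀ R, φ 0 R ≤ δ)
    (hQ : ∀ s', s'.reg 0 = 0 → Far 𝓢 n n → Q s')
    (hQ' : ∀ R, φ ((𝓢).M * L + 1) R < 1 → ∀ s' lo, s'.reg 0 = lo + 1 →
      Far 𝓢 n ((4 * lo + 6) / 7) → ((𝓢).Good n L R → ¬ Far 𝓢 n (lo + 1)) → Q s') :
    FailBound w Q (100 * (n + m + 1) + (400 * ((𝓢).M + 1) + 40) + (ell * 10 + 12) +
      (((𝓢).M * L + 1) * 10 + 10) +
      ((e + e) * ((40000 + 66 * clkCost P) * ((𝓢).M * A * L ^ 2) + 20) + e * 10 + 30) + 30)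
      (some ([search P c], s)) δ := by
  have hN : (𝓢).N = n + n := rfl
  have hM : (𝓢).M = m + m := rfl
  have hell1 : 1 ≤ ell := by rw [hell]; exact Nat.clog_pos (by norm_num) (by omega)
  have hL4 : c + 4 ≤ L := by rw [hL]; exact Nat.le_mul_of_pos_right _ hell1
  have hML : (𝓢).M * (c + 4) ≤ (𝓢).M * L := Nat.mul_le_mul_left _ hL4
  have hLM : L ≤ (𝓢).M * L := Nat.le_mul_of_pos_left _ (by omega)
  have hML4 : (𝓢).M * 4 ≤ (𝓢).M * (c + 4) := Nat.mul_le_mul_left _ (by omega)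
  have hw9 : ((𝓢).N + (𝓢).M + (𝓢).M * L + 3) * 9 ≤ 2 ^ w := by
    refine le_trans ?_ hw
    rw [pow_succ, Nat.mul_comm]
    exact Nat.mul_le_mul_right _ (le_trans (by norm_num) (Nat.pow_le_pow_left
      (show 3 ≤ (𝓢).N + (𝓢).M + (𝓢).M * L + 3 by omega) 2))
  obtain ⟨F, hF⟩ : ∃ F, (e + e) * ((40000 + 66 * clkCost P) * ((𝓢).M * A * L ^ 2) + 20) + e * 10
    + 30 = F := ⟨_, rfl⟩
  obtain ⟨K, hK⟩ : ∃ K, (𝓢).M * L + 1 = K := ⟨_, rfl⟩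
  rw [hF, hK]
  have hfi : ∀ {x}, x ≤ K → Fits w x := fun {x} h => show x < 2 ^ w by omega
  refine .seq (T := (400 * ((𝓢).M + 1) + 40) + (ell * 10 + 12) + (K * 10 + 10) + F + 25)
    (buildGraph_spec ht hh h0 h1 hat hah (by omega)) hs ?_ (by omega)
  rintro s1 hv1 hf1 ⟨hg1, hc1⟩
  refine .seq (T := (ell * 10 + 12) + (K * 10 + 10) + F + 20) (connected_spec (by omega)
    (by rw [hf1.reg _ (by decide), h0]) hg1 hc1) hv1 ?_ (by omega)
  rintro s2 hv2 hf2 ⟨hg2, hc2, e0, e1, htr⟩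
  rw [hf1.reg _ (by decide), h1] at e1
  refine FailBound.mono (.ite (T := (ell * 10 + 12) + (K * 10 + 10) + F + 15) (fun hne => ?_)
    fun heq => ?_) (by omega) le_rfl
  · exact (FailBound.of_ter (.const (Fits.zero _) (hQ _ (by simp) (htr.ne_zero.1 hne))) hv2).mono
      (by omega) zero_le
  have hfar : ¬ Far 𝓢 n n := fun hF => htr.ne_zero.2 hF heq
  refine .seq (T := (K * 10 + 10) + F + 10) (logTwo_spec e1 hg2.one (by omega)) hv2 ?_
    (by rw [← hell]; omega)
  rintro s3 hv3 hf3 e27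
  rw [← hell] at e27
  have hg3 := hg2.frame hf3 (by decide) (by decide)
  have hc3 : Clean 𝓢 s3 := hc2.congr (hf3.arr _ (by decide))
  have f0 : s3.reg 0 = n := by rw [hf3.reg _ (by decide), e0]
  refine .seq (t := 7) (T := (K * 10 + 10) + F + 1) (R := fun s4 => s4.reg 5 = L ∧ s4.reg 6 = K)
    (Ter.of_wp ?_ (by simp [Prog.size])) hv3 ?_ (by omega)
  · have hLc : ell * (c + 4) = L := by rw [hL, Nat.mul_comm]
    simp [e27, hg3.M, hg3.one, hLc, hK]
    exact ⟨hfi (by omega), hfi (by omega), hfi (by omega), hfi (by omega)⟩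
  rintro s4 hv4 hf4 ⟨f5, f6⟩
  have hg4 := hg3.frame hf4 (by simp [Prog.regs]) (by simp [Prog.arrs])
  have hc4 : Clean 𝓢 s4 := hc3.congr (hf4.arr _ (by simp [Prog.arrs]))
  refine FailBound.mono (.head (T := K * 10 + 10 + F) rfl ((drawSamples_failBound (K := K)
    (T := F) (φ := φ) hv4 (by omega) hg4.one hg4.M f6 (by rw [← hK]; exact havg) ?_).mono le_rfl
    (hδ _))) (by omega) le_rfl
  rintro s5 hv5 hf5 hR
  -- A final potential of at least `1` allows failure with certainty, so only the samples with
  -- smaller potential have to be followed further.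
  by_cases hφ : φ K (s5.arr 7) < 1
  · have hE : Env w 𝓢 n L K (s5.arr 7) s5 := by
      refine ⟨hg4.frame hf5 (by decide) (by decide), hc4.congr (hf5.arr _ (by decide)), ?_, ?_, fun _ _ => rfl⟩
      · rw [hf5.reg _ (by decide), hf4.reg _ (by simp [Prog.regs]), f0]
      · rw [hf5.reg _ (by decide), f5]
    rw [← hK] at hE hR
    have := finish_spec (P := P) hn hE hR hw (by omega) hP (by omega) hAM (by omega) hA hA0 hfar he
    rw [hF] at this
    refine (FailBound.of_ter (this.conseq le_rfl ?_) hv5).mono le_rfl zero_le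
    rintro s6 - - ⟨lo, g0, g1, g2⟩
    exact hQ' _ (by rwa [hK]) s6 lo g0 g1 g2
  · exact FailBound.one.mono le_rfl (not_lt.1 hφ)

end

/-! ### The probability that the samples are good -/

open Classical in
/-- The probability that the set `A` is not hit by the first `k` samples from `{0, …, M - 1}`, given
the first `i` ones. -/
noncomputable def missProb (M : ℕ) (A : Finset ℕ) (k i : ℕ) (R : ℕ → ℕ) : ℝ≥0∞ :=
  if ∃ j < i, j < k ∧ R j ∈ A then 0 else (((M - A.card : ℕ) : ℝ≥0∞) * (M : ℝ≥0∞)⁻¹) ^ (k - i)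

/-- Conditional probabilities form a martingale. For `i < k` one more sample misses `A` in `M -
A.card` of `M` cases, each of which lowers the exponent by one; from `i = k` on further samples are
irrelevant, and the truncated exponent stays `0`. -/
theorem missProb_avg {M : ℕ} (hM : 0 < M) {A : Finset ℕ} (hA : A ⊆ Finset.range M) (k i : ℕ)
    (R : ℕ → ℕ) : ∑ x ∈ Finset.range M,
      (M : ℝ≥0∞)⁻¹ * missProb M A k (i + 1) (Function.update R i x) ≤ missProb M A k i R := by
  have hup : ∀ x, ∀ j < i, Function.update R i x j = R j := fun x j hj => by
    rw [Function.update_of_ne (by omega)]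
  have hM0 : (M : ℝ≥0∞) ≠ 0 := by simp; omega
  have hMt : (M : ℝ≥0∞) ≠ ⊤ := by simp
  by_cases hhit : ∃ j < i, j < k ∧ R j ∈ A
  · obtain ⟨j, hj, hjk, hjA⟩ := hhit
    rw [Finset.sum_eq_zero]
    · exact zero_le
    · intro x _
      rw [missProb, if_pos ⟨j, by omega, hjk, by rwa [hup x j hj]⟩, mul_zero]
  · have hR : missProb M A k i R = (((M - A.card : ℕ) : ℝ≥0∞) * (M : ℝ≥0∞)⁻¹) ^ (k - i) := by
      rw [missProb, if_neg hhit]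
    rw [hR]
    by_cases hik : i < k
    · have hx : ∀ x, missProb M A k (i + 1) (Function.update R i x) =
          if x ∈ A then 0 else (((M - A.card : ℕ) : ℝ≥0∞) * (M : ℝ≥0∞)⁻¹) ^ (k - (i + 1)) := by
        intro x
        rw [missProb]
        congr 1
        refine propext ⟨?_, fun hx => ⟨i, by omega, hik, by simpa using hx⟩⟩
        rintro ⟨j, hj, hjk, hjA⟩
        by_cases hji : j = i
        · subst hji; simpa using hjA
        · rw [hup x j (by omega)] at hjA
          exact absurd ⟨j, by omega, hjk, hjA⟩ hhit
      simp only [hx, mul_ite, mul_zero]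
      rw [Finset.sum_ite, Finset.sum_const_zero, zero_add, Finset.sum_const, nsmul_eq_mul]
      have hcard : ((Finset.range M).filter fun x => x ∉ A).card = M - A.card := by
        rw [← Finset.sdiff_eq_filter, Finset.card_sdiff_of_subset hA, Finset.card_range]
      rw [hcard, show k - i = k - (i + 1) + 1 by omega, pow_succ', mul_assoc]
    · rw [show k - i = 0 by omega, pow_zero]
      have hle : ∀ x, missProb M A k (i + 1) (Function.update R i x) ≤ 1 := by
        intro x
        rw [missProb]
        split
        · exact zero_le
        · rw [show k - (i + 1) = 0 by omega, pow_zero]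
      calc _ ≤ ∑ x ∈ Finset.range M, (M : ℝ≥0∞)⁻¹ := Finset.sum_le_sum fun x _ => by
              calc _ ≤ (M : ℝ≥0∞)⁻¹ * 1 := mul_le_mul_right (hle x) _
                _ = _ := mul_one _
        _ = 1 := by
          rw [Finset.sum_const, Finset.card_range, nsmul_eq_mul, ENNReal.mul_inv_cancel hM0 hMt]

/-- From 1 - x ≤ exp(-x) with x = |A|/M: k independent misses have probability at most exp(-k|A|/M)
≤ exp(-L) ≤ 2^(-L). -/
theorem missProb_zero_le {M : ℕ} (hM : 0 < M) {A : Finset ℕ} {k L : ℕ} (hA : A.card ≤ M)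
    (hk : M * L ≤ k * A.card) (R : ℕ → ℕ) : missProb M A k 0 R ≤ (2 ^ L : ℝ≥0∞)⁻¹ := by
  have hM' : (0 : ℝ) < M := by exact_mod_cast hM
  have h1 : ((M - A.card : ℕ) : ℝ≥0∞) * (M : ℝ≥0∞)⁻¹ ≤ ENNReal.ofReal (Real.exp (-(A.card / M))) := by
    rw [← ENNReal.ofReal_natCast, ← ENNReal.ofReal_natCast, ← ENNReal.ofReal_inv_of_pos hM',
      ← ENNReal.ofReal_mul (by positivity)]
    refine ENNReal.ofReal_le_ofReal ?_
    have := Real.add_one_le_exp (-((A.card : ℝ) / M))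
    rw [Nat.cast_sub hA]
    refine le_trans (le_of_eq ?_) this
    field_simp
    ring
  rw [missProb, if_neg (by simp), Nat.sub_zero]
  calc _ ≤ ENNReal.ofReal (Real.exp (-(A.card / M))) ^ k := pow_le_pow_left' h1 k
    _ = ENNReal.ofReal (Real.exp (k * (-(A.card / M)))) := by
      rw [← ENNReal.ofReal_pow (Real.exp_pos _).le, ← Real.exp_nat_mul]
    _ ≤ ENNReal.ofReal ((2 ^ L)⁻¹) := by
      refine ENNReal.ofReal_le_ofReal ?_
      have h2 : (L : ℝ) ≤ k * (A.card / M) := by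
        rw [← mul_div_assoc, le_div_iff₀ hM', mul_comm]
        exact_mod_cast hk
      calc Real.exp (k * (-(A.card / M))) ≤ Real.exp (L * (-1)) := by
            refine Real.exp_le_exp.2 ?_; linarith
        _ = (Real.exp 1 ^ L)⁻¹ := by
            rw [Real.exp_nat_mul, Real.exp_neg, inv_pow]
        _ ≤ _ := by
          gcongr
          have := Real.add_one_le_exp (1 : ℝ); linarith
    _ = _ := by
      rw [ENNReal.ofReal_inv_of_pos (by positivity), ENNReal.ofReal_pow (by norm_num)]
      norm_num

/-- The pairs of a vertex and a radius. -/
def Arcs.pairs (S : Arcs) (n : ℕ) : Finset (ℕ × ℕ) :=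
  (Finset.range S.N ×ˢ Finset.range (n + 1)).filter fun p => (S.arcsLt p.1 p.2).Nonempty

/-- The expected number of pairs that violate the definition of good samples, given the first `i`
samples. -/
noncomputable def Arcs.badCount (S : Arcs) (n L i : ℕ) (R : ℕ → ℕ) : ℝ≥0∞ :=
  ∑ p ∈ S.pairs n, missProb S.M (S.arcsLt p.1 p.2)
    ((S.M * L + (S.arcsLt p.1 p.2).card - 1) / (S.arcsLt p.1 p.2).card) i R

theorem lt_ceil_div {x a j : ℕ} (ha : 0 < a) : j < (x + a - 1) / a ↔ j * a < x := by
  rw [Nat.lt_iff_add_one_le, Nat.le_div_iff_mul_le ha, Nat.succ_mul]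
  omega

theorem Arcs.arcsLt_subset_range (S : Arcs) (v r : ℕ) : S.arcsLt v r ⊆ Finset.range S.M :=
  fun j hj => by simpa using arcsLt_lt hj

theorem Arcs.badCount_avg {S : Arcs} (hM : 0 < S.M) (n L i : ℕ) (R : ℕ → ℕ) :
    ∑ x ∈ Finset.range S.M, (S.M : ℝ≥0∞)⁻¹ * S.badCount n L (i + 1) (Function.update R i x) ≤
      S.badCount n L i R := by
  simp only [badCount, Finset.mul_sum]
  rw [Finset.sum_comm]
  exact Finset.sum_le_sum fun p _ => missProb_avg hM (S.arcsLt_subset_range _ _) _ _ _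

/-- After all samples are drawn, each summand is the indicator of a missed neighbourhood, so a sum
below `1` means that none is missed. The `M * L + 1` samples are enough, because no neighbourhood
asks for more than ⌈ML/s⌉ of them. -/
theorem Arcs.good_of_badCount {S : Arcs} {n L : ℕ} {R : ℕ → ℕ}
    (hb : S.badCount n L (S.M * L + 1) R < 1) : S.Good n L R := by
  intro v hv r hr hne
  by_contra hcon
  push Not at hcon
  refine absurd hb (not_lt.2 ?_)
  have hpos := hne.card_pos
  have hmem : (v, r) ∈ S.pairs n := by
    simp only [pairs, Finset.mem_filter, Finset.mem_product, Finset.mem_range]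
    exact ⟨⟨hv, by omega⟩, hne⟩
  refine le_trans ?_ (Finset.single_le_sum (fun _ _ => zero_le) hmem)
  rw [missProb, if_neg]
  · suffices H : (S.M * L + (S.arcsLt v r).card - 1) / (S.arcsLt v r).card ≤ S.M * L + 1 by
      rw [Nat.sub_eq_zero_of_le H, pow_zero]
    rw [Nat.div_le_iff_le_mul_add_pred hpos]
    have : S.M * L + 1 ≤ (S.arcsLt v r).card * (S.M * L + 1) := Nat.le_mul_of_pos_left _ hpos
    omega
  · rintro ⟨j, -, hj, hjA⟩
    exact hcon j ((lt_ceil_div hpos).1 hj) hjA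

/-- Union bound over the pairs of a vertex and a radius. -/
theorem Arcs.badCount_zero_le {S : Arcs} (hM : 0 < S.M) (n L : ℕ) (R : ℕ → ℕ) :
    S.badCount n L 0 R ≤ (S.N * (n + 1) : ℕ) * (2 ^ L : ℝ≥0∞)⁻¹ := by
  calc S.badCount n L 0 R ≤ ∑ p ∈ S.pairs n, (2 ^ L : ℝ≥0∞)⁻¹ := by
        refine Finset.sum_le_sum fun p hp => ?_
        refine missProb_zero_le hM (S.card_arcsLt_le _ _) ?_ R
        have hpos := (Finset.mem_filter.1 hp).2.card_pos
        by_contra hlt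
        have := (lt_ceil_div hpos).2 (not_le.1 hlt)
        omega
    _ = ((S.pairs n).card : ℝ≥0∞) * (2 ^ L : ℝ≥0∞)⁻¹ := by rw [Finset.sum_const, nsmul_eq_mul]
    _ ≤ _ := by
      refine mul_le_mul_left (Nat.cast_le.2 ?_) _
      refine (Finset.card_filter_le _ _).trans ?_
      rw [Finset.card_product, Finset.card_range, Finset.card_range]

/-! ### Balls and the directed diameter -/

theorem HasWalk.append {V : Type*} {G : Digraph V} {k : ℕ} {u x v : V} (h : HasWalk G k u x)
    (hv : G.Adj x v) : HasWalk G (k + 1) u v := by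
  induction k generalizing u with
  | zero => exact ⟨v, h ▸ hv, rfl⟩
  | succ k ih =>
    obtain ⟨y, hy, h⟩ := h
    exact ⟨y, hy, ih h⟩

/-- The tail of the arc `j`. -/
def arcTail {n m : ℕ} (e : Fin m → Fin n × Fin n) (j : ℕ) : ℕ :=
  if h : j < m then (e ⟨j, h⟩).1 else 0

/-- The head of the arc `j`. -/
def arcHead {n m : ℕ} (e : Fin m → Fin n × Fin n) (j : ℕ) : ℕ :=
  if h : j < m then (e ⟨j, h⟩).2 else 0

section

variable {n m : ℕ} {e : Fin m → Fin n × Fin n}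

theorem arcTail_lt : ∀ j < m, arcTail e j < n := fun j hj => by simp [arcTail, hj]

theorem arcHead_lt : ∀ j < m, arcHead e j < n := fun j hj => by simp [arcHead, hj]

/-- The disjoint union of the graph of the arcs `e` and its reverse. -/
def doubledOf (e : Fin m → Fin n × Fin n) : Arcs :=
  doubled n m (arcTail e) (arcHead e) arcTail_lt arcHead_lt

/-- An arc whose tail is a vertex below `n` has an index below `m`: the tails of the reversed arcs
are shifted by `n`. -/
theorem exists_adj_of_arc {j : ℕ} {u : Fin n}
    (hu : (doubledOf e).tl j = u) :
    ∃ v : Fin n, (doubledOf e).hd j = v ∧ (arcsToDigraph e).Adj u v := by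
  have hun := u.2
  have hjm : j < m := by
    by_contra hcon
    simp only [doubledOf, doubled, if_neg hcon] at hu
    omega
  simp only [doubledOf, doubled, if_pos hjm, arcTail, arcHead, dif_pos hjm] at hu ⊢
  exact ⟨(e ⟨j, hjm⟩).2, rfl, ⟨j, hjm⟩, Prod.ext (Fin.ext hu) rfl⟩

theorem mem_ball_of_adj {u v : Fin n} (h : (arcsToDigraph e).Adj u v) :
    (v : ℕ) ∈ (doubledOf e).ball u 1 := by
  obtain ⟨i, hi⟩ := h
  refine Arcs.mem_ball_succ.2 (.inr ⟨i, ?_, ?_, ?_⟩)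
  · simp [doubledOf, doubled]; omega
  · simp [doubledOf, doubled, arcTail, hi, Arcs.ball]
  · simp [doubledOf, doubled, arcHead, hi]

theorem mem_ball_of_hasWalk {k : ℕ} {u v : Fin n} (h : HasWalk (arcsToDigraph e) k u v) :
    (v : ℕ) ∈ (doubledOf e).ball u k := by
  induction k generalizing u with
  | zero => rw [show u = v from h]; exact Arcs.mem_ball_self _ _
  | succ k ih =>
    obtain ⟨x, hx, h⟩ := h
    rw [Nat.add_comm]
    exact Arcs.ball_trans (mem_ball_of_adj hx) (ih h)

theorem exists_hasWalk {k y : ℕ} {u : Fin n} (hy : y ∈ (doubledOf e).ball u k) :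
    ∃ v : Fin n, y = v ∧ ∃ j ≤ k, HasWalk (arcsToDigraph e) j u v := by
  induction k generalizing y with
  | zero =>
    simp only [Arcs.ball, Finset.mem_singleton] at hy
    exact ⟨u, hy, 0, le_rfl, rfl⟩
  | succ k ih =>
    rcases Arcs.mem_ball_succ.1 hy with h1 | ⟨j, hj, h1, rfl⟩
    · obtain ⟨v, hv, i, hi, hw⟩ := ih h1
      exact ⟨v, hv, i, by omega, hw⟩
    · obtain ⟨x, hx, i, hi, hw⟩ := ih h1
      obtain ⟨v, hv, ha⟩ := exists_adj_of_arc hx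
      exact ⟨v, hv, i + 1, by omega, hw.append ha⟩

theorem le_directedDiam {d : ℕ} (h : Far (doubledOf e) n d) :
    (d : ℕ∞) ≤ directedDiam (arcsToDigraph e) := by
  obtain ⟨u, v, hu, hv, H⟩ := h
  refine le_trans ?_ (le_iSup₂_of_le (⟨u, hu⟩ : Fin n) (⟨v, hv⟩ : Fin n) le_rfl)
  refine le_iInf₂ fun k hk => ?_
  by_contra hlt
  exact H k (by exact_mod_cast not_le.1 hlt) (mem_ball_of_hasWalk hk)

theorem directedDiam_le {d : ℕ} (h : ¬ Far (doubledOf e) n (d + 1)) :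
    directedDiam (arcsToDigraph e) ≤ d := by
  refine iSup₂_le fun u v => ?_
  have : ∃ k < d + 1, (v : ℕ) ∈ (doubledOf e).ball u k := by
    by_contra hcon
    push Not at hcon
    exact h ⟨u, v, u.2, v.2, hcon⟩
  obtain ⟨k, hk, hm⟩ := this
  obtain ⟨v', hv', j, hj, hw⟩ := exists_hasWalk hm
  obtain rfl : v = v' := Fin.ext hv'
  refine (iInf₂_le j hw).trans ?_
  exact_mod_cast (by omega : j ≤ d)

theorem directedDiam_eq_top (h : ∀ d, Far (doubledOf e) n d) :
    directedDiam (arcsToDigraph e) = ⊤ :=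
  ENat.eq_top_iff_forall_ge.2 fun d => le_directedDiam (h d)

/-- With fewer arcs than vertices some vertex is not the tail of any arc, so it reaches no other
vertex and the diameter is infinite. This case is answered at once, which permits the assumption `n
≤ m` elsewhere. -/
theorem far_of_arcs_lt (hn : 2 ≤ n) (hmn : m < n) (d : ℕ) : Far (doubledOf e) n d := by
  obtain ⟨u, hu⟩ : ∃ u : Fin n, ∀ i, (e i).1 ≠ u := by
    by_contra hcon
    push Not at hcon
    have := Fintype.card_le_of_surjective (fun i => (e i).1) hcon
    simp at this
    omega
  obtain ⟨v, hv⟩ : ∃ v : Fin n, v ≠ u :=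
    haveI : Nontrivial (Fin n) := Fin.nontrivial_iff_two_le.2 hn
    exists_ne u
  refine ⟨u, v, u.2, v.2, fun k _ hk => hv ?_⟩
  obtain ⟨v', hv', j, -, hw⟩ := exists_hasWalk hk
  obtain rfl : v = v' := Fin.ext hv'
  rcases j with _ | j
  · exact hw.symm
  · obtain ⟨x, ⟨i, hi⟩, -⟩ := hw
    exact absurd (by rw [hi]) (hu i)

theorem isSevenFourthsApprox_zero (hn : n < 2) : IsSevenFourthsApprox (arcsToDigraph e) 0 := by
  have : directedDiam (arcsToDigraph e) = 0 := by
    refine le_antisymm (iSup₂_le fun u v => ?_) (zero_le)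
    have huv : u = v := Fin.ext (by omega)
    exact iInf₂_le 0 huv
  exact ⟨this.le, by simp⟩

theorem isSevenFourthsApprox_top (h : ∀ d, Far (doubledOf e) n d) :
    IsSevenFourthsApprox (arcsToDigraph e) ⊤ := by
  rw [IsSevenFourthsApprox, directedDiam_eq_top h]
  exact ⟨le_rfl, by simp⟩

/-- The number `(4 * lo + 6) / 7` is 4 lo/7 rounded up, so seven times it is at least 4 lo. -/
theorem isSevenFourthsApprox_of_far {lo : ℕ} (h1 : Far (doubledOf e) n ((4 * lo + 6) / 7))
    (h2 : ¬ Far (doubledOf e) n (lo + 1)) : IsSevenFourthsApprox (arcsToDigraph e) lo := by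
  refine ⟨directedDiam_le h2, ?_⟩
  calc (4 * lo : ℕ∞) ≤ 7 * (((4 * lo + 6) / 7 : ℕ) : ℕ∞) := by
        exact_mod_cast (by omega : 4 * lo ≤ 7 * ((4 * lo + 6) / 7))
    _ ≤ _ := mul_le_mul_right (le_directedDiam h1) _

/-! ### The first steps of the algorithm -/

theorem diameter_trivial {w c : ℕ} {P : Prog} {s : Memory} (h0 : s.reg 0 = n) (h1 : s.reg 1 = m)
    (hw : 1 < 2 ^ w) (hnm : n < 2 ∨ m < n) :
    Ter w (diameter P c) s 10 (fun s' => s'.reg 0 = if n < 2 then 1 else 0) := by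
  refine Ter.seq' (t1 := 3) (t2 := 6) (R := fun s1 => s1.reg 0 = n ∧ s1.reg 1 = m ∧
    s1.reg 25 = if 1 < n then 1 else 0) (Ter.of_wp ?_ (by simp [Prog.size])) ?_ (by omega)
  · simp [h0, h1]
    exact ⟨hw, fun _ => hw⟩
  rintro s1 - - ⟨e0, e1, e25⟩
  refine Ter.ite (t := 5) (fun hne => ?_) fun heq => ?_
  · have hn : 1 < n := by by_contra hcon; simp [hcon] at e25; omega
    refine Ter.seq' (t1 := 1) (t2 := 3) (R := fun s2 => s2.reg 25 = 1)
      (Ter.of_wp ?_ (by simp [Prog.size])) ?_ (by omega)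
    · simp [e0, e1, show m < n by omega]
      exact hw
    · rintro s2 - - e25
      refine Ter.ite (t := 2) (fun _ => ?_) fun heq => by omega
      refine (Ter.const (Fits.zero _) ?_).conseq (by omega) fun _ _ _ h => h
      simp; omega
  · have hn : ¬ 1 < n := by intro hcon; simp [hcon] at e25; omega
    refine (Ter.const hw ?_).conseq (by omega) fun _ _ _ h => h
    simp; omega

theorem diameter_failBound {w c T : ℕ} {P : Prog} {s : Memory} {Q : Memory → Prop} {δ : ℝ≥0∞}
    (hs : s.Valid w) (h0 : s.reg 0 = n) (h1 : s.reg 1 = m) (hw : 1 < 2 ^ w) (hn : 2 ≤ n)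
    (hnm : n ≤ m) (h : ∀ s', s'.Valid w → s'.reg 0 = s.reg 0 → s'.reg 1 = s.reg 1 →
      s'.arr = s.arr → FailBound w Q T (some ([search P c], s')) δ) :
    FailBound w Q (T + 10) (some ([diameter P c], s)) δ := by
  refine .seq (t := 3) (T := T + 6) (R := fun s1 => s1.reg 0 = n ∧ s1.reg 1 = m ∧
    s1.reg 25 = 1 ∧ s1.arr = s.arr) (Ter.of_wp ?_ (by simp [Prog.size])) hs ?_ (by omega)
  · simp [h0, h1, show 1 < n by omega]
    exact hw
  rintro s1 hv1 - ⟨e0, e1, e25, ea⟩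
  refine .ite (T := T + 5) (fun _ => ?_) fun heq => by omega
  refine .seq (t := 1) (T := T + 3) (R := fun s2 => s2.reg 0 = n ∧ s2.reg 1 = m ∧
    s2.reg 25 = 0 ∧ s2.arr = s.arr) (Ter.of_wp ?_ (by simp [Prog.size])) hv1 ?_ (by omega)
  · simp [e0, e1, ea, show ¬ m < n by omega]
  rintro s2 hv2 - ⟨e0, e1, e25, ea⟩
  refine .ite (T := T + 2) (fun hne => by omega) fun _ => ?_
  exact (h s2 hv2 (by rw [e0, h0]) (by rw [e1, h1]) ea).mono (by omega) le_rfl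

end

/-! ### Bounds for the running time -/

/-- Taking p-th roots; since `B`, `M` and `L` are at least `1`, their exponents may be enlarged for
a uniform form. -/
theorem le_of_rpow_le {a B M L p q r α : ℝ} (h : a ^ p ≤ B * M ^ q * L ^ r) (hB : 1 ≤ B)
    (hM : 1 ≤ M) (hL : 1 ≤ L) (hp : 1 ≤ p) (hq : q ≤ α * p) (hr : r ≤ p) :
    a ≤ B * M ^ α * L := by
  by_contra! hlt
  have hpos : 0 < B * M ^ α * L := by positivity
  have h1 := Real.rpow_lt_rpow hpos.le hlt (by linarith : 0 < p)
  rw [Real.mul_rpow (by positivity) (by positivity), Real.mul_rpow (by positivity) (by positivity),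
    ← Real.rpow_mul (by positivity)] at h1
  have h2 : B ≤ B ^ p := Real.self_le_rpow_of_one_le hB hp
  have h3 : M ^ q ≤ M ^ (α * p) := Real.rpow_le_rpow_of_exponent_le hM hq
  have h4 : L ^ r ≤ L ^ p := Real.rpow_le_rpow_of_exponent_le hL hr
  have h5 : B * M ^ q * L ^ r ≤ B ^ p * M ^ (α * p) * L ^ p := by gcongr
  linarith

/-- Exceeding the budget M a bounds a from above. The number l of vertices with large buckets is at
most of order M³L/a⁵, and the number K of samples at most of order ML/a. The costs l K of storing
the matrices and (l + K) K^(ω-1) of multiplying them decrease as a grows, and M a increases, so each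
comparison is solved for a. The worst exponent is α, from M a ≤ O(l K^(ω-1)). -/
theorem MayAbort.le {ω α c : ℝ} {M L a T : ℕ} (hω : 2 ≤ ω) (hα : α = (ω + 1) / (ω + 5))
    (hc : 1 ≤ c) (hM : 1 ≤ M) (hL : 1 ≤ L) (ha : 1 ≤ a)
    (hT : (T : ℝ) ≤ c * ((M * L / a + 1 : ℕ) : ℝ) ^ ω) (h : MayAbort M L a T) :
    (a : ℝ) ≤ 8 * c * 2 ^ ω * (M : ℝ) ^ α * L := by
  obtain ⟨haM, l, hl, hcase⟩ := h
  have haM' : a ≤ M := le_trans (Nat.le_mul_self a) haM.le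
  obtain ⟨K, hK⟩ : ∃ K, M * L / a + 1 = K := ⟨_, rfl⟩
  have hKa : K * a ≤ 2 * (M * L) := hK ▸ samples_mul_le haM' hL
  have hMa := radius_mul_le haM'
  rw [hK] at hl hcase hT
  have hK1 : 1 ≤ K := hK ▸ Nat.le_add_left 1 _
  have hl5 : l * a ^ 5 ≤ 4 * M ^ 3 * L := by
    have h1 : a * a * a ≤ M * (a * a * a / M + 1) := (Nat.lt_mul_div_succ _ hM).le
    calc l * a ^ 5 = l * (a * a * a) * (a * a) := by ring
      _ ≤ l * (M * (a * a * a / M + 1)) * (a * a) := by gcongr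
      _ = M * (l * (a * a * a / M + 1)) * (a * a) := by ring
      _ ≤ M * (K * (M / a + 1)) * (a * a) := by gcongr
      _ = M * (K * a) * ((M / a + 1) * a) := by ring
      _ ≤ M * (2 * (M * L)) * (2 * M) := by gcongr
      _ = _ := by ring
  have ha0 : (0 : ℝ) < a := by exact_mod_cast ha
  have hM0 : (0 : ℝ) < M := by exact_mod_cast hM
  have hL0 : (0 : ℝ) < L := by exact_mod_cast hL
  have hK0 : (0 : ℝ) < K := by exact_mod_cast hK1
  have hM1 : (1 : ℝ) ≤ M := by exact_mod_cast hM
  have hL1 : (1 : ℝ) ≤ L := by exact_mod_cast hL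
  have h2ω : (2 : ℝ) ≤ 2 ^ ω := by
    calc (2 : ℝ) = 2 ^ (1 : ℝ) := (Real.rpow_one 2).symm
      _ ≤ _ := Real.rpow_le_rpow_of_exponent_le (by norm_num) (by linarith)
  have hαp : α * (ω + 5) = ω + 1 := by rw [hα]; field_simp
  have hα7 : 3 ≤ α * 7 := by rw [hα, div_mul_eq_mul_div, le_div_iff₀ (by linarith)]; linarith
  have hB : 1 ≤ 8 * c * 2 ^ ω := by nlinarith
  have hKar : (K : ℝ) * a ≤ 2 * M * L := by rw [mul_assoc]; exact_mod_cast hKa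
  have hl5r : (l : ℝ) * a ^ (5 : ℝ) ≤ 4 * M ^ (3 : ℝ) * L := by
    norm_cast
  have hKpow : ∀ p : ℝ, 0 ≤ p → (K : ℝ) ^ p * a ^ p ≤ 2 ^ p * M ^ p * L ^ p := fun p hp => by
    rw [← Real.mul_rpow hK0.le ha0.le, ← Real.mul_rpow (by norm_num) hM0.le,
      ← Real.mul_rpow (by positivity) hL0.le]
    exact Real.rpow_le_rpow (by positivity) hKar hp
  rcases hcase with hcase | hcase
  -- Too many entries of the matrices: M a < l K gives the exponent 3/7, and 3/7 ≤ α holds because ω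
  -- ≥ 2.
  · have h7 : a ^ 7 ≤ 8 * M ^ 3 * L ^ 2 := by
      refine Nat.le_of_mul_le_mul_left ?_ hM
      calc M * a ^ 7 = M * a * a ^ 6 := by ring
        _ ≤ l * K * a ^ 6 := by gcongr
        _ = l * a ^ 5 * (K * a) := by ring
        _ ≤ 4 * M ^ 3 * L * (2 * (M * L)) := by gcongr
        _ = _ := by ring
    refine le_of_rpow_le (p := 7) (q := 3) (r := 2) ?_ hB hM1 hL1 (by norm_num) hα7 (by norm_num)
    calc (a : ℝ) ^ (7 : ℝ) ≤ 8 * (M : ℝ) ^ (3 : ℝ) * (L : ℝ) ^ (2 : ℝ) := by exact_mod_cast h7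
      _ ≤ _ := by gcongr; nlinarith
  · obtain ⟨q, hq⟩ : ∃ q, (l + K - 1) / K = q := ⟨_, rfl⟩
    rw [hq] at hcase
    have hqK : q * K ≤ l + K := by
      have := Nat.div_mul_le_self (l + K - 1) K
      rw [hq] at this; omega
    have hqKr : (q : ℝ) * K ≤ l + K := by exact_mod_cast hqK
    have hKω : (K : ℝ) ^ ω = K ^ (ω - 1) * K := by
      rw [← Real.rpow_add_one hK0.ne', sub_add_cancel]
    have h1 : (M : ℝ) * a ≤ (l + K) * (c * K ^ (ω - 1)) := by
      calc (M : ℝ) * a ≤ q * T := by exact_mod_cast hcase.le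
        _ ≤ q * (c * K ^ ω) := by gcongr
        _ = (q * K) * (c * K ^ (ω - 1)) := by rw [hKω]; ring
        _ ≤ _ := by gcongr
    rcases le_total (l : ℝ) K with hlK | hlK
    · have h2 : (M : ℝ) * a ≤ 2 * c * K ^ ω := by
        calc (M : ℝ) * a ≤ (K + K) * (c * K ^ (ω - 1)) := h1.trans (by gcongr)
          _ = _ := by rw [hKω]; ring
      have h3 : (a : ℝ) ^ (ω + 1) ≤ 8 * c * 2 ^ ω * M ^ (ω - 1) * L ^ ω := by
        refine le_of_mul_le_mul_left ?_ hM0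
        calc (M : ℝ) * a ^ (ω + 1) = M * a * a ^ ω := by rw [Real.rpow_add_one ha0.ne']; ring
          _ ≤ 2 * c * K ^ ω * a ^ ω := by gcongr
          _ = 2 * c * (K ^ ω * a ^ ω) := by ring
          _ ≤ 2 * c * (2 ^ ω * M ^ ω * L ^ ω) :=
            mul_le_mul_of_nonneg_left (hKpow ω (by linarith)) (by positivity)
          _ ≤ 8 * c * (2 ^ ω * M ^ ω * L ^ ω) := by gcongr; norm_num
          _ = _ := by
            rw [show (M : ℝ) ^ ω = M ^ (ω - 1) * M by
              rw [← Real.rpow_add_one hM0.ne', sub_add_cancel]]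
            ring
      -- If l ≤ K, a bounded number of blocks is multiplied and the exponent is (ω - 1)/(ω + 1),
      -- which is at most α only for ω ≤ 3. For larger ω already a² < M suffices, since then α ≥
      -- 1/2.
      by_cases h3ω : ω ≤ 3
      · refine le_of_rpow_le h3 hB hM1 hL1 (by linarith) ?_ (by linarith)
        rw [hα, div_mul_eq_mul_div, le_div_iff₀ (by linarith)]
        nlinarith
      · refine le_of_rpow_le (p := 2) (q := 1) (r := 0) ?_ hB hM1 hL1 (by norm_num) ?_ (by norm_num)
        · calc (a : ℝ) ^ (2 : ℝ) ≤ M := by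
                rw [Real.rpow_two, sq]; exact_mod_cast haM.le
            _ ≤ 8 * c * 2 ^ ω * M := le_mul_of_one_le_left hM0.le hB
            _ = _ := by simp
        · rw [hα, div_mul_eq_mul_div, le_div_iff₀ (by linarith)]
          linarith
    -- The balanced case: multiplying by a^(ω+4) gives M a^(ω+5) ≤ O(M^(ω+2) L^ω), whence the
    -- exponent (ω+1)/(ω+5).
    · have h2 : (M : ℝ) * a ≤ 2 * c * (l * K ^ (ω - 1)) := by
        calc (M : ℝ) * a ≤ (l + l) * (c * K ^ (ω - 1)) := h1.trans (by gcongr)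
          _ = _ := by ring
      refine le_of_rpow_le (p := ω + 5) (q := ω + 1) (r := ω) ?_ hB hM1 hL1 (by linarith) hαp.ge
        (by linarith)
      refine le_of_mul_le_mul_left ?_ hM0
      have e1 : (a : ℝ) ^ (ω + 5) = a * (a ^ (5 : ℝ) * a ^ (ω - 1)) := by
        rw [← Real.rpow_add ha0, ← Real.rpow_one_add' ha0.le (by linarith)]
        congr 1; ring
      have e2 : (M : ℝ) * M ^ (ω + 1) = M ^ (3 : ℝ) * M ^ (ω - 1) := by
        rw [← Real.rpow_add hM0, ← Real.rpow_one_add' hM0.le (by linarith)]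
        congr 1; ring
      have e3 : (L : ℝ) ^ ω = L * L ^ (ω - 1) := by
        rw [← Real.rpow_one_add' hL0.le (by linarith)]
        congr 1; ring
      have e4 : (2 : ℝ) ^ ω = 2 * 2 ^ (ω - 1) := by
        rw [← Real.rpow_one_add' (by norm_num) (by linarith)]
        congr 1; ring
      calc (M : ℝ) * a ^ (ω + 5) = M * a * (a ^ (5 : ℝ) * a ^ (ω - 1)) := by rw [e1]; ring
        _ ≤ 2 * c * (l * K ^ (ω - 1)) * (a ^ (5 : ℝ) * a ^ (ω - 1)) := by gcongr
        _ = 2 * c * (l * a ^ (5 : ℝ)) * (K ^ (ω - 1) * a ^ (ω - 1)) := by ring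
        _ ≤ 2 * c * (4 * M ^ (3 : ℝ) * L) * (2 ^ (ω - 1) * M ^ (ω - 1) * L ^ (ω - 1)) := by
          refine mul_le_mul ?_ (hKpow _ (by linarith)) (by positivity) (by positivity)
          gcongr
        _ ≤ 2 * c * (4 * M ^ (3 : ℝ) * L) * (2 ^ (ω - 1) * M ^ (ω - 1) * L ^ (ω - 1)) * 2 :=
          le_mul_of_one_le_right (by positivity) (by norm_num)
        _ = 8 * c * (2 * 2 ^ (ω - 1)) * (M ^ (3 : ℝ) * M ^ (ω - 1)) * (L * L ^ (ω - 1)) := by ring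
        _ = _ := by rw [← e2, ← e3, ← e4]; ring

theorem time_le {n m M A ell L c E : ℕ} (hM : M = m + m) (hnm : n ≤ m) (hA : 1 ≤ A) (hell : 1 ≤ ell)
    (hL : L = (c + 4) * ell) :
    100 * (n + m + 1) + (400 * (M + 1) + 40) + (ell * 10 + 12) +
      ((M * L + 1) * 10 + 10) +
      ((ell + 1 + (ell + 1)) * (E * (M * A * L ^ 2) + 20) + (ell + 1) * 10 + 30) + 30 + 10 ≤
    (1500 + 20 * (c + 4) + 8 * E * (c + 4) ^ 2) * ((m + 2) * A * ell ^ 3) := by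
  subst hM
  obtain ⟨X, hX⟩ : ∃ X, m + 2 = X := ⟨_, rfl⟩
  have hU1 : X * ell ≤ X * A * ell ^ 3 := by
    calc X * ell = X * 1 * ell ^ 1 := by ring
      _ ≤ _ := by gcongr; omega
  have hX1 : X ≤ X * ell := Nat.le_mul_of_pos_right _ hell
  have hX2 : ell ≤ X * ell := Nat.le_mul_of_pos_left _ (by omega)
  rw [hX]
  have h1 : ((m + m) * L + 1) * 10 ≤ 20 * (c + 4) * (X * A * ell ^ 3) + 10 := by
    rw [hL]
    calc ((m + m) * ((c + 4) * ell) + 1) * 10 = 20 * (c + 4) * (m * ell) + 10 := by ring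
      _ ≤ 20 * (c + 4) * (X * ell) + 10 := by gcongr; omega
      _ ≤ _ := by gcongr
  have h2 : (ell + 1 + (ell + 1)) * (E * ((m + m) * A * L ^ 2) + 20) ≤
      8 * E * (c + 4) ^ 2 * (X * A * ell ^ 3) + 80 * (X * A * ell ^ 3) := by
    calc (ell + 1 + (ell + 1)) * (E * ((m + m) * A * L ^ 2) + 20)
        ≤ (4 * ell) * (E * ((X + X) * A * L ^ 2) + 20) := by gcongr <;> omega
      _ = 8 * E * (c + 4) ^ 2 * (X * A * ell ^ 3) + 80 * ell := by rw [hL]; ring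
      _ ≤ _ := by gcongr; omega
  have e : (1500 + 20 * (c + 4) + 8 * E * (c + 4) ^ 2) * (X * A * ell ^ 3) =
    1500 * (X * A * ell ^ 3) + 20 * (c + 4) * (X * A * ell ^ 3) +
      8 * E * (c + 4) ^ 2 * (X * A * ell ^ 3) := by ring
  rw [e]
  omega

/-- Rounding up costs at most one, which is at most log X/log 2 for X ≥ 2; and 2/log 2 < 4. -/
theorem clog_le_log {X : ℕ} (hX : 2 ≤ X) : (Nat.clog 2 X : ℝ) ≤ 4 * Real.log X := by
  have h1 := Nat.pow_pred_clog_lt_self (b := 2) (by norm_num) (x := X) (by omega)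
  have h2 := Nat.clog_pos (b := 2) (n := X) (by norm_num) (by omega)
  have hlog2 := Real.log_two_gt_d9
  have h3 : ((Nat.clog 2 X - 1 : ℕ) : ℝ) * Real.log 2 ≤ Real.log X := by
    rw [← Real.log_pow]
    refine Real.log_le_log (by positivity) ?_
    exact_mod_cast h1.le
  rw [Nat.cast_sub (Nat.succ_le_of_lt h2), Nat.cast_one] at h3
  have h4 : Real.log 2 ≤ Real.log X := Real.log_le_log (by norm_num) (by exact_mod_cast hX)
  have h5 : (1 : ℝ) ≤ Nat.clog 2 X := by exact_mod_cast h2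
  nlinarith

/-- The base is at most the power `2 * c + 12` of `n + m + 2`, where numerical constants are
absorbed by powers of two. The exponent `q + 3` serves the multiplication program and the cubic
indices at once. -/
theorem word_le {n m c ell L q w : ℕ} (hell : ell = Nat.clog 2 (m + 2))
    (hL : L = (c + 4) * ell) (hw : (n + m + 2) ^ ((2 * c + 12) * (q + 3)) ≤ 2 ^ w) :
    (n + n + (m + m) + (m + m) * L + 3) ^ (q + 3) ≤ 2 ^ w := by
  refine le_trans ?_ hw
  rw [pow_mul]
  refine Nat.pow_le_pow_left ?_ _
  obtain ⟨Y, hY⟩ : ∃ Y, n + m + 2 = Y := ⟨_, rfl⟩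
  have hellY : ell ≤ Y := by
    rw [hell]
    exact (Nat.clog_le_of_le_pow (Nat.lt_two_pow_self).le).trans (by omega)
  rw [hY]
  calc n + n + (m + m) + (m + m) * L + 3 ≤ (Y + Y) * 1 + (Y + Y) * ((c + 4) * Y) := by
        have : (m + m) * L ≤ (Y + Y) * ((c + 4) * Y) := by rw [hL]; gcongr <;> omega
        omega
    _ ≤ (Y + Y) * Y + (Y + Y) * ((c + 4) * Y) := by gcongr; omega
    _ = (2 * c + 10) * Y ^ 2 := by ring
    _ ≤ 2 ^ (2 * c + 10) * Y ^ 2 := by gcongr; exact Nat.lt_two_pow_self.le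
    _ ≤ Y ^ (2 * c + 10) * Y ^ 2 := by gcongr; omega
    _ = _ := by ring

/-- By the choice of `L`, 2^L ≥ (m + 2)^(c + 4), and the number of pairs is at most (m + 2)³. -/
theorem failure_le {n m c L : ℕ} (hn : n ≤ m) (hL : L = (c + 4) * Nat.clog 2 (m + 2)) :
    (((n + n) * (n + 1) : ℕ) : ℝ≥0∞) * (2 ^ L : ℝ≥0∞)⁻¹ ≤ ((m + 2 : ℝ≥0∞) ^ c)⁻¹ := by
  have h1 : m + 2 ≤ 2 ^ Nat.clog 2 (m + 2) := Nat.le_pow_clog (by norm_num) _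
  have h2 : (n + n) * (n + 1) * (m + 2) ^ c ≤ 2 ^ L := by
    calc (n + n) * (n + 1) * (m + 2) ^ c ≤ ((m + 2) * (m + 2)) * (m + 2) * (m + 2) ^ c := by
          gcongr
          · nlinarith
          · omega
      _ ≤ (m + 2) ^ (c + 4) := by
          rw [show c + 4 = c + 3 + 1 by omega, pow_succ (m + 2) (c + 3)]
          calc _ = (m + 2) ^ (c + 3) * 1 := by ring
            _ ≤ _ := by gcongr; omega
      _ ≤ (2 ^ Nat.clog 2 (m + 2)) ^ (c + 4) := Nat.pow_le_pow_left h1 _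
      _ = 2 ^ L := by rw [← pow_mul, hL, Nat.mul_comm]
  have h3 : (((n + n) * (n + 1) : ℕ) : ℝ≥0∞) * (m + 2 : ℝ≥0∞) ^ c ≤ 2 ^ L := by exact_mod_cast h2
  rw [← div_eq_mul_inv, ENNReal.div_le_iff (by simp) (by simp), mul_comm ((m + 2 : ℝ≥0∞) ^ c)⁻¹, ← div_eq_mul_inv,
    ENNReal.le_div_iff_mul_le (by simp) (by simp)]
  exact h3

/-- A matrix multiplication exponent provides the product of square matrices, for all random
choices. -/
theorem IsMatMulExponent.exists_multiplies {ω : ℝ} (h : IsMatMulExponent ω) :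
    ∃ (P : Prog) (q : ℕ) (C : ℝ), 1 ≤ C ∧ ∀ k w : ℕ, 0 < k → (k + 2) ^ q ≤ 2 ^ w →
      Multiplies P w k ⌊C * (k : ℝ) ^ ω⌋₊ := by
  obtain ⟨P, q, C, h⟩ := h
  refine ⟨P, q, max C 1, le_max_right _ _, fun k w hk hw A B hA hB s hs hAB => ?_⟩
  obtain ⟨T, hT, hp⟩ := h k w hk hw A B hA hB s hs hAB
  refine (Ev.of_probHalts hp).mono (fun _ h => h) (Nat.le_floor (hT.trans ?_))
  gcongr
  exact le_max_left _ _

/-- An upper bound for the size parameter during the search. -/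
noncomputable def sizeBound (ω α C : ℝ) (M L : ℕ) : ℕ :=
  min M ⌊16 * C * 2 ^ ω * (M : ℝ) ^ α * L⌋₊

section

variable {ω α C : ℝ} {M L : ℕ}

/-- The constant 16 in `sizeBound` is twice the 8 of `MayAbort.le`, so that it also covers the value
after doubling. The cap `M` survives because an aborted test has a² < M. -/
theorem two_mul_le_sizeBound {a T : ℕ} (hω : 2 ≤ ω) (hα : α = (ω + 1) / (ω + 5)) (hC : 1 ≤ C)
    (hM : 2 ≤ M) (hL : 1 ≤ L) (ha : 1 ≤ a)
    (hT : (T : ℝ) ≤ C * ((M * L / a + 1 : ℕ) : ℝ) ^ ω) (h : MayAbort M L a T) :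
    2 * a ≤ sizeBound ω α C M L := by
  refine le_min ?_ (Nat.le_floor ?_)
  · have haM := h.1
    rcases Nat.lt_or_ge a 2 with h2 | h2
    · omega
    · exact (Nat.mul_le_mul_right a h2).trans haM.le
  · have := h.le hω hα hC (by omega) hL ha hT
    push_cast
    linarith

/-- The starting value is of order M^(1/3), and α ≥ 1/3. -/
theorem le_sizeBound {a : ℕ} (hω : 2 ≤ ω) (hα : α = (ω + 1) / (ω + 5)) (hC : 1 ≤ C)
    (hM : 4 ≤ M) (hL : 1 ≤ L) (h : a * a * a ≤ 8 * M) : a ≤ sizeBound ω α C M L := by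
  refine le_min ?_ (Nat.le_floor ?_)
  · by_contra! hlt
    have h1 : M * M * M < a * a * a := by gcongr
    have h2 : 4 * 4 * M ≤ M * M * M := by gcongr
    omega
  · have hM1 : (1 : ℝ) ≤ M := by exact_mod_cast (by omega : 1 ≤ M)
    have hL1 : (1 : ℝ) ≤ L := by exact_mod_cast hL
    have h1 : (a : ℝ) ≤ 8 * (M : ℝ) ^ α * L := by
      refine le_of_rpow_le (p := 3) (q := 1) (r := 0) ?_ (by norm_num) hM1 hL1 (by norm_num) ?_
        (by norm_num)
      · have : ((a * a * a : ℕ) : ℝ) ≤ (8 * M : ℕ) := by exact_mod_cast h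
        push_cast at this
        calc (a : ℝ) ^ (3 : ℝ) = a * a * a := by norm_cast; ring
          _ ≤ 8 * M := this
          _ = _ := by simp
      · rw [hα, div_mul_eq_mul_div, le_div_iff₀ (by linarith)]
        linarith
    have h2ω : (1 : ℝ) ≤ 2 ^ ω := Real.one_le_rpow (by norm_num) (by linarith)
    refine h1.trans ?_
    gcongr
    nlinarith

end

/-- Three logarithms come from L² and the number of rounds, and the fourth from the factor L in
`sizeBound`. -/
theorem real_time_le {ω α C D : ℝ} {m c ell L A T : ℕ} (hα0 : 0 ≤ α) (hα1 : α ≤ 1)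
    (hC : 0 ≤ C) (hD : 0 ≤ D) (hell : ell = Nat.clog 2 (m + 2)) (hL : L = (c + 4) * ell)
    (hA : A = sizeBound ω α C (m + m) L) (hT : (T : ℝ) ≤ D * ((m + 2) * A * ell ^ 3)) :
    (T : ℝ) ≤ D * (32 * C * 2 ^ ω * (c + 4) * 4 ^ 4) * (m + 2 : ℝ) ^ (1 + α) *
      Real.log (m + 2) ^ 4 := by
  have hX : (0 : ℝ) < m + 2 := by positivity
  have hlog : (ell : ℝ) ≤ 4 * Real.log (m + 2) := by
    rw [hell]; exact_mod_cast clog_le_log (X := m + 2) (by omega)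
  have hAle : (A : ℝ) ≤ 16 * C * 2 ^ ω * (2 * (m + 2 : ℝ) ^ α) * ((c + 4) * ell) := by
    rw [hA]
    refine (Nat.cast_le.2 (min_le_right _ _)).trans ((Nat.floor_le (by positivity)).trans ?_)
    have h1 : ((m + m : ℕ) : ℝ) ^ α ≤ 2 * (m + 2 : ℝ) ^ α := by
      calc ((m + m : ℕ) : ℝ) ^ α ≤ (2 * (m + 2 : ℝ)) ^ α := by
            refine Real.rpow_le_rpow (by positivity) ?_ hα0
            push_cast; linarith
        _ = 2 ^ α * (m + 2 : ℝ) ^ α := Real.mul_rpow (by norm_num) hX.le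
        _ ≤ 2 ^ (1 : ℝ) * (m + 2 : ℝ) ^ α := by
            gcongr
            · norm_num
        _ = _ := by rw [Real.rpow_one]
    rw [hL]; push_cast
    gcongr
    exact_mod_cast h1
  calc (T : ℝ) ≤ D * ((m + 2) * A * ell ^ 3) := hT
    _ ≤ D * ((m + 2) * (16 * C * 2 ^ ω * (2 * (m + 2 : ℝ) ^ α) * ((c + 4) * ell)) * ell ^ 3) := by
      gcongr
    _ = D * (32 * C * 2 ^ ω * (c + 4)) * ((m + 2) * (m + 2 : ℝ) ^ α) * ell ^ 4 := by ring
    _ ≤ D * (32 * C * 2 ^ ω * (c + 4)) * ((m + 2) * (m + 2 : ℝ) ^ α) *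
        (4 * Real.log (m + 2)) ^ 4 := by gcongr
    _ = _ := by rw [Real.rpow_add hX, Real.rpow_one]; ring

theorem const_time_le {α C : ℝ} {m : ℕ} (hα0 : 0 ≤ α) (hC : 160 ≤ C) :
    (10 : ℝ) ≤ C * (m + 2 : ℝ) ^ (1 + α) * Real.log (m + 2) ^ 4 := by
  have h1 : (1 : ℝ) ≤ (m + 2 : ℝ) ^ (1 + α) :=
    Real.one_le_rpow (by linarith [(Nat.cast_nonneg m : (0 : ℝ) ≤ m)]) (by linarith)
  have h2 : (1 / 2 : ℝ) ≤ Real.log (m + 2) := by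
    have := Real.log_two_gt_d9
    have : Real.log 2 ≤ Real.log (m + 2) :=
      Real.log_le_log (by norm_num) (by linarith [(Nat.cast_nonneg m : (0 : ℝ) ≤ m)])
    linarith
  calc (10 : ℝ) = 160 * 1 * (1 / 2) ^ 4 := by norm_num
    _ ≤ _ := by gcongr

theorem theorem4 (ω : ℝ) (hω2 : 2 ≤ ω) (hω : IsMatMulExponent ω)
    (α : ℝ) (hα : α = (ω + 1) / (ω + 5)) :
    (∀ c : ℕ, ∃ (P : Prog) (q k : ℕ) (C : ℝ),
      ∀ (n m w : ℕ) (e : Fin m → Fin n × Fin n), (n + m + 2) ^ q ≤ 2 ^ w →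
        ∀ s : Memory, s.Valid w → HoldsArcs e s →
          ∃ T : ℕ, (T : ℝ) ≤ C * (m + 2 : ℝ) ^ (1 + α) * Real.log (m + 2) ^ k ∧
            probHalts w T P s (fun _ => True) = 1 ∧
            1 - ((m + 2 : ENNReal) ^ c)⁻¹ ≤
              probHalts w T P s
                (fun s' => IsSevenFourthsApprox (arcsToDigraph e) (decodeOutput (s'.reg 0)))) ∧
    (ω ≤ 2.3728596 → α ≤ 0.4575) := by
  have hα0 : 0 ≤ α := by rw [hα]; exact div_nonneg (by linarith) (by linarith)
  have hα1 : α ≤ 1 := by rw [hα, div_le_one (by linarith)]; linarith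
  refine ⟨fun c => ?_, fun h => ?_⟩
  swap
  · rw [hα, div_le_iff₀ (by linarith)]
    linarith
  obtain ⟨P, q, C, hC, hP⟩ := hω.exists_multiplies
  obtain ⟨D, hD⟩ : ∃ D, 1500 + 20 * (c + 4) + 8 * (40000 + 66 * clkCost P) * (c + 4) ^ 2 = D :=
    ⟨_, rfl⟩
  refine ⟨diameter P c, (2 * c + 12) * (q + 3), 4, D * (32 * C * 2 ^ ω * (c + 4) * 4 ^ 4), ?_⟩
  intro n m w e hw s hs ⟨h0, h1, hat, hah⟩
  have h2ω : (1 : ℝ) ≤ 2 ^ ω := Real.one_le_rpow (by norm_num) (by linarith)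
  have hw1 : 1 < 2 ^ w := by
    refine lt_of_lt_of_le (Nat.one_lt_pow ?_ (by omega)) hw
    positivity
  by_cases htriv : n < 2 ∨ m < n
  · have hter := diameter_trivial (c := c) (P := P) h0 h1 hw1 htriv
    refine ⟨10, ?_, ?_, ?_⟩
    · have hD1 : (1500 : ℝ) ≤ D := by exact_mod_cast (by omega : 1500 ≤ D)
      push_cast
      refine const_time_le hα0 ?_
      have : (1 : ℝ) ≤ 32 * C * 2 ^ ω * (c + 4) * 4 ^ 4 := by
        have hc : (0 : ℝ) ≤ c := Nat.cast_nonneg c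
        calc (1 : ℝ) ≤ 32 * 1 * 1 * (0 + 4) * 4 ^ 4 := by norm_num
          _ ≤ _ := by gcongr
      nlinarith
    · exact (FailBound.of_ter (hter.conseq le_rfl fun _ _ _ _ => trivial) hs).probHalts_eq_one
    · refine le_trans ?_ (FailBound.of_ter (hter.conseq le_rfl fun s' _ _ h => ?_) hs).le_probHalts
      · simp
      · rw [h]
        split
        · exact isSevenFourthsApprox_zero ‹_›
        · exact isSevenFourthsApprox_top fun d => far_of_arcs_lt (by omega) (by omega) d
  push Not at htriv
  obtain ⟨hn, hnm⟩ := htriv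
  obtain ⟨ell, hell⟩ : ∃ ell, ell = Nat.clog 2 (m + 2) := ⟨_, rfl⟩
  obtain ⟨L, hL⟩ : ∃ L, L = (c + 4) * ell := ⟨_, rfl⟩
  obtain ⟨A, hA⟩ : ∃ A, A = sizeBound ω α C (m + m) L := ⟨_, rfl⟩
  have hell1 : 1 ≤ ell := hell ▸ Nat.clog_pos (by norm_num) (by omega)
  have hL1 : 1 ≤ L := hL ▸ Nat.mul_pos (by omega) hell1
  have hword := word_le hell hL hw
  have hM : (doubledOf e).M = m + m := rfl
  have hN : (doubledOf e).N = n + n := rfl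
  have hbase : 1 ≤ n + n + (m + m) + (m + m) * L + 3 := by omega
  have hA0 : ∀ a, a * a * a ≤ 8 * (m + m) → a ≤ A := fun a ha =>
    hA ▸ le_sizeBound hω2 hα hC (by omega) hL1 ha
  -- One time bound has to serve both probability statements, so `T` is fixed before the event `Q`
  -- and the potential are chosen.
  obtain ⟨T, hT, key⟩ : ∃ T, T ≤ D * ((m + 2) * A * ell ^ 3) ∧ ∀ (Q : Memory → Prop) (φ : ℕ → (ℕ → ℕ) → ℝ≥0∞) (δ : ℝ≥0∞),
      (∀ i < (doubledOf e).M * L + 1, ∀ R, ∑ x ∈ Finset.range (doubledOf e).M,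
        ((doubledOf e).M : ℝ≥0∞)⁻¹ * φ (i + 1) (Function.update R i x) ≤ φ i R) →
      (∀ R, φ 0 R ≤ δ) → (∀ s', s'.reg 0 = 0 → Far (doubledOf e) n n → Q s') →
      (∀ R, φ ((doubledOf e).M * L + 1) R < 1 → ∀ s' lo, s'.reg 0 = lo + 1 →
        Far (doubledOf e) n ((4 * lo + 6) / 7) →
        ((doubledOf e).Good n L R → ¬ Far (doubledOf e) n (lo + 1)) → Q s') →
      FailBound w Q T (some ([diameter P c], s)) δ := by
    refine ⟨_, ?_, fun Q φ δ havg hδ hQ hQ' =>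
    diameter_failBound hs h0 h1 hw1 hn hnm fun s' hs' e0 e1 ea =>
      search_failBound (t := arcTail e) (h := arcHead e) (ht := arcTail_lt) (hh := arcHead_lt)
        (T := fun a => ⌊C * (((m + m) * L / a + 1 : ℕ) : ℝ) ^ ω⌋₊) (A := A) (e := ell + 1)
        hn hnm hs' (e0.trans h0) (e1.trans h1)
        (fun j hj => by rw [ea, arcTail, dif_pos hj]; exact hat ⟨j, hj⟩)
        (fun j hj => by rw [ea, arcHead, dif_pos hj]; exact hah ⟨j, hj⟩) hell hL
        ((Nat.pow_le_pow_right hbase (by omega)).trans hword)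
        (fun a ha => hP _ w (Nat.succ_pos _) (le_trans (le_trans (Nat.pow_le_pow_left (by
          have := Nat.div_le_self ((m + m) * L) a
          change (m + m) * L / a + 1 + 2 ≤ n + n + (m + m) + (m + m) * L + 3
          omega) q) (Nat.pow_le_pow_right hbase (by omega))) hword))
        (hA ▸ min_le_left _ _)
        (fun a ha _ hab => hA ▸ two_mul_le_sizeBound hω2 hα hC (by omega) hL1 ha
          (Nat.floor_le (by positivity)) hab) hA0
        (by
          have : m + 2 ≤ 2 ^ ell := hell ▸ Nat.le_pow_clog (by norm_num) _
          change m + m < 2 ^ (ell + 1)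
          rw [pow_succ]; omega) havg hδ hQ hQ'⟩
    exact hD ▸ time_le hM hnm (hA0 1 (by omega)) hell1 hL
  -- With the trivial event the zero potential is admissible, and it shows that the program halts
  -- almost surely.
  refine ⟨T, ?_, (key (fun _ => True) (fun _ _ => 0) 0 (by simp) (by simp) (by simp)
    (by simp)).probHalts_eq_one, ?_⟩
  · refine real_time_le hα0 hα1 (by linarith) (by positivity) hell hL hA ?_
    exact_mod_cast hT
  · refine (key _ ((doubledOf e).badCount n L) _ ?_ ?_ ?_ ?_).le_probHalts
    · exact fun i _ R => Arcs.badCount_avg (by omega) n L i R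
    · exact fun R => (Arcs.badCount_zero_le (by omega) n L R).trans
        (failure_le hnm (hell ▸ hL))
    · intro s' h hF
      rw [h]
      exact isSevenFourthsApprox_top hF.all
    · intro R hR s' lo h hF hG
      rw [h]
      exact isSevenFourthsApprox_of_far hF (hG (Arcs.good_of_badCount hR))
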